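/- Let $n\ge 1$ be an integer, $r_0>0$, and $p\in B_{r_0}(0)\subset\mathbb R^2\cong\mathbb C$. For a harmonic function $u$ on $B_{r_0}(0)$, a \emph{nodal curve} of $u$ is a regular real-analytic curve $\gamma:I\to B_{r_0}(0)$ ($I$ an open interval, $\gamma'\neq 0$) contained in the nodal set $Z(u)=\{z\in B_{r_0}(0): u(z)=0\}$ whose trace is maximal with respect to inclusion among the traces of such curves. We say that $u$ has \emph{boundary value in} $L^1$ if there is $g\in L^1(0,2\pi)$ with $\int_0^{2\pi}|u(re^{i\theta})-g(\theta)|\,d\theta\to 0$ as $r\to r_0^-$. Let $\mathcal H(n,r_0,p)$ be the set of all non-constant harmonic functions $u:B_{r_0}(0)\to\mathbb R$ with boundary value in $L^1$ such that $u(p)=0$ and $u$ has only $n$ nodal curves in $B_{r_0}(0)$, intersecting at $p$; that is, $Z(u)$ is the union of exactly $n$ distinct nodal curves, all of which pass through $p$. Put $\alpha_0=0$ if $n$ is odd and $\alpha_0=\frac{\pi}{2n(n+1)}$ if $n$ is even. Then for every $u\in\mathcal H(n,r_0,p)$ and every nodal curve $\gamma$ of $u$ through $p$, the curvature $\kappa(u)|_{\gamma}(p)$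 of $\gamma$ at $p$ satisfies $$\Big|\kappa(u)|_{\gamma}(p)\Big|\le \frac{4(n+1)}{(r_0^2-|p|^2)\,n}\,r_0\cos (n\alpha_0)+\frac{2|p|}{r_0^2-|p|^2}.$$ Moreover, the bound is sharp for all $n\ge1$, $r_0>0$ and $p\in B_{r_0}(0)$: for every $\varepsilon>0$ there are $u\in\mathcal H(n,r_0,p)$ and a nodal curve $\gamma$ of $u$ through $p$ such that $\big|\kappa(u)|_{\gamma}(p)\big|$ exceeds the right-hand side minus $\varepsilon$. -/

import Mathlib

open Set Filter Topology MeasureTheory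

namespace NodalCurvature

/-- The nodal set of `u` in the region `U ⊆ ℂ = ℝ²`. -/
def nodalSet (u : ℂ → ℝ) (U : Set ℂ) : Set ℂ := {z | z ∈ U ∧ u z = 0}

/-- A regular real-analytic plane curve. Every open interval is analytically diffeomorphic
to `ℝ`, so it is no restriction to use `ℝ` as the parameter interval. -/
def IsRegularAnalyticCurve (γ : ℝ → ℂ) : Prop :=
  ∀ t, AnalyticAt ℝ γ t ∧ deriv γ t ≠ 0

/-- A nodal curve of `u` in `U`: a regular analytic curve lying in the nodal set of `u` in `U`
and maximal with this property, i.e. its trace is not properly contained in the trace of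
another such curve. -/
def IsNodalCurve (u : ℂ → ℝ) (U : Set ℂ) (γ : ℝ → ℂ) : Prop :=
  IsRegularAnalyticCurve γ ∧ range γ ⊆ nodalSet u U ∧
    ∀ δ : ℝ → ℂ, IsRegularAnalyticCurve δ → range δ ⊆ nodalSet u U →
      range γ ⊆ range δ → range δ ⊆ range γ

/-- In `U`, the function `u` has only `n` nodal curves, and they intersect at `p`: the nodal set
of `u` in `U` is composed of `n` nodal curves with distinct traces, all passing through `p`. -/
def HasOnlyNodalCurvesThrough (u : ℂ → ℝ) (U : Set ℂ) (n : ℕ) (p : ℂ) : Prop :=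
  ∃ Γ : Fin n → ℝ → ℂ,
    (∀ k, IsNodalCurve u U (Γ k)) ∧
    (∀ j k, j ≠ k → range (Γ j) ≠ range (Γ k)) ∧
    (∀ k, p ∈ range (Γ k)) ∧
    nodalSet u U = ⋃ k, range (Γ k)

/-- The function `u` on the disc of radius `r₀` about `0` has a boundary value in `L¹` of the
circle: for some integrable `g`, the functions `θ ↦ u (r e^{iθ})` tend to `g` in `L¹(0, 2π)` as
`r ↑ r₀`. -/
def HasL1BoundaryValue (u : ℂ → ℝ) (r₀ : ℝ) : Prop :=
  ∃ g : ℝ → ℝ, IntervalIntegrable g volume 0 (2 * Real.pi) ∧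
    Tendsto (fun r : ℝ => ∫ θ in (0 : ℝ)..(2 * Real.pi), |u (circleMap 0 r θ) - g θ|)
      (𝓝[<] r₀) (𝓝 0)

/-- Harmonic functions as in the theorem: `u` is harmonic and non-constant in the disc
`B_{r₀}(0)`, has an `L¹` boundary value, vanishes at `p`, and has only `n` nodal curves in the
disc, which intersect at `p`. -/
structure IsAdmissible (u : ℂ → ℝ) (r₀ : ℝ) (n : ℕ) (p : ℂ) : Prop where
  harmonic : InnerProductSpace.HarmonicOnNhd u (Metric.ball (0 : ℂ) r₀)
  nonconstant : ¬ ∃ c : ℝ, ∀ z ∈ Metric.ball (0 : ℂ) r₀, u z = c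
  boundary : HasL1BoundaryValue u r₀
  zero : u p = 0
  nodal : HasOnlyNodalCurvesThrough u (Metric.ball (0 : ℂ) r₀) n p

/-- The signed curvature `(x' y'' - y' x'') / |γ'|³` of the plane curve `γ = x + i y` at the
parameter `t`. -/
noncomputable def curvature (γ : ℝ → ℂ) (t : ℝ) : ℝ :=
  ((deriv γ t).re * (deriv (deriv γ) t).im - (deriv γ t).im * (deriv (deriv γ) t).re) /
    ‖deriv γ t‖ ^ 3

/-- The angle `α₀`: zero for odd `n` and `π / (2 n (n + 1))` for even `n`. -/
noncomputable def alpha₀ (n : ℕ) : ℝ :=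
  if Odd n then 0 else Real.pi / (2 * (n : ℝ) * ((n : ℝ) + 1))

/-- The curvature bound. -/
noncomputable def curvatureBound (n : ℕ) (r₀ : ℝ) (p : ℂ) : ℝ :=
  4 * ((n : ℝ) + 1) / ((r₀ ^ 2 - ‖p‖ ^ 2) * (n : ℝ)) * r₀ * Real.cos ((n : ℝ) * alpha₀ n) +
    2 * ‖p‖ / (r₀ ^ 2 - ‖p‖ ^ 2)

end NodalCurvature

namespace NodalCurvature

/-! ### Variation of the argument along a path -/

/-! Reduction. A Möbius map carries `p` to `0` and the disc to the unit disc. It preserves nodal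
curves, and by `curvature_comp` the curvature at `p` is `r₀ / (r₀² - |p|²)` times the curvature at
`0` plus a term of size at most `2|p| / (r₀² - |p|²)`. So it suffices to bound the curvature at `0`
for `Re f`, where `f` is holomorphic on the unit disc, `f 0 = 0`, and the circle means of `|Re f|`
are bounded.

Topology. By the maximum principle every component of `{Re f > 0}` or `{Re f < 0}` comes arbitrarily
close to the unit circle. The gradient segment at a regular zero therefore extends to a crosscut, so
the nodal set cannot connect the two sides of that zero (`not_joinedIn_sides`). Hence nodal curves
are injective and close up no loops, the origin is the only zero of `Re f` that can be critical, and
`f = z ^ n * G` with `G` free of zeros (`exists_eq_pow_mul`, `le_order`). Every component of either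
sign touches `0`, and at most `n` of them are positive (`exists_sectors`). Two positive points in
one component cannot alternate on a circle with two negative points, which are joined through `0`;
so no `2n + 2` points of a circle alternate in sign (`not_alternating`). Consequently some product
`T` of `2n` half-angle sines matches the sign of `v = Re f` on the circle, up to a global sign and a
part of small mass (`exists_separating_angles`, `exists_small_remainder`).

Extremal problem. `T` is a trigonometric polynomial of degree `n`, so the integrals of `v T` and `v
T e^{-iθ}` involve only `c = G 0` and `d = G' 0` (`moments_prod_sin`). As `v T` has nearly one sign,
the second integral is at most the first in absolute value, up to an error. A tangent direction `ω`
at `0` satisfies `Re (c ω ^ n) = 0`, and the curvature is `-(2/n) Im (d ω / c)`. The inequality of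
moments becomes `|Im (d ω / c)| ≤ |∑ sin y_j| + 2 |sin (∑ y_j / 2)|` for some `2n` angles, in the
limit. The right side is at most `2 (n + 1) cos (n α₀)` (`abs_sum_sin_add_le`); for even `n` a
parity obstruction excludes the trivial value `2 (n + 1)`.

Sharpness. With `s = (1 + z) / (1 - z)` the extremal function is a real multiple of `(1 - s²)^n (s +
iτ)`, whose real part vanishes on the unit circle off `1`. Its argument increases along circles at
the zeros of its real part (`extremal_derivative_pos`), so the level lines of the argument form a
star of `n` nodal curves (`hasOnlyNodalCurvesThrough_zero`). A dilation by `l < 1` gives continuous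
boundary values and costs a factor `l`; a rotation makes the Möbius term add up with the main term.
-/

theorem exp_variation_const {S : Set ℂ} (hS : IsPreconnected S) {V l : ℂ → ℂ}
    (hV : ContinuousOn V S) (hl : ContinuousOn l S)
    (h : ∀ w ∈ S, Complex.exp (V w) = Complex.exp (l w)) {x y : ℂ} (hx : x ∈ S) (hy : y ∈ S) :
    V x - V y = l x - l y := by
  have : DiscreteTopology (AddSubgroup.zmultiples (2 * Real.pi * Complex.I)) :=
    NormedSpace.discreteTopology_zmultiples _
  have key := hS.constant_of_mapsTo
    (T := (AddSubgroup.zmultiples (2 * Real.pi * Complex.I) : Set ℂ))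
    (f := fun w => V w - l w) ⟨this⟩ (hV.sub hl) (fun w hw => by
      obtain ⟨n, hn⟩ := Complex.exp_eq_exp_iff_exists_int.1 (h w hw)
      exact ⟨n, by simp [hn]⟩) hx hy
  linear_combination key

/-- The variation of the logarithm of `c s - w` along a path `c`, as a function of `w`. -/
theorem exists_logVariation {x y : ℂ} (c : Path x y) :
    ∃ V : ℂ → ℂ, ContinuousOn V (range c)ᶜ ∧
      (∀ w ∉ range c, Complex.exp (V w) = (y - w) / (x - w)) ∧
      ∀ w ∉ range c, ∀ e : ℂ, (∀ s, (c s - w) * e ∈ Complex.slitPlane) →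
        V w = Complex.log ((y - w) * e) - Complex.log ((x - w) * e) := by
  classical
  let U : Set ℂ := (range c)ᶜ
  have hne : ∀ (s : unitInterval) (w : U), c s - w ≠ 0 := fun s w h =>
    w.2 ⟨s, sub_eq_zero.1 h⟩
  have hne0 : ∀ (w : U), x - w ≠ 0 := fun w => by simpa using hne 0 w
  -- The homotopy `(c s - w) / (x - w)` starts at `1` and is lifted through the covering map `exp`;
  -- the lift at `s = 1` is a logarithm of `(y - w) / (x - w)` that depends continuously on `w`.
  let H : C(unitInterval × U, {z : ℂ // z ≠ 0}) :=
    ⟨fun q => ⟨(c q.1 - q.2) / (x - q.2), div_ne_zero (hne q.1 q.2) (hne0 q.2)⟩, by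
      refine Continuous.subtype_mk ?_ _
      refine Continuous.div ?_ ?_ fun q => hne0 q.2
      · exact (c.continuous.comp continuous_fst).sub (continuous_subtype_val.comp continuous_snd)
      · exact continuous_const.sub (continuous_subtype_val.comp continuous_snd)⟩
  have H0 : ∀ a : U, H (0, a) = ⟨Complex.exp ((0 : C(U, ℂ)) a), Complex.exp_ne_zero _⟩ := by
    intro a
    apply Subtype.ext
    simp [H, div_self (hne0 a)]
  let G := Complex.isCoveringMap_exp.liftHomotopy H 0 H0
  have hG : ∀ s a, Complex.exp (G (s, a)) = (c s - a) / (x - a) := fun s a => by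
    have := congr_fun (Complex.isCoveringMap_exp.liftHomotopy_lifts H 0 H0) (s, a)
    exact congrArg Subtype.val this
  have hG0 : ∀ a, G (0, a) = 0 := fun a =>
    Complex.isCoveringMap_exp.liftHomotopy_zero H 0 H0 a
  refine ⟨fun w => if h : w ∈ U then G (1, ⟨w, h⟩) else 0, ?_, ?_, ?_⟩
  · rw [continuousOn_iff_continuous_domRestrict]
    have : Continuous fun w : U => G (1, w) := G.continuous.comp (by fun_prop)
    convert this using 1
    ext w
    have := w.2
    simp only [Set.domRestrict_apply]
    rw [dif_pos this]
  · intro w hw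
    have hw' : w ∈ U := hw
    simp only [hw', dif_pos]
    rw [hG]; simp
  · intro w hw e he
    have hw' : w ∈ U := hw
    simp only [hw', dif_pos]
    have hc : Continuous fun s : unitInterval => Complex.log ((c s - w) * e) :=
      Continuous.clog (by fun_prop) he
    have hGc : Continuous fun s : unitInterval => G (s, ⟨w, hw'⟩) := G.continuous.comp (by fun_prop)
    have he0 : e ≠ 0 := by
      rintro rfl
      simpa using he 0
    have : DiscreteTopology (AddSubgroup.zmultiples (2 * Real.pi * Complex.I)) :=
      NormedSpace.discreteTopology_zmultiples _
    have key := (isPreconnected_univ (α := unitInterval)).constant_of_mapsTo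
      (T := (AddSubgroup.zmultiples (2 * Real.pi * Complex.I) : Set ℂ))
      (f := fun s => G (s, ⟨w, hw'⟩) - (Complex.log ((c s - w) * e) - Complex.log ((x - w) * e)))
      ⟨this⟩ (hGc.sub (hc.sub continuous_const)).continuousOn (fun s _ => by
        have : Complex.exp (G (s, ⟨w, hw'⟩)) =
            Complex.exp (Complex.log ((c s - w) * e) - Complex.log ((x - w) * e)) := by
          rw [hG, Complex.exp_sub, Complex.exp_log (mul_ne_zero (hne s ⟨w, hw'⟩) he0),
            Complex.exp_log (mul_ne_zero (hne0 ⟨w, hw'⟩) he0), mul_div_mul_right _ _ he0]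
        obtain ⟨n, hn⟩ := Complex.exp_eq_exp_iff_exists_int.1 this
        exact ⟨n, by simp [hn]⟩) (mem_univ 1) (mem_univ 0)
    simp only [hG0, c.source, c.target, sub_self] at key
    linear_combination key

theorem mem_slitPlane_of_norm_sub_one_lt {w : ℂ} (h : ‖w - 1‖ < 1) : 0 < w.re := by
  have := (Complex.abs_re_le_norm (w - 1)).trans_lt h
  rw [abs_lt] at this
  simp at this
  linarith [this.1]

/-- Seen from a point `b` outside the disc containing the path, all `1 - c s / b` lie in the right
half-plane, so the argument varies by less than `π` and the variation is the principal logarithm. -/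
theorem logVariation_eq_log_of_far {x y : ℂ} (c : Path x y) {R : ℝ} (hR : 0 < R)
    (hc : ∀ s, ‖c s‖ < R) {V : ℂ → ℂ}
    (hexp : ∀ w ∉ range c, Complex.exp (V w) = (y - w) / (x - w))
    (hV : ∀ w ∉ range c, ∀ e : ℂ, (∀ s, (c s - w) * e ∈ Complex.slitPlane) →
        V w = Complex.log ((y - w) * e) - Complex.log ((x - w) * e))
    {b : ℂ} (hb : R ≤ ‖b‖) : V b = Complex.log ((y - b) / (x - b)) := by
  have hb0 : b ≠ 0 := by
    rintro rfl; simp at hb; linarith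
  have hbr : b ∉ range c := by
    rintro ⟨s, rfl⟩; linarith [hc s]
  have hre : ∀ s, 0 < ((c s - b) * (-1 / b)).re := fun s => by
    apply mem_slitPlane_of_norm_sub_one_lt
    have : (c s - b) * (-1 / b) - 1 = -(c s / b) := by field_simp; ring
    rw [this, norm_neg, norm_div, div_lt_one (by positivity)]
    linarith [hc s]
  have h1 := hV b hbr (-1 / b) fun s => Or.inl (hre s)
  rw [← hexp b hbr, Complex.log_exp]
  all_goals
    have hx := Complex.abs_arg_lt_pi_div_two_iff.2 (Or.inl (hre 0))
    have hy := Complex.abs_arg_lt_pi_div_two_iff.2 (Or.inl (hre 1))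
    rw [abs_lt] at hx hy
    simp only [c.source, c.target] at hx hy
    rw [h1, Complex.sub_im, Complex.log_im, Complex.log_im]
    linarith [hx.1, hx.2, hy.1, hy.2]

/-- A crosscut `b₂ ⋯ z - δν, z + δν ⋯ b₁` separates the points near `z` on its two sides. -/
theorem not_joinedIn_across {z ν b₁ b₂ : ℂ} (hν : ν ≠ 0) {R δ : ℝ} (hR : 0 < R) (hδ : 0 < δ)
    {P : Set ℂ} (hz : z ∉ P) (h₁ : JoinedIn P (z + δ * ν) b₁) (h₂ : JoinedIn P (z - δ * ν) b₂)
    (hb₁ : R ≤ ‖b₁‖) (hb₂ : R ≤ ‖b₂‖) :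
    ∃ η > 0, ∀ C : Set ℂ, C ⊆ Metric.ball 0 R → Disjoint C P →
      (∀ x : ℝ, |x| ≤ δ → z + x * ν ∉ C) →
      ∀ q₁ q₂, dist q₁ z < η → dist q₂ z < η → 0 < ((q₁ - z) / ν).im → ((q₂ - z) / ν).im < 0 →
        ¬ JoinedIn C q₁ q₂ := by
  let K : Set ℂ := range h₁.somePath ∪ range h₂.somePath
  have hK : IsCompact K := (isCompact_range h₁.somePath.continuous).union
    (isCompact_range h₂.somePath.continuous)
  have hKP : K ⊆ P := by
    rintro _ (⟨s, rfl⟩ | ⟨s, rfl⟩)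
    · exact h₁.somePath_mem s
    · exact h₂.somePath_mem s
  have hzK : z ∉ K := fun h => hz (hKP h)
  obtain ⟨η₀, hη₀, hη⟩ : ∃ η₀ > 0, ∀ w ∈ K, η₀ ≤ dist w z := by
    obtain ⟨ε, hε, h⟩ := Metric.isOpen_iff.1 hK.isClosed.isOpen_compl z hzK
    exact ⟨ε, hε, fun w hw => not_lt.1 fun hlt => h hlt hw⟩
  have hνn : 0 < ‖ν‖ := norm_pos_iff.2 hν
  refine ⟨min (η₀ / 4) (δ * ‖ν‖), by positivity, ?_⟩
  intro C hCR hCP hseg q₁ q₂ hq₁ hq₂ hi₁ hi₂ hJ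
  rw [lt_min_iff] at hq₁ hq₂
  set c := hJ.somePath with hc
  have hcC : ∀ s, c s ∈ C := hJ.somePath_mem
  obtain ⟨V, hVc, hexp, hV⟩ := exists_logVariation c
  have hcR : ∀ s, ‖c s‖ < R := fun s => by simpa using hCR (hcC s)
  have hKc : K ⊆ (range c)ᶜ := by
    rintro w hw ⟨s, rfl⟩
    exact disjoint_left.1 hCP (hcC s) (hKP hw)
  -- Both `q₁` and `q₂` are much closer to `z` than `K` is, so the quotient is close to `1` and its
  -- principal logarithm is continuous along `K`.
  have hWre : ∀ w ∈ K, 0 < ((q₂ - w) / (q₁ - w)).re := by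
    intro w hw
    have h3 := hη w hw
    have h4 : 3 * η₀ / 4 < ‖q₁ - w‖ := by
      have := dist_triangle w q₁ z
      rw [← dist_eq_norm, dist_comm]; linarith [hq₁.1]
    have hne : q₁ - w ≠ 0 := norm_pos_iff.1 (by linarith)
    apply mem_slitPlane_of_norm_sub_one_lt
    have : (q₂ - w) / (q₁ - w) - 1 = (q₂ - q₁) / (q₁ - w) := by field_simp; ring
    rw [this, norm_div, div_lt_one (by linarith), ← dist_eq_norm]
    have := dist_triangle_right q₂ q₁ z
    linarith [hq₁.1, hq₂.1]
  have hlogc : ContinuousOn (fun w => Complex.log ((q₂ - w) / (q₁ - w))) K := by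
    refine ContinuousOn.clog ?_ fun w hw => Or.inl (hWre w hw)
    refine ContinuousOn.div (by fun_prop) (by fun_prop) fun w hw h0 => ?_
    have := hWre w hw
    simp [h0] at this
  have hne : ∀ w ∉ range c, q₁ - w ≠ 0 ∧ q₂ - w ≠ 0 := fun w hw =>
    ⟨fun h => hw ⟨0, by simpa using sub_eq_zero.1 h⟩,
      fun h => hw ⟨1, by simpa using sub_eq_zero.1 h⟩⟩
  have hlogexp : ∀ w ∉ range c, Complex.exp (V w) =
      Complex.exp (Complex.log ((q₂ - w) / (q₁ - w))) := fun w hw => by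
    rw [hexp w hw, Complex.exp_log (div_ne_zero (hne w hw).2 (hne w hw).1)]
  -- Along a path in `K` the variation `V` and the principal logarithm differ by a constant, which
  -- vanishes at the far end `b`. So `V` is principal at both ends of the segment through `z`.
  have hend : ∀ (w b : ℂ) (h : JoinedIn P w b), range h.somePath ⊆ K → R ≤ ‖b‖ →
      V w = Complex.log ((q₂ - w) / (q₁ - w)) := by
    intro w b h hsub hb
    have h1 := exp_variation_const (S := range h.somePath)
      (isPreconnected_range h.somePath.continuous) (hVc.mono (hsub.trans hKc))
      (hlogc.mono hsub) (fun w hw => hlogexp w (hKc (hsub hw)))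
      (x := w) (y := b) ⟨0, by simp⟩ ⟨1, by simp⟩
    have h2 := logVariation_eq_log_of_far c hR hcR hexp hV hb
    rw [h2] at h1
    linear_combination h1
  have hVp := hend _ _ h₁ subset_union_left hb₁
  have hVm := hend _ _ h₂ subset_union_right hb₂
  have hwp : 0 < ((q₂ - (z + δ * ν)) / (q₁ - (z + δ * ν))).re := hWre _ (Or.inl ⟨0, by simp⟩)
  have hwm : 0 < ((q₂ - (z - δ * ν)) / (q₁ - (z - δ * ν))).re := hWre _ (Or.inr ⟨0, by simp⟩)
  set u₁ := (q₁ - z) / ν with hu₁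
  set u₂ := (q₂ - z) / ν with hu₂
  have hr₁ : |u₁.re| < δ := by
    refine (Complex.abs_re_le_norm _).trans_lt ?_
    rw [hu₁, norm_div, div_lt_iff₀ hνn, ← dist_eq_norm]; exact hq₁.2
  have hr₂ : |u₂.re| < δ := by
    refine (Complex.abs_re_le_norm _).trans_lt ?_
    rw [hu₂, norm_div, div_lt_iff₀ hνn, ← dist_eq_norm]; exact hq₂.2
  rw [abs_lt] at hr₁ hr₂
  have hq₁z : q₁ = z + u₁ * ν := by rw [hu₁]; field_simp; ring
  have hq₂z : q₂ = z + u₂ * ν := by rw [hu₂]; field_simp; ring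
  have hWu : ∀ x : ℝ, (q₂ - (z + x * ν)) / (q₁ - (z + x * ν)) = (u₂ - x) / (u₁ - x) := fun x => by
    rw [hq₁z, hq₂z, show z + u₂ * ν - (z + x * ν) = (u₂ - x) * ν by ring,
      show z + u₁ * ν - (z + x * ν) = (u₁ - x) * ν by ring, mul_div_mul_right _ _ hν]
  -- the segment, parametrized
  have hIcc : ∀ x ∈ Icc (-δ) δ, z + (x : ℂ) * ν ∉ range c := by
    rintro x hx ⟨s, hs⟩
    exact hseg x (abs_le.2 hx) (hs ▸ hcC s)
  let S : Set ℂ := (fun x : ℝ => (z + x * ν : ℂ)) '' Icc (-δ) δ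
  have hSpre : IsPreconnected S := isPreconnected_Icc.image _ (by fun_prop)
  have hSc : S ⊆ (range c)ᶜ := by
    rintro _ ⟨x, hx, rfl⟩
    exact hIcc x hx
  -- Across the segment, which the path `c` avoids, `V` changes like this difference of logarithms:
  -- `q₁` and `q₂` stay strictly on opposite sides of the line.
  let l : ℂ → ℂ := fun w => Complex.log ((q₂ - w) / ν) - Complex.log ((q₁ - w) / ν)
  have hlu : ∀ x : ℝ, l (z + x * ν) = Complex.log (u₂ - x) - Complex.log (u₁ - x) := fun x => by
    simp only [l]
    congr 2
    · rw [hq₂z]; field_simp; ring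
    · rw [hq₁z]; field_simp; ring
  have hslit : ∀ (x : ℝ), (u₂ - x) ∈ Complex.slitPlane ∧ (u₁ - x) ∈ Complex.slitPlane := fun x =>
    ⟨Or.inr (by simpa using hi₂.ne), Or.inr (by simpa using hi₁.ne')⟩
  have hlc : ContinuousOn l S := by
    have h1 : ∀ w ∈ S, (q₂ - w) / ν ∈ Complex.slitPlane ∧ (q₁ - w) / ν ∈ Complex.slitPlane := by
      rintro _ ⟨x, hx, rfl⟩
      have := hslit x
      rw [hq₁z, hq₂z]
      refine ⟨?_, ?_⟩
      · rw [show (z + u₂ * ν - (z + x * ν)) / ν = u₂ - x by field_simp; ring]; exact this.1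
      · rw [show (z + u₁ * ν - (z + x * ν)) / ν = u₁ - x by field_simp; ring]; exact this.2
    exact (ContinuousOn.clog (by fun_prop) fun w hw => (h1 w hw).1).sub
      (ContinuousOn.clog (by fun_prop) fun w hw => (h1 w hw).2)
  have hlexp : ∀ x : ℝ, Complex.exp (l (z + x * ν)) =
      (q₂ - (z + x * ν)) / (q₁ - (z + x * ν)) := fun x => by
    rw [hWu, hlu, Complex.exp_sub, Complex.exp_log (Complex.slitPlane_ne_zero (hslit x).1),
      Complex.exp_log (Complex.slitPlane_ne_zero (hslit x).2)]
  have hseg' := exp_variation_const hSpre (hVc.mono hSc) hlc (by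
    rintro _ ⟨x, hx, rfl⟩
    rw [hexp _ (hIcc x hx), hlexp]) (x := z + (δ : ℝ) * ν) (y := z + ((-δ : ℝ) : ℂ) * ν)
    ⟨δ, ⟨by linarith, le_rfl⟩, rfl⟩ ⟨-δ, ⟨le_rfl, by linarith⟩, rfl⟩
  have hm' : z + ((-δ : ℝ) : ℂ) * ν = z - δ * ν := by push_cast; ring
  rw [hm', hVp, hVm] at hseg'
  -- identify both values of `l`
  have hpi := Real.pi_pos
  have hlm : Complex.log ((q₂ - (z - δ * ν)) / (q₁ - (z - δ * ν))) = l (z - δ * ν) := by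
    rw [← hm', ← hlexp, Complex.log_exp]
    all_goals
      rw [hlu, Complex.sub_im, Complex.log_im, Complex.log_im]
      have h1 := Complex.abs_arg_lt_pi_div_two_iff.2
        (Or.inl (show 0 < (u₁ - ((-δ : ℝ) : ℂ)).re by simp; linarith [hr₁.1]))
      have h2 := Complex.abs_arg_lt_pi_div_two_iff.2
        (Or.inl (show 0 < (u₂ - ((-δ : ℝ) : ℂ)).re by simp; linarith [hr₂.1]))
      rw [abs_lt] at h1 h2
      linarith [h1.1, h1.2, h2.1, h2.2]
  -- Beyond `q₁` and `q₂` the two arguments lie in `(π/2, π]` and `(-π, -π/2)`, so `l` misses the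
  -- principal value by a full turn, whereas at the other end it is principal. This is the
  -- contradiction.
  have hlp : Complex.log ((q₂ - (z + δ * ν)) / (q₁ - (z + δ * ν))) =
      l (z + δ * ν) + 2 * Real.pi * Complex.I := by
    rw [← hlexp, ← Complex.exp_periodic (l (z + δ * ν)), Complex.log_exp]
    all_goals
      rw [hlu, Complex.add_im, Complex.sub_im, Complex.log_im, Complex.log_im]
      have h1 : Real.pi / 2 < (u₁ - δ).arg := not_le.1 fun h => by
        rcases Complex.arg_le_pi_div_two_iff.1 h with h | h
        · simp at h; linarith [hr₁.2]
        · simp at h; linarith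
      have h2 : (u₂ - δ).arg < -(Real.pi / 2) := not_le.1 fun h => by
        rcases Complex.neg_pi_div_two_le_arg_iff.1 h with h | h
        · simp at h; linarith [hr₂.2]
        · simp at h; linarith
      have h3 := Complex.arg_le_pi (u₁ - δ)
      have h4 := Complex.neg_pi_lt_arg (u₂ - δ)
      simp
      linarith
  rw [hlm, hlp] at hseg'
  have : (2 * Real.pi * Complex.I : ℂ) = 0 := by linear_combination hseg'
  simp [Real.pi_ne_zero] at this

/-! ### Paths in a disc with alternating end points -/

theorem one_sub_exp_mul_I (x : ℝ) : (1 - Complex.exp (x * Complex.I) : ℂ) =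
    (2 * Real.sin (x / 2) : ℝ) *
      (Complex.cos ((x - Real.pi) / 2 : ℝ) + Complex.sin ((x - Real.pi) / 2 : ℝ) * Complex.I) := by
  have h1 : (x - Real.pi) / 2 = x / 2 - Real.pi / 2 := by ring
  have hx : (x : ℝ) = 2 * (x / 2) := by ring
  have h2 : Complex.exp (x * Complex.I) =
      ((1 - 2 * (Real.sin (x / 2) * Real.sin (x / 2)) : ℝ) : ℂ) +
        ((2 * Real.sin (x / 2) * Real.cos (x / 2) : ℝ) : ℂ) * Complex.I := by
    rw [Complex.exp_mul_I, ← Complex.ofReal_cos, ← Complex.ofReal_sin, ← Real.sin_two_mul, ← hx]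
    congr 2
    rw [← sq, Real.sin_sq_eq_half_sub, ← hx]; ring
  rw [← Complex.ofReal_cos, ← Complex.ofReal_sin, h1, Real.cos_sub_pi_div_two,
    Real.sin_sub_pi_div_two, h2]
  generalize Real.sin (x / 2) = s at *
  generalize Real.cos (x / 2) = c at *
  apply Complex.ext
  · simp; ring
  · simp

theorem arg_one_sub_exp {x : ℝ} (h0 : 0 < x) (h1 : x < 2 * Real.pi) :
    (1 - Complex.exp (x * Complex.I)).arg = (x - Real.pi) / 2 := by
  rw [one_sub_exp_mul_I, Complex.arg_mul_cos_add_sin_mul_I]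
  · have := Real.sin_pos_of_pos_of_lt_pi (x := x / 2) (by linarith) (by linarith)
    linarith
  · constructor <;> linarith

theorem arg_one_sub_exp_neg {x : ℝ} (h0 : x < 0) (h1 : -(2 * Real.pi) < x) :
    (1 - Complex.exp (x * Complex.I)).arg = (x + Real.pi) / 2 := by
  have := arg_one_sub_exp (x := x + 2 * Real.pi) (by linarith) (by linarith)
  push_cast at this
  rw [add_mul, Complex.exp_periodic] at this
  rw [this]; ring

/-- Paths in a closed disc whose end points alternate on the boundary circle meet. -/
theorem not_disjoint_of_alternating {r : ℝ} (hr : 0 < r) {A B : Set ℂ}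
    (hA : A ⊆ Metric.closedBall 0 r) (hB : B ⊆ Metric.closedBall 0 r) {θ₁ θ₂ θ₃ θ₄ : ℝ}
    (h₁₂ : θ₁ < θ₂) (h₂₃ : θ₂ < θ₃) (h₃₄ : θ₃ < θ₄) (h₄₁ : θ₄ < θ₁ + 2 * Real.pi)
    (hJA : JoinedIn A (circleMap 0 r θ₁) (circleMap 0 r θ₃))
    (hJB : JoinedIn B (circleMap 0 r θ₂) (circleMap 0 r θ₄)) : ¬ Disjoint A B := by
  intro hdisj
  have hpi := Real.pi_pos
  set a₁ := circleMap 0 r θ₁ with ha₁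
  set a₂ := circleMap 0 r θ₃ with ha₂
  set c := hJA.somePath with hc
  have hcA : ∀ s, c s ∈ A := hJA.somePath_mem
  obtain ⟨V, hVc, hexp, hV⟩ := exists_logVariation c
  have hBc : B ⊆ (range c)ᶜ := by
    rintro w hw ⟨s, rfl⟩
    exact disjoint_left.1 hdisj (hcA s) hw
  have hrC : (r : ℂ) ≠ 0 := by exact_mod_cast hr.ne'
  -- the value of `V` at boundary points of `B`
  have hquot : ∀ φ θ : ℝ, circleMap 0 r θ / circleMap 0 r φ =
      Complex.exp ((θ - φ : ℝ) * Complex.I) := fun φ θ => by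
    simp only [circleMap, zero_add]
    rw [mul_div_mul_left _ _ hrC, ← Complex.exp_sub]
    congr 1; push_cast; ring
  have hVb : ∀ φ, circleMap 0 r φ ∈ B → (V (circleMap 0 r φ)).im =
      (1 - Complex.exp ((θ₃ - φ : ℝ) * Complex.I)).arg -
        (1 - Complex.exp ((θ₁ - φ : ℝ) * Complex.I)).arg := by
    intro φ hφ
    have hb0 : circleMap 0 r φ ≠ 0 := circleMap_ne_center hr.ne'
    have hbn : ‖circleMap 0 r φ‖ = r := by simp [abs_of_pos hr]
    rw [hV _ (hBc hφ) (-1 / circleMap 0 r φ), Complex.sub_im, Complex.log_im, Complex.log_im]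
    · have : ∀ θ, (circleMap 0 r θ - circleMap 0 r φ) * (-1 / circleMap 0 r φ) =
          1 - Complex.exp ((θ - φ : ℝ) * Complex.I) := fun θ => by
        rw [← hquot]; field_simp; ring
      rw [ha₁, ha₂, this, this]
    · intro s
      left
      have e1 : (c s - circleMap 0 r φ) * (-1 / circleMap 0 r φ) = 1 - c s / circleMap 0 r φ := by
        field_simp; ring
      rw [e1]
      have hn : ‖c s / circleMap 0 r φ‖ ≤ 1 := by
        rw [norm_div, hbn, div_le_one hr]
        simpa using hA (hcA s)
      have hne : c s / circleMap 0 r φ ≠ 1 := by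
        rw [Ne, div_eq_one_iff_eq hb0]
        intro h
        exact hBc hφ ⟨s, h⟩
      set w := c s / circleMap 0 r φ
      have hre : w.re ≤ 1 := (Complex.re_le_norm _).trans hn
      rcases hre.lt_or_eq with h | h
      · simp; exact h
      · exfalso
        apply hne
        have h2 : w.re ^ 2 + w.im ^ 2 ≤ 1 := by
          have := Complex.sq_norm w
          rw [Complex.normSq_apply] at this
          nlinarith [norm_nonneg w]
        rw [h] at h2
        have h3 : w.im = 0 := by nlinarith
        exact Complex.ext h h3
  -- a branch of the logarithm of the quotient on the disc
  set μ := (θ₃ - θ₁) / 2 with hμ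
  set ω := -Complex.I * Complex.exp (-μ * Complex.I) with hω
  have hωne : ω ≠ 0 := by simp [hω, Complex.exp_ne_zero]
  have hne : ∀ w ∈ B, a₁ - w ≠ 0 ∧ a₂ - w ≠ 0 := fun w hw =>
    ⟨fun h => hBc hw ⟨0, by simpa using sub_eq_zero.1 h⟩,
      fun h => hBc hw ⟨1, by simpa using sub_eq_zero.1 h⟩⟩
  have hsinμ : 0 < Real.sin μ := Real.sin_pos_of_pos_of_lt_pi (by linarith) (by linarith)
  -- The Möbius map `w ↦ ω (a₂ - w) / (a₁ - w)` sends the disc to the right half-plane: its real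
  -- part is a positive multiple of `(r² - |w|²) sin μ`. So a logarithm of the quotient exists along
  -- all of `B`.
  have hre : ∀ w ∈ B, 0 ≤ ((a₂ - w) / (a₁ - w) * ω).re := by
    intro w hw
    have hwr : ‖w‖ ≤ r := by simpa using hB hw
    have e1 : (a₂ - w) / (a₁ - w) * ω =
        (((1 / Complex.normSq (a₁ - w) : ℝ)) : ℂ) *
          ((a₂ - w) * (starRingEnd ℂ) (a₁ - w) * ω) := by
      have := Complex.mul_conj (a₁ - w)
      have h0 : (Complex.normSq (a₁ - w) : ℂ) ≠ 0 := by
        exact_mod_cast (Complex.normSq_pos.2 (hne w hw).1).ne'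
      have h1 := (hne w hw).1
      push_cast
      field_simp
      rw [← this]
      ring
    rw [e1, Complex.re_ofReal_mul]
    apply mul_nonneg (by have := Complex.normSq_nonneg (a₁ - w); positivity)
    have ha1 : a₁ = r * (Real.cos θ₁ + Real.sin θ₁ * Complex.I) := by
      rw [ha₁, circleMap, Complex.exp_mul_I]; simp
    have ha2 : a₂ = r * (Real.cos θ₃ + Real.sin θ₃ * Complex.I) := by
      rw [ha₂, circleMap, Complex.exp_mul_I]; simp
    have hω' : ω = -Complex.I * (Real.cos μ - Real.sin μ * Complex.I) := by
      rw [hω, Complex.exp_mul_I]; simp [sub_eq_add_neg]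
    have e2 : ((a₂ - w) * (starRingEnd ℂ) (a₁ - w) * ω).re =
        (r ^ 2 - ‖w‖ ^ 2) * Real.sin μ := by
      rw [Complex.sq_norm, Complex.normSq_apply, hω']
      have t1 : θ₁ = (θ₁ + θ₃) / 2 - μ := by rw [hμ]; ring
      have t3 : θ₃ = (θ₁ + θ₃) / 2 + μ := by rw [hμ]; ring
      rw [ha1, ha2]
      generalize (θ₁ + θ₃) / 2 = M at t1 t3
      rw [t1, t3, Real.cos_add, Real.cos_sub, Real.sin_add, Real.sin_sub]
      have hM := Real.sin_sq_add_cos_sq M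
      have hm := Real.sin_sq_add_cos_sq μ
      generalize Real.sin M = sM at *
      generalize Real.cos M = cM at *
      generalize Real.sin μ = sm at *
      generalize Real.cos μ = cm at *
      simp
      have hM' : sM ^ 2 = 1 - cM ^ 2 := by linarith
      have hm' : sm ^ 2 = 1 - cm ^ 2 := by linarith
      have hsm3 : sm ^ 3 = sm * (1 - cm ^ 2) := by rw [← hm']; ring
      ring_nf
      simp only [hM', hsm3]
      ring
    rw [e2]
    apply mul_nonneg _ hsinμ.le
    nlinarith [norm_nonneg w]
  have hslit : ∀ w ∈ B, (a₂ - w) / (a₁ - w) * ω ∈ Complex.slitPlane := by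
    intro w hw
    have hn0 : (a₂ - w) / (a₁ - w) * ω ≠ 0 :=
      mul_ne_zero (div_ne_zero (hne w hw).2 (hne w hw).1) hωne
    rcases (hre w hw).lt_or_eq with h | h
    · exact Or.inl h
    · refine Or.inr fun him => hn0 (Complex.ext h.symm him)
  have hpath : range hJB.somePath ⊆ B := by
    rintro _ ⟨s, rfl⟩
    exact hJB.somePath_mem s
  have hlc : ContinuousOn (fun w => Complex.log ((a₂ - w) / (a₁ - w) * ω) - Complex.log ω) B := by
    refine ContinuousOn.sub (ContinuousOn.clog ?_ hslit) continuousOn_const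
    refine ContinuousOn.mul (ContinuousOn.div (by fun_prop) (by fun_prop)
      fun w hw => (hne w hw).1) continuousOn_const
  have key := exp_variation_const (isPreconnected_range hJB.somePath.continuous)
    (hVc.mono (hpath.trans hBc)) (hlc.mono hpath) (fun w hw => by
      rw [hexp w (hBc (hpath hw)), Complex.exp_sub, Complex.exp_log hωne,
        Complex.exp_log (Complex.slitPlane_ne_zero (hslit w (hpath hw)))]
      field_simp) (x := circleMap 0 r θ₂) (y := circleMap 0 r θ₄) ⟨0, by simp⟩ ⟨1, by simp⟩
  have hb₁ := hJB.mem.1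
  have hb₂ := hJB.mem.2
  have hI := congrArg Complex.im key
  rw [Complex.sub_im, hVb _ hb₁, hVb _ hb₂, arg_one_sub_exp (by linarith) (by linarith),
    arg_one_sub_exp_neg (by linarith) (by linarith),
    arg_one_sub_exp_neg (by linarith) (by linarith),
    arg_one_sub_exp_neg (by linarith) (by linarith)] at hI
  -- value of the branch
  have hval : ∀ φ, circleMap 0 r φ ∈ B → (a₂ - circleMap 0 r φ) / (a₁ - circleMap 0 r φ) * ω =
      (Real.sin ((θ₃ - φ) / 2) / Real.sin ((θ₁ - φ) / 2) : ℝ) * -Complex.I := by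
    intro φ hφ
    have hb0 : circleMap 0 r φ ≠ 0 := circleMap_ne_center hr.ne'
    have hsub : ∀ θ, circleMap 0 r θ - circleMap 0 r φ = -circleMap 0 r φ *
        ((2 * Real.sin ((θ - φ) / 2) : ℝ) * (-Complex.I *
          Complex.exp ((θ - φ) / 2 * Complex.I))) := fun θ => by
      have h1 : circleMap 0 r θ - circleMap 0 r φ = -circleMap 0 r φ *
          (1 - Complex.exp ((θ - φ : ℝ) * Complex.I)) := by
        rw [← hquot]; field_simp; ring
      rw [h1, one_sub_exp_mul_I]
      congr 2
      rw [← Complex.exp_mul_I]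
      have : (((θ - φ - Real.pi) / 2 : ℝ) : ℂ) * Complex.I =
        (θ - φ) / 2 * Complex.I - Real.pi / 2 * Complex.I := by push_cast; ring
      rw [this, Complex.exp_sub, Complex.exp_pi_div_two_mul_I]
      field_simp
      rw [Complex.I_sq]; ring
    have h1 := (hne _ hφ).1
    rw [ha₁, hsub] at h1
    rw [ha₁, ha₂, hsub, hsub, hω]
    have hs : (Real.sin ((θ₁ - φ) / 2) : ℂ) ≠ 0 := by
      intro h
      apply h1
      rw [Complex.ofReal_mul, h]; simp
    have hexpμ : Complex.exp ((θ₃ - φ) / 2 * Complex.I) * Complex.exp (-μ * Complex.I) =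
        Complex.exp ((θ₁ - φ) / 2 * Complex.I) := by
      rw [← Complex.exp_add]; congr 1; rw [hμ]; push_cast; ring
    have hen := Complex.exp_ne_zero ((θ₁ - φ) / 2 * Complex.I)
    rw [← hexpμ] at hen ⊢
    push_cast
    field_simp
  have hs1 : 0 < Real.sin ((θ₃ - θ₂) / 2) / -Real.sin ((θ₁ - θ₂) / 2) := by
    apply div_pos (Real.sin_pos_of_pos_of_lt_pi (by linarith) (by linarith))
    rw [← Real.sin_neg]
    exact Real.sin_pos_of_pos_of_lt_pi (by linarith) (by linarith)
  have hs2 : 0 < Real.sin ((θ₃ - θ₄) / 2) / Real.sin ((θ₁ - θ₄) / 2) := by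
    rw [← neg_div_neg_eq, ← Real.sin_neg, ← Real.sin_neg]
    exact div_pos (Real.sin_pos_of_pos_of_lt_pi (by linarith) (by linarith))
      (Real.sin_pos_of_pos_of_lt_pi (by linarith) (by linarith))
  -- From `θ₄` to `θ₂` the imaginary part of `V` changes by `-π`, by the explicit arguments of `1 -
  -- e^{ix}`, while the half-plane branch goes from `-π/2` to `π/2`.
  rw [hval _ hb₁, hval _ hb₂] at hI
  have e1 : ((Real.sin ((θ₃ - θ₂) / 2) / Real.sin ((θ₁ - θ₂) / 2) : ℝ) : ℂ) * -Complex.I =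
      ((Real.sin ((θ₃ - θ₂) / 2) / -Real.sin ((θ₁ - θ₂) / 2) : ℝ) : ℂ) * Complex.I := by
    push_cast; rw [div_neg]; ring
  rw [e1] at hI
  simp only [Complex.sub_im, Complex.log_im] at hI
  rw [Complex.arg_real_mul _ hs1, Complex.arg_real_mul _ hs2, Complex.arg_I,
    Complex.arg_neg_I] at hI
  linarith

/-! ### Nodal sets of real parts of holomorphic functions on the unit disc -/

/-- The nodal set in the unit disc of the real part of `f`. -/
abbrev reNodal (f : ℂ → ℂ) : Set ℂ := nodalSet (fun z => (f z).re) (Metric.ball 0 1)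

theorem isOpen_re_pos {f : ℂ → ℂ} {U : Set ℂ} (hU : IsOpen U) (hf : ContinuousOn f U) :
    IsOpen {w | w ∈ U ∧ 0 < (f w).re} :=
  (Complex.continuous_re.comp_continuousOn hf).isOpen_inter_preimage hU isOpen_Ioi

/-- Path components of an open set are open, hence relatively closed in it. -/
theorem mem_pathComponentIn_of_mem_closure {P : Set ℂ} (hP : IsOpen P) {z w : ℂ}
    (hw : w ∈ closure (pathComponentIn P z)) (hwP : w ∈ P) : w ∈ pathComponentIn P z := by
  obtain ⟨y, hy, hyz⟩ := mem_closure_iff.1 hw _ (hP.pathComponentIn w)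
    (mem_pathComponentIn_self hwP)
  exact hyz.trans hy.symm

/-- Components of `{Re f > 0}` reach the boundary of the disc. -/
theorem exists_joinedIn_far {f : ℂ → ℂ} (hf : DifferentiableOn ℂ f (Metric.ball 0 1)) {z : ℂ}
    (hz : z ∈ Metric.ball (0 : ℂ) 1) (hfz : 0 < (f z).re) {R : ℝ} (hR : R < 1) :
    ∃ w, R ≤ ‖w‖ ∧ JoinedIn {w | w ∈ Metric.ball (0 : ℂ) 1 ∧ 0 < (f w).re} z w := by
  set P := {w | w ∈ Metric.ball (0 : ℂ) 1 ∧ 0 < (f w).re} with hP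
  have hPo : IsOpen P := isOpen_re_pos Metric.isOpen_ball hf.continuousOn
  by_contra! hcon
  set U := pathComponentIn P z
  have hUR : U ⊆ Metric.closedBall 0 R := fun w hw => by
    by_contra h
    exact hcon w (by simp at h; exact h.le) hw
  have hclR : closure U ⊆ Metric.closedBall 0 R :=
    closure_minimal hUR Metric.isClosed_closedBall
  have hcl : closure U ⊆ Metric.ball 0 1 :=
    hclR.trans (Metric.closedBall_subset_ball hR)
  have hUo : IsOpen U := hPo.pathComponentIn z
  -- Maximum principle for `exp ∘ f`, whose norm is `e^{Re f}`: on the frontier of a component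
  -- staying inside the disc one would have `Re f ≤ 0`, against `Re f > 0` at `z`.
  have hd : DiffContOnCl ℂ (fun w => Complex.exp (f w)) U :=
    ((hf.mono hcl).cexp).diffContOnCl
  have := Complex.norm_le_of_forall_mem_frontier_norm_le
    (Metric.isBounded_closedBall.subset hUR) hd (C := 1) (fun w hw => by
      rw [Complex.norm_exp]
      apply Real.exp_le_one_iff.2
      by_contra hpos
      have hw1 : w ∈ closure U := frontier_subset_closure hw
      have : w ∈ U := mem_pathComponentIn_of_mem_closure hPo hw1 ⟨hcl hw1, not_le.1 hpos⟩
      rw [hUo.frontier_eq] at hw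
      exact hw.2 this)
    (subset_closure (mem_pathComponentIn_self (⟨hz, hfz⟩ : z ∈ P)))
  rw [Complex.norm_exp, Real.exp_le_one_iff] at this
  linarith

theorem joinedIn_image_Icc {γ : ℝ → ℂ} {a b : ℝ} (hab : a ≤ b) (hγ : ContinuousOn γ (Icc a b))
    {S : Set ℂ} (h : ∀ t ∈ Icc a b, γ t ∈ S) : JoinedIn S (γ a) (γ b) := by
  have h1 : IsPathConnected (γ '' Icc a b) :=
    ((convex_Icc a b).isPathConnected ⟨a, left_mem_Icc.2 hab⟩).image' hγ
  refine (h1.joinedIn _ ⟨a, left_mem_Icc.2 hab, rfl⟩ _ ⟨b, right_mem_Icc.2 hab, rfl⟩).mono ?_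
  rintro _ ⟨t, ht, rfl⟩
  exact h t ht

theorem joinedIn_image_uIcc {γ : ℝ → ℂ} {a b : ℝ} (hγ : ContinuousOn γ (uIcc a b))
    {S : Set ℂ} (h : ∀ t ∈ uIcc a b, γ t ∈ S) : JoinedIn S (γ a) (γ b) := by
  rcases le_total a b with hab | hab
  · rw [uIcc_of_le hab] at *
    exact joinedIn_image_Icc hab hγ h
  · rw [uIcc_of_ge hab] at *
    exact (joinedIn_image_Icc hab hγ h).symm

theorem hasDerivAt_comp_real {f : ℂ → ℂ} {γ : ℝ → ℂ} {f' a : ℂ} {t : ℝ}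
    (hf : HasDerivAt f f' (γ t)) (hγ : HasDerivAt γ a t) :
    HasDerivAt (fun s => f (γ s)) (f' * a) t := by
  rw [mul_comm]
  exact hf.scomp t hγ

/-- At a regular zero of `Re f`, the nodal points on the two sides of the gradient direction
cannot be joined within the nodal set minus that zero. -/
theorem not_joinedIn_across_regular {f : ℂ → ℂ} (hf : DifferentiableOn ℂ f (Metric.ball 0 1))
    {z : ℂ} (hz : z ∈ reNodal f) (hz' : deriv f z ≠ 0) {K : Set ℂ} (hK : IsCompact K)
    (hKZ : K ⊆ reNodal f) :
    ∃ η > 0, ∀ q₁ q₂, dist q₁ z < η → dist q₂ z < η →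
      0 < ((q₁ - z) / (starRingEnd ℂ) (deriv f z)).im →
      ((q₂ - z) / (starRingEnd ℂ) (deriv f z)).im < 0 → ¬ JoinedIn (K \ {z}) q₁ q₂ := by
  set ν := (starRingEnd ℂ) (deriv f z) with hν
  have hν0 : ν ≠ 0 := by simpa [hν] using hz'
  obtain ⟨R, hR0, hR1, hKR⟩ : ∃ R, 0 < R ∧ R < 1 ∧ K ⊆ Metric.ball 0 R := by
    rcases K.eq_empty_or_nonempty with rfl | hne
    · exact ⟨1 / 2, by norm_num, by norm_num, by simp⟩
    obtain ⟨w, hw, hmax⟩ := hK.exists_isMaxOn hne continuous_norm.continuousOn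
    have hw1 : ‖w‖ < 1 := by simpa using (hKZ hw).1
    refine ⟨(‖w‖ + 1) / 2, by positivity, by linarith, fun y hy => ?_⟩
    have : ‖y‖ ≤ ‖w‖ := hmax hy
    simp; linarith
  have hD : HasDerivAt f (deriv f z) z :=
    (hf.differentiableAt (Metric.isOpen_ball.mem_nhds hz.1)).hasDerivAt
  -- `ν`, the conjugate of `f' z`, is the gradient of `Re f`, and the derivative in this direction
  -- is `|ν|² > 0`. So `Re f` changes sign at `z` along the segment.
  have hφ : HasDerivAt (fun x : ℝ => (f (z + x * ν)).re) (Complex.normSq ν) 0 := by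
    have h1 : HasDerivAt (fun x : ℝ => z + x * ν) ν 0 := by
      simpa using ((Complex.ofRealCLM.hasDerivAt (x := (0 : ℝ))).mul_const ν).const_add z
    have h2 : HasDerivAt (fun x : ℝ => f (z + x * ν)) (deriv f z * ν) 0 := by
      have h3 : HasDerivAt f (deriv f z) (z + ((0 : ℝ) : ℂ) * ν) := by simpa using hD
      exact hasDerivAt_comp_real h3 h1
    have h3 := Complex.reCLM.hasFDerivAt.comp_hasDerivAt (0 : ℝ) h2
    have h4 : (deriv f z * ν).re = Complex.normSq ν := by
      rw [hν, Complex.mul_conj]; simp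
    rw [← h4]
    exact h3
  have hpos : 0 < Complex.normSq ν := Complex.normSq_pos.2 hν0
  have hz0 : (f z).re = 0 := hz.2
  have hsign : ∀ᶠ x : ℝ in 𝓝 0, (0 < x → 0 < (f (z + x * ν)).re) ∧
      (x < 0 → (f (z + x * ν)).re < 0) := by
    have h1 := hasDerivAt_iff_tendsto_slope.1 hφ
    have h2 := h1.eventually (lt_mem_nhds hpos)
    rw [eventually_nhdsWithin_iff] at h2
    filter_upwards [h2] with x hx
    refine ⟨fun h => ?_, fun h => ?_⟩
    · have := hx h.ne'
      rw [slope_def_field] at this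
      simp only [Complex.ofReal_zero, zero_mul, add_zero, hz0, sub_zero] at this
      exact (div_pos_iff_of_pos_right h).1 this
    · have := hx h.ne
      rw [slope_def_field] at this
      simp only [Complex.ofReal_zero, zero_mul, add_zero, hz0, sub_zero] at this
      by_contra hc
      exact absurd this (not_lt.2 (div_nonpos_of_nonneg_of_nonpos (not_lt.1 hc) h.le))
  have hball : ∀ᶠ x : ℝ in 𝓝 0, z + x * ν ∈ Metric.ball (0 : ℂ) 1 := by
    have : ContinuousAt (fun x : ℝ => z + x * ν) 0 := by fun_prop
    apply this.eventually_mem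
    simpa using Metric.isOpen_ball.mem_nhds hz.1
  obtain ⟨δ, hδ, hδ'⟩ := Metric.eventually_nhds_iff.1 (hsign.and hball)
  have hd : ∀ x : ℝ, |x| ≤ δ / 2 → ((0 < x → 0 < (f (z + x * ν)).re) ∧
      (x < 0 → (f (z + x * ν)).re < 0)) ∧ z + x * ν ∈ Metric.ball (0 : ℂ) 1 := fun x hx =>
    hδ' (by rw [Real.dist_eq, sub_zero]; linarith)
  have hp := hd (δ / 2) (by rw [abs_of_pos]; linarith)
  have hm := hd (-(δ / 2)) (by rw [abs_neg, abs_of_pos]; linarith)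
  -- The ends of the segment are continued inside `{Re f > 0}` and `{Re f < 0}` out of the disc of
  -- radius `R` that contains `K`; this completes the crosscut.
  obtain ⟨b₁, hb₁, hJ₁⟩ := exists_joinedIn_far hf hp.2 (hp.1.1 (by linarith)) hR1
  obtain ⟨b₂, hb₂, hJ₂⟩ := exists_joinedIn_far hf.neg hm.2
    (by simpa using hm.1.2 (by linarith)) hR1
  set P := {w | w ∈ Metric.ball (0 : ℂ) 1 ∧ (f w).re ≠ 0} with hP
  have hJ₁' : JoinedIn P (z + ((δ / 2 : ℝ) : ℂ) * ν) b₁ := hJ₁.mono fun w hw => ⟨hw.1, hw.2.ne'⟩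
  have hJ₂' : JoinedIn P (z - ((δ / 2 : ℝ) : ℂ) * ν) b₂ := by
    have : z + ((-(δ / 2) : ℝ) : ℂ) * ν = z - ((δ / 2 : ℝ) : ℂ) * ν := by push_cast; ring
    rw [this] at hJ₂
    refine hJ₂.mono fun w hw => ⟨hw.1, ?_⟩
    have := hw.2
    simp at this
    exact this.ne
  obtain ⟨η, hη, h⟩ := not_joinedIn_across hν0 hR0 (half_pos hδ) (P := P)
    (fun h => h.2 hz0) hJ₁' hJ₂' hb₁ hb₂
  refine ⟨η, hη, fun q₁ q₂ h1 h2 h3 h4 hJ => h (K \ {z}) (sdiff_subset.trans hKR) ?_ ?_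
    q₁ q₂ h1 h2 h3 h4 hJ⟩
  · rw [disjoint_left]
    exact fun w hw hwP => hwP.2 (hKZ hw.1).2
  · rintro x hx ⟨hxK, hxz⟩
    have := (hd x hx).1
    have h0 : (f (z + x * ν)).re = 0 := (hKZ hxK).2
    rcases lt_trichotomy x 0 with hx0 | rfl | hx0
    · linarith [this.2 hx0]
    · simp at hxz
    · linarith [this.1 hx0]

/-- A differentiable curve in the nodal set through a regular zero `γ t₀` cuts the nodal set
there: its two sides cannot be joined within a compact part of the nodal set minus `γ t₀`. -/
theorem not_joinedIn_sides {f : ℂ → ℂ} (hf : DifferentiableOn ℂ f (Metric.ball 0 1))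
    {γ : ℝ → ℂ} {t₀ : ℝ} {a : ℂ} (hγ : HasDerivAt γ a t₀) (ha : a ≠ 0)
    (hγZ : ∀ᶠ t in 𝓝 t₀, γ t ∈ reNodal f) (hreg : deriv f (γ t₀) ≠ 0) {K : Set ℂ}
    (hK : IsCompact K) (hKZ : K ⊆ reNodal f) :
    ∀ᶠ ε : ℝ in 𝓝[>] 0, ¬ JoinedIn (K \ {γ t₀}) (γ (t₀ - ε)) (γ (t₀ + ε)) := by
  have hz : γ t₀ ∈ reNodal f := hγZ.self_of_nhds
  set z := γ t₀ with hzdef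
  obtain ⟨η, hη, h⟩ := not_joinedIn_across_regular hf hz hreg hK hKZ
  set ν := (starRingEnd ℂ) (deriv f z) with hν
  have hν0 : ν ≠ 0 := by simpa [hν] using hreg
  have hfd : HasDerivAt f (deriv f z) (γ t₀) :=
    (hf.differentiableAt (Metric.isOpen_ball.mem_nhds hz.1)).hasDerivAt
  have h1 : (deriv f z * a).re = 0 := by
    have h2 := Complex.reCLM.hasFDerivAt.comp_hasDerivAt t₀ (hasDerivAt_comp_real hfd hγ)
    have h3 : (Complex.reCLM ∘ fun s => f (γ s)) =ᶠ[𝓝 t₀] fun _ => (0 : ℝ) := by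
      filter_upwards [hγZ] with t ht
      exact ht.2
    exact (h2.congr_of_eventuallyEq h3.symm).unique (hasDerivAt_const t₀ (0 : ℝ))
  have haν : a / ν = ((Complex.normSq ν)⁻¹ : ℝ) * (deriv f z * a) := by
    have : deriv f z = (starRingEnd ℂ) ν := by simp [hν]
    rw [this, div_eq_mul_inv, Complex.inv_def]
    push_cast
    ring
  -- The tangent `a` is orthogonal to the gradient, so `a / ν` is purely imaginary and non-zero: `γ
  -- (t₀ - ε)` and `γ (t₀ + ε)` lie on different sides of the crosscut.
  have him : (a / ν).im ≠ 0 := by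
    intro h0
    have h2 : (a / ν).re = 0 := by rw [haν, Complex.re_ofReal_mul, h1, mul_zero]
    exact div_ne_zero ha hν0 (Complex.ext h2 h0)
  -- the imaginary part of `(γ t - z) / ν` near `t₀`
  have hψ : HasDerivAt (fun t => ((γ t - z) / ν).im) (a / ν).im t₀ :=
    Complex.imCLM.hasFDerivAt.comp_hasDerivAt t₀ ((hγ.sub_const z).div_const ν)
  have hslope := hasDerivAt_iff_tendsto_slope.1 hψ
  have hsq : 0 < (a / ν).im * (a / ν).im := mul_self_pos.2 him
  have hev : ∀ᶠ t in 𝓝[≠] t₀, 0 < (a / ν).im * (((γ t - z) / ν).im / (t - t₀)) := by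
    have := (hslope.const_mul (a / ν).im).eventually (lt_mem_nhds hsq)
    filter_upwards [this] with t ht
    rw [slope_def_field] at ht
    simpa [hzdef] using ht
  have hdist : ∀ᶠ t in 𝓝 t₀, dist (γ t) z < η := hγ.continuousAt.eventually
    (Metric.ball_mem_nhds _ hη)
  have hev' : ∀ᶠ t in 𝓝 t₀, t ≠ t₀ → 0 < (a / ν).im * (((γ t - z) / ν).im / (t - t₀)) := by
    rwa [eventually_nhdsWithin_iff] at hev
  have hp : Tendsto (fun ε : ℝ => t₀ + ε) (𝓝 0) (𝓝 t₀) := by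
    have : ContinuousAt (fun ε : ℝ => t₀ + ε) 0 := by fun_prop
    simpa [ContinuousAt] using this
  have hm : Tendsto (fun ε : ℝ => t₀ - ε) (𝓝 0) (𝓝 t₀) := by
    have : ContinuousAt (fun ε : ℝ => t₀ - ε) 0 := by fun_prop
    simpa [ContinuousAt] using this
  rw [eventually_nhdsWithin_iff]
  filter_upwards [hp.eventually (hev'.and hdist), hm.eventually (hev'.and hdist)] with ε hr hl hε
  have hε0 : (0 : ℝ) < ε := hε
  have hA := hr.1 (by linarith)
  have hB := hl.1 (by linarith)
  rw [add_sub_cancel_left, ← mul_div_assoc, div_pos_iff_of_pos_right hε0] at hA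
  rw [show t₀ - ε - t₀ = -ε by ring, ← mul_div_assoc, div_neg, Left.neg_pos_iff, div_neg_iff] at hB
  have hB : (a / ν).im * ((γ (t₀ - ε) - z) / ν).im < 0 := by
    rcases hB with h | h
    · linarith [h.2]
    · exact h.1
  intro hJ
  rcases lt_or_gt_of_ne him with hneg | hpos
  · exact h _ _ hl.2 hr.2 (by nlinarith) (by nlinarith) hJ
  · exact h _ _ hr.2 hl.2 (by nlinarith) (by nlinarith) hJ.symm

/-! ### Regular analytic curves in the nodal set -/

namespace IsRegularAnalyticCurve

variable {γ : ℝ → ℂ} (h : IsRegularAnalyticCurve γ)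

include h

theorem continuous : Continuous γ := continuous_iff_continuousAt.2 fun t => (h t).1.continuousAt

theorem hasDerivAt (t : ℝ) : HasDerivAt γ (deriv γ t) t := (h t).1.differentiableAt.hasDerivAt

theorem comp_analytic {g : ℝ → ℝ} (hg : ∀ t, AnalyticAt ℝ g t ∧ deriv g t ≠ 0) :
    IsRegularAnalyticCurve fun t => γ (g t) := fun t => by
  refine ⟨(h (g t)).1.fun_comp (hg t).1, ?_⟩
  have h1 : HasDerivAt (fun t => γ (g t)) (deriv g t • deriv γ (g t)) t :=
    (h.hasDerivAt (g t)).scomp t (hg t).1.differentiableAt.hasDerivAt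
  rw [h1.deriv]
  exact smul_ne_zero (hg t).2 (h (g t)).2

theorem comp_affine (t₀ : ℝ) {σ : ℝ} (hσ : σ ≠ 0) :
    IsRegularAnalyticCurve fun t => γ (t₀ + σ * t) := by
  apply h.comp_analytic
  intro t
  refine ⟨by fun_prop, ?_⟩
  have : HasDerivAt (fun t : ℝ => t₀ + σ * t) σ t := by
    simpa using ((hasDerivAt_id t).const_mul σ).const_add t₀
  rw [this.deriv]
  exact hσ

theorem eventually_regular {f : ℂ → ℂ} {t₀ : ℝ}
    (hreg : ∀ᶠ w in 𝓝[≠] (γ t₀), deriv f w ≠ 0) : ∀ᶠ t in 𝓝[≠] t₀, deriv f (γ t) ≠ 0 :=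
  ((h.hasDerivAt t₀).tendsto_nhdsNE (h t₀).2).eventually hreg

/-- A regular analytic curve in the nodal set of a nonconstant harmonic function is injective. -/
theorem injective_of_subset_reNodal {f : ℂ → ℂ} (hf : DifferentiableOn ℂ f (Metric.ball 0 1))
    (hreg : ∀ z ∈ Metric.ball (0 : ℂ) 1, ∀ᶠ w in 𝓝[≠] z, deriv f w ≠ 0)
    (hγ : range γ ⊆ reNodal f) : Function.Injective γ := by
  have hZ : ∀ t, γ t ∈ reNodal f := fun t => hγ ⟨t, rfl⟩
  suffices key : ∀ s₀ t₀, s₀ < t₀ → γ s₀ ≠ γ t₀ by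
    intro s t hst
    rcases lt_trichotomy s t with hlt | rfl | hlt
    · exact absurd hst (key s t hlt)
    · rfl
    · exact absurd hst.symm (key t s hlt)
  intro s₀ t₀ hlt heq
  -- The set of coincidences of `γ`; its compactness yields a first one, hence a loop without
  -- earlier self-intersections.
  let K : Set (ℝ × ℝ) := {q | q ∈ Icc s₀ t₀ ×ˢ Icc s₀ t₀ ∧ q.1 < q.2 ∧ γ q.1 = γ q.2}
  have hKcl : IsClosed K := by
    apply isClosed_of_closure_subset
    intro q hq
    have h1 : q ∈ {q : ℝ × ℝ | q ∈ Icc s₀ t₀ ×ˢ Icc s₀ t₀ ∧ q.1 ≤ q.2 ∧ γ q.1 = γ q.2} := by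
      refine closure_minimal (s := K) (fun q hq => ?_) ?_ hq
      · exact ⟨hq.1, hq.2.1.le, hq.2.2⟩
      refine (isClosed_Icc.prod isClosed_Icc).inter (IsClosed.inter ?_ ?_)
      · exact isClosed_le continuous_fst continuous_snd
      · exact isClosed_eq (h.continuous.comp continuous_fst) (h.continuous.comp continuous_snd)
    -- Coincidences do not accumulate on the diagonal, because strict differentiability with
    -- non-zero derivative makes `γ` locally injective.
    refine ⟨h1.1, lt_of_le_of_ne h1.2.1 fun he => ?_, h1.2.2⟩
    have hs : HasStrictDerivAt γ (deriv γ q.1) q.1 := (h q.1).1.hasStrictDerivAt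
    have hev := hs.hasStrictFDerivAt.isLittleO.def
      (half_pos (norm_pos_iff.2 (h q.1).2))
    rw [show (q.1, q.1) = q from Prod.ext rfl he] at hev
    obtain ⟨q', hq'U, hq'K⟩ := mem_closure_iff_nhds.1 hq _ hev
    have h2 : ‖γ q'.1 - γ q'.2 - ContinuousLinearMap.toSpanSingleton ℝ (deriv γ q.1) (q'.1 - q'.2)‖ ≤
      ‖deriv γ q.1‖ / 2 * ‖q'.1 - q'.2‖ := hq'U
    rw [hq'K.2.2, sub_self, zero_sub, norm_neg, ContinuousLinearMap.toSpanSingleton_apply,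
      norm_smul] at h2
    have h3 : 0 < ‖q'.1 - q'.2‖ := norm_pos_iff.2 (sub_ne_zero.2 hq'K.2.1.ne)
    have h4 := norm_pos_iff.2 (h q.1).2
    nlinarith [mul_pos h3 h4]
  have hKc : IsCompact K := (isCompact_Icc.prod isCompact_Icc).of_isClosed_subset hKcl fun q hq => hq.1
  have hKne : K.Nonempty := ⟨(s₀, t₀), ⟨⟨le_rfl, hlt.le⟩, ⟨hlt.le, le_rfl⟩⟩, hlt, heq⟩
  obtain ⟨⟨s₁, t₁⟩, ⟨⟨hs₁, ht₁⟩, hlt₁, heq₁⟩, hmin⟩ :=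
    hKc.exists_isMinOn hKne continuous_snd.continuousOn
  simp only at hs₁ ht₁ hlt₁ heq₁
  have hmin' : ∀ s t, s₁ ≤ s → s < t → t < t₁ → γ s ≠ γ t := by
    intro s t h1 h2 h3 h4
    have : t₁ ≤ t := hmin (show (s, t) ∈ K from ⟨⟨⟨hs₁.1.trans h1, by linarith [ht₁.2]⟩,
      ⟨by linarith [hs₁.1], by linarith [ht₁.2]⟩⟩, h2, h4⟩)
    linarith
  -- a regular parameter strictly inside
  obtain ⟨x, hxreg, hx⟩ : ∃ x, deriv f (γ x) ≠ 0 ∧ x ∈ Ioo s₁ t₁ := by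
    have h1 := h.eventually_regular (hreg _ (hZ ((s₁ + t₁) / 2)).1)
    have h2 : ∀ᶠ x in 𝓝[≠] ((s₁ + t₁) / 2), x ∈ Ioo s₁ t₁ :=
      nhdsWithin_le_nhds (Ioo_mem_nhds (by linarith) (by linarith))
    exact (h1.and h2).exists
  have honce : ∀ y ∈ Icc s₁ t₁, y ≠ x → γ y ≠ γ x := by
    intro y hy hyx he
    rcases lt_or_gt_of_ne hyx with hlt' | hlt'
    · exact hmin' y x hy.1 hlt' hx.2 he
    · rcases hy.2.lt_or_eq with h1 | h1
      · exact hmin' x y hx.1.le hlt' h1 he.symm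
      · rw [h1, ← heq₁] at he
        exact hmin' s₁ x le_rfl hx.1 hx.2 he
  have hcut := not_joinedIn_sides hf (h.hasDerivAt x) (h x).2 (Eventually.of_forall hZ) hxreg
    (isCompact_Icc.image h.continuous : IsCompact (γ '' Icc s₁ t₁))
    (by rintro _ ⟨t, -, rfl⟩; exact hZ t)
  have hsmall : ∀ᶠ ε : ℝ in 𝓝[>] 0, ε < min (x - s₁) (t₁ - x) :=
    nhdsWithin_le_nhds (gt_mem_nhds (by simpa using hx))
  obtain ⟨ε, hε, hε1, hε0⟩ := (hcut.and (hsmall.and self_mem_nhdsWithin)).exists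
  have hε0' : (0 : ℝ) < ε := hε0
  rw [lt_min_iff] at hε1
  -- The rest of the loop, through its closing point `γ s₁ = γ t₁`, joins the two sides of the
  -- regular point `γ x`.
  apply hε
  have hmem : ∀ t ∈ Icc s₁ t₁, t ≠ x → γ t ∈ γ '' Icc s₁ t₁ \ {γ x} := fun t ht htx =>
    ⟨⟨t, ht, rfl⟩, honce t ht htx⟩
  have hJ1 : JoinedIn (γ '' Icc s₁ t₁ \ {γ x}) (γ s₁) (γ (x - ε)) :=
    joinedIn_image_Icc (by linarith) h.continuous.continuousOn fun t ht =>
      hmem t ⟨ht.1, by linarith [ht.2, hx.2]⟩ (by linarith [ht.2] : t < x).ne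
  have hJ2 : JoinedIn (γ '' Icc s₁ t₁ \ {γ x}) (γ (x + ε)) (γ t₁) :=
    joinedIn_image_Icc (by linarith) h.continuous.continuousOn fun t ht =>
      hmem t ⟨by linarith [ht.1, hx.1], ht.2⟩ (by linarith [ht.1] : x < t).ne'
  rw [← heq₁] at hJ2
  exact hJ1.symm.trans hJ2.symm

end IsRegularAnalyticCurve

/-- If a curve with initial direction `b` meets a compact part of a differentiable curve `γ`
arbitrarily close to its starting point, then `γ` passes through that point, with tangent
direction parallel to `b`. -/
theorem exists_parallel_of_frequently {γ : ℝ → ℂ} (hγ : Differentiable ℝ γ) {a : ℝ → ℂ} {b : ℂ}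
    (ha : HasDerivAt a b 0) {J : Set ℝ} (hJ : IsCompact J) (hne : ∀ᶠ x in 𝓝[>] 0, a x ≠ a 0)
    (hf : ∃ᶠ x in 𝓝[>] (0 : ℝ), a x ∈ γ '' J) :
    ∃ t ∈ J, γ t = a 0 ∧ (deriv γ t * (starRingEnd ℂ) b).im = 0 := by
  obtain ⟨x, hx, hxJ⟩ := exists_seq_forall_of_frequently (hf.and_eventually hne)
  choose hxJ hxne using hxJ
  choose t ht htx using hxJ
  obtain ⟨t', ht', φ, hφ, hlim⟩ := hJ.tendsto_subseq ht
  have hx0 : Tendsto x atTop (𝓝[≠] 0) := hx.mono_right (nhdsGT_le_nhdsNE 0)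
  have hxφ : Tendsto (x ∘ φ) atTop (𝓝[≠] 0) := hx0.comp hφ.tendsto_atTop
  have h1 : γ t' = a 0 := by
    have h2 : Tendsto (fun i => γ (t (φ i))) atTop (𝓝 (γ t')) :=
      (hγ.continuous.tendsto t').comp hlim
    have h3 : Tendsto (fun i => a (x (φ i))) atTop (𝓝 (a 0)) :=
      ha.continuousAt.tendsto.comp (hxφ.mono_right nhdsWithin_le_nhds)
    refine tendsto_nhds_unique h2 (h3.congr fun i => (htx _).symm)
  refine ⟨t', ht', h1, ?_⟩
  have htne : ∀ i, t (φ i) ≠ t' := fun i he => hxne (φ i) (by rw [← htx, he, h1])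
  have hlim' : Tendsto (t ∘ φ) atTop (𝓝[≠] t') :=
    tendsto_nhdsWithin_iff.2 ⟨hlim, Eventually.of_forall htne⟩
  have hs1 := (hasDerivAt_iff_tendsto_slope.1 (hγ t').hasDerivAt).comp hlim'
  have hs2 := (hasDerivAt_iff_tendsto_slope.1 ha).comp hxφ
  have hs3 := hs1.mul ((Complex.continuous_conj.tendsto b).comp hs2)
  have hs4 := (Complex.continuous_im.tendsto _).comp hs3
  refine tendsto_nhds_unique hs4 (tendsto_const_nhds.congr fun i => ?_)
  simp only [Function.comp_apply, slope_def_module, htx, h1, Complex.real_smul, map_mul,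
    Complex.conj_ofReal, sub_zero]
  -- Both slopes are real multiples of the same chord, since `γ (t i) = a (x i)`; hence slope times
  -- conjugate slope is real, and so is the limit.
  have : (((t (φ i) - t')⁻¹ : ℝ) : ℂ) * (a (x (φ i)) - a 0) *
      ((((x (φ i))⁻¹ : ℝ) : ℂ) * (starRingEnd ℂ) (a (x (φ i)) - a 0)) =
      (((t (φ i) - t')⁻¹ * (x (φ i))⁻¹ * Complex.normSq (a (x (φ i)) - a 0) : ℝ) : ℂ) := by
    push_cast
    rw [← Complex.mul_conj]
    ring
  rw [this, Complex.ofReal_im]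

/-! ### Local normal form at a zero -/

/-- If `f - f z₁` vanishes to order `k` at `z₁`, then it is the `k`-th power of a local
coordinate. -/
theorem exists_local_pow {f g : ℂ → ℂ} {z₁ : ℂ} {k : ℕ} (hk : k ≠ 0) (hg : AnalyticAt ℂ g z₁)
    (hg0 : g z₁ ≠ 0) (hfg : ∀ᶠ z in 𝓝 z₁, f z = f z₁ + (z - z₁) ^ k * g z) {U : Set ℂ}
    (hU : U ∈ 𝓝 z₁) :
    ∃ e : OpenPartialHomeomorph ℂ ℂ, z₁ ∈ e.source ∧ e z₁ = 0 ∧ e.source ⊆ U ∧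
      (∀ z ∈ e.source, f z = f z₁ + e z ^ k) ∧
      ∀ w ∈ e.target, ∃ d ≠ 0, HasDerivAt e.symm d w := by
  have hkC : (k : ℂ) ≠ 0 := by exact_mod_cast hk
  set c : ℂ := (g z₁) ^ ((k : ℂ)⁻¹) with hc
  have hck : c ^ k = g z₁ := Complex.cpow_nat_inv_pow _ hk
  have hc0 : c ≠ 0 := by
    intro h
    rw [h, zero_pow hk] at hck
    exact hg0 hck.symm
  -- A `k`-th root of `(z - z₁) ^ k * g z`: `c` is a root of `g z₁`, and `g / g z₁` is near `1`,
  -- where the principal logarithm is analytic.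
  set ζ : ℂ → ℂ := fun z => (z - z₁) * (c * Complex.exp (Complex.log (g z / g z₁) / k)) with hζ
  have hζa : AnalyticAt ℂ ζ z₁ := by
    have h1 : AnalyticAt ℂ (fun z => g z / g z₁) z₁ := hg.div analyticAt_const hg0
    have h2 : AnalyticAt ℂ (fun z => Complex.log (g z / g z₁)) z₁ :=
      h1.clog (by rw [div_self hg0]; simp)
    have h3 : AnalyticAt ℂ (fun z => Complex.exp (Complex.log (g z / g z₁) / k)) z₁ :=
      (h2.div analyticAt_const hkC).cexp
    exact (analyticAt_id.sub analyticAt_const).mul (analyticAt_const.mul h3)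
  have hζd : HasDerivAt ζ c z₁ := by
    have h1 : HasDerivAt (fun z : ℂ => z - z₁) 1 z₁ := (hasDerivAt_id z₁).sub_const z₁
    have h2 : AnalyticAt ℂ (fun z => c * Complex.exp (Complex.log (g z / g z₁) / k)) z₁ := by
      have h1 : AnalyticAt ℂ (fun z => g z / g z₁) z₁ := hg.div analyticAt_const hg0
      have h2 : AnalyticAt ℂ (fun z => Complex.log (g z / g z₁)) z₁ :=
        h1.clog (by rw [div_self hg0]; simp)
      exact analyticAt_const.mul (h2.div analyticAt_const hkC).cexp
    have := h1.mul h2.differentiableAt.hasDerivAt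
    simp only [div_self hg0, Complex.log_one, zero_div, Complex.exp_zero, mul_one, sub_self,
      zero_mul, add_zero, one_mul] at this
    exact this
  have hζpow : ∀ᶠ z in 𝓝 z₁, f z = f z₁ + ζ z ^ k := by
    have hgne : ∀ᶠ z in 𝓝 z₁, g z ≠ 0 := hg.continuousAt.eventually_ne hg0
    filter_upwards [hfg, hgne] with z hz hgz
    rw [hz, hζ]
    simp only
    rw [mul_pow, mul_pow, hck, ← Complex.exp_nat_mul, mul_div_cancel₀ _ hkC,
      Complex.exp_log (div_ne_zero hgz hg0), mul_div_cancel₀ _ hg0]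
  have hstrict : HasStrictDerivAt ζ c z₁ := hζd.deriv ▸ hζa.hasStrictDerivAt
  have hsf := hstrict.hasStrictFDerivAt_equiv hc0
  have hgood : ∀ᶠ z in 𝓝 z₁, f z = f z₁ + ζ z ^ k ∧ AnalyticAt ℂ ζ z ∧ deriv ζ z ≠ 0 ∧ z ∈ U := by
    have h1 : ∀ᶠ z in 𝓝 z₁, deriv ζ z ≠ 0 :=
      hζa.deriv.continuousAt.eventually_ne (by rw [hζd.deriv]; exact hc0)
    exact hζpow.and (hζa.eventually_analyticAt.and (h1.and hU))
  obtain ⟨S, hS, hSo, hzS⟩ := eventually_nhds_iff.1 hgood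
  let e := (hsf.toOpenPartialHomeomorph ζ).restrOpen S hSo
  have heS : e.source ⊆ S := fun z hz => by
    have : z ∈ (hsf.toOpenPartialHomeomorph ζ).source ∩ S := hz
    exact this.2
  have hez : ∀ z, e z = ζ z := fun z => rfl
  refine ⟨e, ?_, ?_, fun z hz => (hS z (heS hz)).2.2.2, fun z hz => ?_, fun w hw => ?_⟩
  · exact ⟨hsf.mem_toOpenPartialHomeomorph_source, hzS⟩
  · rw [hez]; simp [hζ]
  · rw [hez]; exact (hS z (heS hz)).1
  · have hz := heS (e.map_target hw)
    refine ⟨_, inv_ne_zero (hS _ hz).2.2.1, e.hasDerivAt_symm hw (hS _ hz).2.2.1 ?_⟩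
    exact (hS _ hz).2.1.differentiableAt.hasDerivAt

/-- If `f - f z₁` vanished to infinite order, `f'` would vanish near `z₁`; so the order is finite,
and it is not `0` because the difference vanishes at `z₁`. -/
theorem exists_factor {f : ℂ → ℂ} {z₁ : ℂ} (hf : AnalyticAt ℂ f z₁)
    (hreg : ∀ᶠ w in 𝓝[≠] z₁, deriv f w ≠ 0) :
    ∃ k ≠ 0, ∃ g : ℂ → ℂ, AnalyticAt ℂ g z₁ ∧ g z₁ ≠ 0 ∧
      ∀ᶠ z in 𝓝 z₁, f z = f z₁ + (z - z₁) ^ k * g z := by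
  have h1 : AnalyticAt ℂ (fun z => f z - f z₁) z₁ := hf.sub analyticAt_const
  have h2 : analyticOrderAt (fun z => f z - f z₁) z₁ ≠ ⊤ := by
    intro h
    rw [analyticOrderAt_eq_top] at h
    have h3 : f =ᶠ[𝓝 z₁] fun _ => f z₁ := by
      filter_upwards [h] with z hz
      exact sub_eq_zero.1 hz
    have h4 : ∀ᶠ w in 𝓝 z₁, deriv f w = 0 := by
      filter_upwards [h3.deriv] with w hw
      rw [hw]; simp
    obtain ⟨w, hw, hw'⟩ := (hreg.and (nhdsWithin_le_nhds h4)).exists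
    exact hw hw'
  obtain ⟨g, hg, hg0, hfg⟩ := (h1.analyticOrderAt_ne_top).1 h2
  refine ⟨analyticOrderNatAt (fun z => f z - f z₁) z₁, ?_, g, hg, hg0, ?_⟩
  · intro h0
    rw [h0] at hfg
    have := hfg.self_of_nhds
    simp at this
    exact hg0 this.symm
  · filter_upwards [hfg] with z hz
    rw [smul_eq_mul] at hz
    rw [← hz]; ring

/-- A differentiable arc of nodal points, all regular except possibly `a 0`. -/
structure IsNodalArc (f : ℂ → ℂ) (a : ℝ → ℂ) (η : ℝ) : Prop where
  pos : 0 < η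
  mem : ∀ x ∈ Ioo (-η) η, a x ∈ reNodal f
  hasDerivAt : ∀ x ∈ Ioo (-η) η, ∃ d ≠ 0, HasDerivAt a d x
  injOn : InjOn a (Ioo (-η) η)
  regular : ∀ x ∈ Ioo (-η) η, x ≠ 0 → deriv f (a x) ≠ 0

/-- In the coordinate whose `k`-th power is `f - f z₁`, a real line with direction `ω`, `Re (ω ^ k)
= 0`, consists of zeros of `Re f`. The constant `c` is the derivative of the inverse coordinate at
`0`, so it is the same for all directions. -/
theorem exists_nodalArc {f g : ℂ → ℂ} (hf : DifferentiableOn ℂ f (Metric.ball 0 1)) {z₁ : ℂ}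
    (hz : z₁ ∈ reNodal f) {k : ℕ} (hk : k ≠ 0) (hg : AnalyticAt ℂ g z₁) (hg0 : g z₁ ≠ 0)
    (hfg : ∀ᶠ z in 𝓝 z₁, f z = f z₁ + (z - z₁) ^ k * g z) :
    ∃ c ≠ 0, ∀ ω : ℂ, ‖ω‖ = 1 → (ω ^ k).re = 0 →
      ∃ a η, IsNodalArc f a η ∧ a 0 = z₁ ∧ HasDerivAt a (c * ω) 0 := by
  obtain ⟨e, hze, he0, heU, hfe, hed⟩ := exists_local_pow hk hg hg0 hfg
    (Metric.isOpen_ball.mem_nhds hz.1)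
  have h0t : (0 : ℂ) ∈ e.target := he0 ▸ e.map_source hze
  obtain ⟨c, hc0, hc⟩ := hed 0 h0t
  obtain ⟨η, hη, hηt⟩ := Metric.isOpen_iff.1 e.open_target 0 h0t
  refine ⟨c, hc0, fun ω hω hre => ⟨fun x => e.symm (x * ω), η, ?_, ?_, ?_⟩⟩
  · have hω0 : ω ≠ 0 := norm_ne_zero_iff.1 (by rw [hω]; exact one_ne_zero)
    have hmem : ∀ x ∈ Ioo (-η) η, (x * ω : ℂ) ∈ e.target := fun x hx => hηt (by
      simp [hω, abs_lt]; exact hx)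
    have hder : ∀ x ∈ Ioo (-η) η, ∃ d ≠ 0, HasDerivAt (fun x : ℝ => e.symm (x * ω)) d x := by
      intro x hx
      obtain ⟨d, hd0, hd⟩ := hed _ (hmem x hx)
      have h1 : HasDerivAt (fun x : ℝ => (x * ω : ℂ)) ω x := by
        simpa using (Complex.ofRealCLM.hasDerivAt (x := x)).mul_const ω
      exact ⟨d * ω, mul_ne_zero hd0 hω0, hasDerivAt_comp_real hd h1⟩
    have hval : ∀ x ∈ Ioo (-η) η, f (e.symm (x * ω)) = f z₁ + (x * ω) ^ k := fun x hx => by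
      rw [hfe _ (e.map_target (hmem x hx)), e.right_inv (hmem x hx)]
    refine ⟨hη, fun x hx => ⟨heU (e.map_target (hmem x hx)), ?_⟩, hder, ?_, ?_⟩
    · show (f _).re = 0
      rw [hval x hx, Complex.add_re, show (f z₁).re = 0 from hz.2, zero_add, mul_pow, ← Complex.ofReal_pow,
        Complex.re_ofReal_mul, hre, mul_zero]
    · intro x hx y hy hxy
      have := e.symm.injOn (hmem x hx) (hmem y hy) hxy
      exact_mod_cast mul_right_cancel₀ hω0 this
    · intro x hx hx0 hd0
      obtain ⟨d, -, hd⟩ := hder x hx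
      have h1 : HasDerivAt f (deriv f (e.symm (x * ω))) (e.symm (x * ω)) :=
        (hf.differentiableAt (Metric.isOpen_ball.mem_nhds
          (heU (e.map_target (hmem x hx))))).hasDerivAt
      have h2 := hasDerivAt_comp_real h1 hd
      rw [hd0, zero_mul] at h2
      have h3 : HasDerivAt (fun x : ℝ => f z₁ + (x * ω) ^ k) (k * (x * ω) ^ (k - 1) * ω) x := by
        have h1 : HasDerivAt (fun x : ℝ => (x * ω : ℂ)) ω x := by
          simpa using (Complex.ofRealCLM.hasDerivAt (x := x)).mul_const ω
        exact (hasDerivAt_comp_real (γ := fun x : ℝ => (x * ω : ℂ)) (hasDerivAt_pow k _) h1).const_add _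
      have h4 := h2.congr_of_eventuallyEq (f₁ := fun x : ℝ => f z₁ + (x * ω) ^ k) (by
        filter_upwards [Ioo_mem_nhds hx.1 hx.2] with y hy
        exact (hval y hy).symm)
      have h5 := h3.unique h4
      have hx0' : (x : ℂ) ≠ 0 := by exact_mod_cast hx0
      have hkC : (k : ℂ) ≠ 0 := by exact_mod_cast hk
      exact mul_ne_zero (mul_ne_zero hkC (pow_ne_zero _ (mul_ne_zero hx0' hω0))) hω0 h5
  · simp only [Complex.ofReal_zero, zero_mul]
    rw [← he0, e.left_inv hze]
  · have h1 : HasDerivAt (fun x : ℝ => (x * ω : ℂ)) ω 0 := by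
      simpa using (Complex.ofRealCLM.hasDerivAt (x := (0:ℝ))).mul_const ω
    exact hasDerivAt_comp_real (by simpa using hc) h1

/-! ### Nodal stars: critical points, zeros and order at the origin -/

/-- The nodal set of `Re f` in the unit disc is the union of the regular analytic curves `Γ k`,
all of which pass through the origin. -/
structure IsNodalStar (f : ℂ → ℂ) {n : ℕ} (Γ : Fin n → ℝ → ℂ) : Prop where
  differentiableOn : DifferentiableOn ℂ f (Metric.ball 0 1)
  nonconst : ∀ z ∈ Metric.ball (0 : ℂ) 1, ∀ᶠ w in 𝓝[≠] z, deriv f w ≠ 0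
  curve : ∀ k, IsRegularAnalyticCurve (Γ k)
  subset : ∀ k, range (Γ k) ⊆ reNodal f
  zero_mem : ∀ k, (0 : ℂ) ∈ range (Γ k)
  cover : reNodal f ⊆ ⋃ k, range (Γ k)

namespace IsNodalStar

variable {f : ℂ → ℂ} {n : ℕ} {Γ : Fin n → ℝ → ℂ} (h : IsNodalStar f Γ)

include h

theorem injective (k : Fin n) : Function.Injective (Γ k) :=
  (h.curve k).injective_of_subset_reNodal h.differentiableOn h.nonconst (h.subset k)

theorem differentiable (k : Fin n) : Differentiable ℝ (Γ k) := fun t =>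
  ((h.curve k).hasDerivAt t).differentiableAt

theorem analyticAt {z : ℂ} (hz : z ∈ Metric.ball (0 : ℂ) 1) : AnalyticAt ℂ f z :=
  h.differentiableOn.analyticAt (Metric.isOpen_ball.mem_nhds hz)

/-- A nodal arc whose initial point can be joined to the origin away from the arc is tangent to
one of the curves `Γ k`. -/
theorem exists_parallel {a : ℝ → ℂ} {η : ℝ} (ha : IsNodalArc f a η) {b : ℂ}
    (hb : HasDerivAt a b 0) {K₀ : Set ℂ} (hK₀ : IsCompact K₀) (hK₀Z : K₀ ⊆ reNodal f)
    (hJ : JoinedIn K₀ (a 0) 0) (haK : ∀ᶠ x in 𝓝[>] 0, a x ∉ K₀) :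
    ∃ k t, Γ k t = a 0 ∧ (deriv (Γ k) t * (starRingEnd ℂ) b).im = 0 := by
  have hηp := ha.pos
  obtain ⟨x₁, hx₁, hx₁K⟩ := (mem_nhdsGT_iff_exists_Ioo_subset).1 haK
  have hx₁' : (0 : ℝ) < x₁ := hx₁
  set x₀ := min x₁ η / 2 with hx₀def
  have hx₀ : 0 < x₀ := by positivity
  have hx₀1 : x₀ < x₁ := by
    have := min_le_left x₁ η
    rw [hx₀def]; linarith
  have hx₀η : x₀ < η := by
    have := min_le_right x₁ η
    rw [hx₀def]; linarith
  have hIoo : ∀ x ∈ Icc 0 x₀, x ∈ Ioo (-η) η := fun x hx => ⟨by linarith [hx.1], by linarith [hx.2]⟩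
  obtain ⟨k, t₀, ht₀⟩ := mem_iUnion.1 (h.cover (ha.mem x₀ (hIoo x₀ ⟨hx₀.le, le_rfl⟩)))
  obtain ⟨τ, hτ⟩ := h.zero_mem k
  have hne : ∀ᶠ x in 𝓝[>] (0 : ℝ), a x ≠ a 0 := by
    filter_upwards [Ioo_mem_nhdsGT hηp] with x hx he
    exact hx.1.ne' (ha.injOn ⟨by linarith [hx.1], hx.2⟩ ⟨by linarith, hηp⟩ he)
  -- If `Γ k` between `a x₀` and the origin missed some `a x`, this regular point could be bypassed:
  -- from `a 0` to the origin in `K₀`, then along `Γ k` to `a x₀`. So `Γ k` meets the arc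
  -- arbitrarily close to `a 0`.
  have hfr : ∃ᶠ x in 𝓝[>] (0 : ℝ), a x ∈ Γ k '' uIcc t₀ τ := by
    intro hcon
    obtain ⟨x, hxJ, hx⟩ := (hcon.and (Ioo_mem_nhdsGT hx₀)).exists
    have hxI := hIoo x ⟨hx.1.le, hx.2.le⟩
    have hacont : ContinuousOn a (Icc 0 x₀) := fun y hy => by
      obtain ⟨d, -, hd⟩ := ha.hasDerivAt y (hIoo y hy)
      exact hd.continuousAt.continuousWithinAt
    set K := K₀ ∪ a '' Icc 0 x₀ ∪ Γ k '' uIcc t₀ τ with hK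
    have hKc : IsCompact K := (hK₀.union (isCompact_Icc.image_of_continuousOn hacont)).union
      (isCompact_uIcc.image (h.curve k).continuous)
    have hKZ : K ⊆ reNodal f := by
      rintro _ ((hw | ⟨y, hy, rfl⟩) | ⟨t, -, rfl⟩)
      · exact hK₀Z hw
      · exact ha.mem y (hIoo y hy)
      · exact h.subset k ⟨t, rfl⟩
    obtain ⟨d, hd0, hd⟩ := ha.hasDerivAt x hxI
    have hcut := not_joinedIn_sides h.differentiableOn hd hd0 (by
      filter_upwards [Ioo_mem_nhds hxI.1 hxI.2] with y hy
      exact ha.mem y hy) (ha.regular x hxI hx.1.ne') hKc hKZ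
    have hsmall : ∀ᶠ ε : ℝ in 𝓝[>] 0, ε < min x (x₀ - x) :=
      nhdsWithin_le_nhds (gt_mem_nhds (by simpa using hx))
    obtain ⟨ε, hε, hε1, hε0⟩ := (hcut.and (hsmall.and self_mem_nhdsWithin)).exists
    have hε0' : (0 : ℝ) < ε := hε0
    rw [lt_min_iff] at hε1
    apply hε
    have hmem : ∀ y ∈ Icc 0 x₀, y ≠ x → a y ∈ K \ {a x} := fun y hy hyx =>
      ⟨Or.inl (Or.inr ⟨y, hy, rfl⟩), fun he => hyx (ha.injOn (hIoo y hy) hxI he)⟩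
    have hJ1 : JoinedIn (K \ {a x}) (a 0) (a (x - ε)) :=
      joinedIn_image_Icc (by linarith) (hacont.mono (Icc_subset_Icc le_rfl (by linarith [hx.2])))
        fun y hy => hmem y ⟨hy.1, by linarith [hy.2, hx.2]⟩ (by linarith [hy.2] : y < x).ne
    have hJ2 : JoinedIn (K \ {a x}) (a (x + ε)) (a x₀) :=
      joinedIn_image_Icc (by linarith) (hacont.mono (Icc_subset_Icc (by linarith [hx.1]) le_rfl))
        fun y hy => hmem y ⟨by linarith [hy.1, hx.1], hy.2⟩ (by linarith [hy.1] : x < y).ne'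
    have hJ3 : JoinedIn (K \ {a x}) (a x₀) 0 := by
      rw [← ht₀, ← hτ]
      exact joinedIn_image_uIcc (h.curve k).continuous.continuousOn fun t ht =>
        ⟨Or.inr ⟨t, ht, rfl⟩, fun he => hxJ ⟨t, ht, he⟩⟩
    have hJ4 : JoinedIn (K \ {a x}) (a 0) 0 := hJ.mono fun w hw => ⟨Or.inl (Or.inl hw), by
      rintro rfl
      exact hx₁K ⟨hx.1, hx.2.trans hx₀1⟩ hw⟩
    exact (hJ1.symm.trans hJ4).trans (hJ2.trans hJ3).symm
  obtain ⟨t, -, ht, hp⟩ := exists_parallel_of_frequently (h.differentiable k) hb isCompact_uIcc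
    hne hfr
  exact ⟨k, t, ht, hp⟩

end IsNodalStar

/-- Vanishing of `Im (q * conj b)` expresses real parallelism; this is its transitivity through a
non-zero vector. -/
theorem im_mul_conj_eq_zero_trans {q b d : ℂ} (hq : q ≠ 0)
    (hb : (q * (starRingEnd ℂ) b).im = 0) (hd : (q * (starRingEnd ℂ) d).im = 0) :
    (d * (starRingEnd ℂ) b).im = 0 := by
  have h1 : (Complex.normSq q : ℂ) * (d * (starRingEnd ℂ) b) =
      (q * (starRingEnd ℂ) b) * (starRingEnd ℂ) (q * (starRingEnd ℂ) d) := by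
    rw [← Complex.mul_conj]; simp only [map_mul, Complex.conj_conj]; ring
  have h2 := congrArg Complex.im h1
  rw [Complex.im_ofReal_mul, Complex.mul_im (q * _), hb, Complex.conj_im (q * _), hd] at h2
  simp only [neg_zero, mul_zero, zero_mul, add_zero] at h2
  exact (mul_eq_zero.1 h2).resolve_left (Complex.normSq_pos.2 hq).ne'

namespace IsNodalStar

variable {f : ℂ → ℂ} {n : ℕ} {Γ : Fin n → ℝ → ℂ} (h : IsNodalStar f Γ)

include h

/-- The origin is the only zero of `Re f` that can be critical. -/
theorem deriv_ne_zero {z₁ : ℂ} (hz₁ : z₁ ∈ reNodal f) (hz0 : z₁ ≠ 0) : deriv f z₁ ≠ 0 := by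
  intro hcrit
  obtain ⟨k, hk, g, hg, hg0, hfg⟩ := exists_factor (h.analyticAt hz₁.1) (h.nonconst z₁ hz₁.1)
  have hk2 : 2 ≤ k := by
    by_contra hk2
    have hk1 : k = 1 := by omega
    subst hk1
    have h1 : HasDerivAt (fun z => f z₁ + (z - z₁) ^ 1 * g z)
        (1 * g z₁ + (z₁ - z₁) ^ 1 * deriv g z₁) z₁ := by
      have h2 : HasDerivAt (fun z : ℂ => (z - z₁) ^ 1) 1 z₁ := by
        simpa using (hasDerivAt_id z₁).sub_const z₁
      exact (h2.mul hg.differentiableAt.hasDerivAt).const_add _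
    have h3 := (h1.congr_of_eventuallyEq hfg).deriv
    rw [hcrit] at h3
    simp at h3
    exact hg0 h3.symm
  obtain ⟨c, hc0, harc⟩ := exists_nodalArc h.differentiableOn hz₁ hk hg hg0 hfg
  obtain ⟨j, t₁, ht₁⟩ := mem_iUnion.1 (h.cover hz₁)
  obtain ⟨τ, hτ⟩ := h.zero_mem j
  have hτt : τ - t₁ ≠ 0 := fun he => hz0 (by rw [← ht₁, ← sub_eq_zero.1 he, hτ])
  set γ : ℝ → ℂ := fun x => Γ j (t₁ + (τ - t₁) * x) with hγdef
  have hγ : IsRegularAnalyticCurve γ := (h.curve j).comp_affine t₁ hτt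
  have hγ0 : γ 0 = z₁ := by simp [hγdef, ht₁]
  have hγ1 : γ 1 = 0 := by simp [hγdef, hτ]
  have hγZ : ∀ t, γ t ∈ reNodal f := fun t => h.subset j ⟨_, rfl⟩
  have hγinj : Function.Injective γ := hγ.injective_of_subset_reNodal h.differentiableOn h.nonconst
    (by rintro _ ⟨t, rfl⟩; exact hγZ t)
  have hγdiff : Differentiable ℝ γ := fun t => (hγ.hasDerivAt t).differentiableAt
  set d := deriv γ 0 with hd
  have hd0 : d ≠ 0 := (hγ 0).2
  have hkR : (0 : ℝ) < k := by positivity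
  -- an arc transversal to `γ`
  obtain ⟨ω, hω1, hωre, hωd⟩ : ∃ ω : ℂ, ‖ω‖ = 1 ∧ (ω ^ k).re = 0 ∧
      (d * (starRingEnd ℂ) (c * ω)).im ≠ 0 := by
    have hpow : ∀ x : ℝ, (Complex.exp ((x / k : ℝ) * Complex.I)) ^ k =
        Complex.exp (x * Complex.I) := fun x => by
      rw [← Complex.exp_nat_mul]
      congr 1
      push_cast
      have : (k : ℂ) ≠ 0 := by exact_mod_cast hk
      field_simp
    -- Two admissible directions differ by the angle `π / k`, which is not a multiple of `π` as `k ≥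
    -- 2`; so `γ` cannot be tangent to both.
    by_contra! hcon
    have h1 := hcon (Complex.exp ((Real.pi / 2 / k : ℝ) * Complex.I))
      (Complex.norm_exp_ofReal_mul_I _) (by rw [hpow, Complex.exp_ofReal_mul_I_re]; simp)
    have h2 := hcon (Complex.exp ((3 * Real.pi / 2 / k : ℝ) * Complex.I))
      (Complex.norm_exp_ofReal_mul_I _) (by
        rw [hpow, Complex.exp_ofReal_mul_I_re,
          show 3 * Real.pi / 2 = Real.pi / 2 + Real.pi by ring, Real.cos_add_pi,
          Real.cos_pi_div_two, neg_zero])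
    have h3 := im_mul_conj_eq_zero_trans hd0 h1 h2
    have h4 : c * Complex.exp ((3 * Real.pi / 2 / k : ℝ) * Complex.I) *
        (starRingEnd ℂ) (c * Complex.exp ((Real.pi / 2 / k : ℝ) * Complex.I)) =
        (Complex.normSq c : ℝ) * Complex.exp ((Real.pi / k : ℝ) * Complex.I) := by
      rw [map_mul, ← Complex.exp_conj, map_mul, Complex.conj_ofReal, Complex.conj_I,
        ← Complex.mul_conj, mul_mul_mul_comm, ← Complex.exp_add]
      congr 2
      push_cast
      ring
    rw [h4, Complex.im_ofReal_mul, Complex.exp_ofReal_mul_I_im] at h3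
    have h5 : 0 < Real.sin (Real.pi / k) := by
      apply Real.sin_pos_of_pos_of_lt_pi (by positivity)
      rw [div_lt_iff₀ hkR]
      have : (2 : ℝ) ≤ k := by exact_mod_cast hk2
      nlinarith [Real.pi_pos]
    exact (mul_pos (Complex.normSq_pos.2 hc0) h5).ne' h3
  obtain ⟨a, η, ha, ha0, hader⟩ := harc ω hω1 hωre
  have hane : ∀ᶠ x in 𝓝[>] (0 : ℝ), a x ≠ a 0 := by
    filter_upwards [Ioo_mem_nhdsGT ha.pos] with x hx he
    exact hx.1.ne' (ha.injOn ⟨by linarith [hx.1, ha.pos], hx.2⟩ ⟨by linarith [ha.pos], ha.pos⟩ he)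
  set K₀ := γ '' Icc 0 1 with hK₀
  have hK₀c : IsCompact K₀ := isCompact_Icc.image hγ.continuous
  have hK₀Z : K₀ ⊆ reNodal f := by
    rintro _ ⟨t, -, rfl⟩; exact hγZ t
  have haK : ∀ᶠ x in 𝓝[>] 0, a x ∉ K₀ := by
    by_contra hcon
    obtain ⟨t, -, ht, hp⟩ := exists_parallel_of_frequently hγdiff hader isCompact_Icc hane
      ((not_eventually.1 hcon).mono fun x hx => not_not.1 hx)
    rw [ha0, ← hγ0] at ht
    rw [hγinj ht] at hp
    exact hωd hp
  have hJ0 : JoinedIn K₀ (a 0) 0 := by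
    rw [ha0, ← hγ0, ← hγ1]
    exact joinedIn_image_Icc zero_le_one hγ.continuous.continuousOn fun t ht => ⟨t, ht, rfl⟩
  -- The arc leaves `γ` transversally, so it is tangent at `z₁` to some `Γ i` with a direction
  -- different from that of `γ`.
  obtain ⟨i, t', ht', hpar⟩ := h.exists_parallel ha hader hK₀c hK₀Z hJ0 haK
  rw [ha0] at ht'
  have hnp : (deriv (Γ i) t' * (starRingEnd ℂ) d).im ≠ 0 := fun h0 =>
    hωd (im_mul_conj_eq_zero_trans (h.curve i t').2 hpar h0)
  obtain ⟨τ', hτ'⟩ := h.zero_mem i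
  set K₂ := Γ i '' uIcc t' τ' with hK₂
  have hγne : ∀ᶠ x in 𝓝[>] (0 : ℝ), γ x ≠ γ 0 := by
    filter_upwards [self_mem_nhdsWithin] with x hx he
    exact (show (0 : ℝ) < x from hx).ne' (hγinj he)
  have hγK : ∀ᶠ x in 𝓝[>] 0, γ x ∉ K₂ := by
    by_contra hcon
    obtain ⟨t, -, ht, hp⟩ := exists_parallel_of_frequently (h.differentiable i)
      (hγ.hasDerivAt 0) isCompact_uIcc hγne ((not_eventually.1 hcon).mono fun x hx => not_not.1 hx)
    rw [hγ0, ← ht'] at ht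
    rw [h.injective i ht] at hp
    exact hnp hp
  have hregγ : ∀ᶠ x in 𝓝[>] 0, deriv f (γ x) ≠ 0 :=
    nhdsGT_le_nhdsNE 0 (hγ.eventually_regular (h.nonconst _ (hγZ 0).1))
  obtain ⟨x, ⟨hxK, hxreg⟩, hx⟩ :=
    ((hγK.and hregγ).and (Ioo_mem_nhdsGT (zero_lt_one (α := ℝ)))).exists
  have hKc : IsCompact (K₀ ∪ K₂) := hK₀c.union (isCompact_uIcc.image (h.curve i).continuous)
  have hKZ : K₀ ∪ K₂ ⊆ reNodal f := by
    rintro _ (hw | ⟨t, -, rfl⟩)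
    · exact hK₀Z hw
    · exact h.subset i ⟨t, rfl⟩
  -- Now `γ` and `Γ i` both run from `z₁` to the origin and close a loop, which bypasses the regular
  -- point `γ x`.
  have hcut := not_joinedIn_sides h.differentiableOn (hγ.hasDerivAt x) (hγ x).2
    (Eventually.of_forall hγZ) hxreg hKc hKZ
  have hsmall : ∀ᶠ ε : ℝ in 𝓝[>] 0, ε < min x (1 - x) :=
    nhdsWithin_le_nhds (gt_mem_nhds (by simpa using hx))
  obtain ⟨ε, hε, hε1, hε0⟩ := (hcut.and (hsmall.and self_mem_nhdsWithin)).exists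
  have hε0' : (0 : ℝ) < ε := hε0
  rw [lt_min_iff] at hε1
  apply hε
  have hmem : ∀ y ∈ Icc (0 : ℝ) 1, y ≠ x → γ y ∈ (K₀ ∪ K₂) \ {γ x} := fun y hy hyx =>
    ⟨Or.inl ⟨y, hy, rfl⟩, fun he => hyx (hγinj he)⟩
  have hJ1 : JoinedIn ((K₀ ∪ K₂) \ {γ x}) (γ 0) (γ (x - ε)) :=
    joinedIn_image_Icc (by linarith) hγ.continuous.continuousOn fun t ht =>
      hmem t ⟨ht.1, by linarith [ht.2, hx.2]⟩ (by linarith [ht.2] : t < x).ne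
  have hJ2 : JoinedIn ((K₀ ∪ K₂) \ {γ x}) (γ (x + ε)) (γ 1) :=
    joinedIn_image_Icc (by linarith) hγ.continuous.continuousOn fun t ht =>
      hmem t ⟨by linarith [ht.1, hx.1], ht.2⟩ (by linarith [ht.1] : x < t).ne'
  have hJ3 : JoinedIn ((K₀ ∪ K₂) \ {γ x}) (γ 0) (γ 1) := by
    rw [hγ0, hγ1, ← ht', ← hτ']
    exact joinedIn_image_uIcc (h.curve i).continuous.continuousOn fun t ht =>
      ⟨Or.inr ⟨t, ht, rfl⟩, fun he => hxK ⟨t, ht, he⟩⟩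
  exact (hJ1.symm.trans hJ3).trans hJ2.symm

/-- `f` has no zeros besides the origin. -/
theorem ne_zero (hf0 : f 0 = 0) {z : ℂ} (hz : z ∈ Metric.ball (0 : ℂ) 1) (hz0 : z ≠ 0) :
    f z ≠ 0 := by
  intro hfz
  have hzZ : z ∈ reNodal f := ⟨hz, by simp [hfz]⟩
  obtain ⟨k, t, ht⟩ := mem_iUnion.1 (h.cover hzZ)
  obtain ⟨τ, hτ⟩ := h.zero_mem k
  have hder : ∀ s, HasDerivAt (fun s => f (Γ k s)) (deriv f (Γ k s) * deriv (Γ k) s) s := fun s =>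
    hasDerivAt_comp_real (h.differentiableOn.differentiableAt
      (Metric.isOpen_ball.mem_nhds (h.subset k ⟨s, rfl⟩).1)).hasDerivAt ((h.curve k).hasDerivAt s)
  have hre : ∀ s, (deriv f (Γ k s) * deriv (Γ k) s).re = 0 := fun s => by
    have h1 := Complex.reCLM.hasFDerivAt.comp_hasDerivAt s (hder s)
    have h2 : (Complex.reCLM ∘ fun s => f (Γ k s)) = fun _ => (0 : ℝ) := by
      ext s; exact (h.subset k ⟨s, rfl⟩).2
    rw [h2] at h1
    exact h1.unique (hasDerivAt_const s (0 : ℝ))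
  have him : ∀ s, HasDerivAt (fun s => (f (Γ k s)).im) (deriv f (Γ k s) * deriv (Γ k) s).im s :=
    fun s => Complex.imCLM.hasFDerivAt.comp_hasDerivAt s (hder s)
  -- `Re f` is constant along `Γ k`, so a critical point of `Im f` along `Γ k` is a critical point
  -- of `f`, hence the origin. Rolle's theorem between two zeros of `f` then gives the
  -- contradiction.
  have hcrit : ∀ s, (deriv f (Γ k s) * deriv (Γ k) s).im = 0 → s = τ := by
    intro s hs
    have h0 : deriv f (Γ k s) * deriv (Γ k) s = 0 := Complex.ext (hre s) hs
    have h1 : deriv f (Γ k s) = 0 := (mul_eq_zero.1 h0).resolve_right (h.curve k s).2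
    by_contra hne
    refine h.deriv_ne_zero (h.subset k ⟨s, rfl⟩) (fun he => hne ?_) h1
    exact h.injective k (he.trans hτ.symm)
  have hcont : Continuous fun s => (f (Γ k s)).im :=
    continuous_iff_continuousAt.2 fun s => (him s).continuousAt
  have hval : (f (Γ k t)).im = (f (Γ k τ)).im := by rw [ht, hτ, hfz, hf0]
  have htτ : t ≠ τ := by
    rintro rfl; exact hz0 (ht.symm.trans hτ)
  rcases lt_or_gt_of_ne htτ with hlt | hlt
  · obtain ⟨s, hs, hs0⟩ := exists_hasDerivAt_eq_zero hlt hcont.continuousOn hval fun s _ => him s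
    exact hs.2.ne (hcrit s hs0)
  · obtain ⟨s, hs, hs0⟩ := exists_hasDerivAt_eq_zero hlt hcont.continuousOn hval.symm
      fun s _ => him s
    exact hs.1.ne' (hcrit s hs0)

/-- The order of `f` at the origin is at most the number of curves. -/
theorem order_le (hf0 : (f 0).re = 0) {g : ℂ → ℂ} {m : ℕ} (hm : m ≠ 0) (hg : AnalyticAt ℂ g 0)
    (hg0 : g 0 ≠ 0) (hfg : ∀ᶠ z in 𝓝 0, f z = f 0 + (z - 0) ^ m * g z) : m ≤ n := by
  have h0Z : (0 : ℂ) ∈ reNodal f := ⟨by simp, hf0⟩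
  obtain ⟨c, hc0, harc⟩ := exists_nodalArc h.differentiableOn h0Z hm hg hg0 hfg
  have hmR : (0 : ℝ) < m := by positivity
  -- The angles `(2j + 1)π / (2m)`: pairwise non-parallel directions with `Re (ω ^ m) = 0`, each
  -- tangent to one of the curves at the origin.
  let θ : Fin m → ℝ := fun j => Real.pi * (2 * j + 1) / 2 / m
  let ω : Fin m → ℂ := fun j => Complex.exp (θ j * Complex.I)
  have hω : ∀ j, ‖ω j‖ = 1 ∧ ((ω j) ^ m).re = 0 := fun j => by
    refine ⟨Complex.norm_exp_ofReal_mul_I _, ?_⟩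
    simp only [ω]
    rw [← Complex.exp_nat_mul]
    have : (m : ℂ) * (θ j * Complex.I) = ((j * Real.pi + Real.pi / 2 : ℝ) : ℂ) * Complex.I := by
      have : (m : ℂ) ≠ 0 := by exact_mod_cast hm
      simp only [θ]; push_cast; field_simp
    rw [this, Complex.exp_ofReal_mul_I_re, Real.cos_add_pi_div_two, Real.sin_nat_mul_pi, neg_zero]
  have hpar : ∀ j, ∃ k t, Γ k t = 0 ∧ (deriv (Γ k) t * (starRingEnd ℂ) (c * ω j)).im = 0 := by
    intro j
    obtain ⟨a, η, ha, ha0, hader⟩ := harc (ω j) (hω j).1 (hω j).2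
    obtain ⟨k, t, ht, hp⟩ := h.exists_parallel ha hader isCompact_singleton
      (K₀ := {0}) (by simpa using h0Z) (by rw [ha0]; exact JoinedIn.refl rfl) (by
        filter_upwards [Ioo_mem_nhdsGT ha.pos] with x hx he
        exact hx.1.ne' (ha.injOn ⟨by linarith [hx.1, ha.pos], hx.2⟩
          ⟨by linarith [ha.pos], ha.pos⟩ ((mem_singleton_iff.1 he).trans ha0.symm)))
    exact ⟨k, t, ht.trans ha0, hp⟩
  choose κ t ht hp using hpar
  -- An injective curve passes through the origin only once and so has a single tangent line there.
  have hinj : Function.Injective κ := by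
    intro i j hij
    have htt : t i = t j := h.injective (κ i) (by rw [ht i, hij, ht j])
    have h1 := hp i
    have h2 := hp j
    rw [hij, htt] at h1
    have h3 := im_mul_conj_eq_zero_trans (h.curve (κ j) (t j)).2 h2 h1
    have h4 : c * ω i * (starRingEnd ℂ) (c * ω j) =
        (Complex.normSq c : ℝ) * Complex.exp ((θ i - θ j : ℝ) * Complex.I) := by
      simp only [ω]
      rw [map_mul, ← Complex.exp_conj, map_mul, Complex.conj_ofReal, Complex.conj_I,
        ← Complex.mul_conj, mul_mul_mul_comm, ← Complex.exp_add]
      congr 2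
      push_cast
      ring
    rw [h4, Complex.im_ofReal_mul, Complex.exp_ofReal_mul_I_im] at h3
    have h5 := (mul_eq_zero.1 h3).resolve_left (Complex.normSq_pos.2 hc0).ne'
    have h6 : θ i - θ j = Real.pi * (((i : ℕ) : ℝ) - ((j : ℕ) : ℝ)) / m := by
      simp only [θ]; field_simp; ring
    have hi : ((i : ℕ) : ℝ) < m := by exact_mod_cast i.2
    have hj : ((j : ℕ) : ℝ) < m := by exact_mod_cast j.2
    have hi0 : (0 : ℝ) ≤ (i : ℕ) := by positivity
    have hj0 : (0 : ℝ) ≤ (j : ℕ) := by positivity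
    have h7 : θ i - θ j = 0 := by
      refine (Real.sin_eq_zero_iff_of_lt_of_lt ?_ ?_).1 h5
      · rw [h6, lt_div_iff₀ hmR]; nlinarith [Real.pi_pos]
      · rw [h6, div_lt_iff₀ hmR]; nlinarith [Real.pi_pos]
    rw [h6, div_eq_zero_iff, or_iff_left hmR.ne', mul_eq_zero, or_iff_right Real.pi_ne_zero,
      sub_eq_zero] at h7
    exact Fin.ext (by exact_mod_cast h7)
  simpa using Fintype.card_le_of_injective κ hinj

end IsNodalStar

/-! ### Analytic changes of parameter -/

theorem injective_of_deriv_ne_zero {x : ℝ → ℝ} (hx : ∀ t, AnalyticAt ℝ x t ∧ deriv x t ≠ 0) :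
    Function.Injective x := by
  have key : ∀ s t, s < t → x s ≠ x t := by
    intro s t hst he
    obtain ⟨c, -, hc⟩ := exists_deriv_eq_zero hst
      (fun y _ => (hx y).1.continuousAt.continuousWithinAt) he
    exact (hx c).2 hc
  intro s t he
  rcases lt_trichotomy s t with h | h | h
  · exact absurd he (key s t h)
  · exact h
  · exact absurd he.symm (key t s h)

theorem exists_analytic_inverse {x : ℝ → ℝ} (hx : ∀ t, AnalyticAt ℝ x t ∧ deriv x t ≠ 0) :
    IsOpen (range x) ∧ ∃ ξ : ℝ → ℝ, (∀ t, ξ (x t) = t) ∧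
      ∀ s ∈ range x, AnalyticAt ℝ ξ s ∧ deriv ξ s ≠ 0 := by
  have hinj := injective_of_deriv_ne_zero hx
  have hleft : ∀ t, Function.invFun x (x t) = t := Function.leftInverse_invFun hinj
  have hev : ∀ t, ∃ r : ℝ → ℝ, AnalyticAt ℝ r (x t) ∧ ∀ᶠ s in 𝓝 (x t), x (r s) = s := fun t =>
    ⟨_, (hx t).1.analyticAt_localInverse (hx t).2,
      HasStrictDerivAt.eventually_right_inverse (hx t).1.hasStrictDerivAt (hx t).2⟩
  have han : ∀ t, AnalyticAt ℝ (Function.invFun x) (x t) := fun t => by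
    obtain ⟨r, hr, hxr⟩ := hev t
    refine hr.congr ?_
    filter_upwards [hxr] with s hs
    rw [← hleft (r s), hs]
  refine ⟨?_, Function.invFun x, hleft, ?_⟩
  · rw [isOpen_iff_mem_nhds]
    rintro _ ⟨t, rfl⟩
    obtain ⟨r, -, hxr⟩ := hev t
    filter_upwards [hxr] with s hs
    exact ⟨r s, hs⟩
  · rintro _ ⟨t, rfl⟩
    refine ⟨han t, fun h0 => ?_⟩
    have h1 : HasDerivAt (Function.invFun x ∘ x) (deriv (Function.invFun x) (x t) * deriv x t) t :=
      (han t).differentiableAt.hasDerivAt.comp t (hx t).1.differentiableAt.hasDerivAt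
    have h2 : Function.invFun x ∘ x = id := funext hleft
    rw [h2, h0, zero_mul] at h1
    exact one_ne_zero ((hasDerivAt_id t).unique h1)

/-- Every open interval is the range of an analytic parametrization by the real line. -/
theorem exists_analytic_parametrization {U : Set ℝ} (hU : IsOpen U) (hUc : IsPreconnected U)
    (hUn : U.Nonempty) :
    ∃ p : ℝ → ℝ, (∀ t, AnalyticAt ℝ p t ∧ deriv p t ≠ 0) ∧ range p = U := by
  by_cases hb : BddBelow U <;> by_cases ha : BddAbove U
  · have hlt : ∀ y ∈ U, sInf U < y ∧ y < sSup U := fun y hy => by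
      obtain ⟨ε, hε, hεU⟩ := Metric.isOpen_iff.1 hU y hy
      have h1 : y - ε / 2 ∈ U := hεU (by simp [abs_of_pos hε, hε])
      have h2 : y + ε / 2 ∈ U := hεU (by simp [abs_of_pos hε, hε])
      exact ⟨by linarith [csInf_le hb h1], by linarith [le_csSup ha h2]⟩
    have hUe : U = Ioo (sInf U) (sSup U) :=
      Subset.antisymm hlt (IsConnected.Ioo_csInf_csSup_subset ⟨hUn, hUc⟩ hb ha)
    obtain ⟨y, hy⟩ := hUn
    have hL : 0 < sSup U - sInf U := by linarith [(hlt y hy).1, (hlt y hy).2]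
    generalize sInf U = A at *
    generalize sSup U = B at *
    have hder : ∀ t, HasDerivAt (fun t => B - (B - A) / (1 + Real.exp t))
        ((B - A) * Real.exp t / (1 + Real.exp t) ^ 2) t := fun t => by
      have h1 : (1 + Real.exp t) ≠ 0 := by positivity
      have := (((hasDerivAt_const t (B - A)).div ((Real.hasDerivAt_exp t).const_add 1) h1)).const_sub B
      refine this.congr_deriv ?_
      field_simp
      ring
    refine ⟨fun t => B - (B - A) / (1 + Real.exp t), fun t => ⟨?_, ?_⟩, ?_⟩
    · have h1 : (1 + Real.exp t) ≠ 0 := by positivity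
      have h2 : AnalyticAt ℝ (fun t => 1 + Real.exp t) t := by fun_prop
      exact analyticAt_const.sub (analyticAt_const.div h2 h1)
    · rw [(hder t).deriv]; positivity
    · rw [hUe]
      ext y
      constructor
      · rintro ⟨t, rfl⟩
        have h1 := Real.exp_pos t
        have h2 : (B - A) / (1 + Real.exp t) < B - A := div_lt_self hL (by linarith)
        have h3 : 0 < (B - A) / (1 + Real.exp t) := by positivity
        exact ⟨by linarith, by linarith⟩
      · rintro ⟨h1, h2⟩
        have h3 : 0 < B - y := by linarith
        refine ⟨Real.log ((y - A) / (B - y)), ?_⟩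
        have h4 : 0 < (y - A) / (B - y) := div_pos (by linarith) h3
        simp only
        rw [Real.exp_log h4]
        have h5 : B - y ≠ 0 := h3.ne'
        have h6 : B - y + (y - A) ≠ 0 := by linarith
        field_simp
        ring
  · have hlt : ∀ y ∈ U, sInf U < y := fun y hy => by
      obtain ⟨ε, hε, hεU⟩ := Metric.isOpen_iff.1 hU y hy
      have h1 : y - ε / 2 ∈ U := hεU (by simp [abs_of_pos hε, hε])
      linarith [csInf_le hb h1]
    have hUe : U = Ioi (sInf U) := Subset.antisymm hlt (hUc.Ioi_csInf_subset hb ha)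
    have hder : ∀ t, HasDerivAt (fun t => sInf U + Real.exp t) (Real.exp t) t := fun t =>
      (Real.hasDerivAt_exp t).const_add _
    refine ⟨fun t => sInf U + Real.exp t, fun t => ⟨by fun_prop, ?_⟩, ?_⟩
    · rw [(hder t).deriv]; positivity
    · nth_rewrite 2 [hUe]
      ext y
      constructor
      · rintro ⟨t, rfl⟩
        exact lt_add_of_pos_right _ (Real.exp_pos t)
      · intro hy
        have : (0 : ℝ) < y - sInf U := sub_pos.2 hy
        exact ⟨Real.log (y - sInf U), by simp only; rw [Real.exp_log this]; ring⟩
  · have hlt : ∀ y ∈ U, y < sSup U := fun y hy => by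
      obtain ⟨ε, hε, hεU⟩ := Metric.isOpen_iff.1 hU y hy
      have h1 : y + ε / 2 ∈ U := hεU (by simp [abs_of_pos hε, hε])
      linarith [le_csSup ha h1]
    have hUe : U = Iio (sSup U) := Subset.antisymm hlt (hUc.Iio_csSup_subset hb ha)
    have hder : ∀ t, HasDerivAt (fun t => sSup U - Real.exp t) (-Real.exp t) t := fun t =>
      (Real.hasDerivAt_exp t).const_sub _
    refine ⟨fun t => sSup U - Real.exp t, fun t => ⟨by fun_prop, ?_⟩, ?_⟩
    · rw [(hder t).deriv]; exact neg_ne_zero.2 (Real.exp_ne_zero t)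
    · nth_rewrite 2 [hUe]
      ext y
      constructor
      · rintro ⟨t, rfl⟩
        exact sub_lt_self _ (Real.exp_pos t)
      · intro hy
        have : (0 : ℝ) < sSup U - y := sub_pos.2 hy
        exact ⟨Real.log (sSup U - y), by simp only; rw [Real.exp_log this]; ring⟩
  · have hUe : U = univ := hUc.eq_univ_of_unbounded hb ha
    exact ⟨id, fun t => ⟨analyticAt_id, by simp⟩, by simp [hUe]⟩

/-! ### Uniqueness of nodal curves with a given tangent -/

/-- Two nodal curves that are mapped by `F` into the same line agree, provided that `F` is
injective near their common point and that both are maximal. -/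
theorem range_subset_of_map_line {u : ℂ → ℝ} {U : Set ℂ} {F : ℂ → ℂ} {γ δ : ℝ → ℂ} {ω : ℂ}
    (hγ : IsNodalCurve u U γ) (hδ : IsNodalCurve u U δ)
    {V : Set ℂ} (hV : V ∈ 𝓝 (0 : ℂ)) (hF : InjOn F V)
    {x y : ℝ → ℝ} (hx : ∀ t, AnalyticAt ℝ x t ∧ deriv x t ≠ 0)
    (hy : ∀ t, AnalyticAt ℝ y t ∧ deriv y t ≠ 0)
    (hxγ : ∀ t, F (γ t) = x t * ω) (hyδ : ∀ t, F (δ t) = y t * ω)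
    {t₁ t₂ : ℝ} (h₁ : γ t₁ = 0) (h₂ : δ t₂ = 0) (hx0 : x t₁ = 0) (hy0 : y t₂ = 0) :
    range γ = range δ := by
  obtain ⟨hIo, ξ, hξ, hξa⟩ := exists_analytic_inverse hx
  obtain ⟨hJo, ψ, hψ, hψa⟩ := exists_analytic_inverse hy
  have hxc : Continuous x := continuous_iff_continuousAt.2 fun t => (hx t).1.continuousAt
  have hyc : Continuous y := continuous_iff_continuousAt.2 fun t => (hy t).1.continuousAt
  have hIc : IsPreconnected (range x) := isPreconnected_range hxc
  have hJc : IsPreconnected (range y) := isPreconnected_range hyc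
  have h0I : (0 : ℝ) ∈ range x := ⟨t₁, hx0⟩
  have h0J : (0 : ℝ) ∈ range y := ⟨t₂, hy0⟩
  have hγa : ∀ s ∈ range x, AnalyticAt ℝ (γ ∘ ξ) s := fun s hs =>
    (hγ.1 (ξ s)).1.comp (hξa s hs).1
  have hδa : ∀ s ∈ range y, AnalyticAt ℝ (δ ∘ ψ) s := fun s hs =>
    (hδ.1 (ψ s)).1.comp (hψa s hs).1
  have hξ0 : ξ 0 = t₁ := by rw [← hx0, hξ]
  have hψ0 : ψ 0 = t₂ := by rw [← hy0, hψ]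
  have hxξ : ∀ s ∈ range x, x (ξ s) = s := by rintro _ ⟨t, rfl⟩; rw [hξ]
  have hyψ : ∀ s ∈ range y, y (ψ s) = s := by rintro _ ⟨t, rfl⟩; rw [hψ]
  have hIJc : IsPreconnected (range x ∩ range y) :=
    (hIc.ordConnected.inter hJc.ordConnected).isPreconnected
  have heq : EqOn (γ ∘ ξ) (δ ∘ ψ) (range x ∩ range y) := by
    have hA : AnalyticOnNhd ℝ (γ ∘ ξ) (range x ∩ range y) := fun s hs => hγa s hs.1
    have hB : AnalyticOnNhd ℝ (δ ∘ ψ) (range x ∩ range y) := fun s hs => hδa s hs.2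
    refine hA.eqOn_of_preconnected_of_eventuallyEq hB hIJc ⟨h0I, h0J⟩ ?_
    have e1 : ∀ᶠ s in 𝓝 (0 : ℝ), (γ ∘ ξ) s ∈ V :=
      (hγa 0 h0I).continuousAt.eventually_mem (by simpa [hξ0, h₁] using hV)
    have e2 : ∀ᶠ s in 𝓝 (0 : ℝ), (δ ∘ ψ) s ∈ V :=
      (hδa 0 h0J).continuousAt.eventually_mem (by simpa [hψ0, h₂] using hV)
    filter_upwards [e1, e2, hIo.mem_nhds h0I, hJo.mem_nhds h0J] with s hs1 hs2 hsI hsJ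
    apply hF hs1 hs2
    simp only [Function.comp_apply]
    rw [hxγ, hyδ, hxξ s hsI, hyψ s hsJ]
  classical
  -- Both curves are parametrized by the real coordinate on the line. They agree on the common
  -- interval by analytic continuation from `0`, so they glue to one regular curve containing both;
  -- maximality makes all three traces equal.
  let σ : ℝ → ℂ := fun s => if s ∈ range x then γ (ξ s) else δ (ψ s)
  have hσI : ∀ s ∈ range x, σ s = (γ ∘ ξ) s := fun s hs => by simp only [σ]; rw [if_pos hs]; rfl
  have hσJ : ∀ s ∈ range y, σ s = (δ ∘ ψ) s := fun s hs => by
    by_cases h : s ∈ range x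
    · rw [hσI s h, heq ⟨h, hs⟩]
    · simp only [σ]; rw [if_neg h]; rfl
  have hcompder : ∀ (γ : ℝ → ℂ) (ξ : ℝ → ℝ) (s : ℝ), IsRegularAnalyticCurve γ →
      AnalyticAt ℝ ξ s → deriv ξ s ≠ 0 → deriv (γ ∘ ξ) s ≠ 0 := by
    intro γ ξ s hγ ha hd
    have h1 : HasDerivAt (γ ∘ ξ) (deriv ξ s • deriv γ (ξ s)) s :=
      (hγ.hasDerivAt (ξ s)).scomp s ha.differentiableAt.hasDerivAt
    rw [h1.deriv]
    exact smul_ne_zero hd (hγ _).2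
  have hσ : ∀ s ∈ range x ∪ range y, AnalyticAt ℝ σ s ∧ deriv σ s ≠ 0 := by
    rintro s (hs | hs)
    · have he : (γ ∘ ξ) =ᶠ[𝓝 s] σ := by
        filter_upwards [hIo.mem_nhds hs] with r hr
        exact (hσI r hr).symm
      exact ⟨(hγa s hs).congr he, he.deriv_eq ▸ hcompder γ ξ s hγ.1 (hξa s hs).1 (hξa s hs).2⟩
    · have he : (δ ∘ ψ) =ᶠ[𝓝 s] σ := by
        filter_upwards [hJo.mem_nhds hs] with r hr
        exact (hσJ r hr).symm
      exact ⟨(hδa s hs).congr he, he.deriv_eq ▸ hcompder δ ψ s hδ.1 (hψa s hs).1 (hψa s hs).2⟩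
  obtain ⟨p, hp, hpr⟩ := exists_analytic_parametrization (hIo.union hJo)
    (hIc.union 0 h0I h0J hJc) ⟨0, Or.inl h0I⟩
  have hpm : ∀ t, p t ∈ range x ∪ range y := fun t => hpr ▸ mem_range_self t
  have hreg : IsRegularAnalyticCurve (σ ∘ p) := fun t => by
    refine ⟨(hσ _ (hpm t)).1.comp (hp t).1, ?_⟩
    have h1 : HasDerivAt (σ ∘ p) (deriv p t • deriv σ (p t)) t :=
      (hσ _ (hpm t)).1.differentiableAt.hasDerivAt.scomp t (hp t).1.differentiableAt.hasDerivAt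
    rw [h1.deriv]
    exact smul_ne_zero (hp t).2 (hσ _ (hpm t)).2
  have hsub : range (σ ∘ p) ⊆ nodalSet u U := by
    rintro _ ⟨t, rfl⟩
    rcases hpm t with hs | hs
    · rw [Function.comp_apply, hσI _ hs]; exact hγ.2.1 ⟨_, rfl⟩
    · rw [Function.comp_apply, hσJ _ hs]; exact hδ.2.1 ⟨_, rfl⟩
  have hγσ : range γ ⊆ range (σ ∘ p) := by
    rintro _ ⟨t, rfl⟩
    have hm : x t ∈ range p := hpr ▸ Or.inl ⟨t, rfl⟩
    obtain ⟨s, hs⟩ := hm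
    exact ⟨s, by rw [Function.comp_apply, hs, hσI _ ⟨t, rfl⟩, Function.comp_apply, hξ]⟩
  have hδσ : range δ ⊆ range (σ ∘ p) := by
    rintro _ ⟨t, rfl⟩
    have hm : y t ∈ range p := hpr ▸ Or.inr ⟨t, rfl⟩
    obtain ⟨s, hs⟩ := hm
    exact ⟨s, by rw [Function.comp_apply, hs, hσJ _ ⟨t, rfl⟩, Function.comp_apply, hψ]⟩
  exact Subset.antisymm (hγσ.trans (hδ.2.2 _ hreg hsub hδσ)) (hδσ.trans (hγ.2.2 _ hreg hsub hγσ))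

/-! ### Logarithms and roots of nonvanishing functions on the disc -/

theorem exists_log_of_ne_zero {G : ℂ → ℂ} {R : ℝ} (hG : DifferentiableOn ℂ G (Metric.ball 0 R))
    (h0 : ∀ z ∈ Metric.ball (0 : ℂ) R, G z ≠ 0) :
    ∃ L : ℂ → ℂ, DifferentiableOn ℂ L (Metric.ball 0 R) ∧
      ∀ z ∈ Metric.ball (0 : ℂ) R, G z = Complex.exp (L z) := by
  have hd : DifferentiableOn ℂ (fun z => deriv G z / G z) (Metric.ball 0 R) :=
    (hG.deriv Metric.isOpen_ball).div hG h0
  obtain ⟨L, hL0, hL⟩ := (hd.isExactOn_ball).with_val_at 0 (Complex.log (G 0))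
  refine ⟨L, fun z hz => (hL z hz).differentiableAt.differentiableWithinAt, fun z hz => ?_⟩
  have h0R : (0 : ℂ) ∈ Metric.ball (0 : ℂ) R := by
    have := (norm_nonneg z).trans_lt (by simpa using hz)
    simpa using this
  have hder : ∀ w ∈ Metric.ball (0 : ℂ) R,
      HasDerivAt (fun z => G z * Complex.exp (-L z)) 0 w := fun w hw => by
    have h1 := ((hG.differentiableAt (Metric.isOpen_ball.mem_nhds hw)).hasDerivAt).mul
      ((hL w hw).neg.cexp)
    refine h1.congr_deriv ?_
    have := h0 w hw
    have h2 : G w * (deriv G w / G w) = deriv G w := mul_div_cancel₀ _ this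
    simp only [Pi.neg_apply]
    linear_combination (-Complex.exp (-L w)) * h2
  have hconst := (convex_ball (0 : ℂ) R).is_const_of_fderivWithin_eq_zero (𝕜 := ℂ)
    (f := fun z => G z * Complex.exp (-L z))
    (fun w hw => (hder w hw).differentiableAt.differentiableWithinAt)
    (fun w hw => by
      rw [fderivWithin_of_isOpen Metric.isOpen_ball hw]
      have := (hder w hw).hasFDerivAt.fderiv
      rw [this]; ext; simp) hz h0R
  rw [hL0, Complex.exp_neg (Complex.log _), Complex.exp_log (h0 0 h0R),
    mul_inv_cancel₀ (h0 0 h0R), Complex.exp_neg] at hconst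
  have := Complex.exp_ne_zero (L z)
  field_simp at hconst
  exact hconst

theorem eq_mul_of_div_norm_eq {w ω : ℂ} (hw : w ≠ 0) (h : w / (‖w‖ : ℂ) = ω) :
    w = (‖w‖ : ℂ) * ω := by
  have : (‖w‖ : ℂ) ≠ 0 := by exact_mod_cast norm_ne_zero_iff.2 hw
  rw [← h]; field_simp

theorem div_norm_pow_of_re_eq_zero {w : ℂ} {m : ℕ} (hw : w ≠ 0) (hre : (w ^ m).re = 0) :
    (w / (‖w‖ : ℂ)) ^ (2 * m) = -1 := by
  have h1 : w ^ m = ((w ^ m).im : ℂ) * Complex.I := by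
    apply Complex.ext <;> simp [hre]
  have h2 : ((w ^ m).im) ^ 2 = (‖w‖ ^ m) ^ 2 := by
    rw [← norm_pow, ← Complex.normSq_eq_norm_sq, Complex.normSq_apply, hre]; ring
  have h3 : (‖w‖ : ℂ) ≠ 0 := by exact_mod_cast norm_ne_zero_iff.2 hw
  have h4 : w ^ (2 * m) = -((‖w‖ : ℂ) ^ m) ^ 2 := by
    rw [mul_comm, pow_mul, h1, mul_pow, Complex.I_sq]
    have : (((w ^ m).im : ℝ) : ℂ) ^ 2 = ((‖w‖ : ℂ) ^ m) ^ 2 := by exact_mod_cast h2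
    rw [this]; ring
  rw [div_pow, h4, mul_comm 2 m, pow_mul]
  field_simp

theorem finite_pow_eq_neg_one {m : ℕ} (hm : m ≠ 0) : {u : ℂ | u ^ (2 * m) = -1}.Finite := by
  have hpos : 0 < 2 * m := by omega
  refine ((Polynomial.nthRoots (2 * m) (-1 : ℂ)).toFinset.finite_toSet).subset fun u hu => ?_
  simpa [Polynomial.mem_nthRoots hpos] using hu

/-- A curve that avoids `0` and along which `w ^ m` is purely imaginary stays on a ray. -/
theorem div_norm_eq_of_re_pow_eq_zero {w : ℝ → ℂ} {m : ℕ} (hm : m ≠ 0) {S : Set ℝ}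
    (hS : IsPreconnected S) (hw : ContinuousOn w S) (hw0 : ∀ t ∈ S, w t ≠ 0)
    (hre : ∀ t ∈ S, (w t ^ m).re = 0) {s t : ℝ} (hs : s ∈ S) (ht : t ∈ S) :
    w s / (‖w s‖ : ℂ) = w t / (‖w t‖ : ℂ) := by
  have hfin := finite_pow_eq_neg_one hm
  have hcont : ContinuousOn (fun t => w t / (‖w t‖ : ℂ)) S :=
    hw.div (Complex.continuous_ofReal.comp_continuousOn hw.norm) fun t ht => by
      exact_mod_cast norm_ne_zero_iff.2 (hw0 t ht)
  have : Finite {u : ℂ | u ^ (2 * m) = -1} := hfin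
  exact hS.constant_of_mapsTo (T := {u : ℂ | u ^ (2 * m) = -1}) ⟨inferInstance⟩ hcont
    (fun t ht => div_norm_pow_of_re_eq_zero (hw0 t ht) (hre t ht)) hs ht

/-- A differentiable curve through `0` that elsewhere avoids `0` and along which `w ^ m` is
purely imaginary stays on a line. -/
theorem exists_line_of_re_pow_eq_zero {w : ℝ → ℂ} {m : ℕ} (hm : m ≠ 0) (hw : Continuous w)
    {τ : ℝ} {q : ℂ} (hq : q ≠ 0) (hτ : HasDerivAt w q τ) (hwτ : w τ = 0)
    (hw0 : ∀ t, t ≠ τ → w t ≠ 0) (hre : ∀ t, (w t ^ m).re = 0) :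
    ∃ ω : ℂ, ‖ω‖ = 1 ∧ ω ^ (2 * m) = -1 ∧ ∀ t, w t = ((w t * (starRingEnd ℂ) ω).re : ℂ) * ω := by
  have hslope : Tendsto (slope w τ) (𝓝[≠] τ) (𝓝 q) := hasDerivAt_iff_tendsto_slope.1 hτ
  have hqn : (‖q‖ : ℂ) ≠ 0 := by exact_mod_cast norm_ne_zero_iff.2 hq
  -- On either side of `τ` the direction `w / |w|` is constant; the tangent `q` identifies it as `q
  -- / |q|` on the right and its negative on the left, so the two rays form a line.
  have hlim : Tendsto (fun t => slope w τ t / (‖slope w τ t‖ : ℂ)) (𝓝[≠] τ) (𝓝 (q / ‖q‖)) :=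
    hslope.div ((Complex.continuous_ofReal.tendsto _).comp hslope.norm) hqn
  have hsl : ∀ t, slope w τ t = ((t - τ)⁻¹ : ℝ) * w t := fun t => by
    rw [slope_def_module, hwτ, sub_zero, Complex.real_smul]
  have hright : ∀ t, τ < t → w t / (‖w t‖ : ℂ) = q / ‖q‖ := by
    intro t ht
    have h1 : Tendsto (fun t => slope w τ t / (‖slope w τ t‖ : ℂ)) (𝓝[>] τ) (𝓝 (q / ‖q‖)) :=
      hlim.mono_left (nhdsGT_le_nhdsNE τ)
    refine tendsto_nhds_unique (tendsto_const_nhds.congr' ?_) h1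
    filter_upwards [self_mem_nhdsWithin] with s hs
    have hs' : τ < s := hs
    have hp : 0 < (s - τ)⁻¹ := inv_pos.2 (sub_pos.2 hs')
    rw [hsl, norm_mul, Complex.norm_real, Real.norm_of_nonneg hp.le, Complex.ofReal_mul,
      mul_div_mul_left _ _ (by exact_mod_cast hp.ne')]
    exact div_norm_eq_of_re_pow_eq_zero hm (convex_Ioi τ).isPreconnected hw.continuousOn
      (fun t ht => hw0 t (ne_of_gt ht)) (fun t _ => hre t) ht hs'
  have hleft : ∀ t, t < τ → w t / (‖w t‖ : ℂ) = -(q / ‖q‖) := by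
    intro t ht
    have h1 : Tendsto (fun t => -(slope w τ t / (‖slope w τ t‖ : ℂ))) (𝓝[<] τ)
        (𝓝 (-(q / ‖q‖))) := (hlim.mono_left (nhdsLT_le_nhdsNE τ)).neg
    refine tendsto_nhds_unique (tendsto_const_nhds.congr' ?_) h1
    filter_upwards [self_mem_nhdsWithin] with s hs
    have hs' : s < τ := hs
    have hp : (s - τ)⁻¹ < 0 := inv_lt_zero.2 (sub_neg.2 hs')
    rw [hsl, norm_mul, Complex.norm_real, Real.norm_of_nonpos hp.le, Complex.ofReal_mul,
      Complex.ofReal_neg, neg_mul, div_neg, neg_neg,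
      mul_div_mul_left _ _ (by exact_mod_cast hp.ne)]
    exact div_norm_eq_of_re_pow_eq_zero hm (convex_Iio τ).isPreconnected hw.continuousOn
      (fun t ht => hw0 t (ne_of_lt ht)) (fun t _ => hre t) ht hs'
  have hω : ‖q / (‖q‖ : ℂ)‖ = 1 := by
    rw [norm_div, Complex.norm_real, norm_norm, div_self (norm_ne_zero_iff.2 hq)]
  have hωc : q / (‖q‖ : ℂ) * (starRingEnd ℂ) (q / (‖q‖ : ℂ)) = 1 := by
    rw [Complex.mul_conj, Complex.normSq_eq_norm_sq, hω]; simp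
  refine ⟨q / ‖q‖, hω, ?_, fun t => ?_⟩
  · rw [← hright (τ + 1) (by linarith)]
    exact div_norm_pow_of_re_eq_zero (hw0 _ (by linarith)) (hre _)
  · have hx : ∀ x : ℝ, w t = x * (q / (‖q‖ : ℂ)) →
        w t = ((w t * (starRingEnd ℂ) (q / (‖q‖ : ℂ))).re : ℂ) * (q / (‖q‖ : ℂ)) := by
      intro x hx
      have : w t * (starRingEnd ℂ) (q / (‖q‖ : ℂ)) = x := by rw [hx, mul_assoc, hωc, mul_one]
      rw [this, Complex.ofReal_re, hx]
    rcases lt_trichotomy t τ with h | h | h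
    · apply hx (-‖w t‖)
      have := eq_mul_of_div_norm_eq (hw0 t h.ne) (hleft t h)
      rw [Complex.ofReal_neg, neg_mul, ← mul_neg]
      exact this
    · apply hx 0; rw [h, hwτ]; simp
    · exact hx _ (eq_mul_of_div_norm_eq (hw0 t h.ne') (hright t h))

namespace IsNodalStar

variable {f : ℂ → ℂ} {n : ℕ} {Γ : Fin n → ℝ → ℂ} (h : IsNodalStar f Γ)

include h

/-- `f` is a power of `z` times a function without zeros. -/
theorem exists_eq_pow_mul (hf0 : f 0 = 0) :
    ∃ m, m ≠ 0 ∧ m ≤ n ∧ ∃ G : ℂ → ℂ, DifferentiableOn ℂ G (Metric.ball 0 1) ∧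
      (∀ z ∈ Metric.ball (0 : ℂ) 1, G z ≠ 0) ∧ ∀ z ∈ Metric.ball (0 : ℂ) 1, f z = z ^ m * G z := by
  have h0 : (0 : ℂ) ∈ Metric.ball (0 : ℂ) 1 := by simp
  obtain ⟨m, hm, g, hg, hg0, hfg⟩ := exists_factor (h.analyticAt h0) (h.nonconst 0 h0)
  have hmn := h.order_le (by simp [hf0]) hm hg hg0 hfg
  classical
  let G : ℂ → ℂ := fun z => if z = 0 then g 0 else f z / z ^ m
  have hGg : G =ᶠ[𝓝 0] g := by
    filter_upwards [hfg] with z hz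
    by_cases hz0 : z = 0
    · simp [G, hz0]
    · simp only [G, if_neg hz0]
      rw [hz, hf0, zero_add, sub_zero]
      field_simp
  refine ⟨m, hm, hmn, G, fun z hz => ?_, fun z hz => ?_, fun z hz => ?_⟩
  · by_cases hz0 : z = 0
    · rw [hz0]
      exact (hg.congr hGg.symm).differentiableAt.differentiableWithinAt
    · have h1 : (fun z => f z / z ^ m) =ᶠ[𝓝 z] G := by
        filter_upwards [isOpen_ne.mem_nhds hz0] with w hw
        simp only [G]; rw [if_neg hw]
      exact ((((h.analyticAt hz).div (analyticAt_id.pow m) (pow_ne_zero m hz0)).congr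
        h1).differentiableAt).differentiableWithinAt
  · by_cases hz0 : z = 0
    · simpa [G, hz0] using hg0
    · simp only [G]; rw [if_neg hz0]
      exact div_ne_zero (h.ne_zero hf0 hz hz0) (pow_ne_zero m hz0)
  · by_cases hz0 : z = 0
    · simp [hz0, hf0, hm]
    · simp only [G]; rw [if_neg hz0]
      field_simp

/-- If the curves are maximal and distinct, the order of vanishing at the origin is the number
of curves. -/
theorem le_order (hmax : ∀ k, IsNodalCurve (fun z => (f z).re) (Metric.ball 0 1) (Γ k))
    (hne : ∀ j k, j ≠ k → range (Γ j) ≠ range (Γ k)) {m : ℕ} (hm : m ≠ 0) {G : ℂ → ℂ}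
    (hG : DifferentiableOn ℂ G (Metric.ball 0 1)) (hG0 : ∀ z ∈ Metric.ball (0 : ℂ) 1, G z ≠ 0)
    (hfG : ∀ z ∈ Metric.ball (0 : ℂ) 1, f z = z ^ m * G z) : n ≤ m := by
  have h0 : (0 : ℂ) ∈ Metric.ball (0 : ℂ) 1 := by simp
  have hmC : (m : ℂ) ≠ 0 := by exact_mod_cast hm
  obtain ⟨L, hL, hLG⟩ := exists_log_of_ne_zero hG hG0
  -- `F = z E` is a global `m`-th root of `f`, with non-zero derivative on the nodal set and
  -- injective near `0`. Since `F ^ m` is imaginary on the nodal set, `F` maps each `Γ k` into a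
  -- real line.
  set E : ℂ → ℂ := fun z => Complex.exp (L z / m) with hE
  set F : ℂ → ℂ := fun z => z * E z with hF
  have hEd : DifferentiableOn ℂ E (Metric.ball 0 1) := (hL.div_const _).cexp
  have hE0 : ∀ z, E z ≠ 0 := fun z => Complex.exp_ne_zero _
  have hFd : DifferentiableOn ℂ F (Metric.ball 0 1) := differentiableOn_id.mul hEd
  have hFm : ∀ z ∈ Metric.ball (0 : ℂ) 1, F z ^ m = f z := fun z hz => by
    rw [hfG z hz, hLG z hz]
    simp only [F, E]
    rw [mul_pow, ← Complex.exp_nat_mul]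
    congr 2
    field_simp
  have hFan : ∀ z ∈ Metric.ball (0 : ℂ) 1, AnalyticAt ℂ F z := fun z hz =>
    hFd.analyticAt (Metric.isOpen_ball.mem_nhds hz)
  have hFat : ∀ z ∈ Metric.ball (0 : ℂ) 1, HasDerivAt F (deriv F z) z := fun z hz =>
    (hFan z hz).differentiableAt.hasDerivAt
  have hF'0 : deriv F 0 = E 0 := by
    have h1 : HasDerivAt F (1 * E 0 + 0 * deriv E 0) 0 := (hasDerivAt_id 0).mul
      (hEd.differentiableAt (Metric.isOpen_ball.mem_nhds h0)).hasDerivAt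
    simpa using h1.deriv
  have hF' : ∀ z ∈ reNodal f, deriv F z ≠ 0 := fun z hz => by
    by_cases hz0 : z = 0
    · rw [hz0, hF'0]; exact hE0 0
    · intro hcon
      apply h.deriv_ne_zero hz hz0
      have h1 := (hFat z hz.1).pow m
      rw [hcon, mul_zero] at h1
      refine (h1.congr_of_eventuallyEq ?_).deriv
      filter_upwards [Metric.isOpen_ball.mem_nhds hz.1] with w hw
      exact (hFm w hw).symm
  obtain ⟨e, hze, -, -, hFe, -⟩ := exists_local_pow one_ne_zero
    (hEd.analyticAt (Metric.isOpen_ball.mem_nhds h0)) (hE0 0) (f := F)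
    (Eventually.of_forall fun z => by simp [F]) (Metric.isOpen_ball.mem_nhds h0)
  have hFinj : InjOn F e.source := fun z hz w hw hzw => by
    rw [hFe z hz, hFe w hw] at hzw
    simp only [pow_one, add_right_inj] at hzw
    exact e.injOn hz hw hzw
  choose τ hτ using h.zero_mem
  have hmem : ∀ k t, Γ k t ∈ reNodal f := fun k t => h.subset k ⟨t, rfl⟩
  have hder : ∀ k t, HasDerivAt (fun s => F (Γ k s)) (deriv F (Γ k t) * deriv (Γ k) t) t :=
    fun k t => hasDerivAt_comp_real (hFat _ (hmem k t).1) ((h.curve k).hasDerivAt t)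
  have hline : ∀ k, ∃ ω : ℂ, ‖ω‖ = 1 ∧ ω ^ (2 * m) = -1 ∧
      ∀ t, F (Γ k t) = ((F (Γ k t) * (starRingEnd ℂ) ω).re : ℂ) * ω := fun k =>
    exists_line_of_re_pow_eq_zero hm
      (continuous_iff_continuousAt.2 fun t => (hder k t).continuousAt)
      (mul_ne_zero (hF' _ (hmem k (τ k))) (h.curve k _).2) (hder k (τ k)) (by simp [F, hτ])
      (fun t ht => mul_ne_zero (fun h1 => ht (h.injective k (h1.trans (hτ k).symm))) (hE0 _))
      fun t => by rw [hFm _ (hmem k t).1]; exact (hmem k t).2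
  choose ω hω1 hω2 hω using hline
  set x : Fin n → ℝ → ℝ := fun k t => (F (Γ k t) * (starRingEnd ℂ) (ω k)).re with hxdef
  have hx : ∀ k t, AnalyticAt ℝ (x k) t ∧ deriv (x k) t ≠ 0 := by
    intro k t
    have h1 : AnalyticAt ℝ (fun s => F (Γ k s)) t :=
      ((hFan _ (hmem k t).1).restrictScalars (𝕜 := ℝ)).comp (h.curve k t).1
    have h2 : AnalyticAt ℝ (fun s => F (Γ k s) * (starRingEnd ℂ) (ω k)) t :=
      h1.mul analyticAt_const
    have h3 : AnalyticAt ℝ (x k) t := (Complex.reCLM.analyticAt _).comp h2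
    refine ⟨h3, fun hcon => ?_⟩
    have h4 : HasDerivAt (x k) 0 t := hcon ▸ h3.differentiableAt.hasDerivAt
    have h5 : HasDerivAt (fun s => F (Γ k s)) (((0 : ℝ) : ℂ) * ω k) t :=
      (h4.ofReal_comp.mul_const (ω k)).congr_of_eventuallyEq (Eventually.of_forall (hω k))
    have h6 := h5.unique (hder k t)
    rw [Complex.ofReal_zero, zero_mul] at h6
    exact mul_ne_zero (hF' _ (hmem k t)) (h.curve k t).2 h6.symm
  have hx0 : ∀ k, x k (τ k) = 0 := fun k => by simp [x, F, hτ]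
  have hpos : 0 < m := Nat.pos_of_ne_zero hm
  -- The square forgets the sign of `ω`, hence names the line. Curves on the same line have the same
  -- trace, and `(ω ^ 2) ^ m = -1` leaves at most `m` lines.
  have hinj : Function.Injective fun k => ω k ^ 2 := by
    intro j k hjk
    by_contra hne'
    refine hne j k hne' ?_
    rcases sq_eq_sq_iff_eq_or_eq_neg.1 hjk with he | he
    · exact range_subset_of_map_line (hmax j) (hmax k) (e.open_source.mem_nhds hze) hFinj
        (hx j) (hx k) (hω j) (by rw [he]; exact hω k) (hτ j) (hτ k) (hx0 j) (hx0 k)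
    · refine range_subset_of_map_line (hmax j) (hmax k) (y := fun t => -x k t)
        (e.open_source.mem_nhds hze) hFinj
        (hx j) (fun t => ⟨(hx k t).1.neg, ?_⟩) (hω j) (fun t => ?_) (hτ j) (hτ k) (hx0 j)
        (by simp [hx0 k])
      · rw [deriv.fun_neg]; exact neg_ne_zero.2 (hx k t).2
      · rw [he, Complex.ofReal_neg, neg_mul_neg]; exact hω k t
  have hcard : Finset.univ.image (fun k => ω k ^ 2) ⊆
      (Polynomial.nthRoots m (-1 : ℂ)).toFinset := by
    intro u hu
    obtain ⟨k, -, rfl⟩ := Finset.mem_image.1 hu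
    rw [Multiset.mem_toFinset, Polynomial.mem_nthRoots hpos, ← pow_mul]
    exact hω2 k
  have h1 := Finset.card_le_card hcard
  rw [Finset.card_image_of_injective _ hinj, Finset.card_univ, Fintype.card_fin] at h1
  exact h1.trans ((Multiset.toFinset_card_le _).trans (Polynomial.card_nthRoots m _))

end IsNodalStar

/-! ### Every component of `{Re f > 0}` touches the origin -/

/-- With `z = log (w ^ m)` a sector becomes a half-strip, which is convex; its image under `ω * exp
(z / m)` joins `w` to the point of modulus `c` on the axis of its sector, `ω` being the matching
root of unity. -/
theorem exists_joinedIn_sector {m : ℕ} (hm : m ≠ 0) {η c : ℝ} (hc : 0 < c) (hcη : c < η) {w : ℂ}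
    (hw : ‖w‖ < η) (hre : 0 < (w ^ m).re) :
    ∃ ω : ℂ, ω ^ m = 1 ∧ JoinedIn {w | ‖w‖ < η ∧ 0 < (w ^ m).re} w (c * ω) := by
  have hmC : (m : ℂ) ≠ 0 := by exact_mod_cast hm
  have hmR : (0 : ℝ) < m := by positivity
  have hw0 : w ≠ 0 := by
    rintro rfl; simp [hm] at hre
  have hη : 0 < η := hc.trans hcη
  set L : ℂ := Complex.log (w ^ m) with hL
  have hLe : Complex.exp L = w ^ m := Complex.exp_log (pow_ne_zero m hw0)
  set ω : ℂ := w * Complex.exp (-(L / m)) with hω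
  have hωm : ω ^ m = 1 := by
    rw [hω, mul_pow, ← Complex.exp_nat_mul, ← hLe, ← Complex.exp_add]
    have : L + m * -(L / m) = 0 := by field_simp; ring
    rw [this, Complex.exp_zero]
  have hω1 : ‖ω‖ = 1 := by
    have : ‖ω‖ ^ m = 1 := by rw [← norm_pow, hωm, norm_one]
    exact (pow_eq_one_iff_of_nonneg (norm_nonneg _) hm).1 this
  refine ⟨ω, hωm, ?_⟩
  set M : ℂ := ((m * Real.log c : ℝ) : ℂ) with hM
  set S : Set ℂ := {z | z.re < m * Real.log η ∧ |z.im| < Real.pi / 2} with hS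
  have hconv : Convex ℝ S := by
    have h1 : Convex ℝ {z : ℂ | z.re < m * Real.log η} := convex_halfSpace_re_lt _
    have h2 : Convex ℝ {z : ℂ | z.im < Real.pi / 2} := convex_halfSpace_im_lt _
    have h3 : Convex ℝ {z : ℂ | -(Real.pi / 2) < z.im} := convex_halfSpace_im_gt _
    convert h1.inter (h3.inter h2) using 1
    ext z; simp [S, abs_lt]
  have hLS : L ∈ S := by
    refine ⟨?_, ?_⟩
    · rw [hL, Complex.log_re, norm_pow, Real.log_pow]
      exact mul_lt_mul_of_pos_left (Real.log_lt_log (norm_pos_iff.2 hw0) hw) hmR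
    · rw [hL, Complex.log_im, Complex.abs_arg_lt_pi_div_two_iff]
      exact Or.inl hre
  have hMS : M ∈ S := by
    refine ⟨?_, ?_⟩
    · rw [hM, Complex.ofReal_re]
      exact mul_lt_mul_of_pos_left (Real.log_lt_log hc hcη) hmR
    · rw [hM, Complex.ofReal_im, abs_zero]; positivity
  have hJ : JoinedIn ((fun z => ω * Complex.exp (z / m)) '' S) (ω * Complex.exp (L / m))
      (ω * Complex.exp (M / m)) :=
    ((hconv.isPathConnected ⟨L, hLS⟩).image (by fun_prop)).joinedIn _ ⟨L, hLS, rfl⟩ _ ⟨M, hMS, rfl⟩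
  have e1 : ω * Complex.exp (L / m) = w := by
    rw [hω, mul_assoc, ← Complex.exp_add, neg_add_cancel, Complex.exp_zero, mul_one]
  have e2 : ω * Complex.exp (M / m) = c * ω := by
    have : M / m = ((Real.log c : ℝ) : ℂ) := by rw [hM]; push_cast; field_simp
    rw [this, ← Complex.ofReal_exp, Real.exp_log hc, mul_comm]
  rw [e1, e2] at hJ
  refine hJ.mono ?_
  rintro _ ⟨z, ⟨hz1, hz2⟩, rfl⟩
  have hzm : (ω * Complex.exp (z / m)) ^ m = Complex.exp z := by
    rw [mul_pow, hωm, one_mul, ← Complex.exp_nat_mul]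
    congr 1; field_simp
  refine ⟨?_, ?_⟩
  · rw [norm_mul, hω1, one_mul, Complex.norm_exp]
    have : (z / m).re = z.re / m := by
      rw [← Complex.ofReal_natCast, Complex.div_ofReal_re]
    rw [this, ← Real.lt_log_iff_exp_lt hη, div_lt_iff₀ hmR, mul_comm]
    exact hz1
  · show 0 < ((ω * Complex.exp (z / m)) ^ m).re
    rw [hzm, Complex.exp_re]
    exact mul_pos (Real.exp_pos _) (Real.cos_pos_of_mem_Ioo (abs_lt.1 hz2))

/-- Near a zero of `Re f` of order `m`, the set `{Re f > 0}` consists of at most `m` sectors. -/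
theorem exists_local_sectors {f g : ℂ → ℂ} {U : Set ℂ} {z₁ : ℂ} (hU : U ∈ 𝓝 z₁) {m : ℕ}
    (hm : m ≠ 0) (hg : AnalyticAt ℂ g z₁) (hg0 : g z₁ ≠ 0) (hz₁ : (f z₁).re = 0)
    (hfg : ∀ᶠ z in 𝓝 z₁, f z = f z₁ + (z - z₁) ^ m * g z) :
    ∃ W ∈ 𝓝 z₁, ∃ Ξ : Finset ℂ, Ξ.card ≤ m ∧
      (∀ ξ ∈ Ξ, JoinedIn ({w | w ∈ U ∧ 0 < (f w).re} ∪ {z₁}) ξ z₁) ∧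
      (∀ z ∈ W, 0 < (f z).re → ∃ ξ ∈ Ξ, JoinedIn {w | w ∈ U ∧ 0 < (f w).re} z ξ) := by
  obtain ⟨e, hze, he0, heU, hfe, -⟩ := exists_local_pow hm hg hg0 hfg hU
  have h0t : (0 : ℂ) ∈ e.target := he0 ▸ e.map_source hze
  obtain ⟨η, hη, hηt⟩ := Metric.isOpen_iff.1 e.open_target 0 h0t
  have hηt' : ∀ w : ℂ, ‖w‖ < η → w ∈ e.target := fun w hw => hηt (by simpa using hw)
  have hre : ∀ w : ℂ, ‖w‖ < η → (f (e.symm w)).re = (w ^ m).re := fun w hw => by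
    rw [hfe _ (e.map_target (hηt' w hw)), e.right_inv (hηt' w hw), Complex.add_re, hz₁, zero_add]
  have hsymm : ContinuousOn e.symm {w | ‖w‖ < η} := e.continuousOn_symm.mono hηt'
  have hpos : 0 < m := Nat.pos_of_ne_zero hm
  have hnorm : ∀ ω : ℂ, ω ^ m = 1 → ‖ω‖ = 1 := fun ω hω =>
    (pow_eq_one_iff_of_nonneg (norm_nonneg _) hm).1 (by rw [← norm_pow, hω, norm_one])
  classical
  refine ⟨e.source ∩ e ⁻¹' Metric.ball 0 η,
    (e.isOpen_inter_preimage Metric.isOpen_ball).mem_nhds ⟨hze, by simp [he0, hη]⟩,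
    (Polynomial.nthRoots m (1 : ℂ)).toFinset.image fun ω => e.symm (((η / 2 : ℝ) : ℂ) * ω),
    Finset.card_image_le.trans ((Multiset.toFinset_card_le _).trans (Polynomial.card_nthRoots m _)),
    fun ξ hξ => ?_, fun z hz hzpos => ?_⟩
  · obtain ⟨ω, hω, rfl⟩ := Finset.mem_image.1 hξ
    rw [Multiset.mem_toFinset, Polynomial.mem_nthRoots hpos] at hω
    have hlt : ∀ t ∈ Icc (0 : ℝ) (η / 2), ‖(t : ℂ) * ω‖ < η := fun t ht => by
      rw [norm_mul, hnorm ω hω, mul_one, Complex.norm_real, Real.norm_of_nonneg ht.1]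
      linarith [ht.2]
    have h1 := joinedIn_image_Icc (γ := fun t : ℝ => e.symm ((t : ℂ) * ω)) (a := 0) (b := η / 2)
      (S := {w | w ∈ U ∧ 0 < (f w).re} ∪ {z₁})
      (by positivity) (hsymm.comp (by fun_prop) hlt) (fun t ht => by
        rcases ht.1.eq_or_lt with h0 | h0
        · right
          rw [← h0, mem_singleton_iff, Complex.ofReal_zero, zero_mul, ← he0, e.left_inv hze]
        · left
          refine ⟨heU (e.map_target (hηt' _ (hlt t ht))), ?_⟩
          rw [hre _ (hlt t ht), mul_pow, hω, mul_one, ← Complex.ofReal_pow, Complex.ofReal_re]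
          positivity)
    have h2 : e.symm (((0 : ℝ) : ℂ) * ω) = z₁ := by
      rw [Complex.ofReal_zero, zero_mul, ← he0, e.left_inv hze]
    simp only [h2] at h1
    exact h1.symm
  · have hzη : ‖e z‖ < η := by simpa using hz.2
    have hzre : 0 < ((e z) ^ m).re := by
      have := hre (e z) hzη
      rw [e.left_inv hz.1] at this
      rwa [← this]
    obtain ⟨ω, hω, hJ⟩ := exists_joinedIn_sector hm (c := η / 2) (by positivity) (by linarith)
      hzη hzre
    refine ⟨e.symm (((η / 2 : ℝ) : ℂ) * ω), Finset.mem_image.2 ⟨ω, ?_, rfl⟩, ?_⟩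
    · rwa [Multiset.mem_toFinset, Polynomial.mem_nthRoots hpos]
    · have h1 := hJ.map_continuousOn (f := e.symm) (hsymm.mono fun w hw => hw.1)
      rw [e.left_inv hz.1] at h1
      refine h1.mono ?_
      rintro _ ⟨w, ⟨hw1, hw2⟩, rfl⟩
      exact ⟨heU (e.map_target (hηt' w hw1)), by rw [hre w hw1]; exact hw2⟩

/-- If a component of `{Re f > 0}` has a regular zero in its closure, then it has all
neighbouring zeros in its closure. -/
theorem eventually_mem_closure_pathComponentIn {f : ℂ → ℂ} {U : Set ℂ} {z₁ z₀ : ℂ}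
    (hU : U ∈ 𝓝 z₁) (hf : AnalyticAt ℂ f z₁) (hf' : deriv f z₁ ≠ 0) (hz₁ : (f z₁).re = 0)
    (hcl : z₁ ∈ closure (pathComponentIn {w | w ∈ U ∧ 0 < (f w).re} z₀)) :
    ∀ᶠ z in 𝓝 z₁, (f z).re = 0 →
      z ∈ closure (pathComponentIn {w | w ∈ U ∧ 0 < (f w).re} z₀) := by
  obtain ⟨k, hk, g, hg, hg0, hfg⟩ := exists_factor hf (by
    refine nhdsWithin_le_nhds (hf.deriv.continuousAt.eventually_ne hf'))
  have hk1 : k = 1 := by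
    by_contra hk1
    have h1 : HasDerivAt (fun z => f z₁ + (z - z₁) ^ k * g z)
        (k * (z₁ - z₁) ^ (k - 1) * 1 * g z₁ + (z₁ - z₁) ^ k * deriv g z₁) z₁ :=
      ((((hasDerivAt_id z₁).sub_const z₁).pow k).mul hg.differentiableAt.hasDerivAt).const_add _
    rw [sub_self, zero_pow (by omega : k - 1 ≠ 0), zero_pow hk] at h1
    apply hf'
    rw [(h1.congr_of_eventuallyEq hfg).deriv]; ring
  subst hk1
  obtain ⟨e, hze, he0, heU, hfe, -⟩ := exists_local_pow hk hg hg0 hfg hU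
  have h0t : (0 : ℂ) ∈ e.target := he0 ▸ e.map_source hze
  obtain ⟨η, hη, hηt⟩ := Metric.isOpen_iff.1 e.open_target 0 h0t
  have hre : ∀ w ∈ Metric.ball (0 : ℂ) η, (f (e.symm w)).re = w.re := fun w hw => by
    rw [hfe _ (e.map_target (hηt hw)), e.right_inv (hηt hw), Complex.add_re, hz₁, zero_add, pow_one]
  have hre' : ∀ z ∈ e.source, (f z).re = (e z).re := fun z hz => by
    rw [hfe z hz, Complex.add_re, hz₁, zero_add, pow_one]
  have hW : e.source ∩ e ⁻¹' Metric.ball 0 η ∈ 𝓝 z₁ :=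
    (e.isOpen_inter_preimage Metric.isOpen_ball).mem_nhds ⟨hze, by simp [he0, hη]⟩
  -- In the straightening coordinate `{Re f > 0}` is this convex half-disc. It meets the component,
  -- hence lies in it, and its diameter consists of the neighbouring zeros.
  set H : Set ℂ := Metric.ball 0 η ∩ {w | 0 < w.re} with hH
  have hHc : Convex ℝ H := (convex_ball _ _).inter (convex_halfSpace_re_gt _)
  obtain ⟨y, ⟨hy1, hy2⟩, hy⟩ := mem_closure_iff_nhds.1 hcl _ hW
  have hyP := (show JoinedIn _ _ _ from hy).target_mem
  have hyH : e y ∈ H := ⟨hy2, show 0 < (e y).re by rw [← hre' y hy1]; exact hyP.2⟩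
  have hHU : ∀ w ∈ H, e.symm w ∈ pathComponentIn {w | w ∈ U ∧ 0 < (f w).re} z₀ := by
    intro w hw
    have h1 := ((hHc.isPathConnected ⟨_, hyH⟩).joinedIn _ hyH _ hw).map_continuousOn
      (f := e.symm) (e.continuousOn_symm.mono fun w hw => hηt hw.1)
    rw [e.left_inv hy1] at h1
    refine (show JoinedIn _ _ _ from hy).trans (h1.mono ?_)
    rintro _ ⟨v, hv, rfl⟩
    exact ⟨heU (e.map_target (hηt hv.1)), by rw [hre v hv.1]; exact hv.2⟩
  filter_upwards [hW] with z hz hfz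
  have hzt : e z ∈ e.target := e.map_source hz.1
  have hlim : Tendsto (fun ε : ℝ => e.symm (e z + ε)) (𝓝[>] 0) (𝓝 z) := by
    have h1 : Tendsto (fun ε : ℝ => e z + ε) (𝓝[>] 0) (𝓝 (e z)) := by
      have : Continuous fun ε : ℝ => e z + ε := by fun_prop
      exact (this.tendsto' 0 _ (by simp)).mono_left nhdsWithin_le_nhds
    have h2 := (e.symm.continuousAt hzt).tendsto.comp h1
    rwa [e.left_inv hz.1] at h2
  have hball : ∀ᶠ ε : ℝ in 𝓝[>] 0, e z + ε ∈ Metric.ball (0 : ℂ) η := by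
    have h1 : Tendsto (fun ε : ℝ => e z + ε) (𝓝[>] 0) (𝓝 (e z)) := by
      have : Continuous fun ε : ℝ => e z + ε := by fun_prop
      exact (this.tendsto' 0 _ (by simp)).mono_left nhdsWithin_le_nhds
    exact h1.eventually (Metric.isOpen_ball.mem_nhds hz.2)
  refine mem_closure_of_tendsto hlim ?_
  filter_upwards [hball, self_mem_nhdsWithin] with ε h1 h2
  refine hHU _ ⟨h1, ?_⟩
  show 0 < (e z + ε).re
  rw [Complex.add_re, Complex.ofReal_re, ← hre' z hz.1, hfz, zero_add]
  exact h2

namespace IsNodalStar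

variable {f : ℂ → ℂ} {n : ℕ} {Γ : Fin n → ℝ → ℂ} (h : IsNodalStar f Γ)

include h

theorem neg : IsNodalStar (fun z => -f z) Γ where
  differentiableOn := h.differentiableOn.neg
  nonconst := fun z hz => by
    filter_upwards [h.nonconst z hz] with w hw
    rw [deriv.fun_neg]; exact neg_ne_zero.2 hw
  curve := h.curve
  subset := fun k => by
    intro z hz
    have := h.subset k hz
    exact ⟨this.1, by simpa using this.2⟩
  zero_mem := h.zero_mem
  cover := fun z hz => h.cover ⟨hz.1, by simpa using hz.2⟩

/-- If a component of `{Re f > 0}` has a nodal point in its closure, then it has the origin in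
its closure. -/
theorem zero_mem_closure_of_mem {z₀ z₁ : ℂ} (hz₁ : z₁ ∈ reNodal f)
    (hcl : z₁ ∈ closure (pathComponentIn {w | w ∈ Metric.ball (0 : ℂ) 1 ∧ 0 < (f w).re} z₀)) :
    (0 : ℂ) ∈ closure (pathComponentIn {w | w ∈ Metric.ball (0 : ℂ) 1 ∧ 0 < (f w).re} z₀) := by
  set C := closure (pathComponentIn {w | w ∈ Metric.ball (0 : ℂ) 1 ∧ 0 < (f w).re} z₀) with hC
  obtain ⟨k, t₁, rfl⟩ := mem_iUnion.1 (h.cover hz₁)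
  obtain ⟨τ, hτ⟩ := h.zero_mem k
  have hmem : ∀ t, Γ k t ∈ reNodal f := fun t => h.subset k ⟨t, rfl⟩
  have hclosed : IsClosed (Γ k ⁻¹' C) := isClosed_closure.preimage (h.curve k).continuous
  -- Belonging to the closure is an open condition along `Γ k` away from the origin, and a closed
  -- one; so it propagates from `t₁` up to the parameter `τ` of the origin.
  have hopen : ∀ t, t ≠ τ → t ∈ Γ k ⁻¹' C → Γ k ⁻¹' C ∈ 𝓝 t := by
    intro t ht htC
    have h0 : Γ k t ≠ 0 := fun h0 => ht (h.injective k (h0.trans hτ.symm))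
    have h1 := eventually_mem_closure_pathComponentIn
      (Metric.isOpen_ball.mem_nhds (hmem t).1) (h.analyticAt (hmem t).1)
      (h.deriv_ne_zero (hmem t) h0) (hmem t).2 htC
    filter_upwards [(h.curve k).continuous.continuousAt.eventually h1] with s hs
    exact hs (hmem s).2
  rw [← hτ]
  rcases lt_trichotomy t₁ τ with hlt | heq | hlt
  · have hsub : Ico t₁ τ ⊆ Γ k ⁻¹' C := by
      refine isPreconnected_Ico.subset_of_closure_inter_subset (u := interior (Γ k ⁻¹' C))
        isOpen_interior ⟨t₁, ⟨le_rfl, hlt⟩, mem_interior_iff_mem_nhds.2 (hopen t₁ hlt.ne hcl)⟩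
        ?_ |>.trans interior_subset
      rintro t ⟨ht1, ht2⟩
      exact mem_interior_iff_mem_nhds.2 (hopen t ht2.2.ne
        (closure_minimal interior_subset hclosed ht1))
    have : τ ∈ closure (Ico t₁ τ) := by rw [closure_Ico hlt.ne]; exact ⟨hlt.le, le_rfl⟩
    exact closure_minimal hsub hclosed this
  · rw [← heq]; exact hcl
  · have hsub : Ioc τ t₁ ⊆ Γ k ⁻¹' C := by
      refine isPreconnected_Ioc.subset_of_closure_inter_subset (u := interior (Γ k ⁻¹' C))
        isOpen_interior ⟨t₁, ⟨hlt, le_rfl⟩, mem_interior_iff_mem_nhds.2 (hopen t₁ hlt.ne' hcl)⟩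
        ?_ |>.trans interior_subset
      rintro t ⟨ht1, ht2⟩
      exact mem_interior_iff_mem_nhds.2 (hopen t ht2.1.ne'
        (closure_minimal interior_subset hclosed ht1))
    have : τ ∈ closure (Ioc τ t₁) := by rw [closure_Ioc hlt.ne]; exact ⟨le_rfl, hlt.le⟩
    exact closure_minimal hsub hclosed this

/-- The set `{Re f > 0}` has at most `m` components, all of which touch the origin. -/
theorem exists_sectors (hf0 : f 0 = 0) {m : ℕ} (hm : m ≠ 0) {G : ℂ → ℂ}
    (hG : DifferentiableOn ℂ G (Metric.ball 0 1)) (hG0 : ∀ z ∈ Metric.ball (0 : ℂ) 1, G z ≠ 0)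
    (hfG : ∀ z ∈ Metric.ball (0 : ℂ) 1, f z = z ^ m * G z) :
    ∃ Ξ : Finset ℂ, Ξ.card ≤ m ∧
      (∀ ξ ∈ Ξ, JoinedIn ({w | w ∈ Metric.ball (0 : ℂ) 1 ∧ 0 < (f w).re} ∪ {0}) ξ 0) ∧
      (∀ z ∈ Metric.ball (0 : ℂ) 1, 0 < (f z).re →
        ∃ ξ ∈ Ξ, JoinedIn {w | w ∈ Metric.ball (0 : ℂ) 1 ∧ 0 < (f w).re} z ξ) := by
  have h0 : (0 : ℂ) ∈ Metric.ball (0 : ℂ) 1 := by simp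
  have hnh := Metric.isOpen_ball.mem_nhds h0
  obtain ⟨W, hW, Ξ, hcard, hΞ0, hΞ⟩ := exists_local_sectors (f := f) hnh hm (hG.analyticAt hnh)
    (hG0 0 h0) (by simp [hf0]) (by
      filter_upwards [hnh] with z hz
      rw [hfG z hz, hf0, zero_add, sub_zero])
  refine ⟨Ξ, hcard, hΞ0, fun z hz hfz => ?_⟩
  set P := {w | w ∈ Metric.ball (0 : ℂ) 1 ∧ 0 < (f w).re} with hP
  have hPo : IsOpen P := isOpen_re_pos Metric.isOpen_ball h.differentiableOn.continuousOn
  have hzU : z ∈ pathComponentIn P z := mem_pathComponentIn_self (⟨hz, hfz⟩ : z ∈ P)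
  -- A component whose closure misses `0` has no nodal point of the disc in its closure, so it is
  -- relatively closed and fills the disc, which contains `0`.
  have hcl0 : (0 : ℂ) ∈ closure (pathComponentIn P z) := by
    by_contra hcon
    have hsub : Metric.ball (0 : ℂ) 1 ⊆ pathComponentIn P z := by
      refine (convex_ball (0 : ℂ) 1).isPreconnected.subset_of_closure_inter_subset
        (hPo.pathComponentIn z) ⟨z, hz, hzU⟩ ?_
      rintro y ⟨hy1, hy2⟩
      have hyc : ContinuousAt (fun z => (f z).re) y :=
        Complex.continuous_re.continuousAt.comp (h.analyticAt hy2).continuousAt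
      have hy0 : 0 ≤ (f y).re := by
        by_contra hneg
        obtain ⟨x, hx1, hx2⟩ := mem_closure_iff_nhds.1 hy1 _
          (hyc.eventually_lt continuousAt_const (not_le.1 hneg))
        exact absurd hx1 (not_lt.2 (show JoinedIn _ _ _ from hx2).target_mem.2.le)
      rcases hy0.eq_or_lt with hy0 | hy0
      · exact absurd (h.zero_mem_closure_of_mem ⟨hy2, hy0.symm⟩ hy1) hcon
      · exact mem_pathComponentIn_of_mem_closure hPo hy1 ⟨hy2, hy0⟩
    exact hcon (subset_closure (hsub h0))
  obtain ⟨y, hyW, hy⟩ := mem_closure_iff_nhds.1 hcl0 W hW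
  obtain ⟨ξ, hξ, hJ⟩ := hΞ y hyW (show JoinedIn _ _ _ from hy).target_mem.2
  exact ⟨ξ, hξ, (show JoinedIn _ _ _ from hy).trans hJ⟩

end IsNodalStar

/-! ### Approximation on circles and mean values -/

theorem integral_circleMap_eq {f : ℂ → ℂ} {R : ℝ} (hf : DifferentiableOn ℂ f (Metric.ball 0 R))
    {r : ℝ} (hr : |r| < R) :
    ∫ θ in (0 : ℝ)..(2 * Real.pi), f (circleMap 0 r θ) = 2 * Real.pi * f 0 := by
  have h1 : DiffContOnCl ℂ f (Metric.ball 0 |r|) := (hf.mono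
    (Metric.closure_ball_subset_closedBall.trans (Metric.closedBall_subset_ball hr))).diffContOnCl
  have h2 := h1.circleAverage
  rw [Real.circleAverage_def] at h2
  have hpi : (2 * Real.pi : ℝ) ≠ 0 := by positivity
  rw [inv_smul_eq_iff₀ hpi] at h2
  rw [h2, Complex.real_smul]; push_cast; rfl

theorem continuousOn_comp_circleMap {E : Type*} [TopologicalSpace E] {h : ℂ → E} {R r : ℝ}
    (hh : ContinuousOn h (Metric.closedBall 0 R)) (hr : |r| ≤ R) :
    Continuous fun θ => h (circleMap 0 r θ) :=
  hh.comp_continuous (continuous_circleMap 0 r) fun θ => by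
    simpa using hr

theorem integral_re_circleMap_eq {f : ℂ → ℂ} {R : ℝ}
    (hf : DifferentiableOn ℂ f (Metric.ball 0 R)) {r : ℝ} (hr : |r| < R) :
    ∫ θ in (0 : ℝ)..(2 * Real.pi), (f (circleMap 0 r θ)).re = 2 * Real.pi * (f 0).re := by
  have hc : Continuous fun θ => f (circleMap 0 r θ) :=
    continuousOn_comp_circleMap (hf.continuousOn.mono (Metric.closedBall_subset_ball hr)) le_rfl
  have h1 := Complex.reCLM.intervalIntegral_comp_comm (hc.intervalIntegrable 0 (2 * Real.pi))
    (μ := volume)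
  simp only [Complex.reCLM_apply] at h1
  rw [h1, integral_circleMap_eq hf hr]
  norm_cast
  rw [Complex.re_ofReal_mul]

/-- A continuous function on a circle is uniformly approximated by real parts of entire
functions. -/
theorem exists_re_approx {r : ℝ} (hr : 0 < r) {φ : ℝ → ℝ} (hφ : Continuous φ)
    (hper : Function.Periodic φ (2 * Real.pi)) {δ : ℝ} (hδ : 0 < δ) :
    ∃ P : ℂ → ℂ, Differentiable ℂ P ∧ ∀ θ, |φ θ - (P (circleMap 0 r θ)).re| ≤ δ := by
  have : Fact (0 < 2 * Real.pi) := ⟨by positivity⟩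
  let Φ : C(AddCircle (2 * Real.pi), ℂ) :=
    ⟨fun x => ((hper.lift x : ℝ) : ℂ), Complex.continuous_ofReal.comp
      ((QuotientAddGroup.isQuotientMap_mk _).continuous_iff.2 hφ)⟩
  have hΦ : ∀ θ : ℝ, Φ (θ : AddCircle (2 * Real.pi)) = φ θ := fun θ => rfl
  have hspan : ∀ t ∈ Submodule.span ℂ (range (fourier (T := 2 * Real.pi))), ∀ c : ℂ,
      ∃ P : ℂ → ℂ, Differentiable ℂ P ∧
        ∀ θ : ℝ, (c * t (θ : AddCircle (2 * Real.pi))).re = (P (circleMap 0 r θ)).re := by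
    intro t ht
    induction ht using Submodule.span_induction with
    | mem x hx =>
      obtain ⟨k, rfl⟩ := hx
      intro c
      have hfour : ∀ θ : ℝ, fourier k (θ : AddCircle (2 * Real.pi)) =
          Complex.exp ((k * θ : ℝ) * Complex.I) := fun θ => by
        rw [fourier_coe_apply]
        congr 1
        have : (Real.pi : ℂ) ≠ 0 := by exact_mod_cast Real.pi_ne_zero
        push_cast; field_simp
      have hpow : ∀ (j : ℕ) (θ : ℝ), (circleMap 0 r θ / r) ^ j =
          Complex.exp ((j * θ : ℝ) * Complex.I) := fun j θ => by
        have : (r : ℂ) ≠ 0 := by exact_mod_cast hr.ne'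
        rw [circleMap_zero, mul_div_cancel_left₀ _ this, ← Complex.exp_nat_mul]
        congr 1; push_cast; ring
      rcases Int.eq_nat_or_neg k with ⟨j, rfl | rfl⟩
      · refine ⟨fun z => c * (z / r) ^ j, by fun_prop, fun θ => ?_⟩
        show _ = (c * (circleMap 0 r θ / r) ^ j).re
        rw [hfour, hpow]; simp
      -- Negative frequencies: `c e^{-ijθ}` and its conjugate have the same real part.
      · refine ⟨fun z => (starRingEnd ℂ) c * (z / r) ^ j, by fun_prop, fun θ => ?_⟩
        show _ = ((starRingEnd ℂ) c * (circleMap 0 r θ / r) ^ j).re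
        rw [hfour, hpow, ← Complex.conj_re]
        congr 1
        rw [map_mul, ← Complex.exp_conj]
        congr 2
        simp
    | zero => exact fun c => ⟨0, by fun_prop, fun θ => by simp⟩
    | add x y _ _ hx hy =>
      intro c
      obtain ⟨P, hP, hPx⟩ := hx c
      obtain ⟨Q, hQ, hQy⟩ := hy c
      refine ⟨fun z => P z + Q z, by fun_prop, fun θ => ?_⟩
      rw [ContinuousMap.add_apply, mul_add, Complex.add_re, Complex.add_re, hPx, hQy]
    | smul a x _ hx =>
      intro c
      obtain ⟨P, hP, hPx⟩ := hx (c * a)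
      refine ⟨P, hP, fun θ => ?_⟩
      rw [ContinuousMap.smul_apply, smul_eq_mul, ← mul_assoc, hPx]
  have hmem : Φ ∈ (Submodule.span ℂ (range (fourier (T := 2 * Real.pi)))).topologicalClosure := by
    rw [span_fourier_closure_eq_top]; trivial
  obtain ⟨t, ht, hdist⟩ := Metric.mem_closure_iff.1 hmem δ hδ
  obtain ⟨P, hP, hPt⟩ := hspan t ht 1
  refine ⟨P, hP, fun θ => ?_⟩
  rw [← hPt, one_mul, ← Complex.ofReal_re (φ θ), ← hΦ, ← Complex.sub_re]
  refine (Complex.abs_re_le_norm _).trans ?_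
  rw [← dist_eq_norm]
  exact (ContinuousMap.dist_apply_le_dist _).trans hdist.le

/-! ### Sub-mean value property for unions of components -/

/-- `A` is a union of components of `{Re f > 0}` in the closed disc of radius `r`. -/
structure IsPosPart (f : ℂ → ℂ) (r : ℝ) (A : Set ℂ) : Prop where
  subset : ∀ z ∈ A, ‖z‖ ≤ r ∧ 0 < (f z).re
  joined : ∀ z ∈ A, ∀ w, JoinedIn {z | ‖z‖ ≤ r ∧ 0 < (f z).re} z w → w ∈ A

namespace IsPosPart

variable {f : ℂ → ℂ} {r : ℝ} {A : Set ℂ} (hA : IsPosPart f r A)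

include hA

/-- Near a point with `Re f > 0` a relative ball of the closed disc is convex and stays in `{Re f >
0}`, so a union of components contains either all of it or nothing. -/
theorem eventually_mem_iff (hf : ContinuousOn f (Metric.closedBall 0 r)) {z : ℂ}
    (hz : ‖z‖ ≤ r) (hfz : 0 < (f z).re) :
    ∀ᶠ w in 𝓝[Metric.closedBall 0 r] z, (w ∈ A ↔ z ∈ A) := by
  have hc : ContinuousWithinAt (fun z => (f z).re) (Metric.closedBall 0 r) z :=
    Complex.continuous_re.continuousAt.comp_continuousWithinAt (hf z (by simpa using hz))
  obtain ⟨ε, hε, hεs⟩ := Metric.mem_nhdsWithin_iff.1 (hc.eventually_const_lt hfz)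
  have hconv : Convex ℝ (Metric.ball z ε ∩ Metric.closedBall 0 r) :=
    (convex_ball _ _).inter (convex_closedBall _ _)
  have hzmem : z ∈ Metric.ball z ε ∩ Metric.closedBall 0 r :=
    ⟨Metric.mem_ball_self hε, by simpa using hz⟩
  filter_upwards [inter_mem_nhdsWithin (Metric.closedBall 0 r) (Metric.ball_mem_nhds z hε)]
    with w hw
  have hJ : JoinedIn {z | ‖z‖ ≤ r ∧ 0 < (f z).re} z w :=
    ((hconv.isPathConnected ⟨z, hzmem⟩).joinedIn z hzmem w ⟨hw.2, hw.1⟩).mono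
      fun y hy => ⟨by simpa using hy.2, hεs hy⟩
  exact ⟨fun hwA => hA.joined w hwA z hJ.symm, fun hzA => hA.joined z hzA w hJ⟩

theorem indicator_nonneg (z : ℂ) : 0 ≤ A.indicator (fun z => (f z).re) z :=
  Set.indicator_nonneg (fun z hz => (hA.subset z hz).2.le) z

/-- Where `Re f > 0` the set is locally everything or nothing; where `Re f ≤ 0` the indicator is
squeezed between `0` and `max (Re f) 0`. -/
theorem continuousOn_indicator (hf : ContinuousOn f (Metric.closedBall 0 r)) :
    ContinuousOn (A.indicator fun z => (f z).re) (Metric.closedBall 0 r) := by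
  intro z hz
  have hz' : ‖z‖ ≤ r := by simpa using hz
  have hc : ContinuousWithinAt (fun z => (f z).re) (Metric.closedBall 0 r) z :=
    Complex.continuous_re.continuousAt.comp_continuousWithinAt (hf z hz)
  rcases lt_or_ge 0 (f z).re with hpos | hneg
  · have hev := hA.eventually_mem_iff hf hz' hpos
    by_cases hzA : z ∈ A
    · refine hc.congr_of_eventuallyEq ?_ (indicator_of_mem hzA _)
      filter_upwards [hev] with w hw
      exact indicator_of_mem (hw.2 hzA) _
    · refine (continuousWithinAt_const (b := (0 : ℝ))).congr_of_eventuallyEq ?_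
        (indicator_of_notMem hzA _)
      filter_upwards [hev] with w hw
      exact indicator_of_notMem (fun h => hzA (hw.1 h)) _
  · have hzA : z ∉ A := fun h => absurd (hA.subset z h).2 (not_lt.2 hneg)
    have h0 : A.indicator (fun z => (f z).re) z = 0 := indicator_of_notMem hzA _
    rw [ContinuousWithinAt, h0]
    have hmax : Tendsto (fun w => max (f w).re 0) (𝓝[Metric.closedBall 0 r] z) (𝓝 0) := by
      have := hc.tendsto.max (tendsto_const_nhds (x := (0 : ℝ)))
      rwa [max_eq_right hneg] at this
    refine tendsto_of_tendsto_of_tendsto_of_le_of_le tendsto_const_nhds hmax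
      (fun w => hA.indicator_nonneg w) fun w => ?_
    by_cases hw : w ∈ A
    · rw [indicator_of_mem hw]; exact le_max_left _ _
    · rw [indicator_of_notMem hw]; exact le_max_right _ _

/-- The function `h`, equal to `Re f` on `A` and to `0` elsewhere, is subharmonic. Instead of the
general theory, an entire `P` with `Re P` within `δ` of `h` on the outer circle is used: the maximum
principle gives `h ≤ Re P + δ` inside, and the means of `Re P` over both circles equal `Re P 0`. -/
theorem integral_circle_le (hf : DifferentiableOn ℂ f (Metric.ball 0 1)) (hr : 0 < r)
    (hr1 : r < 1) {s : ℝ} (hs : 0 ≤ s) (hsr : s ≤ r) :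
    ∫ θ in (0 : ℝ)..(2 * Real.pi), A.indicator (fun z => (f z).re) (circleMap 0 s θ) ≤
      ∫ θ in (0 : ℝ)..(2 * Real.pi), A.indicator (fun z => (f z).re) (circleMap 0 r θ) := by
  set h : ℂ → ℝ := A.indicator fun z => (f z).re with hh
  have hfc : ContinuousOn f (Metric.closedBall 0 r) :=
    hf.continuousOn.mono (Metric.closedBall_subset_ball hr1)
  have hhc : ContinuousOn h (Metric.closedBall 0 r) := hA.continuousOn_indicator hfc
  have hcr : Continuous fun θ => h (circleMap 0 r θ) :=
    continuousOn_comp_circleMap hhc (abs_of_pos hr).le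
  have hcs : Continuous fun θ => h (circleMap 0 s θ) :=
    continuousOn_comp_circleMap hhc (by rwa [abs_of_nonneg hs])
  have key : ∀ δ > 0, ∫ θ in (0 : ℝ)..(2 * Real.pi), h (circleMap 0 s θ) ≤
      (∫ θ in (0 : ℝ)..(2 * Real.pi), h (circleMap 0 r θ)) + 2 * Real.pi * (2 * δ) := by
    intro δ hδ
    obtain ⟨P, hP, hPh⟩ := exists_re_approx hr hcr ((periodic_circleMap 0 r).comp h) hδ
    have hcirc : ∀ w : ℂ, ‖w‖ = r → |h w - (P w).re| ≤ δ := fun w hw => by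
      have h1 : circleMap 0 r (Complex.arg w) = w := by
        rw [circleMap_zero, ← hw, Complex.norm_mul_exp_arg_mul_I]
      have h2 := hPh (Complex.arg w)
      rwa [h1] at h2
    have hPge : ∀ w : ℂ, ‖w‖ ≤ r → -δ ≤ (P w).re := by
      intro w hw
      have h1 := Complex.norm_le_of_forall_mem_frontier_norm_le (f := fun w => Complex.exp (-P w))
        (U := Metric.ball 0 r) Metric.isBounded_ball
        (hP.neg.cexp.diffContOnCl) (C := Real.exp δ) (fun y hy => by
          rw [frontier_ball _ hr.ne'] at hy
          have hy' : ‖y‖ = r := by simpa using hy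
          rw [Complex.norm_exp, Real.exp_le_exp, Complex.neg_re]
          have := abs_le.1 (hcirc y hy')
          linarith [hA.indicator_nonneg y, this.2])
        (z := w) (by rw [closure_ball _ hr.ne']; simpa using hw)
      rw [Complex.norm_exp, Real.exp_le_exp, Complex.neg_re] at h1
      linarith
    have hle : ∀ w : ℂ, ‖w‖ ≤ r → h w ≤ (P w).re + δ := by
      intro w hw
      by_cases hwA : w ∈ A
      swap
      · rw [hh, indicator_of_notMem hwA]; linarith [hPge w hw]
      rcases hw.eq_or_lt with hw1 | hw1
      · linarith [(abs_le.1 (hcirc w hw1)).2]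
      set U := A ∩ Metric.ball 0 r with hU
      have hUcl : closure U ⊆ Metric.closedBall 0 r :=
        (closure_mono inter_subset_right).trans Metric.closure_ball_subset_closedBall
      have hd : DiffContOnCl ℂ (fun w => Complex.exp (f w - P w)) U :=
        ((hf.mono (hUcl.trans (Metric.closedBall_subset_ball hr1))).sub
          hP.differentiableOn).cexp.diffContOnCl
      have h1 := Complex.norm_le_of_forall_mem_frontier_norm_le
        (Metric.isBounded_ball.subset (inter_subset_right (s := A))) hd (C := Real.exp δ)
        (fun y hy => by
          have hycl : y ∈ closure U := frontier_subset_closure hy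
          have hyr : ‖y‖ ≤ r := by simpa using hUcl hycl
          rw [Complex.norm_exp, Real.exp_le_exp, Complex.sub_re]
          -- A frontier point of `A` in the open disc has `Re f ≤ 0`, where `Re P ≥ -δ` suffices;
          -- one with `Re f > 0` must lie in `A` and on the outer circle, where `Re P` approximates
          -- `h`.
          rcases lt_or_ge 0 (f y).re with hpos | hneg
          swap
          · linarith [hPge y hyr]
          have hev := hA.eventually_mem_iff hfc hyr hpos
          have hyA : y ∈ A := by
            obtain ⟨x, hx1, hx2⟩ :=
              (mem_closure_iff_clusterPt.1 hycl).neBot.nonempty_of_mem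
                (inter_mem (mem_inf_of_left (mem_nhdsWithin_iff_exists_mem_nhds_inter.1 hev).choose_spec.1)
                  (mem_inf_of_right (mem_principal_self U)))
            exact ((mem_nhdsWithin_iff_exists_mem_nhds_inter.1 hev).choose_spec.2
              ⟨hx1, Metric.ball_subset_closedBall hx2.2⟩).1 hx2.1
          have hyA' : h y = (f y).re := indicator_of_mem hyA _
          rcases hyr.eq_or_lt with hy1 | hy1
          · linarith [(abs_le.1 (hcirc y hy1)).2]
          · exfalso
            have hb : Metric.ball (0 : ℂ) r ∈ 𝓝 y := Metric.isOpen_ball.mem_nhds (by simpa using hy1)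
            have hb' : Metric.closedBall (0 : ℂ) r ∈ 𝓝 y :=
              mem_of_superset hb Metric.ball_subset_closedBall
            rw [nhdsWithin_eq_nhds.2 hb'] at hev
            apply hy.2
            rw [mem_interior_iff_mem_nhds]
            filter_upwards [hev, hb] with x hx1 hx2
            exact ⟨hx1.2 hyA, hx2⟩)
        (subset_closure (⟨hwA, by simpa using hw1⟩ : w ∈ U))
      rw [Complex.norm_exp, Real.exp_le_exp, Complex.sub_re] at h1
      rw [hh, indicator_of_mem hwA]
      linarith
    have hPd : ∀ R : ℝ, DifferentiableOn ℂ P (Metric.ball 0 R) := fun R => hP.differentiableOn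
    have hPr := integral_re_circleMap_eq (hPd (|r| + 1)) (lt_add_one _)
    have hPs := integral_re_circleMap_eq (hPd (|s| + 1)) (lt_add_one _)
    have hPc : ∀ t : ℝ, Continuous fun θ => (P (circleMap 0 t θ)).re := fun t =>
      Complex.continuous_re.comp (hP.continuous.comp (continuous_circleMap 0 t))
    have hpi : (0 : ℝ) ≤ 2 * Real.pi := by positivity
    have i1 : ∫ θ in (0 : ℝ)..(2 * Real.pi), h (circleMap 0 s θ) ≤
        ∫ θ in (0 : ℝ)..(2 * Real.pi), ((P (circleMap 0 s θ)).re + δ) :=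
      intervalIntegral.integral_mono_on hpi (hcs.intervalIntegrable _ _)
        (((hPc s).add continuous_const).intervalIntegrable _ _) fun θ _ =>
          hle _ (by simpa [abs_of_nonneg hs] using hsr)
    have i2 : ∫ θ in (0 : ℝ)..(2 * Real.pi), ((P (circleMap 0 r θ)).re - δ) ≤
        ∫ θ in (0 : ℝ)..(2 * Real.pi), h (circleMap 0 r θ) :=
      intervalIntegral.integral_mono_on hpi
        (((hPc r).sub continuous_const).intervalIntegrable _ _) (hcr.intervalIntegrable _ _)
        fun θ _ => by linarith [(abs_le.1 (hPh θ)).1]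
    rw [intervalIntegral.integral_add ((hPc s).intervalIntegrable _ _)
      (continuous_const.intervalIntegrable _ _), hPs, intervalIntegral.integral_const] at i1
    rw [intervalIntegral.integral_sub ((hPc r).intervalIntegrable _ _)
      (continuous_const.intervalIntegrable _ _), hPr, intervalIntegral.integral_const] at i2
    simp only [sub_zero, smul_eq_mul] at i1 i2
    linarith
  refine le_of_forall_pos_le_add fun ε hε => ?_
  have := key (ε / (4 * Real.pi)) (by positivity)
  have h2 : 2 * Real.pi * (2 * (ε / (4 * Real.pi))) = ε := by
    field_simp; norm_num
  rwa [h2] at this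

end IsPosPart

/-! ### Circles on which most of the mass lies in the given components -/

/-- Choose `s` such that the integral of `|Re f|` over the circle of radius `s` is within `ε / 2` of
the supremum over all circles. As `r → 1` the sets `A r` and `B r` exhaust the non-nodal part of
that circle. From radius `s` to `r` the integrals over `A r` and `B r` do not decrease, while the
total stays below the supremum, so little mass at radius `r` lies elsewhere. -/
theorem exists_small_remainder {f : ℂ → ℂ} (hf : DifferentiableOn ℂ f (Metric.ball 0 1))
    {A B : ℝ → Set ℂ} (hA : ∀ r, IsPosPart f r (A r)) (hB : ∀ r, IsPosPart (fun z => -f z) r (B r))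
    (hAe : ∀ z ∈ Metric.ball (0 : ℂ) 1, 0 < (f z).re → ∀ᶠ r in 𝓝[<] (1 : ℝ), z ∈ A r)
    (hBe : ∀ z ∈ Metric.ball (0 : ℂ) 1, (f z).re < 0 → ∀ᶠ r in 𝓝[<] (1 : ℝ), z ∈ B r)
    {M : ℝ} (hM : ∀ r ∈ Ioo (0 : ℝ) 1,
      ∫ θ in (0 : ℝ)..(2 * Real.pi), |(f (circleMap 0 r θ)).re| ≤ M)
    {ε ρ : ℝ} (hε : 0 < ε) (hρ : ρ < 1) :
    ∃ r, ρ < r ∧ 0 < r ∧ r < 1 ∧ (∫ θ in (0 : ℝ)..(2 * Real.pi), |(f (circleMap 0 r θ)).re|) ≤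
      (∫ θ in (0 : ℝ)..(2 * Real.pi), ((A r).indicator (fun z => (f z).re) (circleMap 0 r θ) +
        (B r).indicator (fun z => (-f z).re) (circleMap 0 r θ))) + ε := by
  have hfn : DifferentiableOn ℂ (fun z => -f z) (Metric.ball 0 1) := hf.neg
  have hfc : ∀ r < 1, ContinuousOn f (Metric.closedBall 0 r) := fun r hr =>
    hf.continuousOn.mono (Metric.closedBall_subset_ball hr)
  have hfnc : ∀ r < 1, ContinuousOn (fun z => -f z) (Metric.closedBall 0 r) := fun r hr =>
    hfn.continuousOn.mono (Metric.closedBall_subset_ball hr)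
  set I : ℝ → ℝ := fun s => ∫ θ in (0 : ℝ)..(2 * Real.pi), |(f (circleMap 0 s θ)).re| with hI
  have hbdd : BddAbove (I '' Ioo 0 1) := ⟨M, by rintro _ ⟨r, hr, rfl⟩; exact hM r hr⟩
  have hne : (I '' Ioo 0 1).Nonempty := ⟨_, 1 / 2, by norm_num, rfl⟩
  obtain ⟨_, ⟨s, hs, rfl⟩, hsS⟩ := exists_lt_of_lt_csSup hne
    (show sSup (I '' Ioo 0 1) - ε / 2 < sSup (I '' Ioo 0 1) by linarith)
  have hcA : ∀ r < 1, ∀ t, |t| ≤ r →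
      Continuous fun θ => (A r).indicator (fun z => (f z).re) (circleMap 0 t θ) := fun r hr t ht =>
    continuousOn_comp_circleMap ((hA r).continuousOn_indicator (hfc r hr)) ht
  have hcB : ∀ r < 1, ∀ t, |t| ≤ r →
      Continuous fun θ => (B r).indicator (fun z => (-f z).re) (circleMap 0 t θ) := fun r hr t ht =>
    continuousOn_comp_circleMap ((hB r).continuousOn_indicator (hfnc r hr)) ht
  have hcv : Continuous fun θ => |(f (circleMap 0 s θ)).re| :=
    (Complex.continuous_re.comp (continuousOn_comp_circleMap (hfc s hs.2) (abs_of_pos hs.1).le)).abs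
  have hrs : ∀ᶠ r in 𝓝[<] (1 : ℝ), max s ρ < r ∧ r < 1 :=
    Ioo_mem_nhdsLT (max_lt hs.2 hρ)
  have hlim : Tendsto (fun r => ∫ θ in (0 : ℝ)..(2 * Real.pi),
      ((A r).indicator (fun z => (f z).re) (circleMap 0 s θ) +
        (B r).indicator (fun z => (-f z).re) (circleMap 0 s θ))) (𝓝[<] 1) (𝓝 (I s)) := by
    refine intervalIntegral.tendsto_integral_filter_of_dominated_convergence
      (fun θ => |(f (circleMap 0 s θ)).re|) ?_ ?_ (hcv.intervalIntegrable _ _) ?_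
    · filter_upwards [hrs] with r hr
      have hsr : |s| ≤ r := by rw [abs_of_pos hs.1]; exact (le_max_left _ _).trans hr.1.le
      exact ((hcA r hr.2 s hsr).add (hcB r hr.2 s hsr)).aestronglyMeasurable
    · refine Eventually.of_forall fun r => ae_of_all _ fun θ _ => ?_
      rw [Real.norm_eq_abs, abs_of_nonneg
        (add_nonneg ((hA r).indicator_nonneg _) ((hB r).indicator_nonneg _))]
      by_cases h1 : circleMap 0 s θ ∈ A r
      · have h2 : circleMap 0 s θ ∉ B r := fun h2 => by
          have e1 := ((hA r).subset _ h1).2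
          have e2 := ((hB r).subset _ h2).2
          rw [Complex.neg_re] at e2; linarith
        rw [indicator_of_mem h1, indicator_of_notMem h2, add_zero]
        exact le_abs_self _
      · rw [indicator_of_notMem h1, zero_add]
        by_cases h2 : circleMap 0 s θ ∈ B r
        · rw [indicator_of_mem h2, Complex.neg_re]; exact neg_le_abs _
        · rw [indicator_of_notMem h2]; exact abs_nonneg _
    · refine ae_of_all _ fun θ _ => ?_
      have hz : circleMap 0 s θ ∈ Metric.ball (0 : ℂ) 1 := by
        simpa [abs_of_pos hs.1] using hs.2
      refine tendsto_const_nhds.congr' ?_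
      rcases lt_trichotomy (f (circleMap 0 s θ)).re 0 with hlt | heq | hlt
      · filter_upwards [hBe _ hz hlt] with r hr
        have h2 : circleMap 0 s θ ∉ A r := fun h2 => by linarith [((hA r).subset _ h2).2]
        rw [indicator_of_mem hr, indicator_of_notMem h2, zero_add, Complex.neg_re, abs_of_neg hlt]
      · refine Eventually.of_forall fun r => ?_
        have h1 : circleMap 0 s θ ∉ A r := fun h2 => by linarith [((hA r).subset _ h2).2]
        have h2 : circleMap 0 s θ ∉ B r := fun h2 => by
          have := ((hB r).subset _ h2).2
          rw [Complex.neg_re] at this; linarith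
        show |_| = (A r).indicator _ _ + (B r).indicator _ _
        rw [indicator_of_notMem h1, indicator_of_notMem h2, heq]; simp
      · filter_upwards [hAe _ hz hlt] with r hr
        have h2 : circleMap 0 s θ ∉ B r := fun h2 => by
          have := ((hB r).subset _ h2).2
          rw [Complex.neg_re] at this; linarith
        rw [indicator_of_mem hr, indicator_of_notMem h2, add_zero, abs_of_pos hlt]
  obtain ⟨r, hr1, hr⟩ := ((hlim.eventually_const_lt
    (show I s - ε / 2 < I s by linarith)).and hrs).exists
  have hsr : s ≤ r := (le_max_left _ _).trans hr.1.le
  have hr0 : 0 < r := hs.1.trans_le hsr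
  have hrr : |r| ≤ r := (abs_of_pos hr0).le
  have hsr' : |s| ≤ r := by rwa [abs_of_pos hs.1]
  refine ⟨r, (le_max_right _ _).trans_lt hr.1, hr0, hr.2, ?_⟩
  have hIr : I r ≤ sSup (I '' Ioo 0 1) := le_csSup hbdd ⟨r, ⟨hr0, hr.2⟩, rfl⟩
  have h1 := (hA r).integral_circle_le hf hr0 hr.2 hs.1.le hsr
  have h2 := (hB r).integral_circle_le hfn hr0 hr.2 hs.1.le hsr
  rw [intervalIntegral.integral_add ((hcA r hr.2 s hsr').intervalIntegrable _ _)
    ((hcB r hr.2 s hsr').intervalIntegrable _ _)] at hr1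
  rw [intervalIntegral.integral_add ((hcA r hr.2 r hrr).intervalIntegrable _ _)
    ((hcB r hr.2 r hrr).intervalIntegrable _ _)]
  have h3 : I r = ∫ θ in (0 : ℝ)..(2 * Real.pi), |(f (circleMap 0 r θ)).re| := rfl
  rw [← h3]
  linarith

/-! ### Sign patterns on a circle -/

theorem sign_prod_range {s : ℕ → ℝ} {K m : ℕ} (hK : K ≤ m) (h1 : ∀ j < K, 0 ≤ s j)
    (h2 : ∀ j, K ≤ j → j < m → s j ≤ 0) : 0 ≤ (-1) ^ (m + K) * ∏ j ∈ Finset.range m, s j := by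
  induction m, hK using Nat.le_induction with
  | base =>
    rw [← two_mul, pow_mul]
    simpa using Finset.prod_nonneg fun j hj => h1 j (Finset.mem_range.1 hj)
  | succ m hm ih =>
    rw [Finset.prod_range_succ]
    have h3 := ih fun j hj hjm => h2 j hj (by omega)
    have h4 := h2 m hm (Nat.lt_succ_self m)
    have : (-1 : ℝ) ^ (m + 1 + K) * ((∏ j ∈ Finset.range m, s j) * s m) =
        ((-1) ^ (m + K) * ∏ j ∈ Finset.range m, s j) * (-s m) := by
      rw [show m + 1 + K = m + K + 1 by ring, pow_succ]; ring
    rw [this]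
    exact mul_nonneg h3 (by linarith)

/-- If two sets of angles do not alternate too often on the circle, they are separated by the
signs of a trigonometric polynomial. -/
theorem exists_separating_angles {P Q : Set ℝ} (hPQ : Disjoint P Q) {a : ℝ} (ha : a ∈ P) {n : ℕ}
    (hchain : ∀ c : ℕ → ℝ, (∀ i < 2 * n + 2, a ≤ c i ∧ c i < a + 2 * Real.pi ∧
      c i ∈ if Even i then P else Q) → ¬ ∀ i, i + 1 < 2 * n + 2 → c i < c (i + 1)) :
    ∃ x : ℕ → ℝ, ∀ θ ∈ Ico a (a + 2 * Real.pi),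
      (θ ∈ P → 0 ≤ ∏ j ∈ Finset.range (2 * n), Real.sin ((θ - x j) / 2)) ∧
      (θ ∈ Q → ∏ j ∈ Finset.range (2 * n), Real.sin ((θ - x j) / 2) ≤ 0) := by
  classical
  set S : ℕ → Set ℝ := fun i => if Even i then P else Q with hS
  have hSd : ∀ i θ, θ ∈ S i → θ ∉ S (i + 1) := fun i θ h1 h2 => by
    simp only [S] at h1 h2
    by_cases hi : Even i
    · rw [if_pos hi] at h1
      rw [if_neg (by rwa [Nat.even_add_one, not_not])] at h2
      exact disjoint_left.1 hPQ h1 h2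
    · rw [if_neg hi] at h1
      rw [if_pos (by rwa [Nat.even_add_one])] at h2
      exact disjoint_left.1 hPQ h2 h1
  -- `U k` is the set of angles by which an alternating chain of length `k`, starting in `P`, has
  -- been completed; it is an up-set and decreases in `k`.
  let U : ℕ → Set ℝ := fun k => {θ | ∃ c : ℕ → ℝ, (∀ i < k, a ≤ c i ∧ c i ≤ θ ∧ c i ∈ S i) ∧
    ∀ i, i + 1 < k → c i < c (i + 1)}
  have hUup : ∀ k θ θ', θ ≤ θ' → θ ∈ U k → θ' ∈ U k := by
    rintro k θ θ' hle ⟨c, hc1, hc2⟩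
    exact ⟨c, fun i hi => ⟨(hc1 i hi).1, (hc1 i hi).2.1.trans hle, (hc1 i hi).2.2⟩, hc2⟩
  have hUanti : ∀ j k, j ≤ k → U k ⊆ U j := by
    rintro j k hjk θ ⟨c, hc1, hc2⟩
    exact ⟨c, fun i hi => hc1 i (by omega), fun i hi => hc2 i (by omega)⟩
  have hUext : ∀ k θ, a ≤ θ → θ ∈ U k → θ ∈ S k → θ ∈ U (k + 1) := by
    rintro k θ haθ ⟨c, hc1, hc2⟩ hθ
    have hlt : ∀ i, i < k → Function.update c k θ i = c i := fun i hi =>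
      Function.update_of_ne hi.ne _ _
    refine ⟨Function.update c k θ, fun i hi => ?_, fun i hi => ?_⟩
    · rcases (Nat.lt_succ_iff.1 hi).eq_or_lt with rfl | hik
      · rw [Function.update_self]; exact ⟨haθ, le_rfl, hθ⟩
      · rw [hlt i hik]; exact hc1 i hik
    · rcases (Nat.lt_succ_iff.1 hi).eq_or_lt with hik | hik
      · rw [hlt i (by omega), hik, Function.update_self]
        have h1 := hc1 i (by omega)
        refine h1.2.1.lt_of_ne fun he => hSd i (c i) h1.2.2 ?_
        rw [he, hik]; exact hθ
      · rw [hlt i (by omega), hlt _ hik]; exact hc2 i hik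
  have hUempty : ∀ θ < a + 2 * Real.pi, θ ∉ U (2 * n + 2) := by
    rintro θ hθ ⟨c, hc1, hc2⟩
    exact hchain c (fun i hi => ⟨(hc1 i hi).1, (hc1 i hi).2.1.trans_lt hθ, (hc1 i hi).2.2⟩) hc2
  have hU1 : ∀ θ, a ≤ θ → θ ∈ U 1 := fun θ hθ =>
    ⟨fun _ => a, fun i hi => ⟨le_rfl, hθ, by
      have : i = 0 := by omega
      subst this; simpa [S] using ha⟩, fun i hi => by omega⟩
  -- The sign change `x j` is the infimum of the angles completing a chain of length `j + 2`; length
  -- `1` is available from `a` on. Inserting `a + 2π` is the default when there is no such chain.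
  let X : ℕ → Set ℝ := fun j => insert (a + 2 * Real.pi) (Icc a (a + 2 * Real.pi) ∩ U (j + 2))
  have hXb : ∀ j, ∀ y ∈ X j, a ≤ y := by
    rintro j y (rfl | hy)
    · linarith [Real.pi_pos]
    · exact hy.1.1
  have hXbdd : ∀ j, BddBelow (X j) := fun j => ⟨a, hXb j⟩
  have hXne : ∀ j, (X j).Nonempty := fun j => ⟨_, Or.inl rfl⟩
  refine ⟨fun j => sInf (X j), fun θ hθ => ?_⟩
  have hx1 : ∀ j, a ≤ sInf (X j) := fun j => le_csInf (hXne j) (hXb j)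
  have hx2 : ∀ j, sInf (X j) ≤ a + 2 * Real.pi := fun j => csInf_le (hXbdd j) (Or.inl rfl)
  have hpos : ∀ j, θ ∈ U (j + 2) → 0 ≤ Real.sin ((θ - sInf (X j)) / 2) := fun j hj => by
    have h1 : sInf (X j) ≤ θ := csInf_le (hXbdd j) (Or.inr ⟨⟨hθ.1, hθ.2.le⟩, hj⟩)
    apply Real.sin_nonneg_of_nonneg_of_le_pi
    · linarith
    · linarith [hx1 j, hθ.2]
  have hneg : ∀ j, θ ∉ U (j + 2) → Real.sin ((θ - sInf (X j)) / 2) ≤ 0 := fun j hj => by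
    have h1 : θ ≤ sInf (X j) := by
      refine le_csInf (hXne j) ?_
      rintro y (rfl | hy)
      · exact hθ.2.le
      · by_contra hlt
        exact hj (hUup _ _ _ (not_le.1 hlt).le hy.2)
    apply Real.sin_nonpos_of_nonpos_of_neg_pi_le
    · linarith
    · linarith [hx2 j, hθ.1]
  have hex : ∃ k, θ ∉ U k := ⟨_, hUempty θ hθ.2⟩
  obtain ⟨N, hN⟩ : ∃ N, Nat.find hex = N + 1 := by
    refine Nat.exists_eq_succ_of_ne_zero fun h0 => ?_
    have := Nat.find_spec hex
    rw [h0] at this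
    exact this (hUanti 0 1 (by omega) (hU1 θ hθ.1))
  have hN1 : θ ∉ U (N + 1) := hN ▸ Nat.find_spec hex
  have hN2 : θ ∈ U N := by
    have := Nat.find_min hex (m := N) (by omega)
    exact not_not.1 this
  have hNpos : 1 ≤ N := by
    by_contra h0
    have : N = 0 := by omega
    subst this
    exact hN1 (hU1 θ hθ.1)
  have hNle : N ≤ 2 * n + 1 := by
    by_contra h0
    exact hUempty θ hθ.2 (hUanti _ _ (by omega) hN2)
  have hsign := sign_prod_range (s := fun j => Real.sin ((θ - sInf (X j)) / 2)) (K := N - 1)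
    (m := 2 * n) (by omega) (fun j hj => hpos j (hUanti _ _ (by omega) hN2))
    (fun j hj _ => hneg j fun h => hN1 (hUanti _ _ (by omega) h))
  -- `N` is the maximal chain length at `θ`, so exactly `N - 1` factors are known to be `≥ 0` and
  -- the others `≤ 0`. A point in the set due next would lengthen the chain, which ties the parity
  -- of `N` to membership in `P` or `Q`.
  have hNS : θ ∉ S N := fun h => hN1 (hUext N θ hθ.1 hN2 h)
  constructor
  · intro hP
    have hodd : ¬ Even N := fun he => hNS (by simpa [S, he] using hP)
    have he : Even (2 * n + (N - 1)) := by
      rw [Nat.even_add, iff_true_left (even_two_mul n)]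
      obtain ⟨k, hk⟩ := Nat.not_even_iff_odd.1 hodd
      exact ⟨k, by omega⟩
    rwa [he.neg_one_pow, one_mul] at hsign
  · intro hQ
    have heven : Even N := by
      by_contra he
      exact hNS (by simpa [S, he] using hQ)
    have ho : Odd (2 * n + (N - 1)) := by
      obtain ⟨k, hk⟩ := heven
      exact ⟨n + k - 1, by omega⟩
    rw [ho.neg_one_pow, neg_one_mul] at hsign
    linarith

/-! ### Moments against a trigonometric product -/

theorem ofReal_sin_half_sub (θ x : ℝ) :
    (Real.sin ((θ - x) / 2) : ℂ) = (Complex.I / 2) * Complex.exp ((x / 2 : ℝ) * Complex.I) *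
      Complex.exp (-((θ / 2 : ℝ) * Complex.I)) *
      (1 - Complex.exp (-(x * Complex.I)) * Complex.exp (θ * Complex.I)) := by
  have h2 : ∀ y : ℝ, Complex.exp (y * Complex.I) = Complex.exp ((y / 2 : ℝ) * Complex.I) ^ 2 :=
    fun y => by rw [← Complex.exp_nat_mul]; congr 1; push_cast; ring
  have h3 : Complex.exp (-((θ - x) / 2 : ℝ) * Complex.I) =
      Complex.exp ((x / 2 : ℝ) * Complex.I) * (Complex.exp ((θ / 2 : ℝ) * Complex.I))⁻¹ := by
    rw [← Complex.exp_neg, ← Complex.exp_add]; congr 1; push_cast; ring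
  have h4 : Complex.exp (((θ - x) / 2 : ℝ) * Complex.I) =
      (Complex.exp ((x / 2 : ℝ) * Complex.I))⁻¹ * Complex.exp ((θ / 2 : ℝ) * Complex.I) := by
    rw [← Complex.exp_neg, ← Complex.exp_add]; congr 1; push_cast; ring
  rw [Complex.ofReal_sin, Complex.sin, h3, h4, Complex.exp_neg, Complex.exp_neg, h2 θ, h2 x]
  have e1 := Complex.exp_ne_zero ((x / 2 : ℝ) * Complex.I)
  have e2 := Complex.exp_ne_zero ((θ / 2 : ℝ) * Complex.I)
  field_simp

/-- The product of half-angle sines is a trigonometric polynomial. -/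
theorem ofReal_prod_sin (x : ℕ → ℝ) (n : ℕ) {r : ℝ} (hr : 0 < r) (θ : ℝ) :
    ((∏ j ∈ Finset.range (2 * n), Real.sin ((θ - x j) / 2) : ℝ) : ℂ) *
      (circleMap 0 r θ) ^ n =
    ((-1 / 4) ^ n * Complex.exp ((∑ j ∈ Finset.range (2 * n), x j / 2 : ℝ) * Complex.I)) *
      ((r : ℂ) ^ n)⁻¹ *
      ∏ j ∈ Finset.range (2 * n), (r - Complex.exp (-(x j * Complex.I)) * circleMap 0 r θ) := by
  have hrC : (r : ℂ) ≠ 0 := by exact_mod_cast hr.ne'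
  have h1 : ∏ j ∈ Finset.range (2 * n), (r - Complex.exp (-(x j * Complex.I)) * circleMap 0 r θ) =
      (r : ℂ) ^ (2 * n) * ∏ j ∈ Finset.range (2 * n),
        (1 - Complex.exp (-(x j * Complex.I)) * Complex.exp (θ * Complex.I)) := by
    have h0 : (r : ℂ) ^ (2 * n) = ∏ j ∈ Finset.range (2 * n), (r : ℂ) := by simp
    rw [h0, ← Finset.prod_mul_distrib]
    refine Finset.prod_congr rfl fun j _ => ?_
    rw [circleMap_zero]; ring
  rw [h1, Complex.ofReal_prod, Finset.prod_congr rfl fun j _ => ofReal_sin_half_sub θ (x j),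
    Finset.prod_mul_distrib, Finset.prod_mul_distrib, Finset.prod_mul_distrib,
    ← Complex.exp_sum, Finset.prod_const, Finset.prod_const, Finset.card_range, circleMap_zero,
    Complex.ofReal_sum, Finset.sum_mul, mul_pow]
  have h2 : (Complex.I / 2) ^ (2 * n) = (-1 / 4) ^ n := by
    rw [pow_mul, div_pow, Complex.I_sq]; norm_num
  have h3 : Complex.exp (-((θ / 2 : ℝ) * Complex.I)) ^ (2 * n) * Complex.exp (θ * Complex.I) ^ n =
      1 := by
    rw [← Complex.exp_nat_mul, ← Complex.exp_nat_mul, ← Complex.exp_add, ← Complex.exp_zero]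
    congr 1; push_cast; ring
  rw [h2]
  generalize ∏ j ∈ Finset.range (2 * n),
    (1 - Complex.exp (-(x j * Complex.I)) * Complex.exp (θ * Complex.I)) = Q
  generalize Complex.exp (∑ i ∈ Finset.range (2 * n), ((x i / 2 : ℝ) : ℂ) * Complex.I) = E
  generalize Complex.exp (-((θ / 2 : ℝ) * Complex.I)) ^ (2 * n) = a at *
  generalize Complex.exp (θ * Complex.I) ^ n = b at *
  have h4 : ((r : ℂ) ^ n)⁻¹ * r ^ (2 * n) = r ^ n := by
    rw [two_mul, pow_add]; field_simp
  linear_combination ((-1 / 4) ^ n * E * Q * r ^ n) * h3 - ((-1 / 4) ^ n * E * Q) * h4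

theorem hasDerivAt_prod_sub_mul (b : ℕ → ℂ) {r : ℂ} (hr : r ≠ 0) (m : ℕ) :
    HasDerivAt (fun z => ∏ j ∈ Finset.range m, (r - b j * z))
      (-(r ^ m * r⁻¹ * ∑ j ∈ Finset.range m, b j)) 0 := by
  induction m with
  | zero => simpa using hasDerivAt_const (0 : ℂ) (1 : ℂ)
  | succ m ih =>
    have h1 : HasDerivAt (fun z : ℂ => r - b m * z) (-(b m)) 0 := by
      simpa using ((hasDerivAt_id (0 : ℂ)).const_mul (b m)).const_sub r
    have h2 := ih.mul h1
    simp only [Finset.prod_range_succ, Finset.sum_range_succ]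
    refine h2.congr_deriv ?_
    simp only [mul_zero, sub_zero, Finset.prod_const, Finset.card_range]
    rw [pow_succ]
    field_simp
    ring

theorem integral_exp_neg_mul_I :
    ∫ θ in (0 : ℝ)..(2 * Real.pi), Complex.exp (-(θ * Complex.I)) = 0 := by
  have h1 := integral_exp_mul_complex (a := 0) (b := 2 * Real.pi) (c := -Complex.I) (by simp)
  have h2 : ∀ θ : ℝ, -(θ * Complex.I) = -Complex.I * θ := fun θ => by ring
  simp only [h2]
  rw [h1]
  have : Complex.exp (-Complex.I * ((2 * Real.pi : ℝ) : ℂ)) = 1 := by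
    rw [show -Complex.I * ((2 * Real.pi : ℝ) : ℂ) = -(2 * Real.pi * Complex.I) by push_cast; ring,
      Complex.exp_neg, Complex.exp_two_pi_mul_I, inv_one]
  rw [this]; simp

theorem integral_mul_exp_neg {K : ℂ → ℂ} (hK : DifferentiableOn ℂ K (Metric.ball 0 1)) {r : ℝ}
    (hr : 0 < r) (hr1 : r < 1) :
    ∫ θ in (0 : ℝ)..(2 * Real.pi), K (circleMap 0 r θ) * Complex.exp (-(θ * Complex.I)) =
      2 * Real.pi * (r * deriv K 0) := by
  have hD : DifferentiableOn ℂ (dslope K 0) (Metric.ball 0 1) :=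
    (Complex.differentiableOn_dslope (Metric.isOpen_ball.mem_nhds (by simp))).2 hK
  have hra : |r| < 1 := by rwa [abs_of_pos hr]
  have h1 : ∀ θ : ℝ, K (circleMap 0 r θ) * Complex.exp (-(θ * Complex.I)) =
      K 0 * Complex.exp (-(θ * Complex.I)) + r * dslope K 0 (circleMap 0 r θ) := fun θ => by
    have h2 := sub_smul_dslope K 0 (circleMap 0 r θ)
    rw [sub_zero, smul_eq_mul, circleMap_zero] at h2
    have h3 : Complex.exp (θ * Complex.I) * Complex.exp (-(θ * Complex.I)) = 1 := by
      rw [← Complex.exp_add, add_neg_cancel, Complex.exp_zero]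
    rw [circleMap_zero]
    linear_combination (-Complex.exp (-(θ * Complex.I))) * h2 +
      (r * dslope K 0 (r * Complex.exp (θ * Complex.I))) * h3
  simp only [h1]
  have hc : Continuous fun θ => dslope K 0 (circleMap 0 r θ) :=
    continuousOn_comp_circleMap (hD.continuousOn.mono (Metric.closedBall_subset_ball hra)) le_rfl
  have hc1 : Continuous fun θ => r * dslope K 0 (circleMap 0 r θ) := continuous_const.mul hc
  have hc2 : Continuous fun θ : ℝ => K 0 * Complex.exp (-(θ * Complex.I)) := by fun_prop
  rw [intervalIntegral.integral_add (hc2.intervalIntegrable _ _)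
    (hc1.intervalIntegrable _ _), intervalIntegral.integral_const_mul,
    intervalIntegral.integral_const_mul, integral_exp_neg_mul_I, integral_circleMap_eq hD hra,
    dslope_same]
  ring

/-- The two leading moments of `Re (z ^ n G z)` against a product of half-angle sines. -/
theorem moments_prod_sin {G : ℂ → ℂ} (hG : DifferentiableOn ℂ G (Metric.ball 0 1)) {r : ℝ}
    (hr : 0 < r) (hr1 : r < 1) (x : ℕ → ℝ) (n : ℕ) {c d : ℂ} (hc : G 0 = c) (hd : deriv G 0 = d) :
    |∫ θ in (0 : ℝ)..(2 * Real.pi), (circleMap 0 r θ ^ n * G (circleMap 0 r θ)).re *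
        ∏ j ∈ Finset.range (2 * n), Real.sin ((θ - x j) / 2)| =
      2 * Real.pi * (r / 4) ^ n *
        |(Complex.exp ((∑ j ∈ Finset.range (2 * n), x j / 2 : ℝ) * Complex.I) * c).re| ∧
    ‖∫ θ in (0 : ℝ)..(2 * Real.pi), (((circleMap 0 r θ ^ n * G (circleMap 0 r θ)).re *
        ∏ j ∈ Finset.range (2 * n), Real.sin ((θ - x j) / 2) : ℝ) : ℂ) *
          Complex.exp (-(θ * Complex.I))‖ =
      Real.pi * (r / 4) ^ n *
        ‖r * d - c * ∑ j ∈ Finset.range (2 * n), Complex.exp (-(x j * Complex.I))‖ := by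
  have hrC : (r : ℂ) ≠ 0 := by exact_mod_cast hr.ne'
  have hra : |r| < 1 := by rwa [abs_of_pos hr]
  set E : ℂ := Complex.exp ((∑ j ∈ Finset.range (2 * n), x j / 2 : ℝ) * Complex.I) with hE
  have hE1 : ‖E‖ = 1 := Complex.norm_exp_ofReal_mul_I _
  set C : ℂ := (-1 / 4) ^ n * E * ((r : ℂ) ^ n)⁻¹ with hC
  set Q : ℂ → ℂ := fun z => ∏ j ∈ Finset.range (2 * n), (r - Complex.exp (-(x j * Complex.I)) * z)
    with hQ
  -- On the circle `T z ^ n = C Q`, so `K` extends `z ^ n G T` holomorphically to the disc and `Re f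
  -- * T = Re K`. The moments are read off from `K 0` and `K' 0`.
  set K : ℂ → ℂ := fun z => C * (G z * Q z) with hK
  have hQd : Differentiable ℂ Q := by
    apply Differentiable.fun_finsetProd
    intro j _
    fun_prop
  have hKd : DifferentiableOn ℂ K (Metric.ball 0 1) := (hG.mul hQd.differentiableOn).const_mul C
  have hQ0 : Q 0 = (r : ℂ) ^ (2 * n) := by simp [Q]
  have hCr : C * (r : ℂ) ^ (2 * n) = (-1 / 4) ^ n * E * r ^ n := by
    rw [hC, two_mul, pow_add]; field_simp
  have hK0 : K 0 = (-1 / 4) ^ n * E * r ^ n * c := by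
    rw [← hCr]; simp only [K]; rw [hQ0, hc]; ring
  have hK' : deriv K 0 = (-1 / 4) ^ n * E * r ^ n *
      (d - c * (r : ℂ)⁻¹ * ∑ j ∈ Finset.range (2 * n), Complex.exp (-(x j * Complex.I))) := by
    have h1 : HasDerivAt G d 0 := hd ▸
      (hG.differentiableAt (Metric.isOpen_ball.mem_nhds (by simp))).hasDerivAt
    have h2 := (h1.mul (hasDerivAt_prod_sub_mul
      (fun j => Complex.exp (-(x j * Complex.I))) hrC (2 * n))).const_mul C
    have h3 : deriv K 0 = _ := h2.deriv
    rw [h3, ← hCr, hc]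
    have : (∏ j ∈ Finset.range (2 * n), (r - Complex.exp (-(x j * Complex.I)) * 0)) =
      (r : ℂ) ^ (2 * n) := hQ0
    rw [this]; ring
  set T : ℝ → ℝ := fun θ => ∏ j ∈ Finset.range (2 * n), Real.sin ((θ - x j) / 2) with hT
  have hKT : ∀ θ : ℝ, (circleMap 0 r θ ^ n * G (circleMap 0 r θ)) * (T θ : ℂ) =
      K (circleMap 0 r θ) := fun θ => by
    have := ofReal_prod_sin x n hr θ
    simp only [K, C, Q, T]
    linear_combination G (circleMap 0 r θ) * this
  have hre : ∀ θ : ℝ, (circleMap 0 r θ ^ n * G (circleMap 0 r θ)).re * T θ =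
      (K (circleMap 0 r θ)).re := fun θ => by
    rw [← hKT, Complex.re_mul_ofReal]
  have hnorm : ‖((-1 / 4 : ℂ)) ^ n * E * (r : ℂ) ^ n‖ = (r / 4) ^ n := by
    rw [norm_mul, norm_mul, hE1, mul_one, norm_pow, norm_pow, ← mul_pow, Complex.norm_real,
      Real.norm_of_nonneg hr.le]
    congr 1
    simp; ring
  constructor
  · have h1 : ∀ θ : ℝ, (circleMap 0 r θ ^ n * G (circleMap 0 r θ)).re *
      ∏ j ∈ Finset.range (2 * n), Real.sin ((θ - x j) / 2) = (K (circleMap 0 r θ)).re := hre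
    simp only [h1]
    rw [integral_re_circleMap_eq hKd hra, hK0]
    have h2 : (-1 / 4 : ℂ) ^ n * E * r ^ n * c = (((-1 / 4) ^ n * r ^ n : ℝ) : ℂ) * (E * c) := by
      push_cast; ring
    rw [h2, Complex.re_ofReal_mul, abs_mul, ← mul_pow, abs_mul _ (E * c).re, abs_pow]
    have h3 : |(-1 / 4 : ℝ) * r| = r / 4 := by
      rw [abs_mul, abs_of_pos hr]; norm_num; ring
    rw [h3, abs_of_pos (by positivity : 0 < 2 * Real.pi)]
    ring
  -- Write `Re K = (K + conj K) / 2`. The conjugate half contributes a multiple of the conjugate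
  -- mean of `z K z`, which is zero.
  · have h1 : ∀ θ : ℝ, (((circleMap 0 r θ ^ n * G (circleMap 0 r θ)).re *
        ∏ j ∈ Finset.range (2 * n), Real.sin ((θ - x j) / 2) : ℝ) : ℂ) *
          Complex.exp (-(θ * Complex.I)) =
        (1 / 2) * (K (circleMap 0 r θ) * Complex.exp (-(θ * Complex.I))) +
        (1 / 2) * (starRingEnd ℂ) ((r : ℂ)⁻¹ * (circleMap 0 r θ * K (circleMap 0 r θ))) := fun θ => by
      have h2 := hre θ
      simp only [T] at h2
      rw [h2, Complex.re_eq_add_conj]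
      have h3 : (starRingEnd ℂ) ((r : ℂ)⁻¹ * (circleMap 0 r θ * K (circleMap 0 r θ))) =
          (starRingEnd ℂ) (K (circleMap 0 r θ)) * Complex.exp (-(θ * Complex.I)) := by
        have h4 : (r : ℂ)⁻¹ * (circleMap 0 r θ * K (circleMap 0 r θ)) =
            K (circleMap 0 r θ) * Complex.exp (θ * Complex.I) := by
          nth_rewrite 1 [circleMap_zero]; field_simp
        rw [h4, map_mul, ← Complex.exp_conj]
        simp
      rw [h3]; ring
    simp only [h1]
    have hKc : Continuous fun θ => K (circleMap 0 r θ) :=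
      continuousOn_comp_circleMap (hKd.continuousOn.mono (Metric.closedBall_subset_ball hra)) le_rfl
    have c1 : Continuous fun θ : ℝ => (1 / 2) * (K (circleMap 0 r θ) *
      Complex.exp (-(θ * Complex.I))) := continuous_const.mul (hKc.mul (by fun_prop))
    have c2 : Continuous fun θ : ℝ => (r : ℂ)⁻¹ * (circleMap 0 r θ * K (circleMap 0 r θ)) :=
      continuous_const.mul ((continuous_circleMap 0 r).mul hKc)
    have c3 : Continuous fun θ : ℝ =>
      (1 / 2) * (starRingEnd ℂ) ((r : ℂ)⁻¹ * (circleMap 0 r θ * K (circleMap 0 r θ))) :=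
      continuous_const.mul (Complex.continuous_conj.comp c2)
    have hzero : ∫ θ in (0 : ℝ)..(2 * Real.pi),
        (starRingEnd ℂ) ((r : ℂ)⁻¹ * (circleMap 0 r θ * K (circleMap 0 r θ))) = 0 := by
      have h2 := Complex.conjCLE.toContinuousLinearMap.intervalIntegral_comp_comm
        (c2.intervalIntegrable 0 (2 * Real.pi)) (μ := volume)
      have h3 : DifferentiableOn ℂ (fun z => (r : ℂ)⁻¹ * (z * K z)) (Metric.ball 0 1) :=
        (differentiableOn_id.mul hKd).const_mul _
      rw [integral_circleMap_eq h3 hra] at h2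
      simpa using h2
    rw [intervalIntegral.integral_add (c1.intervalIntegrable _ _) (c3.intervalIntegrable _ _),
      intervalIntegral.integral_const_mul, intervalIntegral.integral_const_mul, hzero,
      integral_mul_exp_neg hKd hr hr1, hK']
    have h5 : (1 / 2 : ℂ) * (2 * Real.pi * (r * ((-1 / 4) ^ n * E * r ^ n *
      (d - c * (r : ℂ)⁻¹ * ∑ j ∈ Finset.range (2 * n), Complex.exp (-(x j * Complex.I)))))) +
      1 / 2 * 0 = (Real.pi : ℂ) * ((-1 / 4) ^ n * E * r ^ n) *
      (r * d - c * ∑ j ∈ Finset.range (2 * n), Complex.exp (-(x j * Complex.I))) := by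
      generalize ∑ j ∈ Finset.range (2 * n), Complex.exp (-(x j * Complex.I)) = σ
      field_simp
      ring
    rw [h5, norm_mul, norm_mul, hnorm, Complex.norm_real, Real.norm_of_nonneg Real.pi_pos.le]

/-! ### An extremal problem for sums of sines -/

/-- The constant `1.73` is just below `√3 = cot (π/6)`, as `cos_le_tangent` needs. Up to `π/2` the
bound follows from `u < tan u`, beyond it from chord and parabola bounds for sine and cosine. -/
theorem sub_sin_le {u : ℝ} (h0 : 0 ≤ u) (hπ : u ≤ Real.pi) :
    u - Real.sin u ≤ 1.73 * (1 - Real.cos u) := by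
  have hπ1 := Real.pi_gt_d2
  have hπ2 := Real.pi_lt_d2
  have hc := Real.cos_le_one u
  rcases lt_or_ge u (Real.pi / 2) with h | h
  · have hcos : 0 < Real.cos u := Real.cos_pos_of_mem_Ioo ⟨by linarith, h⟩
    have h1 : u * Real.cos u ≤ Real.sin u := by
      rcases h0.eq_or_lt with rfl | h0
      · simp
      · have := Real.lt_tan h0 h
        rw [Real.tan_eq_sin_div_cos, lt_div_iff₀ hcos] at this
        exact this.le
    nlinarith
  · have h1 : 2 / Real.pi * (Real.pi - u) ≤ Real.sin (Real.pi - u) :=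
      Real.mul_le_sin (by linarith) (by linarith)
    rw [Real.sin_pi_sub] at h1
    have h2 : Real.cos u ≤ 1 - 2 / Real.pi ^ 2 * u ^ 2 :=
      Real.cos_le_one_sub_mul_cos_sq (by rw [abs_of_nonneg h0]; exact hπ)
    obtain ⟨q, rfl⟩ : ∃ q, u = Real.pi * q := ⟨u / Real.pi, by field_simp⟩
    have h3 : 2 / Real.pi * (Real.pi - Real.pi * q) = 2 - 2 * q := by field_simp
    have h4 : 2 / Real.pi ^ 2 * (Real.pi * q) ^ 2 = 2 * q ^ 2 := by field_simp
    rw [h3] at h1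
    rw [h4] at h2
    have hq : 0 ≤ q := by
      by_contra hq
      nlinarith
    -- With `u = π q` what remains is `3.46 q² - (π + 2) q + 2 ≥ 0`, a quadratic with minimum near
    -- `0.743` and negative discriminant.
    nlinarith [sq_nonneg (q - 0.743)]

/-- The tangent to the cosine at `a ≤ π/6` stays above it up to `π`, beyond the range of concavity.
With `|z| = a + u` this reads `sin a (u - sin u) ≤ cos a (1 - cos u)`, and `cot a ≥ √3`. -/
theorem cos_le_tangent {a z : ℝ} (ha : 0 ≤ a) (ha' : a ≤ Real.pi / 6) (hz : |z| ≤ Real.pi) :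
    Real.cos z ≤ Real.cos a - Real.sin a * (|z| - a) := by
  rw [← Real.cos_abs z]
  have hz0 := abs_nonneg z
  generalize |z| = y at *
  obtain ⟨u, rfl⟩ : ∃ u, y = a + u := ⟨y - a, by ring⟩
  have hπ := Real.pi_pos
  have hs0 : 0 ≤ Real.sin a := Real.sin_nonneg_of_nonneg_of_le_pi ha (by linarith)
  have hs : Real.sin a ≤ 1 / 2 := by
    rw [← Real.sin_pi_div_six]
    exact Real.sin_le_sin_of_le_of_le_pi_div_two (by linarith) (by linarith) ha'
  have hc : 1.73 * Real.sin a ≤ Real.cos a := by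
    have h1 : Real.cos (Real.pi / 6) ≤ Real.cos a :=
      Real.cos_le_cos_of_nonneg_of_le_pi ha (by linarith) ha'
    rw [Real.cos_pi_div_six] at h1
    have h2 : (1.73 : ℝ) ≤ √3 := Real.le_sqrt_of_sq_le (by norm_num)
    nlinarith
  have hcu := Real.cos_le_one u
  have key : Real.sin a * (u - Real.sin u) ≤ Real.cos a * (1 - Real.cos u) := by
    rcases le_total u 0 with hu | hu
    · have h1 : u ≤ Real.sin u := by
        have := Real.sin_le (x := -u) (by linarith)
        rw [Real.sin_neg] at this; linarith
      nlinarith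
    · have h1 := sub_sin_le hu (by linarith)
      nlinarith
  rw [Real.cos_add]
  nlinarith

theorem exists_int_abs_sub_le (z : ℝ) : ∃ k : ℤ, |z - 2 * Real.pi * k| ≤ Real.pi := by
  refine ⟨round (z / (2 * Real.pi)), ?_⟩
  have h1 := abs_sub_round (z / (2 * Real.pi))
  have hπ := Real.pi_pos
  have h2 : z - 2 * Real.pi * round (z / (2 * Real.pi)) =
      2 * Real.pi * (z / (2 * Real.pi) - round (z / (2 * Real.pi))) := by field_simp
  rw [h2, abs_mul, abs_of_pos (by positivity : 0 < 2 * Real.pi)]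
  nlinarith

/-- Reduction of the angles to `[-π, π]` keeps their sum an odd multiple of `π`, so the sum of
absolute values is at least `π`. Summing the tangent inequality at `π / N` gives the bound; `N ≥ 6`
makes `π / N ≤ π / 6`. -/
theorem sum_cos_le {N : ℕ} (hN : 6 ≤ N) (z : ℕ → ℝ) {m : ℤ}
    (hsum : ∑ j ∈ Finset.range N, z j = (2 * m + 1) * Real.pi) :
    ∑ j ∈ Finset.range N, Real.cos (z j) ≤ N * Real.cos (Real.pi / N) := by
  choose k hk using fun j => exists_int_abs_sub_le (z j)
  have hπ := Real.pi_pos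
  have hN0 : (6 : ℝ) ≤ N := by exact_mod_cast hN
  have ha : 0 ≤ Real.pi / N := by positivity
  have ha' : Real.pi / N ≤ Real.pi / 6 := by gcongr
  have h1 : ∀ j, Real.cos (z j) ≤ Real.cos (Real.pi / N) -
      Real.sin (Real.pi / N) * (|z j - 2 * Real.pi * k j| - Real.pi / N) := fun j => by
    have h2 := cos_le_tangent ha ha' (hk j)
    have h3 : Real.cos (z j - 2 * Real.pi * k j) = Real.cos (z j) := by
      rw [show 2 * Real.pi * (k j : ℝ) = k j * (2 * Real.pi) by ring]
      exact Real.cos_sub_int_mul_two_pi _ _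
    rwa [h3] at h2
  have hs0 : 0 ≤ Real.sin (Real.pi / N) :=
    Real.sin_nonneg_of_nonneg_of_le_pi ha (by linarith)
  have h4 : Real.pi ≤ ∑ j ∈ Finset.range N, |z j - 2 * Real.pi * k j| := by
    refine le_trans ?_ (Finset.abs_sum_le_sum_abs _ _)
    have h5 : ∑ j ∈ Finset.range N, (z j - 2 * Real.pi * k j) =
        ((2 * (m - ∑ j ∈ Finset.range N, k j) + 1 : ℤ) : ℝ) * Real.pi := by
      rw [Finset.sum_sub_distrib, hsum, ← Finset.mul_sum]
      push_cast; ring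
    rw [h5, abs_mul, abs_of_pos hπ]
    have h6 : (1 : ℝ) ≤ |((2 * (m - ∑ j ∈ Finset.range N, k j) + 1 : ℤ) : ℝ)| := by
      rw [← Int.cast_abs]
      exact_mod_cast Int.one_le_abs (by omega)
    nlinarith
  calc ∑ j ∈ Finset.range N, Real.cos (z j) ≤ ∑ j ∈ Finset.range N, (Real.cos (Real.pi / N) -
      Real.sin (Real.pi / N) * (|z j - 2 * Real.pi * k j| - Real.pi / N)) :=
        Finset.sum_le_sum fun j _ => h1 j
    _ = N * Real.cos (Real.pi / N) - Real.sin (Real.pi / N) *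
        (∑ j ∈ Finset.range N, |z j - 2 * Real.pi * k j| - Real.pi) := by
      rw [Finset.sum_sub_distrib, ← Finset.mul_sum, Finset.sum_sub_distrib]
      simp only [Finset.sum_const, Finset.card_range, nsmul_eq_mul]
      field_simp
    _ ≤ _ := by nlinarith

theorem cos_mul_alpha₀_of_even {n : ℕ} (hn : 1 ≤ n) (he : Even n) :
    Real.cos (n * alpha₀ n) = Real.cos (Real.pi / (2 * n + 2 : ℕ)) := by
  have : (n : ℝ) ≠ 0 := by positivity
  rw [alpha₀, if_neg (Nat.not_odd_iff_even.2 he)]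
  congr 1
  push_cast
  field_simp

theorem cos_mul_alpha₀_of_odd {n : ℕ} (ho : Odd n) : Real.cos (n * alpha₀ n) = 1 := by
  rw [alpha₀, if_pos ho, mul_zero, Real.cos_zero]

/-- The angle `w = mπ - ∑ y_j / 2`, counted twice, completes the `y_j` to `2n + 2` angles. Shifted
by `-π/2` they sum to `(2m - n - 1)π`, an odd multiple of `π` exactly when `n` is even; then they
cannot all be `0` modulo `2π`, and `sum_cos_le` applies. Choosing `m` in `{0, 1}` and replacing `y`
by `-y` covers all signs. -/
theorem abs_sum_sin_add_le {n : ℕ} (hn : 1 ≤ n) (y : ℕ → ℝ) :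
    |∑ j ∈ Finset.range (2 * n), Real.sin (y j)| +
      2 * |Real.sin (∑ j ∈ Finset.range (2 * n), y j / 2)| ≤
      2 * (n + 1) * Real.cos (n * alpha₀ n) := by
  rcases Nat.even_or_odd n with he | ho
  swap
  · rw [cos_mul_alpha₀_of_odd ho]
    have h1 : |∑ j ∈ Finset.range (2 * n), Real.sin (y j)| ≤ 2 * n := by
      refine (Finset.abs_sum_le_sum_abs _ _).trans ?_
      refine (Finset.sum_le_sum fun j _ => Real.abs_sin_le_one (y j)).trans ?_
      simp
    linarith [Real.abs_sin_le_one (∑ j ∈ Finset.range (2 * n), y j / 2)]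
  rw [cos_mul_alpha₀_of_even hn he]
  obtain ⟨l, hl⟩ := he
  have key : ∀ (y : ℕ → ℝ) (w : ℝ) (m : ℤ),
      w = m * Real.pi - ∑ j ∈ Finset.range (2 * n), y j / 2 →
      ∑ j ∈ Finset.range (2 * n), Real.sin (y j) + 2 * Real.sin w ≤
        2 * (n + 1) * Real.cos (Real.pi / (2 * n + 2 : ℕ)) := by
    intro y w m hw
    have h1 := sum_cos_le (N := 2 * n + 2) (by omega)
      (fun j => (if j < 2 * n then y j else w) - Real.pi / 2) (m := m - l - 1) (by
        rw [Finset.sum_sub_distrib, Finset.sum_range_succ, Finset.sum_range_succ,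
          Finset.sum_congr rfl (g := y) fun j hj => if_pos (Finset.mem_range.1 hj), if_neg (by omega),
          if_neg (by omega), Finset.sum_const, Finset.card_range, hw, ← Finset.sum_div,
          nsmul_eq_mul]
        have : (n : ℝ) = 2 * l := by rw [hl]; push_cast; ring
        push_cast
        rw [this]; ring)
    simp only [Real.cos_sub_pi_div_two] at h1
    rw [Finset.sum_range_succ, Finset.sum_range_succ,
      Finset.sum_congr rfl (g := fun j => Real.sin (y j)) fun j hj => by
        rw [if_pos (Finset.mem_range.1 hj)], if_neg (by omega), if_neg (by omega)] at h1
    have h2 : (((2 * n + 2 : ℕ)) : ℝ) = 2 * (n + 1) := by push_cast; ring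
    rw [h2] at h1 ⊢
    linarith
  have key2 : ∀ y : ℕ → ℝ, ∑ j ∈ Finset.range (2 * n), Real.sin (y j) +
      2 * |Real.sin (∑ j ∈ Finset.range (2 * n), y j / 2)| ≤
        2 * (n + 1) * Real.cos (Real.pi / (2 * n + 2 : ℕ)) := by
    intro y
    rcases abs_cases (Real.sin (∑ j ∈ Finset.range (2 * n), y j / 2)) with ⟨h, -⟩ | ⟨h, -⟩
    · rw [h, ← Real.sin_pi_sub]
      exact key y _ 1 (by push_cast; ring)
    · rw [h, ← Real.sin_neg]
      exact key y _ 0 (by push_cast; ring)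
  rcases abs_cases (∑ j ∈ Finset.range (2 * n), Real.sin (y j)) with ⟨h, -⟩ | ⟨h, -⟩
  · rw [h]; exact key2 y
  · rw [h]
    have h1 := key2 fun j => -y j
    simp only [Real.sin_neg, neg_div, Finset.sum_neg_distrib, abs_neg] at h1
    exact h1

/-! ### Signs of `Re f` on circles and the trigonometric product -/

theorem JoinedIn.eventually_norm_le {S : Set ℂ} (hS : S ⊆ Metric.ball 0 1) {z w : ℂ}
    (h : JoinedIn S z w) : ∀ᶠ r in 𝓝[<] (1 : ℝ), JoinedIn (S ∩ {z | ‖z‖ ≤ r}) z w := by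
  obtain ⟨γ, hγ⟩ := h
  obtain ⟨t, -, ht⟩ := isCompact_univ.exists_isMaxOn univ_nonempty
    (continuous_norm.comp γ.continuous).continuousOn
  have h1 : ‖γ t‖ < 1 := by simpa using hS (hγ t)
  filter_upwards [Ioo_mem_nhdsLT h1] with r hr
  exact ⟨γ, fun s => ⟨hγ s, (show ‖γ s‖ ≤ ‖γ t‖ from ht (mem_univ s)).trans hr.1.le⟩⟩

/-- The part of `{Re f > 0}` in the closed disc of radius `r` that can be joined to `Ξ`. -/
def joinedPos (f : ℂ → ℂ) (Ξ : Finset ℂ) (r : ℝ) : Set ℂ :=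
  {z | ∃ ξ ∈ Ξ, JoinedIn {w | ‖w‖ ≤ r ∧ 0 < (f w).re} z ξ}

/-- The part of `{Re f < 0}` in the closed disc of radius `r` that can be joined to `0`. -/
def joinedNeg (f : ℂ → ℂ) (r : ℝ) : Set ℂ :=
  {z | (f z).re < 0 ∧ JoinedIn {w | ‖w‖ ≤ r ∧ ((f w).re < 0 ∨ w = 0)} z 0}

theorem isPosPart_joinedPos (f : ℂ → ℂ) (Ξ : Finset ℂ) (r : ℝ) :
    IsPosPart f r (joinedPos f Ξ r) where
  subset := fun _ ⟨_, _, hJ⟩ => hJ.source_mem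
  joined := fun _ ⟨ξ, hξ, hJ⟩ _ hw => ⟨ξ, hξ, hw.symm.trans hJ⟩

theorem isPosPart_joinedNeg (f : ℂ → ℂ) (r : ℝ) :
    IsPosPart (fun z => -f z) r (joinedNeg f r) where
  subset := fun z ⟨hz, hJ⟩ => ⟨hJ.source_mem.1, by simpa using hz⟩
  joined := fun z ⟨hz, hJ⟩ w hw => by
    have h1 : JoinedIn {w | ‖w‖ ≤ r ∧ ((f w).re < 0 ∨ w = 0)} w z :=
      hw.symm.mono fun y hy => ⟨hy.1, Or.inl (by simpa using hy.2)⟩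
    exact ⟨by simpa using hw.target_mem.2, h1.trans hJ⟩

/-- On a circle, the two sets do not alternate too often. -/
theorem not_alternating {f : ℂ → ℂ} (hf0 : f 0 = 0) {Ξ : Finset ℂ} {n : ℕ} (hΞ : Ξ.card ≤ n)
    {r : ℝ} (hr : 0 < r) {a : ℝ} (c : ℕ → ℝ)
    (hc : ∀ i < 2 * n + 2, a ≤ c i ∧ c i < a + 2 * Real.pi ∧
      c i ∈ if Even i then {θ | circleMap 0 r θ ∈ joinedPos f Ξ r}
        else {θ | circleMap 0 r θ ∈ joinedNeg f r})
    (hmono : ∀ i, i + 1 < 2 * n + 2 → c i < c (i + 1)) : False := by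
  have hlt : ∀ i j, i < j → j < 2 * n + 2 → c i < c j := by
    intro i j hij
    induction j, hij using Nat.le_induction with
    | base => exact hmono i
    | succ j _ ih => exact fun hj => (ih (by omega)).trans (hmono j hj)
  have heven : ∀ i < n + 1, circleMap 0 r (c (2 * i)) ∈ joinedPos f Ξ r := fun i hi => by
    have := (hc (2 * i) (by omega)).2.2
    rwa [if_pos (even_two_mul i)] at this
  have hodd : ∀ i < n + 1, circleMap 0 r (c (2 * i + 1)) ∈ joinedNeg f r := fun i hi => by
    have := (hc (2 * i + 1) (by omega)).2.2
    rwa [if_neg (by simp)] at this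
  choose! ξ hξΞ hξJ using heven
  -- Among `n + 1` positive points two are joined to the same base point of `Ξ`, while all negative
  -- points are joined through the origin. Two such paths with alternating ends would have to meet.
  obtain ⟨i, hi, j, hj, hij, he⟩ := Finset.exists_ne_map_eq_of_card_lt_of_maps_to
    (s := Finset.range (n + 1)) (t := Ξ) (f := ξ) (by simp; omega)
    (fun i hi => hξΞ i (Finset.mem_range.1 hi))
  have main : ∀ i j, i < j → j < n + 1 → ξ i = ξ j → False := by
    intro i j hij hj he
    have hJA : JoinedIn {w | ‖w‖ ≤ r ∧ 0 < (f w).re} (circleMap 0 r (c (2 * i)))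
        (circleMap 0 r (c (2 * j))) := (hξJ i (by omega)).trans (he ▸ (hξJ j hj).symm)
    have hJB := (hodd i (by omega)).2.trans (hodd j hj).2.symm
    refine not_disjoint_of_alternating hr (fun w hw => by simpa using hw.1)
      (fun w hw => by simpa using hw.1) (hlt (2 * i) (2 * i + 1) (by omega) (by omega))
      (hlt (2 * i + 1) (2 * j) (by omega) (by omega))
      (hlt (2 * j) (2 * j + 1) (by omega) (by omega))
      ((hc (2 * j + 1) (by omega)).2.1.trans_le (by linarith [(hc (2 * i) (by omega)).1]))
      hJA hJB ?_
    rw [disjoint_left]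
    rintro w ⟨-, hw⟩ ⟨-, hw' | rfl⟩
    · linarith
    · rw [hf0] at hw; simp at hw
  rcases lt_or_gt_of_ne hij with h | h
  · exact main i j h (Finset.mem_range.1 hj) he
  · exact main j i h (Finset.mem_range.1 hi) he.symm

theorem abs_prod_sin_le_one (x : ℕ → ℝ) (m : ℕ) (θ : ℝ) :
    |∏ j ∈ Finset.range m, Real.sin ((θ - x j) / 2)| ≤ 1 := by
  rw [Finset.abs_prod]
  exact Finset.prod_le_one (fun _ _ => abs_nonneg _) fun _ _ => Real.abs_sin_le_one _

theorem periodic_prod_sin (x : ℕ → ℝ) (n : ℕ) :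
    Function.Periodic (fun θ => ∏ j ∈ Finset.range (2 * n), Real.sin ((θ - x j) / 2))
      (2 * Real.pi) := by
  intro θ
  have h1 : ∀ j, Real.sin ((θ + 2 * Real.pi - x j) / 2) = -Real.sin ((θ - x j) / 2) := fun j => by
    rw [← Real.sin_add_pi]; congr 1; ring
  simp only [h1, Finset.prod_neg]
  simp

/-- If most of the mass of `v` on a circle lies where the sign of `v` is controlled, then `v` is
nearly of one sign against a product of half-angle sines. -/
theorem exists_nearly_signed {f : ℂ → ℂ} (hf0 : f 0 = 0) {Ξ : Finset ℂ} {n : ℕ} (hΞ : Ξ.card ≤ n)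
    {r : ℝ} (hr : 0 < r) (hfc : ContinuousOn f (Metric.closedBall 0 r)) {ε : ℝ}
    (hε : (∫ θ in (0 : ℝ)..(2 * Real.pi), |(f (circleMap 0 r θ)).re|) ≤
      (∫ θ in (0 : ℝ)..(2 * Real.pi),
        ((joinedPos f Ξ r).indicator (fun z => (f z).re) (circleMap 0 r θ) +
          (joinedNeg f r).indicator (fun z => (-f z).re) (circleMap 0 r θ))) + ε) :
    ∃ x : ℕ → ℝ, (∫ θ in (0 : ℝ)..(2 * Real.pi), |(f (circleMap 0 r θ)).re *
        ∏ j ∈ Finset.range (2 * n), Real.sin ((θ - x j) / 2)|) ≤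
      |∫ θ in (0 : ℝ)..(2 * Real.pi), (f (circleMap 0 r θ)).re *
        ∏ j ∈ Finset.range (2 * n), Real.sin ((θ - x j) / 2)| + 2 * ε := by
  have hA := isPosPart_joinedPos f Ξ r
  have hB := isPosPart_joinedNeg f r
  have hfnc : ContinuousOn (fun z => -f z) (Metric.closedBall 0 r) := hfc.neg
  set A := joinedPos f Ξ r
  set B := joinedNeg f r
  set v : ℝ → ℝ := fun θ => (f (circleMap 0 r θ)).re with hv
  set H : ℝ → ℝ := fun θ => A.indicator (fun z => (f z).re) (circleMap 0 r θ) +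
    B.indicator (fun z => (-f z).re) (circleMap 0 r θ) with hH
  have hrr : |r| ≤ r := (abs_of_pos hr).le
  have hvc : Continuous v := Complex.continuous_re.comp (continuousOn_comp_circleMap hfc hrr)
  have hHc : Continuous H := (continuousOn_comp_circleMap (hA.continuousOn_indicator hfc) hrr).add
    (continuousOn_comp_circleMap (hB.continuousOn_indicator hfnc) hrr)
  have hvp : Function.Periodic v (2 * Real.pi) :=
    (periodic_circleMap 0 r).comp fun z => (f z).re
  have hHp : Function.Periodic H (2 * Real.pi) :=
    (periodic_circleMap 0 r).comp fun z => A.indicator (fun z => (f z).re) z +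
      B.indicator (fun z => (-f z).re) z
  have hAB : ∀ z, z ∈ A → z ∉ B := fun z h1 h2 => by
    have e1 := (hA.subset z h1).2
    have e2 := (hB.subset z h2).2
    rw [Complex.neg_re] at e2; linarith
  obtain ⟨x, a, σ, hσ, hx⟩ : ∃ (x : ℕ → ℝ) (a σ : ℝ), |σ| = 1 ∧
      ∀ θ ∈ Ico a (a + 2 * Real.pi),
        (circleMap 0 r θ ∈ A → 0 ≤ σ * ∏ j ∈ Finset.range (2 * n), Real.sin ((θ - x j) / 2)) ∧
        (circleMap 0 r θ ∈ B → σ * ∏ j ∈ Finset.range (2 * n), Real.sin ((θ - x j) / 2) ≤ 0) := by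
    by_cases hP : ∃ a, circleMap 0 r a ∈ A
    · obtain ⟨a, ha⟩ := hP
      obtain ⟨x, hx⟩ := exists_separating_angles (P := {θ | circleMap 0 r θ ∈ A})
        (Q := {θ | circleMap 0 r θ ∈ B}) (disjoint_left.2 fun θ h1 h2 => hAB _ h1 h2) ha (n := n)
        fun c hc hm => not_alternating hf0 hΞ hr c hc hm
      exact ⟨x, a, 1, abs_one, fun θ hθ => by rw [one_mul]; exact hx θ hθ⟩
    -- Without positive points on the circle, minus an even power of one sine has the required sign.
    · refine ⟨fun _ => 0, 0, -1, by simp, fun θ _ => ⟨fun h => absurd ⟨θ, h⟩ hP, fun _ => ?_⟩⟩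
      rw [Finset.prod_const, Finset.card_range, pow_mul]
      have : 0 ≤ (Real.sin ((θ - 0) / 2) ^ 2) ^ n := by positivity
      linarith
  set T : ℝ → ℝ := fun θ => ∏ j ∈ Finset.range (2 * n), Real.sin ((θ - x j) / 2) with hT
  have hTc : Continuous T := by
    refine continuous_finsetProd _ fun j _ => ?_
    fun_prop
  have hTp : Function.Periodic T (2 * Real.pi) := periodic_prod_sin x n
  have hT1 : ∀ θ, |T θ| ≤ 1 := fun θ => abs_prod_sin_le_one x _ θ
  refine ⟨x, ?_⟩
  -- On `A ∪ B` the product `v T` has sign `σ` and `H = |v|`; elsewhere `H = 0` and the defect is at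
  -- most `2 |v|`, as `|T| ≤ 1`.
  have hpt : ∀ θ ∈ Ioo a (a + 2 * Real.pi),
      |v θ * T θ| ≤ σ * (v θ * T θ) + 2 * (|v θ| - H θ) := by
    intro θ hθ
    have hxθ := hx θ ⟨hθ.1.le, hθ.2⟩
    have habs : |v θ * T θ| = |v θ * (σ * T θ)| := by
      rw [abs_mul, abs_mul, abs_mul, hσ, one_mul]
    by_cases h1 : circleMap 0 r θ ∈ A
    · have e1 : 0 < v θ := (hA.subset _ h1).2
      have e2 : H θ = v θ := by
        simp only [H]; rw [indicator_of_mem h1, indicator_of_notMem (hAB _ h1), add_zero]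
      rw [habs, abs_of_nonneg (mul_nonneg e1.le (hxθ.1 h1)), e2, abs_of_pos e1]
      linarith
    by_cases h2 : circleMap 0 r θ ∈ B
    · have e1 : v θ < 0 := by
        have := (hB.subset _ h2).2
        rwa [Complex.neg_re, neg_pos] at this
      have e2 : H θ = -v θ := by
        simp only [H]; rw [indicator_of_notMem h1, indicator_of_mem h2, zero_add, Complex.neg_re]
      rw [habs, abs_of_nonneg (mul_nonneg_of_nonpos_of_nonpos e1.le (hxθ.2 h2)), e2, abs_of_neg e1]
      linarith
    · have e2 : H θ = 0 := by
        simp only [H]; rw [indicator_of_notMem h1, indicator_of_notMem h2, zero_add]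
      have e3 : |v θ * T θ| ≤ |v θ| := by
        rw [abs_mul]; exact mul_le_of_le_one_right (abs_nonneg _) (hT1 θ)
      have e4 : -|v θ * T θ| ≤ σ * (v θ * T θ) := by
        have := neg_abs_le (σ * (v θ * T θ))
        rwa [abs_mul σ, hσ, one_mul] at this
      rw [e2]; linarith
  have hvT : Continuous fun θ => v θ * T θ := hvc.mul hTc
  have c1 : Continuous fun θ => σ * (v θ * T θ) := continuous_const.mul hvT
  have c2 : Continuous fun θ => 2 * (|v θ| - H θ) := continuous_const.mul (hvc.abs.sub hHc)
  have i1 := intervalIntegral.integral_mono_on_of_le_Ioo (μ := volume)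
    (show a ≤ a + 2 * Real.pi by linarith [Real.pi_pos])
    (hvT.abs.intervalIntegrable _ _) ((c1.add c2).intervalIntegrable _ _) hpt
  have hp1 : Function.Periodic (fun θ => |v θ * T θ|) (2 * Real.pi) := fun θ => by
    simp only [hvp θ, hTp θ]
  have hp2 : Function.Periodic (fun θ => σ * (v θ * T θ) + 2 * (|v θ| - H θ)) (2 * Real.pi) :=
    fun θ => by simp only [hvp θ, hTp θ, hHp θ]
  have i2 : (∫ θ in (0 : ℝ)..(2 * Real.pi), |v θ * T θ|) ≤
      ∫ θ in (0 : ℝ)..(2 * Real.pi), (σ * (v θ * T θ) + 2 * (|v θ| - H θ)) := by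
    have e1 := hp1.intervalIntegral_add_eq 0 a
    have e2 := hp2.intervalIntegral_add_eq 0 a
    rw [zero_add] at e1 e2
    rw [e1, e2]; exact i1
  rw [intervalIntegral.integral_add (c1.intervalIntegrable _ _) (c2.intervalIntegrable _ _),
    intervalIntegral.integral_const_mul, intervalIntegral.integral_const_mul,
    intervalIntegral.integral_sub (hvc.abs.intervalIntegrable _ _)
      (hHc.intervalIntegrable _ _)] at i2
  have i3 : σ * (∫ θ in (0 : ℝ)..(2 * Real.pi), v θ * T θ) ≤
      |∫ θ in (0 : ℝ)..(2 * Real.pi), v θ * T θ| := by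
    have := le_abs_self (σ * (∫ θ in (0 : ℝ)..(2 * Real.pi), v θ * T θ))
    rwa [abs_mul, hσ, one_mul] at this
  have i4 : (∫ θ in (0 : ℝ)..(2 * Real.pi), |v θ|) ≤
      (∫ θ in (0 : ℝ)..(2 * Real.pi), H θ) + ε := hε
  show (∫ θ in (0 : ℝ)..(2 * Real.pi), |v θ * T θ|) ≤
    |∫ θ in (0 : ℝ)..(2 * Real.pi), v θ * T θ| + 2 * ε
  linarith

/-! ### The bound for the second coefficient of `f` -/

theorem eq_exp_of_norm_eq_one {ω : ℂ} (hω : ‖ω‖ = 1) :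
    ω = Complex.exp (Complex.arg ω * Complex.I) := by
  have := Complex.norm_mul_exp_arg_mul_I ω
  rw [hω] at this
  simpa using this.symm

/-- The sum of the half angles and the sum of the exponentials control the coefficients. -/
theorem im_coeff_le_of_norm_le {n : ℕ} (hn : 1 ≤ n) {c d ω : ℂ} (hc : c ≠ 0) (hω : ‖ω‖ = 1)
    (hre : (c * ω ^ n).re = 0) (x : ℕ → ℝ) {r δ : ℝ} (hr : 0 < r)
    (hle : ‖r * d - c * ∑ j ∈ Finset.range (2 * n), Complex.exp (-(x j * Complex.I))‖ ≤
      2 * |(Complex.exp ((∑ j ∈ Finset.range (2 * n), x j / 2 : ℝ) * Complex.I) * c).re| + δ) :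
    r * |(d * ω / c).im| ≤ 2 * (n + 1) * Real.cos (n * alpha₀ n) + δ / ‖c‖ := by
  have hcn : 0 < ‖c‖ := norm_pos_iff.2 hc
  set φ := Complex.arg ω with hφ
  have hωe : ω = Complex.exp (φ * Complex.I) := eq_exp_of_norm_eq_one hω
  set b := ∑ j ∈ Finset.range (2 * n), Complex.exp (-(x j * Complex.I)) with hb
  have h1 : (b * ω).im = ∑ j ∈ Finset.range (2 * n), Real.sin (φ - x j) := by
    rw [hb, Finset.sum_mul, Complex.im_sum]
    refine Finset.sum_congr rfl fun j _ => ?_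
    rw [hωe, ← Complex.exp_add, show -(x j * Complex.I) + φ * Complex.I =
      ((φ - x j : ℝ) : ℂ) * Complex.I by push_cast; ring, Complex.exp_ofReal_mul_I_im]
  set Y := ∑ j ∈ Finset.range (2 * n), (φ - x j) / 2 with hY
  -- As `c ω ^ n` is purely imaginary, `c` equals `± i |c| ω⁻ⁿ`; the rotation by the half angles
  -- then turns the real part into a sine of `Y`.
  have h2 : |(Complex.exp ((∑ j ∈ Finset.range (2 * n), x j / 2 : ℝ) * Complex.I) * c).re| =
      ‖c‖ * |Real.sin Y| := by
    have e1 : c * ω ^ n = (((c * ω ^ n).im : ℝ) : ℂ) * Complex.I := by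
      apply Complex.ext <;> simp [hre]
    have e2 : |(c * ω ^ n).im| = ‖c‖ := by
      have := congrArg norm e1
      rw [norm_mul, norm_pow, hω, one_pow, mul_one, norm_mul, Complex.norm_I, mul_one,
        Complex.norm_real] at this
      exact this.symm
    have e3 : Complex.exp ((∑ j ∈ Finset.range (2 * n), x j / 2 : ℝ) * Complex.I) * c =
        (((c * ω ^ n).im : ℝ) : ℂ) * (Complex.exp (((-Y : ℝ) : ℂ) * Complex.I) * Complex.I) := by
      have e4 : Complex.exp (((-Y : ℝ) : ℂ) * Complex.I) * ω ^ n =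
          Complex.exp ((∑ j ∈ Finset.range (2 * n), x j / 2 : ℝ) * Complex.I) := by
        rw [hωe, ← Complex.exp_nat_mul, ← Complex.exp_add]
        congr 1
        have : Y = n * φ - ∑ j ∈ Finset.range (2 * n), x j / 2 := by
          rw [hY, Finset.sum_congr rfl fun j _ => sub_div φ (x j) 2, Finset.sum_sub_distrib]
          simp; ring
        rw [this]; push_cast; ring
      have e5 : (((c * ω ^ n).im : ℝ) : ℂ) * (Complex.exp (((-Y : ℝ) : ℂ) * Complex.I) * Complex.I)
          = Complex.exp (((-Y : ℝ) : ℂ) * Complex.I) * (c * ω ^ n) := by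
        rw [mul_left_comm, ← e1]
      rw [e5, ← e4]; ring
    rw [e3, Complex.re_ofReal_mul, abs_mul, e2]
    congr 1
    rw [Complex.mul_I_re, Complex.exp_ofReal_mul_I_im, Real.sin_neg, neg_neg]
  have h3 : |(((r * d - c * b) * ω / c)).im| ≤ 2 * |Real.sin Y| + δ / ‖c‖ := by
    refine (Complex.abs_im_le_norm _).trans ?_
    rw [norm_div, norm_mul, hω, mul_one, div_le_iff₀ hcn]
    refine hle.trans (le_of_eq ?_)
    rw [h2]; field_simp
  have h4 : (r * d - c * b) * ω / c = r * (d * ω / c) - b * ω := by field_simp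
  rw [h4, Complex.sub_im, Complex.im_ofReal_mul, h1] at h3
  have h5 := abs_sum_sin_add_le hn fun j => φ - x j
  have h6 : r * |(d * ω / c).im| = |r * (d * ω / c).im| := by rw [abs_mul, abs_of_pos hr]
  rw [h6]
  have h7 := abs_sub_abs_le_abs_sub (r * (d * ω / c).im)
    (∑ j ∈ Finset.range (2 * n), Real.sin (φ - x j))
  linarith

namespace IsNodalStar

variable {f : ℂ → ℂ} {n : ℕ} {Γ : Fin n → ℝ → ℂ} (h : IsNodalStar f Γ)

include h

/-- The integral of `v T e^{-iθ}` is bounded by that of `|v T|`, which is nearly the absolute value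
of the integral of `v T`. Inserting the two moments leaves an inequality in `G 0`, `G' 0` and the
angles, to which the extremal problem for sines applies; then `r → 1`. -/
theorem im_coeff_le (hn : 1 ≤ n) {G : ℂ → ℂ} (hG : DifferentiableOn ℂ G (Metric.ball 0 1))
    (hG0 : ∀ z ∈ Metric.ball (0 : ℂ) 1, G z ≠ 0)
    (hfG : ∀ z ∈ Metric.ball (0 : ℂ) 1, f z = z ^ n * G z) {M : ℝ}
    (hM : ∀ r ∈ Ioo (0 : ℝ) 1, ∫ θ in (0 : ℝ)..(2 * Real.pi), |(f (circleMap 0 r θ)).re| ≤ M)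
    {ω : ℂ} (hω : ‖ω‖ = 1) (hre : (G 0 * ω ^ n).re = 0) :
    |(deriv G 0 * ω / G 0).im| ≤ 2 * (n + 1) * Real.cos (n * alpha₀ n) := by
  have hn0 : n ≠ 0 := by omega
  have h0 : (0 : ℂ) ∈ Metric.ball (0 : ℂ) 1 := by simp
  have hc : G 0 ≠ 0 := hG0 0 h0
  have hcn : 0 < ‖G 0‖ := norm_pos_iff.2 hc
  have hf0 : f 0 = 0 := by rw [hfG 0 h0, zero_pow hn0, zero_mul]
  obtain ⟨Ξ, hΞc, hΞ0, hΞ⟩ := h.exists_sectors hf0 hn0 hG hG0 hfG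
  obtain ⟨Ξ', -, hΞ0', hΞ'⟩ := h.neg.exists_sectors (by simp [hf0]) hn0 hG.neg
    (fun z hz => neg_ne_zero.2 (hG0 z hz)) (fun z hz => by simp [hfG z hz])
  have hpi := Real.pi_pos
  have hAe : ∀ z ∈ Metric.ball (0 : ℂ) 1, 0 < (f z).re →
      ∀ᶠ r in 𝓝[<] (1 : ℝ), z ∈ joinedPos f Ξ r := fun z hz hfz => by
    obtain ⟨ξ, hξ, hJ⟩ := hΞ z hz hfz
    filter_upwards [JoinedIn.eventually_norm_le (fun w hw => hw.1) hJ] with r hr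
    exact ⟨ξ, hξ, hr.mono fun w hw => ⟨hw.2, hw.1.2⟩⟩
  have hBe : ∀ z ∈ Metric.ball (0 : ℂ) 1, (f z).re < 0 →
      ∀ᶠ r in 𝓝[<] (1 : ℝ), z ∈ joinedNeg f r := fun z hz hfz => by
    obtain ⟨ξ, hξ, hJ⟩ := hΞ' z hz (by simpa using hfz)
    have hJ2 : JoinedIn ({w | w ∈ Metric.ball (0 : ℂ) 1 ∧ 0 < (-f w).re} ∪ {0}) z 0 :=
      (hJ.mono subset_union_left).trans (hΞ0' ξ hξ)
    have hsub : ({w | w ∈ Metric.ball (0 : ℂ) 1 ∧ 0 < (-f w).re} ∪ {0} : Set ℂ) ⊆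
        Metric.ball 0 1 := by
      rintro w (hw | rfl)
      · exact hw.1
      · exact h0
    filter_upwards [JoinedIn.eventually_norm_le hsub hJ2] with r hr
    refine ⟨hfz, hr.mono ?_⟩
    rintro w ⟨hw | hw, hwr⟩
    · exact ⟨hwr, Or.inl (by simpa using hw.2)⟩
    · exact ⟨hwr, Or.inr hw⟩
  have key : ∀ ρ < 1, ∀ δ > 0, ρ * |(deriv G 0 * ω / G 0).im| ≤
      2 * (n + 1) * Real.cos (n * alpha₀ n) + δ := by
    intro ρ hρ δ hδ
    -- The admissible error after division by `π (r / 4) ^ n`; the radius below satisfies `r ≥ 1/2`,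
    -- so `(r / 4) ^ n ≥ (1 / 8) ^ n`.
    have hε : 0 < δ * ‖G 0‖ * Real.pi * (1 / 8) ^ n / 2 := by positivity
    obtain ⟨r, hr, hr0, hr1, hsmall⟩ := exists_small_remainder h.differentiableOn
      (isPosPart_joinedPos f Ξ) (isPosPart_joinedNeg f) hAe hBe hM hε
      (max_lt hρ (by norm_num : (1 / 2 : ℝ) < 1))
    have hr2 : 1 / 2 ≤ r := (le_max_right _ _).trans hr.le
    have hfc : ContinuousOn f (Metric.closedBall 0 r) :=
      h.differentiableOn.continuousOn.mono (Metric.closedBall_subset_ball hr1)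
    obtain ⟨x, hx⟩ := exists_nearly_signed hf0 hΞc hr0 hfc hsmall
    obtain ⟨m1, m2⟩ := moments_prod_sin hG hr0 hr1 x n rfl rfl
    have hfr : ∀ θ, (f (circleMap 0 r θ)).re =
        (circleMap 0 r θ ^ n * G (circleMap 0 r θ)).re := fun θ => by
      rw [hfG _ (by simpa [abs_of_pos hr0] using hr1)]
    simp only [hfr] at hx
    rw [m1] at hx
    set I := ∫ θ in (0 : ℝ)..(2 * Real.pi), |(circleMap 0 r θ ^ n * G (circleMap 0 r θ)).re *
        ∏ j ∈ Finset.range (2 * n), Real.sin ((θ - x j) / 2)| with hI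
    have hle : Real.pi * (r / 4) ^ n * ‖r * deriv G 0 - G 0 * ∑ j ∈ Finset.range (2 * n),
        Complex.exp (-(x j * Complex.I))‖ ≤ I := by
      rw [← m2]
      refine (intervalIntegral.norm_integral_le_integral_norm (by positivity)).trans (le_of_eq ?_)
      refine intervalIntegral.integral_congr fun θ _ => ?_
      rw [norm_mul, Complex.norm_real, Real.norm_eq_abs, ← neg_mul, ← Complex.ofReal_neg,
        Complex.norm_exp_ofReal_mul_I, mul_one]
    have hp : 0 < Real.pi * (r / 4) ^ n := by positivity
    have hp8 : Real.pi * (1 / 8) ^ n ≤ Real.pi * (r / 4) ^ n :=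
      mul_le_mul_of_nonneg_left (pow_le_pow_left₀ (by norm_num) (by linarith) n) hpi.le
    have h8 : 2 * (δ * ‖G 0‖ * Real.pi * (1 / 8) ^ n / 2) ≤
        Real.pi * (r / 4) ^ n * (δ * ‖G 0‖) := by
      have : 0 < δ * ‖G 0‖ := by positivity
      nlinarith
    have h9 : Real.pi * (r / 4) ^ n * ‖r * deriv G 0 - G 0 * ∑ j ∈ Finset.range (2 * n),
        Complex.exp (-(x j * Complex.I))‖ ≤ Real.pi * (r / 4) ^ n *
        (2 * |(Complex.exp ((∑ j ∈ Finset.range (2 * n), x j / 2 : ℝ) * Complex.I) * G 0).re| +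
          δ * ‖G 0‖) := by
      refine (hle.trans hx).trans ?_
      rw [mul_add]
      refine add_le_add (le_of_eq (by ring)) h8
    have h10 := im_coeff_le_of_norm_le hn hc hω hre x hr0 (le_of_mul_le_mul_left h9 hp)
    rw [mul_div_cancel_right₀ _ hcn.ne'] at h10
    refine le_trans ?_ h10
    gcongr
    exact (le_max_left _ _).trans hr.le
  refine le_of_forall_pos_le_add fun ε hε => ?_
  set q := |(deriv G 0 * ω / G 0).im| with hq
  have hq0 : 0 ≤ q := abs_nonneg _
  have h1 := key (1 - ε / (2 * (q + 1))) (by linarith [show 0 < ε / (2 * (q + 1)) by positivity])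
    (ε / 2) (by positivity)
  have h2 : ε / (2 * (q + 1)) * q ≤ ε / 2 := by
    rw [div_mul_eq_mul_div, div_le_div_iff₀ (by positivity) (by norm_num)]
    nlinarith
  nlinarith

end IsNodalStar

/-! ### The curvature of a nodal curve -/

theorem curvature_eq_im_div {γ : ℝ → ℂ} {t : ℝ} (h : deriv γ t ≠ 0) :
    curvature γ t = (deriv (deriv γ) t / deriv γ t).im / ‖deriv γ t‖ := by
  have hn : ‖deriv γ t‖ ≠ 0 := norm_ne_zero_iff.2 h
  rw [curvature, Complex.div_im, Complex.normSq_eq_norm_sq]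
  field_simp

/-- Direction and curvature of a nodal curve at a zero of order `n`. -/
theorem curvature_of_pow_mul {n : ℕ} (hn : n ≠ 0) {G : ℂ → ℂ} (hG : AnalyticAt ℂ G 0)
    (hG0 : G 0 ≠ 0) {γ : ℝ → ℂ} {t₀ : ℝ} (hγ : AnalyticAt ℝ γ t₀) (hγ' : deriv γ t₀ ≠ 0)
    (h0 : γ t₀ = 0) (hre : ∀ᶠ t in 𝓝 t₀, (γ t ^ n * G (γ t)).re = 0) :
    (G 0 * deriv γ t₀ ^ n).re = 0 ∧
      curvature γ t₀ = -(2 / n) * (deriv G 0 * (deriv γ t₀ / ‖deriv γ t₀‖) / G 0).im := by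
  obtain ⟨p, hp⟩ := hγ
  have hqa : AnalyticAt ℝ (dslope γ t₀) t₀ := ⟨_, hp.has_fpower_series_dslope_fslope⟩
  have hγ : AnalyticAt ℝ γ t₀ := ⟨p, hp⟩
  set q := dslope γ t₀ with hq
  have hγq : ∀ t, γ t = ((t - t₀ : ℝ) : ℂ) * q t := fun t => by
    have := sub_smul_dslope γ t₀ t
    rw [h0, sub_zero, Complex.real_smul] at this
    exact this.symm
  have hq0 : q t₀ = deriv γ t₀ := dslope_same γ t₀
  have hlin : ∀ t, HasDerivAt (fun t : ℝ => ((t - t₀ : ℝ) : ℂ)) 1 t := fun t => by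
    simpa using ((hasDerivAt_id t).sub_const t₀).ofReal_comp
  have hd1 : deriv γ =ᶠ[𝓝 t₀] fun t => q t + ((t - t₀ : ℝ) : ℂ) * deriv q t := by
    filter_upwards [hqa.eventually_analyticAt] with t ht
    have h1 : γ = fun t => ((t - t₀ : ℝ) : ℂ) * q t := funext hγq
    have h2 := (hlin t).mul ht.differentiableAt.hasDerivAt
    rw [h1]
    rw [show deriv (fun t => ((t - t₀ : ℝ) : ℂ) * q t) t = _ from h2.deriv]
    ring
  have hd2 : deriv (deriv γ) t₀ = 2 * deriv q t₀ := by
    rw [hd1.deriv_eq]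
    have h1 := hqa.differentiableAt.hasDerivAt.add
      ((hlin t₀).mul hqa.deriv.differentiableAt.hasDerivAt)
    rw [show deriv (fun t => q t + ((t - t₀ : ℝ) : ℂ) * deriv q t) t₀ = _ from h1.deriv]
    simp; ring
  -- With `γ = (t - t₀) q`, cancelling `(t - t₀) ^ n` leaves `Re W = 0`, also at `t₀` by continuity.
  -- The value at `t₀` gives the direction condition; the derivative there involves `q' t₀ = γ'' t₀
  -- / 2` and gives the curvature.
  set W : ℝ → ℂ := fun t => q t ^ n * G (γ t) with hW
  have hG' : HasDerivAt G (deriv G 0) (γ t₀) := by rw [h0]; exact hG.differentiableAt.hasDerivAt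
  have hWd : HasDerivAt W (n * q t₀ ^ (n - 1) * deriv q t₀ * G (γ t₀) +
      q t₀ ^ n * (deriv G 0 * deriv γ t₀)) t₀ := by
    have h1 : HasDerivAt (fun t => q t ^ n) (n * q t₀ ^ (n - 1) * deriv q t₀) t₀ :=
      hqa.differentiableAt.hasDerivAt.pow n
    exact h1.mul (hasDerivAt_comp_real hG' hγ.differentiableAt.hasDerivAt)
  have hWre : ∀ᶠ t in 𝓝 t₀, (W t).re = 0 := by
    have h1 : ∀ᶠ t in 𝓝[≠] t₀, (W t).re = 0 := by
      filter_upwards [nhdsWithin_le_nhds hre, self_mem_nhdsWithin] with t ht hne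
      rw [hγq t, mul_pow, ← hγq t, mul_assoc, ← Complex.ofReal_pow, Complex.re_ofReal_mul] at ht
      exact (mul_eq_zero.1 ht).resolve_left (pow_ne_zero n (sub_ne_zero.2 hne))
    have h2 : (W t₀).re = 0 := by
      have hc : ContinuousAt (fun t => (W t).re) t₀ :=
        Complex.continuous_re.continuousAt.comp hWd.continuousAt
      exact tendsto_nhds_unique (hc.tendsto.mono_left nhdsWithin_le_nhds)
        (tendsto_const_nhds.congr' (by filter_upwards [h1] with t ht using ht.symm))
    rw [eventually_nhdsWithin_iff] at h1
    filter_upwards [h1] with t ht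
    by_cases h3 : t = t₀
    · rw [h3]; exact h2
    · exact ht h3
  have hW0 : W t₀ = G 0 * deriv γ t₀ ^ n := by simp only [W]; rw [hq0, h0]; ring
  have hW0re : (G 0 * deriv γ t₀ ^ n).re = 0 := hW0 ▸ hWre.self_of_nhds
  refine ⟨hW0re, ?_⟩
  have hWd' : (n * q t₀ ^ (n - 1) * deriv q t₀ * G (γ t₀) +
      q t₀ ^ n * (deriv G 0 * deriv γ t₀)).re = 0 := by
    have h1 := Complex.reCLM.hasFDerivAt.comp_hasDerivAt t₀ hWd
    have h2 : (Complex.reCLM ∘ W) =ᶠ[𝓝 t₀] fun _ => (0 : ℝ) := by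
      filter_upwards [hWre] with t ht using ht
    exact h1.unique ((hasDerivAt_const t₀ (0 : ℝ)).congr_of_eventuallyEq h2)
  rw [hq0, h0] at hWd'
  set a := deriv γ t₀ with ha
  have hratio : n * a ^ (n - 1) * deriv q t₀ * G 0 + a ^ n * (deriv G 0 * a) =
      (G 0 * a ^ n) * (n / 2 * (deriv (deriv γ) t₀ / a) + deriv G 0 * a / G 0) := by
    rw [hd2]
    obtain ⟨k, rfl⟩ := Nat.exists_eq_succ_of_ne_zero hn
    rw [Nat.succ_sub_one, pow_succ]
    field_simp
  rw [hratio, Complex.mul_re, hW0re, zero_mul, zero_sub, neg_eq_zero] at hWd'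
  have him : (G 0 * a ^ n).im ≠ 0 := fun him =>
    mul_ne_zero hG0 (pow_ne_zero n hγ') (Complex.ext hW0re him)
  have h1 := (mul_eq_zero.1 hWd').resolve_left him
  rw [Complex.add_im, show (n / 2 : ℂ) = ((n / 2 : ℝ) : ℂ) by push_cast; ring,
    Complex.im_ofReal_mul] at h1
  have hna : (‖a‖ : ℝ) ≠ 0 := norm_ne_zero_iff.2 hγ'
  have hnR : (n : ℝ) ≠ 0 := by exact_mod_cast hn
  have h2 : (deriv G 0 * (a / ‖a‖) / G 0).im = (deriv G 0 * a / G 0).im / ‖a‖ := by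
    rw [show deriv G 0 * (a / ‖a‖) / G 0 = deriv G 0 * a / G 0 / (‖a‖ : ℂ) by ring,
      Complex.div_ofReal_im]
  rw [curvature_eq_im_div hγ', h2]
  have h3 : (deriv (deriv γ) t₀ / a).im = -(2 / n) * (deriv G 0 * a / G 0).im := by
    generalize (deriv G 0 * a / G 0).im = X at *
    field_simp
    linarith
  rw [h3]; ring

/-! ### Conformal changes of coordinates -/

/-- `φ` and `ψ` are mutually inverse holomorphic maps between `U` and `V`. -/
structure IsBiholomorphic (φ ψ : ℂ → ℂ) (U V : Set ℂ) : Prop where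
  analyticAt : ∀ z ∈ U, AnalyticAt ℂ φ z
  analyticAt_inv : ∀ w ∈ V, AnalyticAt ℂ ψ w
  mapsTo : ∀ z ∈ U, φ z ∈ V
  mapsTo_inv : ∀ w ∈ V, ψ w ∈ U
  left_inv : ∀ z ∈ U, ψ (φ z) = z
  right_inv : ∀ w ∈ V, φ (ψ w) = w
  isOpen : IsOpen U
  isOpen_target : IsOpen V

namespace IsBiholomorphic

variable {φ ψ : ℂ → ℂ} {U V : Set ℂ} (h : IsBiholomorphic φ ψ U V)

include h

theorem symm : IsBiholomorphic ψ φ V U :=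
  ⟨h.analyticAt_inv, h.analyticAt, h.mapsTo_inv, h.mapsTo, h.right_inv, h.left_inv,
    h.isOpen_target, h.isOpen⟩

theorem deriv_ne_zero {z : ℂ} (hz : z ∈ U) : deriv φ z ≠ 0 := by
  intro h0
  have h1 : HasDerivAt (fun z => ψ (φ z)) (deriv ψ (φ z) * deriv φ z) z :=
    (h.analyticAt_inv _ (h.mapsTo z hz)).differentiableAt.hasDerivAt.comp z
      (h.analyticAt z hz).differentiableAt.hasDerivAt
  have h2 : (fun z => ψ (φ z)) =ᶠ[𝓝 z] id := by
    filter_upwards [h.isOpen.mem_nhds hz] with w hw using h.left_inv w hw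
  rw [h0, mul_zero] at h1
  exact zero_ne_one (h1.unique ((hasDerivAt_id z).congr_of_eventuallyEq h2))

theorem isRegularAnalyticCurve {γ : ℝ → ℂ} (hγ : IsRegularAnalyticCurve γ) (hU : ∀ t, γ t ∈ U) :
    IsRegularAnalyticCurve (φ ∘ γ) := fun t => by
  refine ⟨((h.analyticAt _ (hU t)).restrictScalars (𝕜 := ℝ)).comp (hγ t).1, ?_⟩
  have h1 : HasDerivAt (φ ∘ γ) (deriv φ (γ t) * deriv γ t) t :=
    hasDerivAt_comp_real (h.analyticAt _ (hU t)).differentiableAt.hasDerivAt (hγ.hasDerivAt t)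
  rw [h1.deriv]
  exact mul_ne_zero (h.deriv_ne_zero (hU t)) (hγ t).2

theorem range_subset_nodalSet {u : ℂ → ℝ} {γ : ℝ → ℂ} (hγ : range γ ⊆ nodalSet u U) :
    range (φ ∘ γ) ⊆ nodalSet (u ∘ ψ) V := by
  rintro _ ⟨t, rfl⟩
  have h1 := hγ ⟨t, rfl⟩
  refine ⟨h.mapsTo _ h1.1, ?_⟩
  show u (ψ (φ (γ t))) = 0
  rw [h.left_inv _ h1.1]
  exact h1.2

theorem isNodalCurve {u : ℂ → ℝ} {γ : ℝ → ℂ} (hγ : IsNodalCurve u U γ) :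
    IsNodalCurve (u ∘ ψ) V (φ ∘ γ) := by
  have hU : ∀ t, γ t ∈ U := fun t => (hγ.2.1 ⟨t, rfl⟩).1
  refine ⟨h.isRegularAnalyticCurve hγ.1 hU, h.range_subset_nodalSet hγ.2.1,
    fun δ hδ hδZ hsub => ?_⟩
  have hV : ∀ t, δ t ∈ V := fun t => (hδZ ⟨t, rfl⟩).1
  have h1 := hγ.2.2 (ψ ∘ δ) (h.symm.isRegularAnalyticCurve hδ hV) (by
    rintro _ ⟨t, rfl⟩
    exact ⟨h.mapsTo_inv _ (hV t), (hδZ ⟨t, rfl⟩).2⟩) (by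
    rintro _ ⟨t, rfl⟩
    obtain ⟨s, hs⟩ := hsub ⟨t, rfl⟩
    exact ⟨s, by rw [Function.comp_apply, hs, Function.comp_apply, h.left_inv _ (hU t)]⟩)
  rintro _ ⟨t, rfl⟩
  obtain ⟨s, hs⟩ := h1 ⟨t, rfl⟩
  exact ⟨s, by rw [Function.comp_apply, hs, Function.comp_apply, h.right_inv _ (hV t)]⟩

theorem range_comp_injective {γ δ : ℝ → ℂ} (hγ : ∀ t, γ t ∈ U) (hδ : ∀ t, δ t ∈ U)
    (he : range (φ ∘ γ) = range (φ ∘ δ)) : range γ = range δ := by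
  have key : ∀ γ δ : ℝ → ℂ, (∀ t, γ t ∈ U) → (∀ t, δ t ∈ U) → range (φ ∘ γ) ⊆ range (φ ∘ δ) →
      range γ ⊆ range δ := by
    rintro γ δ hγ hδ hs _ ⟨t, rfl⟩
    obtain ⟨s, hs⟩ := hs ⟨t, rfl⟩
    exact ⟨s, by rw [← h.left_inv _ (hδ s), ← h.left_inv _ (hγ t)]; exact congrArg ψ hs⟩
  exact Subset.antisymm (key γ δ hγ hδ he.subset) (key δ γ hδ hγ he.symm.subset)

theorem nodalSet_eq_iUnion {ι : Type*} {u : ℂ → ℝ} {Γ : ι → ℝ → ℂ}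
    (hΓ : nodalSet u U = ⋃ k, range (Γ k)) :
    nodalSet (u ∘ ψ) V = ⋃ k, range (φ ∘ Γ k) := by
  ext w
  constructor
  · intro hw
    have h1 : ψ w ∈ nodalSet u U := ⟨h.mapsTo_inv _ hw.1, hw.2⟩
    rw [hΓ] at h1
    obtain ⟨k, t, ht⟩ := mem_iUnion.1 h1
    exact mem_iUnion.2 ⟨k, t, by rw [Function.comp_apply, ht, h.right_inv _ hw.1]⟩
  · intro hw
    obtain ⟨k, hk⟩ := mem_iUnion.1 hw
    exact h.range_subset_nodalSet (hΓ ▸ subset_iUnion (fun k => range (Γ k)) k) hk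

theorem hasOnlyNodalCurvesThrough {u : ℂ → ℝ} {n : ℕ} {p : ℂ}
    (hu : HasOnlyNodalCurvesThrough u U n p) :
    HasOnlyNodalCurvesThrough (u ∘ ψ) V n (φ p) := by
  obtain ⟨Γ, h1, h2, h3, h4⟩ := hu
  have hU : ∀ k t, Γ k t ∈ U := fun k t => ((h1 k).2.1 ⟨t, rfl⟩).1
  refine ⟨fun k => φ ∘ Γ k, fun k => h.isNodalCurve (h1 k),
    fun j k hjk he => h2 j k hjk (h.range_comp_injective (hU j) (hU k) he), fun k => ?_,
    h.nodalSet_eq_iUnion h4⟩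
  obtain ⟨t, ht⟩ := h3 k
  exact ⟨t, congrArg φ ht⟩

end IsBiholomorphic

/-- The behaviour of curvature under a conformal map. -/
theorem curvature_comp {φ : ℂ → ℂ} {γ : ℝ → ℂ} {t : ℝ} (hφ : AnalyticAt ℂ φ (γ t))
    (hφ' : deriv φ (γ t) ≠ 0) (hγ : AnalyticAt ℝ γ t) (hγ' : deriv γ t ≠ 0) :
    curvature γ t = ‖deriv φ (γ t)‖ * curvature (φ ∘ γ) t -
      (deriv (deriv φ) (γ t) / deriv φ (γ t) * (deriv γ t / ‖deriv γ t‖)).im := by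
  have hd1 : deriv (φ ∘ γ) =ᶠ[𝓝 t] fun s => deriv φ (γ s) * deriv γ s := by
    filter_upwards [hγ.eventually_analyticAt, hγ.continuousAt.eventually hφ.eventually_analyticAt]
      with s hs1 hs2
    exact (hasDerivAt_comp_real hs2.differentiableAt.hasDerivAt
      hs1.differentiableAt.hasDerivAt).deriv
  have hd2 : deriv (deriv (φ ∘ γ)) t =
      deriv (deriv φ) (γ t) * deriv γ t * deriv γ t + deriv φ (γ t) * deriv (deriv γ) t := by
    rw [hd1.deriv_eq]
    exact ((hasDerivAt_comp_real hφ.deriv.differentiableAt.hasDerivAt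
      hγ.differentiableAt.hasDerivAt).mul hγ.deriv.differentiableAt.hasDerivAt).deriv
  have hd1' := hd1.self_of_nhds
  have hne : deriv (φ ∘ γ) t ≠ 0 := by rw [hd1']; exact mul_ne_zero hφ' hγ'
  rw [curvature_eq_im_div hne, curvature_eq_im_div hγ', hd2, hd1', norm_mul]
  set a := deriv γ t
  set b := deriv φ (γ t)
  have ha : ‖a‖ ≠ 0 := norm_ne_zero_iff.2 hγ'
  have hb : ‖b‖ ≠ 0 := norm_ne_zero_iff.2 hφ'
  have h1 : (deriv (deriv φ) (γ t) * a * a + b * deriv (deriv γ) t) / (b * a) =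
      deriv (deriv φ) (γ t) / b * a + deriv (deriv γ) t / a := by field_simp
  have h2 : deriv (deriv φ) (γ t) / b * (a / (‖a‖ : ℂ)) =
      (deriv (deriv φ) (γ t) / b * a) / (‖a‖ : ℂ) := by ring
  rw [h1, h2, Complex.div_ofReal_im, Complex.add_im]
  field_simp
  ring

/-! ### Möbius transformations of a disc -/

/-- The conformal map of the disc of radius `r₀` onto the unit disc that takes `p` to `0`. -/
noncomputable def toUnitDisc (r₀ : ℝ) (p z : ℂ) : ℂ :=
  r₀ * (z - p) / (r₀ ^ 2 - (starRingEnd ℂ) p * z)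

/-- The inverse of `toUnitDisc`. -/
noncomputable def ofUnitDisc (r₀ : ℝ) (p w : ℂ) : ℂ :=
  r₀ * (r₀ * w + p) / (r₀ + (starRingEnd ℂ) p * w)

section Moebius

variable {r₀ : ℝ} {p : ℂ} (hr₀ : 0 < r₀) (hp : ‖p‖ < r₀)

include hr₀ hp

theorem toUnitDisc_denom_ne_zero {z : ℂ} (hz : ‖z‖ < r₀) :
    (r₀ : ℂ) ^ 2 - (starRingEnd ℂ) p * z ≠ 0 := by
  intro h
  have h1 : ‖(starRingEnd ℂ) p * z‖ = r₀ ^ 2 := by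
    rw [← sub_eq_zero.1 h, norm_pow, Complex.norm_real, Real.norm_of_nonneg hr₀.le]
  rw [norm_mul, Complex.norm_conj] at h1
  nlinarith [norm_nonneg p, norm_nonneg z]

theorem ofUnitDisc_denom_ne_zero {w : ℂ} (hw : ‖w‖ < 1) :
    (r₀ : ℂ) + (starRingEnd ℂ) p * w ≠ 0 := by
  intro h
  have h1 : ‖(starRingEnd ℂ) p * w‖ = r₀ := by
    rw [eq_neg_of_add_eq_zero_right h, norm_neg, Complex.norm_real, Real.norm_of_nonneg hr₀.le]
  rw [norm_mul, Complex.norm_conj] at h1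
  nlinarith [norm_nonneg p, norm_nonneg w]

theorem norm_toUnitDisc_lt {z : ℂ} (hz : ‖z‖ < r₀) : ‖toUnitDisc r₀ p z‖ < 1 := by
  have hd := norm_pos_iff.2 (toUnitDisc_denom_ne_zero hr₀ hp hz)
  rw [toUnitDisc, norm_div, div_lt_one hd]
  apply lt_of_pow_lt_pow_left₀ 2 hd.le
  have h1 : ‖(r₀ : ℂ) ^ 2 - (starRingEnd ℂ) p * z‖ ^ 2 - ‖(r₀ : ℂ) * (z - p)‖ ^ 2 =
      (r₀ ^ 2 - ‖p‖ ^ 2) * (r₀ ^ 2 - ‖z‖ ^ 2) := by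
    simp only [← Complex.normSq_eq_norm_sq, Complex.normSq_apply]
    simp [pow_two]
    ring
  have h2 : 0 < r₀ ^ 2 - ‖p‖ ^ 2 := by nlinarith [norm_nonneg p]
  have h3 : 0 < r₀ ^ 2 - ‖z‖ ^ 2 := by nlinarith [norm_nonneg z]
  nlinarith [mul_pos h2 h3]

theorem norm_ofUnitDisc_lt {w : ℂ} (hw : ‖w‖ < 1) : ‖ofUnitDisc r₀ p w‖ < r₀ := by
  have hd := norm_pos_iff.2 (ofUnitDisc_denom_ne_zero hr₀ hp hw)
  rw [ofUnitDisc, norm_div, div_lt_iff₀ hd, norm_mul, Complex.norm_real,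
    Real.norm_of_nonneg hr₀.le]
  refine mul_lt_mul_of_pos_left ?_ hr₀
  apply lt_of_pow_lt_pow_left₀ 2 hd.le
  have h1 : ‖(r₀ : ℂ) + (starRingEnd ℂ) p * w‖ ^ 2 - ‖(r₀ : ℂ) * w + p‖ ^ 2 =
      (r₀ ^ 2 - ‖p‖ ^ 2) * (1 - ‖w‖ ^ 2) := by
    simp only [← Complex.normSq_eq_norm_sq, Complex.normSq_apply]
    simp
    ring
  have h2 : 0 < r₀ ^ 2 - ‖p‖ ^ 2 := by nlinarith [norm_nonneg p]
  have h3 : 0 < 1 - ‖w‖ ^ 2 := by nlinarith [norm_nonneg w]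
  nlinarith [mul_pos h2 h3]

theorem ofReal_sq_sub_ne_zero : (r₀ : ℂ) ^ 2 - (starRingEnd ℂ) p * p ≠ 0 :=
  toUnitDisc_denom_ne_zero hr₀ hp hp

theorem isBiholomorphic_toUnitDisc :
    IsBiholomorphic (toUnitDisc r₀ p) (ofUnitDisc r₀ p) (Metric.ball 0 r₀) (Metric.ball 0 1) where
  analyticAt := fun z hz => by
    refine AnalyticAt.div (by fun_prop) (by fun_prop)
      (toUnitDisc_denom_ne_zero hr₀ hp (by simpa using hz))
  analyticAt_inv := fun w hw => by
    refine AnalyticAt.div (by fun_prop) (by fun_prop)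
      (ofUnitDisc_denom_ne_zero hr₀ hp (by simpa using hw))
  mapsTo := fun z hz => by simpa using norm_toUnitDisc_lt hr₀ hp (by simpa using hz)
  mapsTo_inv := fun z hz => by simpa using norm_ofUnitDisc_lt hr₀ hp (by simpa using hz)
  left_inv := fun z hz => by
    have h1 := toUnitDisc_denom_ne_zero hr₀ hp (z := z) (by simpa using hz)
    have h2 := ofUnitDisc_denom_ne_zero hr₀ hp (w := toUnitDisc r₀ p z)
      (norm_toUnitDisc_lt hr₀ hp (by simpa using hz))
    have h3 : toUnitDisc r₀ p z * (r₀ ^ 2 - (starRingEnd ℂ) p * z) = r₀ * (z - p) :=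
      div_mul_cancel₀ _ h1
    rw [ofUnitDisc, div_eq_iff h2]
    apply mul_right_cancel₀ h1
    linear_combination ((r₀ : ℂ) ^ 2 - (starRingEnd ℂ) p * z) * h3
  right_inv := fun w hw => by
    have h1 := ofUnitDisc_denom_ne_zero hr₀ hp (w := w) (by simpa using hw)
    have h2 := toUnitDisc_denom_ne_zero hr₀ hp (z := ofUnitDisc r₀ p w)
      (norm_ofUnitDisc_lt hr₀ hp (by simpa using hw))
    have h3 : ofUnitDisc r₀ p w * (r₀ + (starRingEnd ℂ) p * w) = r₀ * (r₀ * w + p) :=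
      div_mul_cancel₀ _ h1
    rw [toUnitDisc, div_eq_iff h2]
    apply mul_right_cancel₀ h1
    linear_combination (r₀ + (starRingEnd ℂ) p * w) * h3
  isOpen := Metric.isOpen_ball
  isOpen_target := Metric.isOpen_ball

theorem hasDerivAt_toUnitDisc {z : ℂ} (hz : ‖z‖ < r₀) :
    HasDerivAt (toUnitDisc r₀ p) (r₀ * (r₀ ^ 2 - (starRingEnd ℂ) p * p) /
      (r₀ ^ 2 - (starRingEnd ℂ) p * z) ^ 2) z := by
  have h1 := toUnitDisc_denom_ne_zero hr₀ hp hz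
  have h2 : HasDerivAt (fun z : ℂ => (r₀ : ℂ) * (z - p)) (r₀ * 1) z :=
    ((hasDerivAt_id z).sub_const p).const_mul _
  have h3 : HasDerivAt (fun z : ℂ => (r₀ : ℂ) ^ 2 - (starRingEnd ℂ) p * z)
      (-((starRingEnd ℂ) p * 1)) z := ((hasDerivAt_id z).const_mul _).const_sub _
  refine (h2.div h3 h1).congr_deriv ?_
  congr 1
  ring

theorem deriv_toUnitDisc_self :
    deriv (toUnitDisc r₀ p) p = ((r₀ / (r₀ ^ 2 - ‖p‖ ^ 2) : ℝ) : ℂ) := by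
  rw [(hasDerivAt_toUnitDisc hr₀ hp hp).deriv]
  have h1 := ofReal_sq_sub_ne_zero hr₀ hp
  have h2 : (starRingEnd ℂ) p * p = ((‖p‖ ^ 2 : ℝ) : ℂ) := by
    rw [← Complex.normSq_eq_norm_sq, mul_comm, Complex.mul_conj]
  rw [h2] at h1 ⊢
  push_cast at h1 ⊢
  field_simp

theorem deriv_deriv_toUnitDisc_self :
    deriv (deriv (toUnitDisc r₀ p)) p / deriv (toUnitDisc r₀ p) p =
      2 * (starRingEnd ℂ) p / ((r₀ ^ 2 - ‖p‖ ^ 2 : ℝ) : ℂ) := by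
  have h1 := ofReal_sq_sub_ne_zero hr₀ hp
  have h2 : (starRingEnd ℂ) p * p = ((‖p‖ ^ 2 : ℝ) : ℂ) := by
    rw [← Complex.normSq_eq_norm_sq, mul_comm, Complex.mul_conj]
  have hr : (r₀ : ℂ) ≠ 0 := by exact_mod_cast hr₀.ne'
  have h3 : deriv (toUnitDisc r₀ p) =ᶠ[𝓝 p] fun z => r₀ * (r₀ ^ 2 - (starRingEnd ℂ) p * p) /
      (r₀ ^ 2 - (starRingEnd ℂ) p * z) ^ 2 := by
    filter_upwards [Metric.isOpen_ball.mem_nhds (show p ∈ Metric.ball (0 : ℂ) r₀ by simpa using hp)]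
      with z hz
    exact (hasDerivAt_toUnitDisc hr₀ hp (by simpa using hz)).deriv
  have h4 : HasDerivAt (fun z : ℂ => (r₀ : ℂ) ^ 2 - (starRingEnd ℂ) p * z)
      (-((starRingEnd ℂ) p * 1)) p := ((hasDerivAt_id p).const_mul _).const_sub _
  have h5 := (hasDerivAt_const p (r₀ * (r₀ ^ 2 - (starRingEnd ℂ) p * p) : ℂ)).div (h4.pow 2)
    (pow_ne_zero 2 h1)
  have h6 : deriv (deriv (toUnitDisc r₀ p)) p = _ := h3.deriv_eq.trans h5.deriv
  rw [h6, (hasDerivAt_toUnitDisc hr₀ hp hp).deriv]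
  push_cast
  have h7 : (r₀ : ℂ) ^ 2 - (‖p‖ : ℂ) ^ 2 = r₀ ^ 2 - (starRingEnd ℂ) p * p := by
    rw [h2]; push_cast; ring
  rw [h7]
  simp only [Pi.pow_apply]
  generalize (r₀ : ℂ) ^ 2 - (starRingEnd ℂ) p * p = D at *
  field_simp
  ring

end Moebius

/-! ### Conformal invariance of the growth condition -/

/-- Harnack's inequality, for the real part of an entire function. -/
theorem re_le_of_nonneg_on_circle {P : ℂ → ℂ} (hP : Differentiable ℂ P) {R : ℝ} {w : ℂ}
    (hw : ‖w‖ < R) (hpos : ∀ z : ℂ, ‖z‖ = R → 0 ≤ (P z).re) :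
    (P w).re ≤ (R + ‖w‖) / (R - ‖w‖) * (P 0).re := by
  have hR : 0 < R := (norm_nonneg w).trans_lt hw
  have hwR : w ∈ Metric.ball (0 : ℂ) R := by simpa using hw
  have hharm : InnerProductSpace.HarmonicOnNhd (fun z => (P z).re) (Metric.closedBall 0 R) :=
    fun z _ => (hP.analyticAt z).harmonicAt_re
  have h1 := hharm.circleAverage_poissonKernel_smul hwR
  have h0 := integral_re_circleMap_eq (f := P) (R := R + 1) hP.differentiableOn
    (by rw [abs_of_pos hR]; exact lt_add_one R)
  have hPc : Continuous fun θ => (P (circleMap 0 R θ)).re :=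
    Complex.continuous_re.comp (hP.continuous.comp (continuous_circleMap 0 R))
  have hk : Continuous fun θ => poissonKernel 0 w (circleMap 0 R θ) := by
    have h2 : ContinuousOn (poissonKernel 0 w) (Metric.sphere 0 |R|) := by
      rw [poissonKernel_eq_re_herglotzRieszKernel]
      exact Complex.continuous_re.comp_continuousOn (continuousOn_herglotzRieszKernel_sphere hwR)
    exact h2.comp_continuous (continuous_circleMap 0 R) fun θ => circleMap_mem_sphere' 0 R θ
  rw [← h1, Real.circleAverage_def, smul_eq_mul]
  have h3 : (∫ θ in (0 : ℝ)..2 * Real.pi,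
      (poissonKernel 0 w • fun z => (P z).re) (circleMap 0 R θ)) ≤
      ∫ θ in (0 : ℝ)..2 * Real.pi, (R + ‖w‖) / (R - ‖w‖) * (P (circleMap 0 R θ)).re := by
    refine intervalIntegral.integral_mono_on (by positivity) ((hk.mul hPc).intervalIntegrable _ _)
      ((continuous_const.mul hPc).intervalIntegrable _ _) fun θ _ => ?_
    refine mul_le_mul_of_nonneg_right ?_ (hpos _ (by simp [abs_of_pos hR]))
    rw [poissonKernel_eq_re_herglotzRieszKernel, Function.comp_apply, herglotzRieszKernel_def]
    simpa using re_herglotzRieszKernel_le (circleMap_mem_sphere 0 hR.le θ) hwR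
  rw [intervalIntegral.integral_const_mul, h0] at h3
  calc (2 * Real.pi)⁻¹ * _ ≤ (2 * Real.pi)⁻¹ *
        ((R + ‖w‖) / (R - ‖w‖) * (2 * Real.pi * (P 0).re)) :=
        mul_le_mul_of_nonneg_left h3 (by positivity)
    _ = _ := by field_simp

/-- A holomorphic function has an entire function whose real part dominates the absolute value of
its real part in a given disc, without being much larger on the boundary circle. -/
theorem exists_re_majorant {F : ℂ → ℂ} {r₀ R : ℝ} (hF : DifferentiableOn ℂ F (Metric.ball 0 r₀))
    (hR : 0 < R) (hRr : R < r₀) :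
    ∃ P : ℂ → ℂ, Differentiable ℂ P ∧ (∀ z, ‖z‖ ≤ R → |(F z).re| ≤ (P z).re) ∧
      2 * Real.pi * (P 0).re ≤
        (∫ θ in (0 : ℝ)..(2 * Real.pi), |(F (circleMap 0 R θ)).re|) + 4 * Real.pi := by
  have hFc : ContinuousOn F (Metric.closedBall 0 R) :=
    hF.continuousOn.mono (Metric.closedBall_subset_ball hRr)
  have hhc : ContinuousOn (fun z => |(F z).re|) (Metric.closedBall 0 R) :=
    (Complex.continuous_re.comp_continuousOn hFc).abs
  have hc : Continuous fun θ => |(F (circleMap 0 R θ)).re| :=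
    continuousOn_comp_circleMap hhc (abs_of_pos hR).le
  -- Approximating `|Re F| + 1` to within `1` makes `Re P` dominate `|Re F|` on the circle and
  -- exceed it by at most `2`.
  obtain ⟨P, hP, hPh⟩ := exists_re_approx (φ := fun θ => |(F (circleMap 0 R θ)).re| + 1) hR
    (hc.add continuous_const) (fun θ => by simp only [periodic_circleMap 0 R θ]) one_pos
  have hcirc : ∀ w : ℂ, ‖w‖ = R → |(|(F w).re| + 1) - (P w).re| ≤ 1 := fun w hw => by
    have h1 : circleMap 0 R (Complex.arg w) = w := by
      rw [circleMap_zero, ← hw, Complex.norm_mul_exp_arg_mul_I]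
    have h2 := hPh (Complex.arg w)
    simpa only [h1] using h2
  have hle : ∀ G : ℂ → ℂ, DifferentiableOn ℂ G (Metric.ball 0 r₀) →
      (∀ z, |(G z).re| = |(F z).re|) → ∀ z, ‖z‖ ≤ R → (G z).re ≤ (P z).re := by
    intro G hG hGF z hz
    have hd : DiffContOnCl ℂ (fun w => Complex.exp (G w - P w)) (Metric.ball 0 R) := by
      refine DifferentiableOn.diffContOnCl ?_
      rw [closure_ball _ hR.ne']
      exact ((hG.mono (Metric.closedBall_subset_ball hRr)).sub hP.differentiableOn).cexp
    have h1 := Complex.norm_le_of_forall_mem_frontier_norm_le Metric.isBounded_ball hd (C := 1)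
      (fun y hy => by
        rw [frontier_ball _ hR.ne'] at hy
        have hy' : ‖y‖ = R := by simpa using hy
        rw [Complex.norm_exp, Real.exp_le_one_iff, Complex.sub_re]
        have := (abs_le.1 (hcirc y hy')).2
        have := le_abs_self (G y).re
        rw [hGF] at this
        linarith)
      (z := z) (by rw [closure_ball _ hR.ne']; simpa using hz)
    rw [Complex.norm_exp, Real.exp_le_one_iff, Complex.sub_re] at h1
    linarith
  refine ⟨P, hP, fun z hz => abs_le'.2 ⟨hle F hF (fun _ => rfl) z hz, ?_⟩, ?_⟩
  · have := hle (fun z => -F z) hF.neg (fun z => by rw [Complex.neg_re, abs_neg]) z hz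
    simpa using this
  · rw [← integral_re_circleMap_eq (f := P) (R := R + 1) (r := R) hP.differentiableOn
      (by rw [abs_of_pos hR]; exact lt_add_one R)]
    have hPc : Continuous fun θ => (P (circleMap 0 R θ)).re :=
      Complex.continuous_re.comp (hP.continuous.comp (continuous_circleMap 0 R))
    have i2 : (∫ θ in (0 : ℝ)..(2 * Real.pi), (P (circleMap 0 R θ)).re) ≤
        ∫ θ in (0 : ℝ)..(2 * Real.pi), (|(F (circleMap 0 R θ)).re| + 2) :=
      intervalIntegral.integral_mono_on (by positivity) (hPc.intervalIntegrable _ _)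
        ((hc.add continuous_const).intervalIntegrable _ _)
        fun θ _ => by
          have := (abs_le.1 (hPh θ)).1
          linarith
    rw [intervalIntegral.integral_add (hc.intervalIntegrable _ _)
      (continuous_const.intervalIntegrable _ _), intervalIntegral.integral_const] at i2
    simp only [sub_zero, smul_eq_mul] at i2
    linarith

/-- Bounded circle means of `|Re F|` survive composition with `ψ`: a harmonic majorant `Re P` of
`|Re F|` has mean `Re P (ψ 0)` after composition, which Harnack's inequality compares with `Re P 0`,
hence with the mean of `|Re F|` on a circle. -/
theorem exists_integral_comp_le {F ψ : ℂ → ℂ} {r₀ M₀ : ℝ}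
    (hF : DifferentiableOn ℂ F (Metric.ball 0 r₀)) (hψ : DifferentiableOn ℂ ψ (Metric.ball 0 1))
    (hmaps : ∀ z ∈ Metric.ball (0 : ℂ) 1, ψ z ∈ Metric.ball (0 : ℂ) r₀)
    (hM : ∀ᶠ R in 𝓝[<] r₀, ∫ θ in (0 : ℝ)..(2 * Real.pi), |(F (circleMap 0 R θ)).re| ≤ M₀) :
    ∃ M, ∀ s ∈ Ioo (0 : ℝ) 1,
      ∫ θ in (0 : ℝ)..(2 * Real.pi), |(F (ψ (circleMap 0 s θ))).re| ≤ M := by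
  have hp : ‖ψ 0‖ < r₀ := by simpa using hmaps 0 (Metric.mem_ball_self one_pos)
  have hr₀ : 0 < r₀ := (norm_nonneg _).trans_lt hp
  refine ⟨4 * r₀ / (r₀ - ‖ψ 0‖) * (M₀ + 4 * Real.pi), fun s hs => ?_⟩
  have hsub : Metric.closedBall (0 : ℂ) s ⊆ Metric.ball 0 1 := Metric.closedBall_subset_ball hs.2
  have hψc : ContinuousOn ψ (Metric.closedBall 0 s) := hψ.continuousOn.mono hsub
  obtain ⟨z₁, hz₁, hz₁max⟩ := (isCompact_closedBall (0 : ℂ) s).exists_isMaxOn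
    (Metric.nonempty_closedBall.2 hs.1.le) hψc.norm
  have hz₁r : ‖ψ z₁‖ < r₀ := by simpa using hmaps z₁ (hsub hz₁)
  -- `R` must exceed the norm of `ψ` on the closed disc of radius `s`. The second condition, `R >
  -- (r₀ + |ψ 0|) / 2`, keeps the Harnack constant independent of `s`.
  obtain ⟨R, hRM, hR⟩ := (hM.and (Ioo_mem_nhdsLT
    (max_lt hz₁r (by linarith : (r₀ + ‖ψ 0‖) / 2 < r₀)))).exists
  have hR1 : ‖ψ z₁‖ < R := (le_max_left _ _).trans_lt hR.1
  have hR2 : (r₀ + ‖ψ 0‖) / 2 < R := (le_max_right _ _).trans_lt hR.1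
  have hR0 : 0 < R := (norm_nonneg _).trans_lt hR1
  have hpR : ‖ψ 0‖ < R := by linarith
  obtain ⟨P, hP, hPF, hP0⟩ := exists_re_majorant hF hR0 hR.2
  have hψs : ∀ θ, ‖ψ (circleMap 0 s θ)‖ ≤ R := fun θ =>
    (hz₁max (circleMap_mem_closedBall 0 hs.1.le θ)).trans hR1.le
  have hPψ : DifferentiableOn ℂ (fun z => P (ψ z)) (Metric.ball 0 1) :=
    hP.comp_differentiableOn hψ
  have hmean := integral_re_circleMap_eq hPψ (r := s) (by rw [abs_of_pos hs.1]; exact hs.2)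
  have hFψ : ContinuousOn (fun z => |(F (ψ z)).re|) (Metric.closedBall 0 s) :=
    (Complex.continuous_re.comp_continuousOn
      ((hF.continuousOn.comp hψ.continuousOn hmaps).mono hsub)).abs
  have i1 : (∫ θ in (0 : ℝ)..(2 * Real.pi), |(F (ψ (circleMap 0 s θ))).re|) ≤
      ∫ θ in (0 : ℝ)..(2 * Real.pi), (P (ψ (circleMap 0 s θ))).re :=
    intervalIntegral.integral_mono_on (by positivity)
      ((continuousOn_comp_circleMap hFψ (abs_of_pos hs.1).le).intervalIntegrable _ _)
      ((continuousOn_comp_circleMap (h := fun z => (P (ψ z)).re)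
        (Complex.continuous_re.comp_continuousOn (hP.continuous.comp_continuousOn hψc))
        (abs_of_pos hs.1).le).intervalIntegrable _ _) fun θ _ => hPF _ (hψs θ)
  have hP0nn : 0 ≤ (P 0).re := (abs_nonneg _).trans (hPF 0 (by simpa using hR0.le))
  have hharn := re_le_of_nonneg_on_circle hP hpR
    fun z hz => (abs_nonneg _).trans (hPF z hz.le)
  have hK : (R + ‖ψ 0‖) / (R - ‖ψ 0‖) ≤ 4 * r₀ / (r₀ - ‖ψ 0‖) := by
    rw [div_le_div_iff₀ (by linarith) (by linarith)]
    nlinarith [hR.2, norm_nonneg (ψ 0)]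
  calc _ ≤ 2 * Real.pi * (P (ψ 0)).re := i1.trans hmean.le
    _ ≤ 2 * Real.pi * (4 * r₀ / (r₀ - ‖ψ 0‖) * (P 0).re) := by
      gcongr
      exact hharn.trans (mul_le_mul_of_nonneg_right hK hP0nn)
    _ = 4 * r₀ / (r₀ - ‖ψ 0‖) * (2 * Real.pi * (P 0).re) := by ring
    _ ≤ _ := by
      have : 0 ≤ 4 * r₀ / (r₀ - ‖ψ 0‖) := div_nonneg (by positivity) (by linarith)
      exact mul_le_mul_of_nonneg_left (hP0.trans (by linarith)) this

/-- Boundedness of the circle means near `r₀` is all that the upper bound uses of the boundary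
value. -/
theorem HasL1BoundaryValue.exists_integral_le {u : ℂ → ℝ} {r₀ : ℝ} (hr₀ : 0 < r₀)
    (hu : ContinuousOn u (Metric.ball 0 r₀)) (h : HasL1BoundaryValue u r₀) :
    ∃ M₀, ∀ᶠ R in 𝓝[<] r₀, ∫ θ in (0 : ℝ)..(2 * Real.pi), |u (circleMap 0 R θ)| ≤ M₀ := by
  obtain ⟨g, hg, hlim⟩ := h
  refine ⟨(∫ θ in (0 : ℝ)..(2 * Real.pi), |g θ|) + 1, ?_⟩
  filter_upwards [hlim.eventually (gt_mem_nhds one_pos), Ioo_mem_nhdsLT hr₀] with R hR hR0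
  have hc : Continuous fun θ => u (circleMap 0 R θ) :=
    continuousOn_comp_circleMap (hu.mono (Metric.closedBall_subset_ball hR0.2))
      (abs_of_pos hR0.1).le
  have h1 : IntervalIntegrable (fun θ => |u (circleMap 0 R θ) - g θ|) volume 0 (2 * Real.pi) :=
    ((hc.intervalIntegrable _ _).sub hg).abs
  have h2 : (∫ θ in (0 : ℝ)..(2 * Real.pi), |u (circleMap 0 R θ)|) ≤
      ∫ θ in (0 : ℝ)..(2 * Real.pi), (|g θ| + |u (circleMap 0 R θ) - g θ|) :=
    intervalIntegral.integral_mono_on (by positivity) (hc.abs.intervalIntegrable _ _)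
      (hg.abs.add h1) fun θ _ => by
        have := abs_add_le (g θ) (u (circleMap 0 R θ) - g θ)
        rwa [add_sub_cancel] at this
  rw [intervalIntegral.integral_add hg.abs h1] at h2
  linarith

/-! ### The upper bound for the curvature -/

theorem nodalSet_congr {u v : ℂ → ℝ} {U : Set ℂ} (h : EqOn u v U) : nodalSet u U = nodalSet v U :=
  Set.ext fun _ => ⟨fun hz => ⟨hz.1, (h hz.1).symm.trans hz.2⟩,
    fun hz => ⟨hz.1, (h hz.1).trans hz.2⟩⟩

theorem IsNodalCurve.congr {u v : ℂ → ℝ} {U : Set ℂ} {γ : ℝ → ℂ} (hγ : IsNodalCurve u U γ)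
    (h : EqOn u v U) : IsNodalCurve v U γ := by
  rw [IsNodalCurve, ← nodalSet_congr h]
  exact hγ

theorem HasOnlyNodalCurvesThrough.congr {u v : ℂ → ℝ} {U : Set ℂ} {n : ℕ} {p : ℂ}
    (hu : HasOnlyNodalCurvesThrough u U n p) (h : EqOn u v U) :
    HasOnlyNodalCurvesThrough v U n p := by
  obtain ⟨Γ, h1, h2, h3, h4⟩ := hu
  exact ⟨Γ, fun k => (h1 k).congr h, h2, h3, (nodalSet_congr h).symm.trans h4⟩

theorem eventually_deriv_ne_zero_of_nonconst {f : ℂ → ℂ}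
    (hf : DifferentiableOn ℂ f (Metric.ball 0 1)) (hn : ¬ ∀ z ∈ Metric.ball (0 : ℂ) 1, f z = f 0)
    {z : ℂ} (hz : z ∈ Metric.ball (0 : ℂ) 1) : ∀ᶠ w in 𝓝[≠] z, deriv f w ≠ 0 := by
  have hconv := convex_ball (0 : ℂ) 1
  have h0 : (0 : ℂ) ∈ Metric.ball (0 : ℂ) 1 := by simp
  have hd : AnalyticOnNhd ℂ (deriv f) (Metric.ball 0 1) :=
    (hf.analyticOnNhd Metric.isOpen_ball).deriv
  by_contra hcon
  have h1 : ∃ᶠ w in 𝓝[≠] z, deriv f w = 0 := by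
    simpa only [Filter.Frequently, ne_eq] using hcon
  have h2 := hd.eqOn_zero_of_preconnected_of_frequently_eq_zero hconv.isPreconnected hz h1
  refine hn fun w hw => ?_
  exact Metric.isOpen_ball.is_const_of_deriv_eq_zero hconv.isPreconnected hf h2 hw h0

/-- The curvature bound at the centre of the unit disc. -/
theorem abs_curvature_le_of_center {f : ℂ → ℂ} {n : ℕ} (hn : 1 ≤ n)
    (hf : DifferentiableOn ℂ f (Metric.ball 0 1)) (hf0 : f 0 = 0)
    (hnc : ¬ ∀ z ∈ Metric.ball (0 : ℂ) 1, f z = f 0)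
    (hnodal : HasOnlyNodalCurvesThrough (fun z => (f z).re) (Metric.ball 0 1) n 0) {M : ℝ}
    (hM : ∀ r ∈ Ioo (0 : ℝ) 1, ∫ θ in (0 : ℝ)..(2 * Real.pi), |(f (circleMap 0 r θ)).re| ≤ M)
    {γ : ℝ → ℂ} (hγ : IsNodalCurve (fun z => (f z).re) (Metric.ball 0 1) γ) {t : ℝ}
    (ht : γ t = 0) :
    |curvature γ t| ≤ 4 * ((n : ℝ) + 1) / n * Real.cos (n * alpha₀ n) := by
  obtain ⟨Γ, h1, h2, h3, h4⟩ := hnodal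
  have hstar : IsNodalStar f Γ := ⟨hf, fun z hz => eventually_deriv_ne_zero_of_nonconst hf hnc hz,
    fun k => (h1 k).1, fun k => (h1 k).2.1, h3, h4.subset⟩
  have h0 : (0 : ℂ) ∈ Metric.ball (0 : ℂ) 1 := by simp
  obtain ⟨m, hm, hmn, G, hG, hG0, hfG⟩ := hstar.exists_eq_pow_mul hf0
  obtain rfl : m = n := le_antisymm hmn (hstar.le_order h1 h2 hm hG hG0 hfG)
  have hγt := (hγ.1 t)
  obtain ⟨hre, hκ⟩ := curvature_of_pow_mul hm (hG.analyticAt (Metric.isOpen_ball.mem_nhds h0))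
    (hG0 0 h0) hγt.1 hγt.2 ht (Eventually.of_forall fun s => by
      have h5 := hγ.2.1 ⟨s, rfl⟩
      rw [← hfG _ h5.1]
      exact h5.2)
  have hpos : 0 < ‖deriv γ t‖ := norm_pos_iff.2 hγt.2
  set ω : ℂ := deriv γ t / ‖deriv γ t‖ with hω
  have hω1 : ‖ω‖ = 1 := by
    rw [hω, norm_div, Complex.norm_real, norm_norm, div_self hpos.ne']
  have hωre : (G 0 * ω ^ m).re = 0 := by
    have : G 0 * ω ^ m = G 0 * deriv γ t ^ m / ((‖deriv γ t‖ ^ m : ℝ) : ℂ) := by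
      rw [hω, div_pow]; push_cast; ring
    rw [this, Complex.div_ofReal_re, hre, zero_div]
  have hb := hstar.im_coeff_le hn hG hG0 hfG hM hω1 hωre
  have hm0 : (0 : ℝ) < m := by exact_mod_cast hn
  rw [hκ, abs_mul, abs_neg, abs_of_pos (by positivity : (0 : ℝ) < 2 / m)]
  calc _ ≤ 2 / (m : ℝ) * (2 * (m + 1) * Real.cos (m * alpha₀ m)) :=
        mul_le_mul_of_nonneg_left hb (by positivity)
    _ = _ := by ring

/-- `u` is the real part of a holomorphic function; the Möbius map to the unit disc reduces to the
bound at the centre. The factor `φ' p` and the quotient `φ'' p / φ' p` produce the two terms of the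
bound. -/
theorem IsAdmissible.abs_curvature_le {u : ℂ → ℝ} {r₀ : ℝ} {n : ℕ} {p : ℂ} (hn : 1 ≤ n)
    (hp : ‖p‖ < r₀) (hu : IsAdmissible u r₀ n p) {γ : ℝ → ℂ}
    (hγ : IsNodalCurve u (Metric.ball 0 r₀) γ) {t : ℝ} (ht : γ t = p) :
    |curvature γ t| ≤ curvatureBound n r₀ p := by
  have hr₀ : 0 < r₀ := (norm_nonneg p).trans_lt hp
  have hpb : p ∈ Metric.ball (0 : ℂ) r₀ := by simpa using hp
  have hψ := isBiholomorphic_toUnitDisc hr₀ hp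
  have hφp : toUnitDisc r₀ p p = 0 := by simp [toUnitDisc]
  have hψ0 : ofUnitDisc r₀ p 0 = p := by
    have := hψ.left_inv p hpb
    rwa [hφp] at this
  obtain ⟨F, hF, hFu⟩ := hu.harmonic.exists_analyticOnNhd_ball_re_eq
  have hFp : (F p).re = 0 := (hFu hpb).trans hu.zero
  have hFd : DifferentiableOn ℂ (fun z => F z - F p) (Metric.ball 0 r₀) :=
    hF.differentiableOn.sub_const _
  have hψd : DifferentiableOn ℂ (ofUnitDisc r₀ p) (Metric.ball 0 1) := fun w hw =>
    (hψ.analyticAt_inv w hw).differentiableAt.differentiableWithinAt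
  have hFre : ∀ z ∈ Metric.ball (0 : ℂ) r₀, (F z - F p).re = u z := fun z hz => by
    rw [Complex.sub_re, hFp, sub_zero]; exact hFu hz
  set f : ℂ → ℂ := fun w => F (ofUnitDisc r₀ p w) - F p with hf
  have hfu : EqOn (u ∘ ofUnitDisc r₀ p) (fun w => (f w).re) (Metric.ball 0 1) := fun w hw =>
    (hFre _ (hψ.mapsTo_inv w hw)).symm
  have hfd : DifferentiableOn ℂ f (Metric.ball 0 1) := hFd.comp hψd hψ.mapsTo_inv
  have hf0 : f 0 = 0 := by rw [hf]; simp only [hψ0, sub_self]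
  have hnc : ¬ ∀ z ∈ Metric.ball (0 : ℂ) 1, f z = f 0 := fun hc =>
    hu.nonconstant ⟨0, fun z hz => by
      have h1 := hc _ (hψ.mapsTo z hz)
      rw [hf0, hf] at h1
      simp only [hψ.left_inv z hz] at h1
      rw [← hFre z hz, h1, Complex.zero_re]⟩
  have hnodal := (hψ.hasOnlyNodalCurvesThrough hu.nodal).congr hfu
  rw [hφp] at hnodal
  have hucont : ContinuousOn u (Metric.ball 0 r₀) := fun z hz =>
    ((Complex.continuous_re.comp_continuousOn hF.continuousOn).congr
      fun z hz => (hFu hz).symm) z hz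
  obtain ⟨M₀, hM₀⟩ := hu.boundary.exists_integral_le hr₀ hucont
  have hM₀' : ∀ᶠ R in 𝓝[<] r₀,
      ∫ θ in (0 : ℝ)..(2 * Real.pi), |(F (circleMap 0 R θ) - F p).re| ≤ M₀ := by
    filter_upwards [hM₀, Ioo_mem_nhdsLT hr₀] with R hR hR0
    refine le_of_eq_of_le (intervalIntegral.integral_congr fun θ _ => ?_) hR
    show |_| = |_|
    rw [hFre _ (by simpa [abs_of_pos hR0.1] using hR0.2)]
  obtain ⟨M, hM⟩ := exists_integral_comp_le hFd hψd hψ.mapsTo_inv hM₀'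
  have hκ := abs_curvature_le_of_center hn hfd hf0 hnc hnodal hM
    ((hψ.isNodalCurve hγ).congr hfu) (t := t) (by simp [ht, hφp])
  have hd : 0 < r₀ ^ 2 - ‖p‖ ^ 2 := by nlinarith [norm_nonneg p]
  have hγt := hγ.1 t
  have hc := curvature_comp (φ := toUnitDisc r₀ p) (γ := γ) (t := t)
    (by rw [ht]; exact hψ.analyticAt p hpb) (by rw [ht]; exact hψ.deriv_ne_zero hpb) hγt.1 hγt.2
  rw [ht, deriv_deriv_toUnitDisc_self hr₀ hp, deriv_toUnitDisc_self hr₀ hp, Complex.norm_real,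
    Real.norm_of_nonneg (by positivity)] at hc
  have him : |(2 * (starRingEnd ℂ) p / ((r₀ ^ 2 - ‖p‖ ^ 2 : ℝ) : ℂ) *
      (deriv γ t / ‖deriv γ t‖)).im| ≤ 2 * ‖p‖ / (r₀ ^ 2 - ‖p‖ ^ 2) := by
    refine (Complex.abs_im_le_norm _).trans_eq ?_
    rw [norm_mul, norm_div, norm_div, norm_mul, RCLike.norm_conj, Complex.norm_real,
      Complex.norm_real, norm_norm, div_self (norm_pos_iff.2 hγt.2).ne', mul_one,
      Real.norm_of_nonneg hd.le]
    simp
  rw [hc]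
  refine (abs_sub _ _).trans ?_
  rw [curvatureBound, abs_mul, abs_of_pos (by positivity : 0 < r₀ / (r₀ ^ 2 - ‖p‖ ^ 2))]
  refine add_le_add ((mul_le_mul_of_nonneg_left hκ (by positivity)).trans_eq ?_) him
  have : (n : ℝ) ≠ 0 := by exact_mod_cast (by omega : n ≠ 0)
  field_simp

/-! ### An argument estimate -/

/-- The Cusa–Huygens inequality. -/
theorem three_mul_sin_le {ω : ℝ} (h0 : 0 ≤ ω) (hπ : ω ≤ Real.pi) :
    3 * Real.sin ω ≤ ω * (2 + Real.cos ω) := by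
  have hd : ∀ x : ℝ, HasDerivAt (fun x => x * (2 + Real.cos x) - 3 * Real.sin x)
      (1 * (2 + Real.cos x) + x * (-Real.sin x) - 3 * Real.cos x) x := fun x =>
    ((hasDerivAt_id x).mul ((Real.hasDerivAt_cos x).const_add 2)).sub
      ((Real.hasDerivAt_sin x).const_mul 3)
  have hmono : MonotoneOn (fun x => x * (2 + Real.cos x) - 3 * Real.sin x) (Icc 0 Real.pi) := by
    refine monotoneOn_of_deriv_nonneg (convex_Icc _ _) (by fun_prop)
      (fun x _ => (hd x).differentiableAt.differentiableWithinAt) fun x hx => ?_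
    rw [interior_Icc] at hx
    rw [(hd x).deriv]
    have hx2 : 0 < x / 2 := by linarith [hx.1]
    have hx3 : x / 2 < Real.pi / 2 := by linarith [hx.2]
    have hs : 0 < Real.sin (x / 2) := Real.sin_pos_of_pos_of_lt_pi hx2 (by linarith [hx.2])
    have hc : 0 < Real.cos (x / 2) := Real.cos_pos_of_mem_Ioo ⟨by linarith, hx3⟩
    have ht := Real.lt_tan hx2 hx3
    rw [Real.tan_eq_sin_div_cos, lt_div_iff₀ hc] at ht
    have e1 : Real.sin x = 2 * Real.sin (x / 2) * Real.cos (x / 2) := by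
      rw [← Real.sin_two_mul]; ring_nf
    have e2 : Real.cos x = 1 - 2 * Real.sin (x / 2) ^ 2 := by
      have := Real.cos_two_mul (x / 2)
      rw [mul_div_cancel₀ x two_ne_zero, Real.cos_sq'] at this
      linarith
    rw [e1, e2]
    nlinarith [mul_pos hs (sub_pos.2 ht)]
  have := hmono ⟨le_rfl, Real.pi_pos.le⟩ ⟨h0, hπ⟩ h0
  simp at this
  linarith

/-- The polynomial form of `n tan β < ω` in `re_pow_mul_pos`, with `ρ = |q|` and `c = cos ω`, once
the sine has been removed by the Cusa–Huygens inequality. -/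
theorem polynomial_estimate_of_two_le {n τ ρ c : ℝ} (hn : 2 ≤ n) (hτ0 : 0 ≤ τ)
    (hτ : (n + 1) ^ 2 * τ ^ 2 ≤ 3) (hρ0 : 0 ≤ ρ) (hρ : (2 * n + 1) * ρ ^ 2 ≤ 1 + τ ^ 2)
    (hc1 : -1 ≤ c) (hc2 : c ≤ 1) :
    2 * n / 3 * ρ * (2 + c) * (τ - ρ * c) < 1 + τ ^ 2 - 2 * τ * ρ * c + ρ ^ 2 * (2 * c ^ 2 - 1) := by
  set P := ρ ^ 2 with hP
  set E := 1 + τ ^ 2 with hE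
  set B := 2 * n / 3 * (2 + c) + 2 * c with hB
  have hP0 : 0 ≤ P := sq_nonneg _
  have hE1 : 1 ≤ E := by nlinarith [sq_nonneg τ]
  have hcc : -1 ≤ 2 * c + c ^ 2 := by nlinarith [sq_nonneg (c + 1)]
  have hX0 : 0 ≤ (n + 1) * τ * ρ := by positivity
  have key : 0 < (n + 1) * (E - P + 2 * P * c ^ 2 + 2 * n / 3 * P * (2 * c + c ^ 2)) -
      B * ((n + 1) * τ * ρ) := by
    rcases lt_or_ge B 0 with hB0 | hB0
    · have h1 : 0 < E - P + 2 * P * c ^ 2 + 2 * n / 3 * P * (2 * c + c ^ 2) := by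
        have h2 : 2 * n / 3 * P * (-1) ≤ 2 * n / 3 * P * (2 * c + c ^ 2) :=
          mul_le_mul_of_nonneg_left hcc (by positivity)
        have h3 : 0 ≤ 2 * P * c ^ 2 := by positivity
        have h4 : 0 ≤ (n - 2) * P := mul_nonneg (by linarith) hP0
        linarith
      have h4 : 0 < (n + 1) * (E - P + 2 * P * c ^ 2 + 2 * n / 3 * P * (2 * c + c ^ 2)) :=
        mul_pos (by linarith) h1
      have h5 : B * ((n + 1) * τ * ρ) ≤ 0 := mul_nonpos_of_nonpos_of_nonneg hB0.le hX0
      linarith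
    -- With `X = (n + 1) τ ρ`, `X² ≤ 3 P` and `(X - 4/5)² ≥ 0` give `X ≤ 5/8 X² + 2/5`. The mixed
    -- term is thereby replaced by an expression linear in `P`.
    · have hX : (n + 1) * τ * ρ ≤ 15 / 8 * P + 2 / 5 := by
        have h1 : ((n + 1) * τ * ρ) ^ 2 ≤ 3 * P := by
          have : ((n + 1) * τ * ρ) ^ 2 = (n + 1) ^ 2 * τ ^ 2 * P := by rw [hP]; ring
          rw [this]; exact mul_le_mul_of_nonneg_right hτ hP0
        linarith [sq_nonneg ((n + 1) * τ * ρ - 4 / 5)]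
      have hBX := mul_le_mul_of_nonneg_left hX hB0
      have hBle : B ≤ 2 * (n + 1) := by
        have := mul_le_mul_of_nonneg_left hc2 (by linarith : 0 ≤ 2 * n / 3)
        rw [hB]; linarith
      set K := (n + 1) * (-1 + 2 * c ^ 2 + 2 * n / 3 * (2 * c + c ^ 2)) - 15 / 8 * B with hK
      -- The case `E = 1` at the extreme value `(2n + 1) P = E`, expanded around `n = 2`; each
      -- coefficient is a positive quadratic in `c`.
      have hS : 0 < (2 * n + 1) * (n + 1) + K - 2 / 5 * B * (2 * n + 1) := by
        have e : (2 * n + 1) * (n + 1) + K - 2 / 5 * B * (2 * n + 1) =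
            (n - 2) ^ 2 * (14 / 15 + 4 / 5 * c + 2 / 3 * c ^ 2) +
            (n - 2) * (27 / 10 + 17 / 12 * c + 16 / 3 * c ^ 2) +
            (5 / 3 - 59 / 12 * c + 10 * c ^ 2) := by
          rw [hK, hB]; ring
        rw [e]
        have h1 : 0 ≤ (n - 2) ^ 2 * (14 / 15 + 4 / 5 * c + 2 / 3 * c ^ 2) :=
          mul_nonneg (sq_nonneg _) (by nlinarith [sq_nonneg (c + 3 / 5)])
        have h2 : 0 ≤ (n - 2) * (27 / 10 + 17 / 12 * c + 16 / 3 * c ^ 2) :=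
          mul_nonneg (by linarith) (by nlinarith [sq_nonneg (c + 1 / 8)])
        have h3 : 0 < 5 / 3 - 59 / 12 * c + 10 * c ^ 2 := by nlinarith [sq_nonneg (c - 1 / 4)]
        linarith
      -- Linear in `P`: for `K ≥ 0` the end `P = 0` decides, for `K < 0` the end `P = E / (2n + 1)`.
      have hmain : 0 < (n + 1) * E + P * K - 2 / 5 * B := by
        rcases le_or_gt 0 K with hK0 | hK0
        · have h1 := mul_nonneg hP0 hK0
          have h2 : (n + 1) * 1 ≤ (n + 1) * E := mul_le_mul_of_nonneg_left hE1 (by linarith)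
          linarith
        · have hBN : 0 ≤ 2 / 5 * B * (2 * n + 1) := by positivity
          have h1 : 0 < (2 * n + 1) * ((n + 1) * E + P * K - 2 / 5 * B) := by
            have e : (2 * n + 1) * ((n + 1) * E + P * K - 2 / 5 * B) =
                (E * -K - (2 * n + 1) * P * -K) + (E - 1) * ((2 * n + 1) * (n + 1) + K) +
                ((2 * n + 1) * (n + 1) + K - 2 / 5 * B * (2 * n + 1)) := by ring
            have h2 := mul_le_mul_of_nonneg_right hρ (neg_nonneg.2 hK0.le)
            have h3 := mul_nonneg (sub_nonneg.2 hE1)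
              (by linarith : 0 ≤ (2 * n + 1) * (n + 1) + K)
            rw [e]
            linarith
          exact pos_of_mul_pos_right h1 (by linarith)
      have e : (n + 1) * (E - P + 2 * P * c ^ 2 + 2 * n / 3 * P * (2 * c + c ^ 2)) -
          B * (15 / 8 * P + 2 / 5) = (n + 1) * E + P * K - 2 / 5 * B := by
        rw [hK]; ring
      linarith
  have h1 : (n + 1) * (E - P + 2 * P * c ^ 2 + 2 * n / 3 * P * (2 * c + c ^ 2)) -
      B * ((n + 1) * τ * ρ) = (n + 1) * (E - 2 * τ * ρ * c + P * (2 * c ^ 2 - 1) -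
        2 * n / 3 * ρ * (2 + c) * (τ - ρ * c)) := by
    rw [hB, hP]; ring
  rw [h1] at key
  have := pos_of_mul_pos_right key (by linarith)
  linarith

theorem polynomial_estimate_of_eq_zero {n ρ c : ℝ} (hn : 1 ≤ n)
    (hρ : (2 * n + 1) * ρ ^ 2 ≤ 1) :
    2 * n / 3 * ρ * (2 + c) * (0 - ρ * c) < 1 + ρ ^ 2 * (2 * c ^ 2 - 1) := by
  have h2 : 2 * n / 3 * ρ ^ 2 * (-1) ≤ 2 * n / 3 * ρ ^ 2 * (2 * c + c ^ 2) :=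
    mul_le_mul_of_nonneg_left (by nlinarith [sq_nonneg (c + 1)]) (by positivity)
  have h3 : 0 ≤ 2 * ρ ^ 2 * c ^ 2 := by positivity
  nlinarith

/-- In a small half-disc about `-iτ`, the function `(1 - s ^ 2) ^ n * (s + iτ)` has positive real
part. -/
theorem re_pow_mul_pos {n : ℕ} (hn : 1 ≤ n) {τ : ℝ} (hτ0 : 0 ≤ τ)
    (hτ : τ = 0 ∨ 2 ≤ n ∧ ((n : ℝ) + 1) ^ 2 * τ ^ 2 ≤ 3) {s : ℂ} (hs : 0 < s.re)
    (hsmall : (2 * (n : ℝ) + 1) * ‖s + τ * Complex.I‖ ^ 2 ≤ 1 + τ ^ 2) :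
    0 < ((1 - s ^ 2) ^ n * (s + τ * Complex.I)).re := by
  have hn1 : (1 : ℝ) ≤ n := by exact_mod_cast hn
  set q : ℂ := s + τ * Complex.I with hq
  set v : ℂ := 1 - s ^ 2 with hv
  set x := q.re with hx
  set η := q.im with hη
  have hx' : s.re = x := by simp [hx, hq]
  have hη' : s.im = η - τ := by simp [hη, hq]
  have hx0 : 0 < x := hx' ▸ hs
  have hqsq : ‖q‖ ^ 2 = x ^ 2 + η ^ 2 := by
    rw [← Complex.normSq_eq_norm_sq, Complex.normSq_apply]; ring
  have hvre : v.re = 1 + (τ - η) ^ 2 - x ^ 2 := by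
    simp [hv, pow_two, hx', hη']; ring
  have hvim : v.im = 2 * x * (τ - η) := by
    simp [hv, pow_two, hx', hη']; ring
  have hR : ((n : ℝ) + 1) * (x ^ 2 + η ^ 2) ≤ 1 := by
    have h1 : ((n : ℝ) + 1) * (1 + τ ^ 2) ≤ 2 * n + 1 := by
      rcases hτ with rfl | ⟨h2, h3⟩
      · nlinarith
      · have : (2 : ℝ) ≤ n := by exact_mod_cast h2
        nlinarith [mul_nonneg (by linarith : (0 : ℝ) ≤ n - 2) (by positivity : 0 ≤ ((n : ℝ) + 1) * τ ^ 2)]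
    rw [hqsq] at hsmall
    have h4 := mul_le_mul_of_nonneg_left hsmall (by linarith : (0 : ℝ) ≤ n + 1)
    have h5 : (2 * (n : ℝ) + 1) * (((n : ℝ) + 1) * (x ^ 2 + η ^ 2)) ≤ (2 * n + 1) * 1 := by
      nlinarith
    exact le_of_mul_le_mul_left h5 (by linarith)
  have hvre0 : 0 < v.re := by
    rw [hvre]; nlinarith [sq_nonneg (τ - η), sq_nonneg η, sq_nonneg x]
  have hv0 : v ≠ 0 := fun h => by rw [h] at hvre0; simp at hvre0
  have hq0 : q ≠ 0 := fun h => by rw [hx, h] at hx0; simp at hx0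
  set β := Complex.arg v with hβ
  set χ := Complex.arg q with hχ
  have hβ' := abs_lt.1 (Complex.abs_arg_lt_pi_div_two_iff.2 (Or.inl hvre0))
  have hχ' := abs_lt.1 (Complex.abs_arg_lt_pi_div_two_iff.2 (Or.inl hx0))
  rw [← hβ] at hβ'
  rw [← hχ] at hχ'
  have htan : Real.tan β = 2 * x * (τ - η) / (1 + (τ - η) ^ 2 - x ^ 2) := by
    rw [hβ, Complex.tan_arg, hvre, hvim]
  have hval : v ^ n * q = ((‖v‖ ^ n * ‖q‖ : ℝ) : ℂ) * Complex.exp ((n * β + χ : ℝ) * Complex.I) := by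
    conv_lhs => rw [← Complex.norm_mul_exp_arg_mul_I v, ← Complex.norm_mul_exp_arg_mul_I q]
    rw [mul_pow, ← Complex.exp_nat_mul, mul_mul_mul_comm, ← Complex.exp_add]
    push_cast
    congr 2
    ring
  rw [hval, Complex.re_ofReal_mul, Complex.exp_ofReal_mul_I_re]
  refine mul_pos (mul_pos (pow_pos (norm_pos_iff.2 hv0) _) (norm_pos_iff.2 hq0))
    (Real.cos_pos_of_mem_Ioo ?_)
  rw [hvre] at hvre0
  have hρ0 : 0 < ‖q‖ := norm_pos_iff.2 hq0
  -- The claim is `|n β + χ| < π / 2`. If `τ ≤ Im q`, then `β ≤ 0 ≤ χ` and `n |β| ≤ 1`, so each side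
  -- is easy; the delicate case is `β > 0`.
  rcases le_or_gt τ η with hητ | hητ
  · have hβ0 : β ≤ 0 := by
      by_contra hcon
      have h1 : 0 < Real.tan β := Real.tan_pos_of_pos_of_lt_pi_div_two (not_le.1 hcon) hβ'.2
      rw [htan, lt_div_iff₀ hvre0, zero_mul] at h1
      nlinarith
    have hχ0 : 0 ≤ χ := Complex.arg_nonneg_iff.2 (hτ0.trans hητ)
    refine ⟨?_, by nlinarith⟩
    have h1 : -β ≤ Real.tan (-β) := Real.le_tan (by linarith) (by linarith)
    have h2 : (n : ℝ) * -β ≤ 1 := by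
      refine (mul_le_mul_of_nonneg_left h1 (by linarith)).trans ?_
      rw [Real.tan_neg, htan, ← neg_div, mul_div_assoc', div_le_one hvre0]
      nlinarith [sq_nonneg (x - η), sq_nonneg (τ - η), mul_nonneg hx0.le hτ0]
    linarith [Real.pi_gt_three]
  · have hβ0 : 0 ≤ β := by
      rw [hβ, Complex.arg_nonneg_iff, hvim]; nlinarith
    refine ⟨by nlinarith, ?_⟩
    -- `ω` is the angle of `q` with the upper imaginary axis, so `n β < ω` is needed. The bound `β ≤
    -- tan β` and `3 sin ω ≤ ω (2 + cos ω)` make both sides proportional to `ω`.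
    set ω := Real.pi / 2 - χ with hω
    have hxω : x = ‖q‖ * Real.sin ω := by
      rw [hω, Real.sin_pi_div_two_sub, hχ, hx, Complex.norm_mul_cos_arg]
    have hηω : η = ‖q‖ * Real.cos ω := by
      rw [hω, Real.cos_pi_div_two_sub, hχ, hη, Complex.norm_mul_sin_arg]
    have hω0 : 0 < ω := by linarith
    have hωπ : ω ≤ Real.pi := by linarith
    have h1 : β ≤ Real.tan β := Real.le_tan hβ0 hβ'.2
    have hpoly : 2 * (n : ℝ) / 3 * ‖q‖ * (2 + Real.cos ω) * (τ - ‖q‖ * Real.cos ω) <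
        1 + τ ^ 2 - 2 * τ * ‖q‖ * Real.cos ω + ‖q‖ ^ 2 * (2 * Real.cos ω ^ 2 - 1) := by
      rcases hτ with hτ | ⟨h2, h3⟩
      · have := polynomial_estimate_of_eq_zero (c := Real.cos ω) hn1 (ρ := ‖q‖)
          (by rw [hτ] at hsmall; simpa using hsmall)
        rw [hτ]; linarith
      · exact polynomial_estimate_of_two_le (by exact_mod_cast h2) hτ0 h3 hρ0.le hsmall
          (Real.neg_one_le_cos _) (Real.cos_le_one _)
    have hden : 1 + (τ - η) ^ 2 - x ^ 2 =
        1 + τ ^ 2 - 2 * τ * ‖q‖ * Real.cos ω + ‖q‖ ^ 2 * (2 * Real.cos ω ^ 2 - 1) := by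
      have := Real.sin_sq_add_cos_sq ω
      rw [hxω, hηω]
      linear_combination (-‖q‖ ^ 2) * this
    have h3 : (n : ℝ) * Real.tan β < ω := by
      rw [htan, mul_div_assoc', div_lt_iff₀ hvre0, hden]
      have h4 : 3 * x ≤ ‖q‖ * (ω * (2 + Real.cos ω)) := by
        rw [hxω, mul_left_comm]
        exact mul_le_mul_of_nonneg_left (three_mul_sin_le hω0.le hωπ) hρ0.le
      have h5 : (n : ℝ) * (2 * x * (τ - η)) ≤
          ω * (2 * (n : ℝ) / 3 * ‖q‖ * (2 + Real.cos ω) * (τ - ‖q‖ * Real.cos ω)) := by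
        have := mul_le_mul_of_nonneg_left h4
          (mul_nonneg (by linarith) (sub_nonneg.2 hητ.le) : 0 ≤ (n : ℝ) * (τ - η))
        rw [← hηω]
        linarith
      exact h5.trans_lt (mul_lt_mul_of_pos_left hpoly hω0)
    have h6 : (n : ℝ) * β ≤ n * Real.tan β := mul_le_mul_of_nonneg_left h1 (by linarith)
    linarith

/-! ### Functions whose nodal set is a star -/

/-- The argument of `z ^ n * exp (L z)` at `z = r e^{iθ}`, as a function of `(r, θ)`. -/
noncomputable def phase (n : ℕ) (L : ℂ → ℂ) (x : ℝ × ℝ) : ℝ :=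
  n * x.2 + (L (circleMap 0 x.1 x.2)).im

/-- The part of the unit disc where the `n`-th root `z * exp (L z / n)` of `z ^ n * exp (L z)`
lies on the line through `0` with argument `c / n`. -/
def phaseSet (n : ℕ) (L : ℂ → ℂ) (c : ℝ) : Set ℂ :=
  {z | z ∈ Metric.ball (0 : ℂ) 1 ∧
    (z * Complex.exp (L z / n) * Complex.exp (-((c / n : ℝ) * Complex.I))).im = 0}

section Phase

variable {n : ℕ} {L : ℂ → ℂ}

theorem re_pow_mul_exp_circleMap (r θ : ℝ) :
    (circleMap 0 r θ ^ n * Complex.exp (L (circleMap 0 r θ))).re =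
      r ^ n * Real.exp (L (circleMap 0 r θ)).re * Real.cos (phase n L (r, θ)) := by
  set w := L (circleMap 0 r θ) with hw
  have h1 : circleMap 0 r θ ^ n * Complex.exp w =
      ((r ^ n * Real.exp w.re : ℝ) : ℂ) * Complex.exp ((n * θ + w.im : ℝ) * Complex.I) := by
    conv_lhs => rw [← Complex.re_add_im w]
    rw [circleMap_zero, mul_pow, ← Complex.exp_nat_mul, Complex.exp_add]
    push_cast
    rw [add_mul, Complex.exp_add, mul_assoc (n : ℂ)]
    ring
  rw [h1, Complex.re_ofReal_mul, Complex.exp_ofReal_mul_I_re, phase, ← hw]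

theorem im_mul_exp_circleMap (hn : n ≠ 0) (c r θ : ℝ) :
    (circleMap 0 r θ * Complex.exp (L (circleMap 0 r θ) / n) *
      Complex.exp (-((c / n : ℝ) * Complex.I))).im =
      r * Real.exp ((L (circleMap 0 r θ)).re / n) * Real.sin ((phase n L (r, θ) - c) / n) := by
  set w := L (circleMap 0 r θ) with hw
  have hn' : (n : ℂ) ≠ 0 := by exact_mod_cast hn
  have h1 : circleMap 0 r θ * Complex.exp (w / n) * Complex.exp (-((c / n : ℝ) * Complex.I)) =
      ((r * Real.exp (w.re / n) : ℝ) : ℂ) *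
        Complex.exp (((n * θ + w.im - c) / n : ℝ) * Complex.I) := by
    conv_lhs => rw [← Complex.re_add_im w]
    rw [circleMap_zero, mul_assoc, mul_assoc, ← Complex.exp_add, ← Complex.exp_add]
    push_cast
    rw [mul_assoc, ← Complex.exp_add]
    congr 2
    field_simp
    ring
  rw [h1, Complex.im_ofReal_mul, Complex.exp_ofReal_mul_I_im, phase, ← hw]

theorem circleMap_norm_arg (z : ℂ) : circleMap 0 ‖z‖ (Complex.arg z) = z := by
  rw [circleMap_zero, Complex.norm_mul_exp_arg_mul_I]

theorem mem_phaseSet_iff (hn : n ≠ 0) {c : ℝ} {z : ℂ} :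
    z ∈ phaseSet n L c ↔ ‖z‖ < 1 ∧
      (z = 0 ∨ ∃ m : ℤ, phase n L (‖z‖, Complex.arg z) = c + m * (n * Real.pi)) := by
  have hn' : (n : ℝ) ≠ 0 := by exact_mod_cast hn
  have h1 := im_mul_exp_circleMap (L := L) hn c ‖z‖ (Complex.arg z)
  rw [circleMap_norm_arg] at h1
  rw [phaseSet, mem_ofPred_eq, h1, mem_ball_zero_iff]
  refine and_congr_right fun _ => ?_
  rw [mul_eq_zero, mul_eq_zero, norm_eq_zero, or_iff_left (Real.exp_pos _).ne',
    Real.sin_eq_zero_iff]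
  refine or_congr Iff.rfl (exists_congr fun m => ?_)
  rw [eq_div_iff hn', eq_sub_iff_add_eq]
  constructor <;> intro h <;> linarith

theorem phaseSet_eq_of_mem (hn : n ≠ 0) {c c' : ℝ} {z : ℂ} (hz0 : z ≠ 0)
    (hz : z ∈ phaseSet n L c) (hz' : z ∈ phaseSet n L c') :
    phaseSet n L c = phaseSet n L c' ∧ ∃ m : ℤ, c = c' + m * (n * Real.pi) := by
  obtain ⟨-, h | ⟨m, hm⟩⟩ := (mem_phaseSet_iff hn).1 hz
  · exact absurd h hz0
  obtain ⟨-, h | ⟨m', hm'⟩⟩ := (mem_phaseSet_iff hn).1 hz'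
  · exact absurd h hz0
  have hc : c = c' + ((m' - m : ℤ) : ℝ) * (n * Real.pi) := by push_cast; linarith
  refine ⟨Set.ext fun w => ?_, _, hc⟩
  rw [mem_phaseSet_iff hn, mem_phaseSet_iff hn]
  refine and_congr_right fun _ => or_congr Iff.rfl ⟨fun ⟨k, hk⟩ => ⟨k + (m' - m), ?_⟩,
    fun ⟨k, hk⟩ => ⟨k - (m' - m), ?_⟩⟩
  · rw [hk, hc]; push_cast; ring
  · rw [hk, hc]; push_cast; ring

theorem analyticAt_phase (hL : DifferentiableOn ℂ L (Metric.ball 0 1)) {r : ℝ} (hr : |r| < 1)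
    (θ : ℝ) : AnalyticAt ℝ (phase n L) (r, θ) := by
  have h1 : AnalyticAt ℝ L (circleMap 0 r θ) :=
    (hL.analyticAt (Metric.isOpen_ball.mem_nhds (by simpa using hr))).restrictScalars
  have h2 : AnalyticAt ℝ (fun x : ℝ × ℝ => circleMap 0 x.1 x.2) (r, θ) := by
    have e1 : AnalyticAt ℝ (fun x : ℝ × ℝ => (x.1 : ℂ)) (r, θ) :=
      (Complex.ofRealCLM.comp (ContinuousLinearMap.fst ℝ ℝ ℝ)).analyticAt _
    have e2 : AnalyticAt ℝ (fun x : ℝ × ℝ => (x.2 : ℂ)) (r, θ) :=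
      (Complex.ofRealCLM.comp (ContinuousLinearMap.snd ℝ ℝ ℝ)).analyticAt _
    have e3 : AnalyticAt ℝ Complex.exp (θ * Complex.I) :=
      (analyticAt_cexp (z := (θ * Complex.I : ℂ))).restrictScalars
    simp only [circleMap_zero]
    exact e1.mul (AnalyticAt.comp (f := fun x : ℝ × ℝ => (x.2 : ℂ) * Complex.I) e3
      (e2.mul analyticAt_const))
  have h3 : AnalyticAt ℝ (fun x : ℝ × ℝ => L (circleMap 0 x.1 x.2)) (r, θ) :=
    AnalyticAt.comp (f := fun x : ℝ × ℝ => circleMap 0 x.1 x.2) h1 h2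
  exact (analyticAt_const.mul analyticAt_snd).add ((Complex.imCLM.analyticAt _).comp h3)

theorem hasDerivAt_phase (hL : DifferentiableOn ℂ L (Metric.ball 0 1)) {r : ℝ} (hr : |r| < 1)
    (θ : ℝ) : HasDerivAt (fun θ => phase n L (r, θ))
      (n + (circleMap 0 r θ * deriv L (circleMap 0 r θ)).re) θ := by
  have h1 : HasDerivAt L (deriv L (circleMap 0 r θ)) (circleMap 0 r θ) :=
    (hL.differentiableAt (Metric.isOpen_ball.mem_nhds (by simpa using hr))).hasDerivAt
  have h2 := hasDerivAt_comp_real h1 (hasDerivAt_circleMap 0 r θ)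
  have h3 := Complex.imCLM.hasFDerivAt.comp_hasDerivAt θ h2
  have h4 := ((hasDerivAt_id θ).const_mul (n : ℝ)).add h3
  refine h4.congr_deriv ?_
  simp only [mul_one, Complex.imCLM_apply]
  rw [← mul_assoc, Complex.mul_I_im, mul_comm (deriv L _)]

end Phase

section Star

variable {n : ℕ} {L : ℂ → ℂ} (hn : n ≠ 0) (hL : DifferentiableOn ℂ L (Metric.ball 0 1))
  (hpos : ∀ z ∈ Metric.ball (0 : ℂ) 1, (z ^ n * Complex.exp (L z)).re = 0 →
    0 < n + (z * deriv L z).re)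

include hn hL hpos

/-- `hpos` says that the phase has positive angular derivative at the zeros of the real part, so the
level `c` is only crossed upwards, hence at most once. It is attained because the phase differs from
`n θ` by a bounded function. -/
theorem existsUnique_phase_eq {c : ℝ} (hc : Real.cos c = 0) {r : ℝ} (hr : |r| < 1) :
    ∃! θ, phase n L (r, θ) = c := by
  have hn0 : (0 : ℝ) < n := by exact_mod_cast Nat.pos_of_ne_zero hn
  have hd := hasDerivAt_phase (n := n) hL hr
  have hcont : Continuous fun θ => phase n L (r, θ) :=
    continuous_iff_continuousAt.2 fun θ => (hd θ).continuousAt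
  have hroot : ∀ θ, c = phase n L (r, θ) →
      0 < n + (circleMap 0 r θ * deriv L (circleMap 0 r θ)).re := fun θ h =>
    hpos _ (by simpa using hr) (by rw [re_pow_mul_exp_circleMap, ← h, hc, mul_zero])
  have huniq : ∀ a b, a < b → phase n L (r, a) = c → phase n L (r, b) = c → False := by
    intro a b hab ha hb
    have h1 := image_le_of_deriv_right_lt_deriv_boundary (f := fun _ => c) (f' := fun _ => 0)
      (a := a) (b := b) continuousOn_const (fun x _ => hasDerivWithinAt_const _ _ _) ha.symm.le hd
      (fun x _ hx => hroot x hx)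
    have h2 := (hd b).tendsto_slope.eventually (lt_mem_nhds (hroot b hb.symm))
    have h3 : ∀ᶠ x in 𝓝[<] b, 0 < slope (fun θ => phase n L (r, θ)) b x :=
      h2.filter_mono (nhdsWithin_mono _ fun x hx => (ne_of_lt hx : x ≠ b))
    obtain ⟨x, hx1, hx2⟩ := (h3.and (Ioo_mem_nhdsLT hab)).exists
    have h4 := h1 ⟨hx2.1.le, hx2.2.le⟩
    rw [slope_def_field] at hx1
    simp only [hb] at hx1
    have : (phase n L (r, x) - c) / (x - b) ≤ 0 :=
      div_nonpos_of_nonneg_of_nonpos (by linarith) (by linarith [hx2.2])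
    linarith
  obtain ⟨M, hM⟩ : ∃ M, ∀ θ, |(L (circleMap 0 r θ)).im| ≤ M := by
    obtain ⟨M, hM⟩ := (isCompact_sphere (0 : ℂ) |r|).exists_bound_of_continuousOn
      (hL.continuousOn.mono (Metric.sphere_subset_closedBall.trans
        (Metric.closedBall_subset_ball hr)))
    exact ⟨M, fun θ => (Complex.abs_im_le_norm _).trans (hM _ (circleMap_mem_sphere' 0 r θ))⟩
  obtain ⟨θ, hθ⟩ : c ∈ range fun θ => phase n L (r, θ) := by
    refine mem_range_of_exists_le_of_exists_ge hcont ⟨(c - M) / n, ?_⟩ ⟨(c + M) / n, ?_⟩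
    · rw [phase, mul_div_cancel₀ _ hn0.ne']
      linarith [(abs_le.1 (hM ((c - M) / n))).2]
    · rw [phase, mul_div_cancel₀ _ hn0.ne']
      linarith [(abs_le.1 (hM ((c + M) / n))).1]
  refine ⟨θ, hθ, fun θ' hθ' => ?_⟩
  rcases lt_trichotomy θ θ' with h | h | h
  · exact (huniq _ _ h hθ hθ').elim
  · exact h.symm
  · exact (huniq _ _ h hθ' hθ).elim

/-- The implicit function theorem, applicable because the angular derivative is positive. Signed
radii, with `0` included, let the solution pass analytically through the origin. -/
theorem exists_analytic_phase_solution {c : ℝ} (hc : Real.cos c = 0) :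
    ∃ ϑ : ℝ → ℝ, ∀ r ∈ Ioo (-1 : ℝ) 1,
      AnalyticAt ℝ ϑ r ∧ ∀ θ, phase n L (r, θ) = c ↔ θ = ϑ r := by
  have hex : ∀ r : ℝ, ∃ ϑ : ℝ, |r| < 1 → ∀ θ, phase n L (r, θ) = c ↔ θ = ϑ := fun r => by
    by_cases hr : |r| < 1
    · obtain ⟨ϑ, h1, h2⟩ := existsUnique_phase_eq hn hL hpos hc hr
      exact ⟨ϑ, fun _ θ => ⟨h2 θ, fun h => h ▸ h1⟩⟩
    · exact ⟨0, fun h => absurd h hr⟩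
  choose ϑ hϑ using hex
  refine ⟨ϑ, fun r hr => ⟨?_, hϑ r (abs_lt.2 hr)⟩⟩
  have hr' : |r| < 1 := abs_lt.2 hr
  have hroot := (hϑ r hr' _).2 rfl
  have hcd : ContDiffAt ℝ ⊤ (phase n L) (r, ϑ r) := (analyticAt_phase hL hr' (ϑ r)).contDiffAt
  have hd := hasDerivAt_phase (n := n) hL hr' (ϑ r)
  set d := n + (circleMap 0 r (ϑ r) * deriv L (circleMap 0 r (ϑ r))).re with hdef
  have hd0 : 0 < d := hpos _ (by simpa using hr')
    (by rw [re_pow_mul_exp_circleMap, hroot, hc, mul_zero])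
  have hinv : (fderiv ℝ (phase n L) (r, ϑ r) ∘L .inr ℝ ℝ ℝ).IsInvertible := by
    refine ⟨ContinuousLinearEquiv.unitsEquivAut ℝ (Units.mk0 d hd0.ne'), ?_⟩
    ext
    have h1 : HasFDerivAt (phase n L) (fderiv ℝ (phase n L) (r, ϑ r)) (r, ϑ r) :=
      (analyticAt_phase hL hr' (ϑ r)).differentiableAt.hasFDerivAt
    have h2 : HasDerivAt (fun θ : ℝ => (r, θ)) ((0 : ℝ), (1 : ℝ)) (ϑ r) :=
      (hasDerivAt_const _ _).prodMk (hasDerivAt_id _)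
    have h3 := (h1.comp_hasDerivAt (ϑ r) h2).unique hd
    simp only [ContinuousLinearMap.comp_apply, ContinuousLinearMap.inr_apply]
    rw [h3]
    simp
  have hψ := hcd.contDiffAt_implicitFunction (by simp) hinv
  have hψ' : AnalyticAt ℝ (hcd.implicitFunction (by simp) hinv) r :=
    analyticWithinAt_univ.1 (contDiffWithinAt_omega_iff_analyticWithinAt.1 hψ.contDiffWithinAt)
  refine hψ'.congr ?_
  filter_upwards [hcd.eventually_apply_implicitFunction (by simp) hinv,
    isOpen_Ioo.mem_nhds hr] with x hx hx1
  exact (hϑ x (abs_lt.2 hx1) _).1 (hx.trans hroot)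

/-- The curve is `r ↦ r e^{iϑ(r)}` with signed radius in `(-1, 1)`: negative `r` gives the opposite
branch, and the derivative at `r = 0` is `e^{iϑ(0)} ≠ 0`. -/
theorem exists_curve_phaseSet {c : ℝ} (hc : Real.cos c = 0) :
    ∃ γ : ℝ → ℂ, IsRegularAnalyticCurve γ ∧ range γ = phaseSet n L c ∧
      phaseSet n L c ⊆ reNodal (fun z => z ^ n * Complex.exp (L z)) ∧
      (∃ z ∈ phaseSet n L c, z ≠ 0) ∧
      ∃ t s : ℝ, γ t = 0 ∧
        deriv γ t = s * Complex.exp (((c - (L 0).im) / n : ℝ) * Complex.I) := by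
  have hn0 : (n : ℝ) ≠ 0 := by exact_mod_cast hn
  obtain ⟨ϑ, hϑ⟩ := exists_analytic_phase_solution hn hL hpos hc
  obtain ⟨p, hp, hpr⟩ := exists_analytic_parametrization (U := Ioo (-1 : ℝ) 1) isOpen_Ioo
    isPreconnected_Ioo ⟨0, by norm_num⟩
  have hpI : ∀ t, p t ∈ Ioo (-1 : ℝ) 1 := fun t => hpr ▸ mem_range_self t
  set g : ℝ → ℂ := fun r => circleMap 0 r (ϑ r) with hg
  have hga : ∀ r ∈ Ioo (-1 : ℝ) 1, AnalyticAt ℝ g r := fun r hr => by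
    have e1 : AnalyticAt ℝ (fun x : ℝ => (x : ℂ)) r := Complex.ofRealCLM.analyticAt _
    have e2 : AnalyticAt ℝ (fun x : ℝ => (ϑ x : ℂ)) r :=
      (Complex.ofRealCLM.analyticAt _).comp (hϑ r hr).1
    have e3 : AnalyticAt ℝ Complex.exp (ϑ r * Complex.I) :=
      (analyticAt_cexp (z := (ϑ r * Complex.I : ℂ))).restrictScalars
    simp only [hg, circleMap_zero]
    exact e1.mul (AnalyticAt.comp (f := fun x : ℝ => (ϑ x : ℂ) * Complex.I) e3
      (e2.mul analyticAt_const))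
  have hgd : ∀ r ∈ Ioo (-1 : ℝ) 1, HasDerivAt g
      (Complex.exp (ϑ r * Complex.I) * (1 + (r * deriv ϑ r : ℝ) * Complex.I)) r := fun r hr => by
    have e1 : HasDerivAt (fun x : ℝ => (x : ℂ)) 1 r := Complex.ofRealCLM.hasDerivAt
    have e2 : HasDerivAt (fun x : ℝ => (ϑ x : ℂ) * Complex.I) (deriv ϑ r * Complex.I) r :=
      ((hϑ r hr).1.differentiableAt.hasDerivAt.ofReal_comp).mul_const _
    have e3 := e1.mul e2.cexp
    have e4 : g = (fun x : ℝ => (x : ℂ)) * fun x => Complex.exp (ϑ x * Complex.I) := by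
      funext x; simp [hg, circleMap_zero]
    rw [e4]
    refine e3.congr_deriv ?_
    push_cast
    ring
  have hgset : g '' Ioo (-1 : ℝ) 1 = phaseSet n L c := by
    ext z
    constructor
    · rintro ⟨r, hr, rfl⟩
      refine ⟨by simpa [hg] using abs_lt.2 hr, ?_⟩
      rw [hg, im_mul_exp_circleMap hn, ((hϑ r hr).2 _).2 rfl]
      simp
    · intro hz
      obtain ⟨hz1, rfl | ⟨m, hm⟩⟩ := (mem_phaseSet_iff hn).1 hz
      · exact ⟨0, by norm_num, by simp [hg]⟩
      have hs : Real.sin (m * Real.pi) = 0 := Real.sin_int_mul_pi m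
      have hcs : Real.cos (m * Real.pi) ^ 2 = 1 := by
        have := Real.sin_sq_add_cos_sq (m * Real.pi)
        rw [hs] at this; linarith
      have habs : |Real.cos (m * Real.pi)| = 1 := by
        rw [← abs_one, ← sq_eq_sq_iff_abs_eq_abs, hcs, one_pow]
      -- A point whose phase is `c + m n π` is rewritten with radius `(-1)^m |z|` and angle `arg z -
      -- m π`; its phase is then exactly `c`.
      have hcirc : circleMap 0 (‖z‖ * Real.cos (m * Real.pi)) (Complex.arg z - m * Real.pi) = z := by
        conv_rhs => rw [← circleMap_norm_arg z]
        have h1 : Complex.exp ((m * Real.pi : ℝ) * Complex.I) = (Real.cos (m * Real.pi) : ℝ) := by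
          rw [Complex.exp_mul_I, ← Complex.ofReal_cos, ← Complex.ofReal_sin, hs]; simp
        have h2 : ((Real.cos (m * Real.pi) : ℝ) : ℂ) ≠ 0 := by
          have : Real.cos (m * Real.pi) ≠ 0 := fun h => by rw [h] at hcs; norm_num at hcs
          exact_mod_cast this
        rw [circleMap_zero, circleMap_zero, Complex.ofReal_sub, sub_mul, Complex.exp_sub, h1,
          Complex.ofReal_mul]
        field_simp
      have hrI : ‖z‖ * Real.cos (m * Real.pi) ∈ Ioo (-1 : ℝ) 1 := by
        refine abs_lt.1 ?_
        rw [abs_mul, habs, abs_norm, mul_one]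
        exact hz1
      refine ⟨_, hrI, ?_⟩
      show circleMap 0 _ (ϑ _) = z
      rw [← ((hϑ _ hrI).2 (Complex.arg z - m * Real.pi)).1, hcirc]
      rw [phase, circleMap_norm_arg] at hm
      rw [phase, hcirc]
      linarith
  have hcomp : ∀ t, HasDerivAt (g ∘ p) (deriv p t • (Complex.exp (ϑ (p t) * Complex.I) *
      (1 + (p t * deriv ϑ (p t) : ℝ) * Complex.I))) t := fun t =>
    (hgd (p t) (hpI t)).scomp t (hp t).1.differentiableAt.hasDerivAt
  refine ⟨g ∘ p, fun t => ⟨(hga _ (hpI t)).comp (hp t).1, ?_⟩, ?_, ?_, ?_, ?_⟩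
  · rw [(hcomp t).deriv]
    refine smul_ne_zero (hp t).2 (mul_ne_zero (Complex.exp_ne_zero _) fun h => ?_)
    have := congrArg Complex.re h
    rw [Complex.add_re, Complex.re_ofReal_mul] at this
    simp at this
  · rw [range_comp, hpr, hgset]
  · rw [← hgset]
    rintro _ ⟨r, hr, rfl⟩
    refine ⟨by simpa [hg] using abs_lt.2 hr, ?_⟩
    show (g r ^ n * Complex.exp (L (g r))).re = 0
    rw [hg, re_pow_mul_exp_circleMap, ((hϑ r hr).2 _).2 rfl, hc, mul_zero]
  · refine ⟨g (1 / 2), hgset ▸ mem_image_of_mem g (by norm_num), fun h => ?_⟩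
    have := congrArg norm h
    rw [hg, norm_circleMap_zero] at this
    norm_num at this
  · have h0 : (0 : ℝ) ∈ Ioo (-1 : ℝ) 1 := by norm_num
    obtain ⟨t, ht⟩ : (0 : ℝ) ∈ range p := hpr ▸ h0
    refine ⟨t, deriv p t, by simp [hg, ht], ?_⟩
    have h1 := ((hϑ 0 h0).2 _).2 rfl
    rw [phase] at h1
    simp only [circleMap_zero_radius, Function.const_apply] at h1
    have h2 : (c - (L 0).im) / n = ϑ 0 := by
      rw [div_eq_iff hn0]; linarith
    rw [(hcomp t).deriv, ht, h2]
    simp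

omit hL hpos in
theorem exists_mem_phaseSet {z : ℂ} (hz : z ∈ reNodal fun z => z ^ n * Complex.exp (L z)) :
    ∃ k : Fin n, z ∈ phaseSet n L (Real.pi / 2 + (k : ℕ) * Real.pi) := by
  have hn0 : (0 : ℤ) < n := by exact_mod_cast Nat.pos_of_ne_zero hn
  have hz1 : ‖z‖ < 1 := by simpa using hz.1
  by_cases hz0 : z = 0
  · exact ⟨⟨0, Nat.pos_of_ne_zero hn⟩, (mem_phaseSet_iff hn).2 ⟨hz1, Or.inl hz0⟩⟩
  have h1 := re_pow_mul_exp_circleMap (n := n) (L := L) ‖z‖ (Complex.arg z)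
  rw [circleMap_norm_arg, show (z ^ n * Complex.exp (L z)).re = 0 from hz.2] at h1
  have h2 : Real.cos (phase n L (‖z‖, Complex.arg z)) = 0 :=
    (mul_eq_zero.1 h1.symm).resolve_left
      (mul_pos (pow_pos (norm_pos_iff.2 hz0) _) (Real.exp_pos _)).ne'
  obtain ⟨k, hk⟩ := Real.cos_eq_zero_iff.1 h2
  have hk1 := Int.emod_nonneg k hn0.ne'
  have hk2 := Int.emod_lt_of_pos k hn0
  have hk3 := Int.emod_add_mul_ediv k n
  refine ⟨⟨(k % n).toNat, by omega⟩, (mem_phaseSet_iff hn).2 ⟨hz1, Or.inr ⟨k / n, ?_⟩⟩⟩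
  have hk4 : (((k % n).toNat : ℕ) : ℝ) = ((k % n : ℤ) : ℝ) := by
    exact_mod_cast congrArg (Int.cast (R := ℝ)) (Int.toNat_of_nonneg hk1)
  have hk5 : (k : ℝ) = ((k % n : ℤ) : ℝ) + n * ((k / n : ℤ) : ℝ) := by exact_mod_cast hk3.symm
  rw [hk]
  show _ = Real.pi / 2 + (((k % n).toNat : ℕ) : ℝ) * Real.pi + _
  rw [hk4, hk5]
  ring

omit hpos in
-- Membership in the `k`-th phase set is an analytic equation along `δ`. If none held identically,
-- all would fail at some parameter near `0`, although the finitely many phase sets cover the nodal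
-- set.
theorem exists_range_subset_phaseSet {δ : ℝ → ℂ} (hδ : IsRegularAnalyticCurve δ)
    (hδZ : range δ ⊆ reNodal fun z => z ^ n * Complex.exp (L z)) :
    ∃ k : Fin n, range δ ⊆ phaseSet n L (Real.pi / 2 + (k : ℕ) * Real.pi) := by
  set h : Fin n → ℝ → ℝ := fun k t => (δ t * Complex.exp (L (δ t) / n) *
    Complex.exp (-(((Real.pi / 2 + (k : ℕ) * Real.pi) / n : ℝ) * Complex.I))).im with hh
  have hball : ∀ t, δ t ∈ Metric.ball (0 : ℂ) 1 := fun t => (hδZ ⟨t, rfl⟩).1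
  have han : ∀ k, AnalyticOnNhd ℝ (h k) univ := fun k t _ => by
    have e1 : AnalyticAt ℂ (fun z => z * Complex.exp (L z / n) *
        Complex.exp (-(((Real.pi / 2 + (k : ℕ) * Real.pi) / n : ℝ) * Complex.I))) (δ t) :=
      (analyticAt_id.mul ((hL.analyticAt (Metric.isOpen_ball.mem_nhds (hball t))).div_const.cexp)).mul
        analyticAt_const
    exact (Complex.imCLM.analyticAt _).comp
      (AnalyticAt.comp (f := δ) e1.restrictScalars (hδ t).1)
  by_contra hcon
  push Not at hcon
  have hne : ∀ k, ∀ᶠ t in 𝓝[≠] (0 : ℝ), h k t ≠ 0 := fun k => by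
    by_contra hk
    have h1 : ∃ᶠ t in 𝓝[≠] (0 : ℝ), h k t = 0 := by
      simpa only [Filter.Frequently, ne_eq] using hk
    have h2 := (han k).eqOn_zero_of_preconnected_of_frequently_eq_zero isPreconnected_univ
      (mem_univ _) h1
    refine hcon k ?_
    rintro _ ⟨t, rfl⟩
    exact ⟨hball t, h2 (mem_univ t)⟩
  obtain ⟨t, ht⟩ := (eventually_all.2 hne).exists
  obtain ⟨k, hk⟩ := exists_mem_phaseSet hn (hδZ ⟨t, rfl⟩)
  exact ht k hk.2

/-- Phase sets that share a point besides the origin coincide, so a larger curve, which lies in a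
single phase set, stays in this one. -/
theorem isNodalCurve_of_range_eq_phaseSet {c : ℝ} (hc : Real.cos c = 0) {γ : ℝ → ℂ}
    (hγ : IsRegularAnalyticCurve γ) (hr : range γ = phaseSet n L c) :
    IsNodalCurve (fun z => (z ^ n * Complex.exp (L z)).re) (Metric.ball 0 1) γ := by
  obtain ⟨-, -, -, hsub, ⟨z, hz, hz0⟩, -⟩ := exists_curve_phaseSet hn hL hpos hc
  refine ⟨hγ, hr ▸ hsub, fun δ hδ hδZ hγδ => ?_⟩
  obtain ⟨k, hk⟩ := exists_range_subset_phaseSet hn hL hδ hδZ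
  rw [hr] at hγδ ⊢
  rwa [(phaseSet_eq_of_mem hn hz0 hz (hk (hγδ hz))).1]

/-- If the argument of `f(z) = z ^ n * exp (L z)` increases along circles at the zeros of `Re f`,
then the nodal set of `Re f` consists of `n` nodal curves through `0`. -/
theorem hasOnlyNodalCurvesThrough_zero :
    HasOnlyNodalCurvesThrough (fun z => (z ^ n * Complex.exp (L z)).re) (Metric.ball 0 1) n 0 := by
  have hcos : ∀ k : ℕ, Real.cos (Real.pi / 2 + k * Real.pi) = 0 := fun k => by
    rw [Real.cos_add_nat_mul_pi, Real.cos_pi_div_two, mul_zero]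
  have hex := fun k : Fin n => exists_curve_phaseSet hn hL hpos (hcos k)
  choose Γ h1 h2 h3 h4 h5 using hex
  refine ⟨Γ, fun k => isNodalCurve_of_range_eq_phaseSet hn hL hpos (hcos k) (h1 k) (h2 k),
    fun j k hjk hr => hjk ?_, fun k => ?_, ?_⟩
  · rw [h2, h2] at hr
    obtain ⟨z, hz, hz0⟩ := h4 j
    obtain ⟨m, hm⟩ := (phaseSet_eq_of_mem hn hz0 hz (hr ▸ hz)).2
    have h6 : ((j : ℕ) : ℝ) = (k : ℕ) + m * n := by
      have : ((j : ℕ) : ℝ) * Real.pi = ((k : ℕ) + m * n) * Real.pi := by linarith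
      exact mul_right_cancel₀ Real.pi_ne_zero this
    have h7 : ((j : ℕ) : ℤ) = (k : ℕ) + m * n := by exact_mod_cast h6
    have hj := j.2
    have hk := k.2
    have hm0 : m = 0 := by
      rcases lt_trichotomy m 0 with h | h | h
      · nlinarith
      · exact h
      · nlinarith
    ext
    rw [hm0] at h7
    omega
  · obtain ⟨t, s, ht, -⟩ := h5 k
    exact ⟨t, ht⟩
  · refine Subset.antisymm (fun z hz => ?_) (iUnion_subset fun k => h2 k ▸ h3 k)
    obtain ⟨k, hk⟩ := exists_mem_phaseSet hn hz
    exact mem_iUnion.2 ⟨k, h2 k ▸ hk⟩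

/-- Every admissible direction at `0` is the tangent direction of a nodal curve. -/
theorem exists_nodalCurve_tangent {ω : ℂ} (hω : ‖ω‖ = 1)
    (hre : (Complex.exp (L 0) * ω ^ n).re = 0) :
    ∃ γ, IsNodalCurve (fun z => (z ^ n * Complex.exp (L z)).re) (Metric.ball 0 1) γ ∧
      ∃ t s : ℝ, γ t = 0 ∧ deriv γ t = s * ω := by
  have hn0 : (n : ℝ) ≠ 0 := by exact_mod_cast hn
  set c : ℝ := n * Complex.arg ω + (L 0).im with hcdef
  have hωe := eq_exp_of_norm_eq_one hω
  have hc : Real.cos c = 0 := by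
    have h1 : Complex.exp (L 0) * ω ^ n = (Real.exp (L 0).re : ℝ) * Complex.exp (c * Complex.I) := by
      conv_lhs => rw [hωe, ← Complex.re_add_im (L 0)]
      rw [← Complex.exp_nat_mul, ← Complex.exp_add, Complex.ofReal_exp, ← Complex.exp_add, hcdef]
      push_cast
      congr 1
      ring
    rw [h1, Complex.re_ofReal_mul, Complex.exp_ofReal_mul_I_re] at hre
    exact (mul_eq_zero.1 hre).resolve_left (Real.exp_pos _).ne'
  obtain ⟨γ, h1, h2, -, -, t, s, ht, hs⟩ := exists_curve_phaseSet hn hL hpos hc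
  refine ⟨γ, isNodalCurve_of_range_eq_phaseSet hn hL hpos hc h1 h2, t, s, ht, ?_⟩
  rw [hs]
  congr 1
  conv_rhs => rw [hωe]
  congr 3
  rw [hcdef, add_sub_cancel_right, mul_div_cancel_left₀ _ hn0]

end Star

/-! ### The extremal functions -/

section Extremal

variable {n : ℕ} {τ : ℝ} {L : ℂ → ℂ}

theorem one_sub_ne_zero_of_mem_ball {z : ℂ} (hz : z ∈ Metric.ball (0 : ℂ) 1) : 1 - z ≠ 0 := by
  intro h
  rw [← sub_eq_zero.1 h] at hz
  simp at hz

theorem re_cayley_pos {z : ℂ} (hz : z ∈ Metric.ball (0 : ℂ) 1) : 0 < ((1 + z) / (1 - z)).re := by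
  have h1 := one_sub_ne_zero_of_mem_ball hz
  have h2 : ‖z‖ ^ 2 < 1 := by
    have : ‖z‖ < 1 := by simpa using hz
    nlinarith [norm_nonneg z]
  rw [← Complex.normSq_eq_norm_sq, Complex.normSq_apply] at h2
  have h3 : ((1 + z) / (1 - z)).re =
      (1 - (z.re * z.re + z.im * z.im)) / Complex.normSq (1 - z) := by
    rw [Complex.div_re, ← add_div]
    congr 1
    simp
    ring
  rw [h3]
  exact div_pos (by linarith) (Complex.normSq_pos.2 h1)

theorem add_mul_eq_cayley (τ : ℝ) {z : ℂ} (hz : 1 - z ≠ 0) :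
    (1 + τ * Complex.I) + (1 - τ * Complex.I) * z =
      ((1 + z) / (1 - z) + τ * Complex.I) * (1 - z) := by
  field_simp
  ring

theorem cayley_add_ne_zero (τ : ℝ) {z : ℂ} (hz : z ∈ Metric.ball (0 : ℂ) 1) :
    (1 + z) / (1 - z) + τ * Complex.I ≠ 0 := by
  intro h
  have h1 := re_cayley_pos hz
  have h2 := congrArg Complex.re h
  rw [Complex.add_re] at h2
  simp only [Complex.mul_re, Complex.ofReal_re, Complex.ofReal_im, Complex.I_re,
    Complex.I_im, Complex.zero_re, mul_zero, zero_mul, sub_zero, add_zero] at h2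
  exact h1.ne' h2

/-- `exp (L z) = ((1 + iτ) + (1 - iτ) z) / (1 - z) ^ (2n + 1)`: with `s = (1 + z) / (1 - z)` the
function `z ^ n * exp (L z)` is a real multiple of `(1 - s²)^n (s + iτ)`. The numerator has no zero
because `Re s > 0`. -/
theorem exists_extremal_log (n : ℕ) (τ : ℝ) :
    ∃ L : ℂ → ℂ, DifferentiableOn ℂ L (Metric.ball 0 1) ∧ ∀ z ∈ Metric.ball (0 : ℂ) 1,
      Complex.exp (L z) * (1 - z) ^ (2 * n + 1) =
        (1 + τ * Complex.I) + (1 - τ * Complex.I) * z := by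
  have h1 : ∀ z ∈ Metric.ball (0 : ℂ) 1, (1 - z) ^ (2 * n + 1) ≠ 0 := fun z hz =>
    pow_ne_zero _ (one_sub_ne_zero_of_mem_ball hz)
  obtain ⟨L, hL, hLG⟩ := exists_log_of_ne_zero (R := 1)
    (G := fun z => ((1 + τ * Complex.I) + (1 - τ * Complex.I) * z) / (1 - z) ^ (2 * n + 1))
    (DifferentiableOn.div (by fun_prop) (by fun_prop) h1) fun z hz => by
      refine div_ne_zero ?_ (h1 z hz)
      rw [add_mul_eq_cayley τ (one_sub_ne_zero_of_mem_ball hz)]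
      exact mul_ne_zero (cayley_add_ne_zero τ hz) (one_sub_ne_zero_of_mem_ball hz)
  exact ⟨L, hL, fun z hz => by rw [← hLG z hz, div_mul_cancel₀ _ (h1 z hz)]⟩

variable (hL : DifferentiableOn ℂ L (Metric.ball 0 1))
  (hexp : ∀ z ∈ Metric.ball (0 : ℂ) 1, Complex.exp (L z) * (1 - z) ^ (2 * n + 1) =
    (1 + τ * Complex.I) + (1 - τ * Complex.I) * z)

include hL hexp

theorem deriv_extremal_log {z : ℂ} (hz : z ∈ Metric.ball (0 : ℂ) 1) :
    deriv L z = (1 - τ * Complex.I) / ((1 + τ * Complex.I) + (1 - τ * Complex.I) * z) +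
      (2 * n + 1) / (1 - z) := by
  have h1 := one_sub_ne_zero_of_mem_ball hz
  have h2 : (1 + τ * Complex.I) + (1 - τ * Complex.I) * z ≠ 0 := by
    rw [add_mul_eq_cayley τ h1]
    exact mul_ne_zero (cayley_add_ne_zero τ hz) h1
  have hLd := (hL.differentiableAt (Metric.isOpen_ball.mem_nhds hz)).hasDerivAt
  have e1 : HasDerivAt (fun z : ℂ => (1 - z) ^ (2 * n + 1))
      ((2 * n + 1 : ℕ) * (1 - z) ^ (2 * n) * (-1)) z := by
    exact ((hasDerivAt_id z).const_sub 1).pow (2 * n + 1)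
  have e2 := hLd.cexp.mul e1
  have e3 : HasDerivAt (fun z : ℂ => (1 + τ * Complex.I) + (1 - τ * Complex.I) * z)
      (1 - τ * Complex.I) z := by
    simpa using ((hasDerivAt_id z).const_mul (1 - τ * Complex.I)).const_add (1 + τ * Complex.I)
  have e4 : ((fun z => Complex.exp (L z)) * fun z : ℂ => (1 - z) ^ (2 * n + 1)) =ᶠ[𝓝 z]
      fun z : ℂ => (1 + τ * Complex.I) + (1 - τ * Complex.I) * z := by
    filter_upwards [Metric.isOpen_ball.mem_nhds hz] with w hw using hexp w hw
  have e5 := (e2.congr_of_eventuallyEq e4.symm).unique e3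
  have e6 := hexp z hz
  set B := (1 + τ * Complex.I) + (1 - τ * Complex.I) * z with hB
  push_cast at e5
  rw [div_add_div _ _ h2 h1, eq_div_iff (mul_ne_zero h2 h1), ← e5, ← e6]
  ring

/-- With `q = s + iτ` the angular derivative equals `Re s / (2 |q|²)` times `(2n + 1) |q|² - (1 +
τ²)`. It can fail to be positive only in a small half-disc about `s = -iτ`, and there
`re_pow_mul_pos` excludes zeros of the real part. -/
theorem extremal_derivative_pos (hn : 1 ≤ n) (hτ0 : 0 ≤ τ)
    (hτ : τ = 0 ∨ 2 ≤ n ∧ ((n : ℝ) + 1) ^ 2 * τ ^ 2 ≤ 3) {z : ℂ}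
    (hz : z ∈ Metric.ball (0 : ℂ) 1) (hre : (z ^ n * Complex.exp (L z)).re = 0) :
    0 < n + (z * deriv L z).re := by
  have h1 := one_sub_ne_zero_of_mem_ball hz
  set s : ℂ := (1 + z) / (1 - z) with hs
  have hs0 : 0 < s.re := re_cayley_pos hz
  set q : ℂ := s + τ * Complex.I with hq
  have hq0 : q ≠ 0 := cayley_add_ne_zero τ hz
  have hqre : q.re = s.re := by simp [hq]
  have hB := add_mul_eq_cayley τ h1
  rw [← hs, ← hq] at hB
  have hsq : z = -(1 / 4 : ℝ) * (1 - s ^ 2) * (1 - z) ^ 2 := by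
    rw [hs]; push_cast; field_simp; ring
  have hval : z ^ n * Complex.exp (L z) = ((-(1 / 4)) ^ n : ℝ) * ((1 - s ^ 2) ^ n * q) := by
    have e1 : Complex.exp (L z) = q / (1 - z) ^ (2 * n) := by
      rw [eq_div_iff (pow_ne_zero _ h1)]
      have := hexp z hz
      rw [hB, pow_succ, ← mul_assoc] at this
      exact mul_right_cancel₀ h1 this
    have e2 : z ^ n = ((-(1 / 4)) ^ n : ℝ) * (1 - s ^ 2) ^ n * (1 - z) ^ (2 * n) := by
      conv_lhs => rw [hsq]
      rw [mul_pow, mul_pow, ← pow_mul]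
      push_cast
      ring
    rw [e1, e2]
    field_simp
  have hlarge : 1 + τ ^ 2 < (2 * (n : ℝ) + 1) * ‖q‖ ^ 2 := by
    by_contra hcon
    have h2 := re_pow_mul_pos hn hτ0 hτ hs0 (not_lt.1 hcon)
    rw [hval, Complex.re_ofReal_mul] at hre
    rcases mul_eq_zero.1 hre with h3 | h3
    · exact pow_ne_zero n (by norm_num) h3
    · exact h2.ne' h3
  have hmain : z * deriv L z = (1 - τ * Complex.I) / 2 - ((1 + τ ^ 2 : ℝ) : ℂ) / (2 * q) +
      (2 * n + 1) * (s - 1) / 2 := by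
    rw [deriv_extremal_log hL hexp hz, hB]
    have e1 : z / (1 - z) = (s - 1) / 2 := by rw [hs]; field_simp; ring
    have e2 : s = q - τ * Complex.I := by rw [hq]; ring
    have e3 : z * ((1 - τ * Complex.I) / (q * (1 - z)) + (2 * n + 1) / (1 - z)) =
        (1 - τ * Complex.I) / q * (z / (1 - z)) + (2 * n + 1) * (z / (1 - z)) := by
      field_simp
    rw [e3, e1, e2]
    have hI : Complex.I ^ 2 = -1 := Complex.I_sq
    push_cast
    field_simp
    linear_combination (τ ^ 2 : ℂ) * hI
  have hqn : 0 < ‖q‖ ^ 2 := by positivity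
  have hinv : (((1 + τ ^ 2 : ℝ) : ℂ) / (2 * q)).re = (1 + τ ^ 2) * s.re / (2 * ‖q‖ ^ 2) := by
    have h2 : ((1 + τ ^ 2 : ℝ) : ℂ) / (2 * q) = (((1 + τ ^ 2) / 2 : ℝ) : ℂ) * q⁻¹ := by
      push_cast; field_simp
    rw [h2, Complex.re_ofReal_mul, Complex.inv_re, Complex.normSq_eq_norm_sq, hqre]
    field_simp
  have hre2 : (z * deriv L z).re = 1 / 2 - (1 + τ ^ 2) * s.re / (2 * ‖q‖ ^ 2) +
      (2 * n + 1) * (s.re - 1) / 2 := by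
    have e1 : ((1 - τ * Complex.I) / 2 : ℂ).re = 1 / 2 := by simp
    have e2 : ((2 * n + 1) * (s - 1) / 2 : ℂ).re = (2 * n + 1) * (s.re - 1) / 2 := by
      have : ((2 * n + 1) * (s - 1) / 2 : ℂ) = (((2 * n + 1) / 2 : ℝ) : ℂ) * (s - 1) := by
        push_cast; ring
      rw [this, Complex.re_ofReal_mul, Complex.sub_re, Complex.one_re]
      ring
    rw [hmain, Complex.add_re, Complex.sub_re, hinv, e1, e2]
  have hfin : n + (z * deriv L z).re =
      s.re / (2 * ‖q‖ ^ 2) * ((2 * n + 1) * ‖q‖ ^ 2 - (1 + τ ^ 2)) := by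
    rw [hre2]
    field_simp
    ring
  rw [hfin]
  exact mul_pos (by positivity) (by linarith)

end Extremal

/-! ### The extremal angle -/

theorem re_I_pow_of_odd {m : ℕ} (hm : Odd m) : (Complex.I ^ m).re = 0 := by
  obtain ⟨k, rfl⟩ := hm
  rw [pow_succ, pow_mul, Complex.I_sq]
  have : ((-1 : ℂ) ^ k) = (((-1 : ℝ) ^ k : ℝ) : ℂ) := by push_cast; ring
  rw [this, Complex.re_ofReal_mul, Complex.I_re, mul_zero]

/-- Equality holds for `n = 2`, where the angle is `π / 6`; for `n ≥ 3` crude bounds on sine and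
cosine give `(n + 1) tan x ≤ 1.72 < √3`. -/
theorem add_one_sq_mul_tan_sq_le {n : ℕ} (hn : 2 ≤ n) :
    ((n : ℝ) + 1) ^ 2 * Real.tan (Real.pi / (2 * n + 2 : ℕ)) ^ 2 ≤ 3 := by
  rcases hn.eq_or_lt with rfl | hn3
  · have h1 : Real.pi / ((2 * 2 + 2 : ℕ) : ℝ) = Real.pi / 6 := by norm_num
    rw [h1, Real.tan_pi_div_six, div_pow, Real.sq_sqrt (by norm_num)]
    norm_num
  · have hn' : (3 : ℝ) ≤ n := by exact_mod_cast hn3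
    set x : ℝ := Real.pi / (2 * n + 2 : ℕ) with hx
    have hxn : (n + 1) * x = Real.pi / 2 := by
      rw [hx]; push_cast; field_simp
    have hπ := Real.pi_lt_d2
    have hπ0 := Real.pi_gt_three
    have hx0 : 0 < x := by positivity
    have hx1 : x ≤ 2 / 5 := by nlinarith
    have hc : 0.92 ≤ Real.cos x := by
      have := Real.one_sub_sq_div_two_le_cos (x := x)
      nlinarith
    have hs : Real.sin x ≤ x := Real.sin_le hx0.le
    have hs0 : 0 ≤ Real.sin x := Real.sin_nonneg_of_nonneg_of_le_pi hx0.le (by linarith)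
    have ht : (n + 1) * Real.tan x ≤ 1.72 := by
      rw [Real.tan_eq_sin_div_cos, mul_div_assoc', div_le_iff₀ (by linarith)]
      nlinarith
    have ht0 : 0 ≤ (n + 1) * Real.tan x := by
      rw [Real.tan_eq_sin_div_cos]
      have : 0 ≤ Real.cos x := by linarith
      positivity
    rw [← mul_pow]
    nlinarith

/-- `x = 0` for odd `n` and `x = π / (2n + 2)` for even `n`. In the even case `(n + 1) x = π / 2`
contributes one more factor `i`, so that an odd power of `i` results. -/
theorem exists_extremal_angle {n : ℕ} (hn : 1 ≤ n) :
    ∃ x : ℝ, Real.cos x = Real.cos (n * alpha₀ n) ∧ 0 < Real.cos x ∧ 0 ≤ Real.tan x ∧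
      (Real.tan x = 0 ∨ 2 ≤ n ∧ ((n : ℝ) + 1) ^ 2 * Real.tan x ^ 2 ≤ 3) ∧
      (Complex.I ^ n * Complex.exp (((n + 1) * x : ℝ) * Complex.I)).re = 0 := by
  rcases Nat.even_or_odd n with he | ho
  · have h2 : 2 ≤ n := by
      obtain ⟨k, rfl⟩ := he
      omega
    have hpos : (0 : ℝ) < Real.pi / (2 * n + 2 : ℕ) := by positivity
    have hlt : Real.pi / (2 * n + 2 : ℕ) < Real.pi / 2 := by
      refine div_lt_div_of_pos_left Real.pi_pos two_pos ?_
      exact_mod_cast (by omega : 2 < 2 * n + 2)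
    have hmul : ((n : ℝ) + 1) * (Real.pi / (2 * n + 2 : ℕ)) = Real.pi / 2 := by
      push_cast; field_simp
    refine ⟨Real.pi / (2 * n + 2 : ℕ), (cos_mul_alpha₀_of_even hn he).symm,
      Real.cos_pos_of_mem_Ioo ⟨by linarith, hlt⟩,
      (Real.tan_pos_of_pos_of_lt_pi_div_two hpos hlt).le,
      Or.inr ⟨h2, add_one_sq_mul_tan_sq_le h2⟩, ?_⟩
    rw [hmul]
    have : Complex.exp ((Real.pi / 2 : ℝ) * Complex.I) = Complex.I := by
      push_cast; exact Complex.exp_pi_div_two_mul_I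
    rw [this, ← pow_succ]
    exact re_I_pow_of_odd he.add_one
  · refine ⟨0, by rw [cos_mul_alpha₀_of_odd ho, Real.cos_zero], by simp, by simp, by simp, ?_⟩
    simpa using re_I_pow_of_odd ho

/-! ### Boundary values of continuous functions -/

theorem hasL1BoundaryValue_of_continuousOn {u : ℂ → ℝ} {r₀ : ℝ} (hr₀ : 0 < r₀)
    (hu : ContinuousOn u (Metric.closedBall 0 r₀)) : HasL1BoundaryValue u r₀ := by
  have hc : Continuous fun θ => u (circleMap 0 r₀ θ) :=
    continuousOn_comp_circleMap hu (abs_of_pos hr₀).le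
  obtain ⟨M, hM⟩ := (isCompact_closedBall (0 : ℂ) r₀).exists_bound_of_continuousOn hu
  refine ⟨fun θ => u (circleMap 0 r₀ θ), hc.intervalIntegrable _ _, ?_⟩
  have hev : ∀ᶠ r in 𝓝[<] r₀, r ∈ Ioo 0 r₀ := Ioo_mem_nhdsLT hr₀
  have hcirc : ∀ r ∈ Ioo 0 r₀, ∀ θ, circleMap 0 r θ ∈ Metric.closedBall (0 : ℂ) r₀ :=
    fun r hr θ => by simpa [abs_of_pos hr.1] using hr.2.le
  suffices h : Tendsto (fun r : ℝ => ∫ θ in (0 : ℝ)..(2 * Real.pi),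
      |u (circleMap 0 r θ) - u (circleMap 0 r₀ θ)|) (𝓝[<] r₀)
      (𝓝 (∫ _ in (0 : ℝ)..(2 * Real.pi), (0 : ℝ))) by
    rwa [intervalIntegral.integral_zero] at h
  refine intervalIntegral.tendsto_integral_filter_of_dominated_convergence (μ := volume)
    (fun _ => M + M) ?_ ?_ intervalIntegrable_const ?_
  · filter_upwards [hev] with r hr
    have h1 : Continuous fun θ => u (circleMap 0 r θ) :=
      continuousOn_comp_circleMap hu (by rw [abs_of_pos hr.1]; exact hr.2.le)
    exact (h1.sub hc).abs.aestronglyMeasurable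
  · filter_upwards [hev] with r hr
    refine Eventually.of_forall fun θ _ => ?_
    rw [Real.norm_eq_abs, abs_abs]
    refine (abs_sub _ _).trans (add_le_add (hM _ (hcirc r hr θ)) (hM _ ?_))
    simp [abs_of_pos hr₀]
  · refine Eventually.of_forall fun θ _ => ?_
    have h1 : Tendsto (fun r => circleMap 0 r θ) (𝓝[<] r₀)
        (𝓝[Metric.closedBall 0 r₀] (circleMap 0 r₀ θ)) := by
      refine tendsto_nhdsWithin_iff.2 ⟨?_, hev.mono fun r hr => hcirc r hr θ⟩
      have : Continuous fun r : ℝ => circleMap 0 r θ := by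
        simp only [circleMap_zero]; fun_prop
      exact this.continuousAt.tendsto.mono_left nhdsWithin_le_nhds
    have h2 := (hu (circleMap 0 r₀ θ) (by simp [abs_of_pos hr₀])).tendsto.comp h1
    have h3 := (h2.sub_const (u (circleMap 0 r₀ θ))).abs
    simpa using h3

/-! ### Sharpness -/

/-- On the circle of radius `1/2` the phase takes the values `π/2` and `3π/2`, hence also `π`, where
the cosine is `-1`. This gives non-constancy. -/
theorem exists_circleMap_re_ne_zero {n : ℕ} (hn : n ≠ 0) {L : ℂ → ℂ}
    (hL : DifferentiableOn ℂ L (Metric.ball 0 1))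
    (hpos : ∀ z ∈ Metric.ball (0 : ℂ) 1, (z ^ n * Complex.exp (L z)).re = 0 →
      0 < n + (z * deriv L z).re) :
    ∃ z ∈ Metric.ball (0 : ℂ) 1, (z ^ n * Complex.exp (L z)).re ≠ 0 := by
  have hr : |(1 / 2 : ℝ)| < 1 := by norm_num [abs_of_pos]
  have hcont : Continuous fun θ => phase n L (1 / 2, θ) :=
    continuous_iff_continuousAt.2 fun θ => (hasDerivAt_phase hL hr θ).continuousAt
  have hc : ∀ k : ℕ, Real.cos (Real.pi / 2 + k * Real.pi) = 0 := fun k => by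
    rw [Real.cos_add_nat_mul_pi, Real.cos_pi_div_two, mul_zero]
  obtain ⟨θ₀, h0, -⟩ := existsUnique_phase_eq hn hL hpos (hc 0) hr
  obtain ⟨θ₁, h1, -⟩ := existsUnique_phase_eq hn hL hpos (hc 1) hr
  obtain ⟨θ, hθ⟩ := mem_range_of_exists_le_of_exists_ge (c := Real.pi) hcont
    ⟨θ₀, by rw [h0]; push_cast; linarith [Real.pi_pos]⟩
    ⟨θ₁, by rw [h1]; push_cast; linarith [Real.pi_pos]⟩
  refine ⟨circleMap 0 (1 / 2) θ, by simpa using hr, ?_⟩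
  rw [re_pow_mul_exp_circleMap, show phase n L (1 / 2, θ) = Real.pi from hθ, Real.cos_pi]
  have := Real.exp_pos (L (circleMap 0 (1 / 2) θ)).re
  have h2 : (0 : ℝ) < (1 / 2) ^ n := by positivity
  nlinarith [mul_pos h2 this]

/-- A function on the unit disc with a star of nodal curves gives, by a conformal change of
coordinates, an admissible function on the disc of radius `r₀`. -/
theorem isAdmissible_comp_toUnitDisc {n : ℕ} (hn : n ≠ 0) {r₀ : ℝ} {p : ℂ} (hr₀ : 0 < r₀)
    (hp : ‖p‖ < r₀) {L : ℂ → ℂ} (hL : DifferentiableOn ℂ L (Metric.ball 0 1))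
    (hLc : ContinuousOn L (Metric.closedBall 0 1))
    (hpos : ∀ z ∈ Metric.ball (0 : ℂ) 1, (z ^ n * Complex.exp (L z)).re = 0 →
      0 < n + (z * deriv L z).re) :
    IsAdmissible ((fun z => (z ^ n * Complex.exp (L z)).re) ∘ toUnitDisc r₀ p) r₀ n p := by
  have hφ := isBiholomorphic_toUnitDisc hr₀ hp
  have hpb : p ∈ Metric.ball (0 : ℂ) r₀ := by simpa using hp
  have hφp : toUnitDisc r₀ p p = 0 := by simp [toUnitDisc]
  have hψ0 : ofUnitDisc r₀ p 0 = p := by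
    have := hφ.left_inv p hpb
    rwa [hφp] at this
  refine ⟨fun z hz => ?_, ?_, ?_, ?_, ?_⟩
  · have h1 : AnalyticAt ℂ (fun w => w ^ n * Complex.exp (L w)) (toUnitDisc r₀ p z) :=
      (analyticAt_id.pow n).mul (hL.analyticAt (Metric.isOpen_ball.mem_nhds (hφ.mapsTo z hz))).cexp
    exact (AnalyticAt.comp (f := toUnitDisc r₀ p) h1 (hφ.analyticAt z hz)).harmonicAt_re
  · rintro ⟨c, hc⟩
    have hc0 : c = 0 := by
      rw [← hc p hpb]
      simp [hφp, hn]
    obtain ⟨z, hz, hz0⟩ := exists_circleMap_re_ne_zero hn hL hpos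
    refine hz0 ?_
    have := hc _ (hφ.mapsTo_inv z hz)
    rwa [Function.comp_apply, hφ.right_inv z hz, hc0] at this
  · refine hasL1BoundaryValue_of_continuousOn hr₀ ?_
    have hcl : closure (Metric.ball (0 : ℂ) r₀) = Metric.closedBall 0 r₀ := closure_ball _ hr₀.ne'
    have hφc : ContinuousOn (toUnitDisc r₀ p) (Metric.closedBall 0 r₀) := by
      refine ContinuousOn.div (by fun_prop) (by fun_prop) fun z hz h => ?_
      have hz' : ‖z‖ ≤ r₀ := by simpa using hz
      have h1 : ‖(starRingEnd ℂ) p * z‖ = r₀ ^ 2 := by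
        rw [← sub_eq_zero.1 h, norm_pow, Complex.norm_real, Real.norm_of_nonneg hr₀.le]
      rw [norm_mul, RCLike.norm_conj] at h1
      nlinarith [norm_nonneg p, norm_nonneg z]
    have hmaps : MapsTo (toUnitDisc r₀ p) (Metric.closedBall 0 r₀) (Metric.closedBall 0 1) := by
      have h1 : MapsTo (toUnitDisc r₀ p) (Metric.ball 0 r₀) (Metric.ball 0 1) := hφ.mapsTo
      have h2 := h1.closure_of_continuousOn (by rwa [hcl])
      rwa [hcl, closure_ball _ one_ne_zero] at h2
    have h3 : ContinuousOn (fun z => (z ^ n * Complex.exp (L z)).re) (Metric.closedBall 0 1) :=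
      Complex.continuous_re.comp_continuousOn ((continuousOn_id.pow n).mul hLc.cexp)
    exact h3.comp hφc hmaps
  · simp [hφp, hn]
  · have h1 := hφ.symm.hasOnlyNodalCurvesThrough (hasOnlyNodalCurvesThrough_zero hn hL hpos)
    rwa [hψ0] at h1

/-- The orientation of the curve is unknown, but it enters both curvature terms through the same
sign `s / |s|`, which disappears in the absolute value. -/
theorem exists_nodalCurve_comp_toUnitDisc {n : ℕ} (hn : n ≠ 0) {r₀ : ℝ} {p : ℂ} (hr₀ : 0 < r₀)
    (hp : ‖p‖ < r₀) {L : ℂ → ℂ} (hL : DifferentiableOn ℂ L (Metric.ball 0 1))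
    (hpos : ∀ z ∈ Metric.ball (0 : ℂ) 1, (z ^ n * Complex.exp (L z)).re = 0 →
      0 < n + (z * deriv L z).re) {ω : ℂ} (hω : ‖ω‖ = 1)
    (hre : (Complex.exp (L 0) * ω ^ n).re = 0) :
    ∃ γ, IsNodalCurve ((fun z => (z ^ n * Complex.exp (L z)).re) ∘ toUnitDisc r₀ p)
        (Metric.ball 0 r₀) γ ∧
      ∃ t, γ t = p ∧ |curvature γ t| = |r₀ / (r₀ ^ 2 - ‖p‖ ^ 2) * (2 / n * (deriv L 0 * ω).im) +
        2 * ((starRingEnd ℂ) p * ω).im / (r₀ ^ 2 - ‖p‖ ^ 2)| := by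
  have hφ := isBiholomorphic_toUnitDisc hr₀ hp
  have hpb : p ∈ Metric.ball (0 : ℂ) r₀ := by simpa using hp
  have h0b : (0 : ℂ) ∈ Metric.ball (0 : ℂ) 1 := by simp
  have hφp : toUnitDisc r₀ p p = 0 := by simp [toUnitDisc]
  have hψ0 : ofUnitDisc r₀ p 0 = p := by
    have := hφ.left_inv p hpb
    rwa [hφp] at this
  have hD : 0 < r₀ ^ 2 - ‖p‖ ^ 2 := by nlinarith [norm_nonneg p]
  obtain ⟨δ, hδ, t, s, ht, hs⟩ := exists_nodalCurve_tangent hn hL hpos hω hre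
  have hδball : ∀ t, δ t ∈ Metric.ball (0 : ℂ) 1 := fun t => (hδ.2.1 ⟨t, rfl⟩).1
  have hγ := hφ.symm.isNodalCurve hδ
  set γ := ofUnitDisc r₀ p ∘ δ with hγdef
  have hγt : γ t = p := by simp [hγdef, ht, hψ0]
  have hcompδ : toUnitDisc r₀ p ∘ γ = δ := funext fun t => hφ.right_inv _ (hδball t)
  refine ⟨γ, hγ, t, hγt, ?_⟩
  have hδ' := hδ.1 t
  have hγ' := hγ.1 t
  have hs0 : s ≠ 0 := fun h => hδ'.2 (by rw [hs, h]; simp)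
  have hc := curvature_comp (φ := toUnitDisc r₀ p) (γ := γ) (t := t)
    (by rw [hγt]; exact hφ.analyticAt p hpb) (by rw [hγt]; exact hφ.deriv_ne_zero hpb) hγ'.1 hγ'.2
  rw [hγt, deriv_deriv_toUnitDisc_self hr₀ hp, deriv_toUnitDisc_self hr₀ hp, Complex.norm_real,
    Real.norm_of_nonneg (by positivity), hcompδ] at hc
  have hder : deriv δ t = ((r₀ / (r₀ ^ 2 - ‖p‖ ^ 2) : ℝ) : ℂ) * deriv γ t := by
    have h1 := hasDerivAt_comp_real (f := toUnitDisc r₀ p)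
      (hφ.analyticAt (γ t) (by rwa [hγt])).differentiableAt.hasDerivAt (hγ.1.hasDerivAt t)
    rw [hγt, deriv_toUnitDisc_self hr₀ hp] at h1
    rw [← h1.deriv, ← hcompδ]
    rfl
  have hk : 0 < r₀ / (r₀ ^ 2 - ‖p‖ ^ 2) := by positivity
  have hunit : deriv γ t / ‖deriv γ t‖ = deriv δ t / ‖deriv δ t‖ := by
    have hkC : ((r₀ / (r₀ ^ 2 - ‖p‖ ^ 2) : ℝ) : ℂ) ≠ 0 := by exact_mod_cast hk.ne'
    rw [hder, norm_mul, Complex.norm_real, Real.norm_of_nonneg hk.le, Complex.ofReal_mul,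
      mul_div_mul_left _ _ hkC]
  have hdir : deriv δ t / ‖deriv δ t‖ = ((s / |s| : ℝ) : ℂ) * ω := by
    rw [hs, norm_mul, hω, mul_one, Complex.norm_real, Real.norm_eq_abs]
    push_cast
    ring
  have hLa := hL.analyticAt (Metric.isOpen_ball.mem_nhds h0b)
  have hκ := (curvature_of_pow_mul hn (G := fun z => Complex.exp (L z)) hLa.cexp
    (Complex.exp_ne_zero _) hδ'.1 hδ'.2 ht
    (Eventually.of_forall fun t => (hδ.2.1 ⟨t, rfl⟩).2)).2
  have hG : deriv (fun z => Complex.exp (L z)) 0 = Complex.exp (L 0) * deriv L 0 :=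
    hLa.differentiableAt.hasDerivAt.cexp.deriv
  rw [hG, hdir] at hκ
  have e1 : Complex.exp (L 0) * deriv L 0 * (((s / |s| : ℝ) : ℂ) * ω) / Complex.exp (L 0) =
      ((s / |s| : ℝ) : ℂ) * (deriv L 0 * ω) := by
    have := Complex.exp_ne_zero (L 0)
    field_simp
  rw [e1, Complex.im_ofReal_mul] at hκ
  have e2 : 2 * (starRingEnd ℂ) p / ((r₀ ^ 2 - ‖p‖ ^ 2 : ℝ) : ℂ) * (((s / |s| : ℝ) : ℂ) * ω) =
      ((s / |s| * (2 / (r₀ ^ 2 - ‖p‖ ^ 2)) : ℝ) : ℂ) * ((starRingEnd ℂ) p * ω) := by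
    push_cast
    ring
  rw [hunit, hdir, e2, Complex.im_ofReal_mul, hκ] at hc
  have e3 : curvature γ t = -(s / |s|) * (r₀ / (r₀ ^ 2 - ‖p‖ ^ 2) * (2 / n * (deriv L 0 * ω).im) +
      2 * ((starRingEnd ℂ) p * ω).im / (r₀ ^ 2 - ‖p‖ ^ 2)) := by
    rw [hc]; ring
  have e4 : |-(s / |s|)| = 1 := by
    rw [abs_neg, abs_div, abs_abs, div_self (abs_pos.2 hs0).ne']
  rw [e3, abs_mul, e4, one_mul]

/-- The direction `i p / |p|`, in which the Möbius contribution to the curvature is largest. -/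
theorem exists_unit_im_conj_mul (p : ℂ) : ∃ ω : ℂ, ‖ω‖ = 1 ∧ ((starRingEnd ℂ) p * ω).im = ‖p‖ := by
  by_cases hp : p = 0
  · exact ⟨1, by simp, by simp [hp]⟩
  have hpn : (‖p‖ : ℂ) ≠ 0 := by simpa using hp
  refine ⟨Complex.I * p / ‖p‖, ?_, ?_⟩
  · rw [norm_div, norm_mul, Complex.norm_I, one_mul, Complex.norm_real, norm_norm,
      div_self (norm_ne_zero_iff.2 hp)]
  · have : (starRingEnd ℂ) p * (Complex.I * p / ‖p‖) = (‖p‖ : ℂ) * Complex.I := by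
      have h1 : (starRingEnd ℂ) p * p = (‖p‖ : ℂ) ^ 2 := by
        rw [mul_comm, Complex.mul_conj, Complex.normSq_eq_norm_sq]; push_cast; rfl
      field_simp
      linear_combination h1
    rw [this]
    simp

/-- The extremal function is evaluated at `ν z` with `|ν| = l < 1`, which moves its pole out of the
closed disc and multiplies the main term by `l`. The argument of `ν` turns the extremal direction `i
e^{ix}` into the direction `η` that maximizes the Möbius term, so the two terms add. -/
theorem exists_isAdmissible_curvature_eq {n : ℕ} (hn : 1 ≤ n) {r₀ : ℝ} {p : ℂ} (hp : ‖p‖ < r₀)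
    {l : ℝ} (hl : l ∈ Ioo (0 : ℝ) 1) :
    ∃ u : ℂ → ℝ, IsAdmissible u r₀ n p ∧ ∃ γ, IsNodalCurve u (Metric.ball 0 r₀) γ ∧
      ∃ t, γ t = p ∧ |curvature γ t| =
        l * (4 * ((n : ℝ) + 1) / ((r₀ ^ 2 - ‖p‖ ^ 2) * n) * r₀ * Real.cos (n * alpha₀ n)) +
          2 * ‖p‖ / (r₀ ^ 2 - ‖p‖ ^ 2) := by
  have hr₀ : 0 < r₀ := (norm_nonneg p).trans_lt hp
  have hn0 : n ≠ 0 := by omega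
  have hnR : (0 : ℝ) < n := by exact_mod_cast hn
  have hD : 0 < r₀ ^ 2 - ‖p‖ ^ 2 := by nlinarith [norm_nonneg p]
  obtain ⟨x, hx1, hx2, hx3, hx4, hx5⟩ := exists_extremal_angle hn
  set τ := Real.tan x with hτ
  obtain ⟨L, hL, hexp⟩ := exists_extremal_log n τ
  obtain ⟨η, hη, hηp⟩ := exists_unit_im_conj_mul p
  have hA : (1 + τ * Complex.I : ℂ) * Real.cos x = Complex.exp (x * Complex.I) := by
    have hc : (Real.cos x : ℂ) ≠ 0 := by exact_mod_cast hx2.ne'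
    rw [Complex.exp_mul_I, ← Complex.ofReal_cos, ← Complex.ofReal_sin, hτ, Real.tan_eq_sin_div_cos]
    push_cast at hc ⊢
    field_simp
  have hη0 : η ≠ 0 := norm_ne_zero_iff.1 (by rw [hη]; exact one_ne_zero)
  set ω : ℂ := Complex.I * Complex.exp (x * Complex.I) with hω
  have hω1 : ‖ω‖ = 1 := by
    rw [hω, norm_mul, Complex.norm_I, Complex.norm_exp_ofReal_mul_I, one_mul]
  have hω0 : ω ≠ 0 := norm_ne_zero_iff.1 (by rw [hω1]; exact one_ne_zero)
  set ν : ℂ := l * (ω / η) with hν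
  have hνn : ‖ν‖ = l := by
    rw [hν, norm_mul, norm_div, hω1, hη, div_one, mul_one, Complex.norm_real,
      Real.norm_of_nonneg hl.1.le]
  have hν0 : ν ≠ 0 := norm_ne_zero_iff.1 (by rw [hνn]; exact hl.1.ne')
  have hmaps : ∀ z : ℂ, ‖z‖ ≤ 1 → ν * z ∈ Metric.ball (0 : ℂ) 1 := fun z hz => by
    rw [mem_ball_zero_iff, norm_mul, hνn]
    nlinarith [hl.1, hl.2, norm_nonneg z]
  -- The summand `n log ν` turns `z ^ n` into `(ν z) ^ n`, so that `z ^ n * exp (K z)` is the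
  -- extremal function at `ν z`.
  set K : ℂ → ℂ := fun z => L (ν * z) + n * Complex.log ν with hK
  have hKd : ∀ z : ℂ, ‖z‖ ≤ 1 → HasDerivAt K (deriv L (ν * z) * ν) z := fun z hz => by
    have h1 := (hL.differentiableAt (Metric.isOpen_ball.mem_nhds (hmaps z hz))).hasDerivAt
    have h2 : HasDerivAt (fun z : ℂ => ν * z) ν z := by
      simpa using (hasDerivAt_id z).const_mul ν
    exact (h1.comp z h2).add_const _
  have hKL : DifferentiableOn ℂ K (Metric.ball 0 1) := fun z hz =>
    (hKd z (by simpa using (mem_ball_zero_iff.1 hz).le)).differentiableAt.differentiableWithinAt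
  have hKc : ContinuousOn K (Metric.closedBall 0 1) := fun z hz =>
    (hKd z (by simpa using hz)).continuousAt.continuousWithinAt
  have hKexp : ∀ z, Complex.exp (K z) = ν ^ n * Complex.exp (L (ν * z)) := fun z => by
    simp only [hK]
    rw [Complex.exp_add, Complex.exp_nat_mul, Complex.exp_log hν0, mul_comm]
  have hpos : ∀ z ∈ Metric.ball (0 : ℂ) 1, (z ^ n * Complex.exp (K z)).re = 0 →
      0 < n + (z * deriv K z).re := fun z hz h => by
    have hz1 : ‖z‖ ≤ 1 := (mem_ball_zero_iff.1 hz).le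
    rw [hKexp, mul_left_comm, ← mul_assoc, ← mul_pow] at h
    have h1 := extremal_derivative_pos hL hexp hn hx3 hx4 (hmaps z hz1) h
    rw [(hKd z hz1).deriv]
    convert h1 using 3
    ring
  have hL0 : Complex.exp (L 0) = 1 + τ * Complex.I := by
    have := hexp 0 (by simp)
    simpa using this
  have hωn : ν ^ n * η ^ n = ((l ^ n : ℝ) : ℂ) * ω ^ n := by
    rw [hν, ← mul_pow, mul_assoc, div_mul_cancel₀ _ hη0, mul_pow]
    push_cast
    rfl
  have hre : (Complex.exp (K 0) * η ^ n).re = 0 := by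
    rw [hKexp, mul_zero, hL0]
    have hc : (Real.cos x : ℂ) ≠ 0 := by exact_mod_cast hx2.ne'
    have e1 : ν ^ n * (1 + τ * Complex.I) * η ^ n = ((l ^ n / Real.cos x : ℝ) : ℂ) *
        (Complex.I ^ n * Complex.exp (((n + 1) * x : ℝ) * Complex.I)) := by
      have e2 : (1 + τ * Complex.I : ℂ) = Complex.exp (x * Complex.I) / Real.cos x := by
        rw [← hA, mul_div_cancel_right₀ _ hc]
      have e3 : Complex.exp (((n + 1) * x : ℝ) * Complex.I) =
          Complex.exp (x * Complex.I) ^ n * Complex.exp (x * Complex.I) := by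
        rw [← Complex.exp_nat_mul, ← Complex.exp_add]
        congr 1
        push_cast
        ring
      rw [mul_right_comm, hωn, e2, e3, hω, mul_pow]
      push_cast
      ring
    rw [e1, Complex.re_ofReal_mul, hx5, mul_zero]
  obtain ⟨γ, hγ, t, ht, hκ⟩ :=
    exists_nodalCurve_comp_toUnitDisc hn0 hr₀ hp hKL hpos hη hre
  refine ⟨_, isAdmissible_comp_toUnitDisc hn0 hr₀ hp hKL hKc hpos, γ, hγ, t, ht, ?_⟩
  -- `L' 0 = (1 - iτ) / (1 + iτ) + 2n + 1` and `e^{ix} = (1 + iτ) cos x`, so `L' 0 * i e^{ix}` has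
  -- imaginary part `(2n + 2) cos x`.
  have him : (deriv K 0 * η).im = l * ((2 * n + 2) * Real.cos x) := by
    have hA0 : (1 + τ * Complex.I : ℂ) ≠ 0 := hL0 ▸ Complex.exp_ne_zero _
    have e1 : deriv K 0 * η = (l : ℂ) * (((2 * n + 2) * Real.cos x : ℝ) * Complex.I +
        (2 * n * (Real.cos x * τ) : ℝ) * (-1)) := by
      rw [(hKd 0 (by simp)).deriv, mul_zero, deriv_extremal_log hL hexp (by simp), hν, hω, ← hA]
      have d1 := div_mul_cancel₀ (1 - τ * Complex.I) hA0
      have d2 : η⁻¹ * η = 1 := inv_mul_cancel₀ hη0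
      rw [mul_zero, add_zero, sub_zero, div_one]
      push_cast
      set A : ℂ := 1 + τ * Complex.I with hAdef
      set q : ℂ := (1 - τ * Complex.I) / A with hq
      have hI : Complex.I ^ 2 = -1 := Complex.I_sq
      rw [div_eq_mul_inv]
      linear_combination (norm := (rw [hAdef]; ring_nf))
        (q + (2 * n + 1)) * l * Complex.I * A * Complex.cos x * d2 +
        l * Complex.I * Complex.cos x * d1 + 2 * n * l * τ * Complex.cos x * hI
    rw [e1, Complex.im_ofReal_mul, Complex.add_im, Complex.im_ofReal_mul, Complex.I_im, mul_one,
      Complex.im_ofReal_mul, Complex.neg_im, Complex.one_im, neg_zero, mul_zero, add_zero]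
  rw [hκ, him, hηp, hx1]
  rw [hx1] at hx2
  rw [abs_of_nonneg]
  · field_simp
    ring
  · have h1 := hl.1.le
    have : 0 ≤ l * ((2 * n + 2) * Real.cos (n * alpha₀ n)) := by positivity
    positivity

end NodalCurvature

/-! ### The upper bound and its sharpness -/

theorem mainTheorem5 (n : ℕ) (hn : 1 ≤ n) (r₀ : ℝ) (p : ℂ)
    (hp : p ∈ Metric.ball (0 : ℂ) r₀) :
    (∀ u : ℂ → ℝ, NodalCurvature.IsAdmissible u r₀ n p →
      ∀ γ : ℝ → ℂ, NodalCurvature.IsNodalCurve u (Metric.ball (0 : ℂ) r₀) γ →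
        ∀ t : ℝ, γ t = p →
          |NodalCurvature.curvature γ t| ≤ NodalCurvature.curvatureBound n r₀ p) ∧
    (∀ ε : ℝ, 0 < ε →
      ∃ u : ℂ → ℝ, NodalCurvature.IsAdmissible u r₀ n p ∧
        ∃ γ : ℝ → ℂ, NodalCurvature.IsNodalCurve u (Metric.ball (0 : ℂ) r₀) γ ∧
          ∃ t : ℝ, γ t = p ∧
            NodalCurvature.curvatureBound n r₀ p - ε < |NodalCurvature.curvature γ t|) := by
  have hp' : ‖p‖ < r₀ := mem_ball_zero_iff.1 hp
  refine ⟨fun u hu γ hγ t ht => hu.abs_curvature_le hn hp' hγ ht, fun ε hε => ?_⟩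
  set K : ℝ := 4 * ((n : ℝ) + 1) / ((r₀ ^ 2 - ‖p‖ ^ 2) * (n : ℝ)) * r₀ *
    Real.cos ((n : ℝ) * NodalCurvature.alpha₀ n) with hK
  -- With `l = 1 - δ` the loss is `δ K < ε`; the minimum with `1/2` keeps `l` in `(0, 1)`.
  have hδ : 0 < min (1 / 2) (ε / (|K| + 1)) := by positivity
  set δ : ℝ := min (1 / 2) (ε / (|K| + 1)) with hδdef
  have hδK : δ * K < ε := by
    have h1 : δ * (|K| + 1) ≤ ε := (le_div_iff₀ (by positivity)).1 (min_le_right _ _)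
    have h2 := mul_le_mul_of_nonneg_left (le_abs_self K) hδ.le
    linarith
  obtain ⟨u, hu, γ, hγ, t, ht, hκ⟩ := NodalCurvature.exists_isAdmissible_curvature_eq hn hp'
    (l := 1 - δ) ⟨by linarith [min_le_left (1 / 2) (ε / (|K| + 1))], by linarith⟩
  refine ⟨u, hu, γ, hγ, t, ht, ?_⟩
  rw [hκ, NodalCurvature.curvatureBound, ← hK]
  linarith
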